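/- Throughout, functions and distributions are complex-valued and $\langle a\rangle = 1+|a|$. For real $\alpha,\beta$ with $\beta\ne0$ put $p(\xi)=-\beta\xi^5+\alpha\xi^3$. For $s,b\in\mathbb R$, let $X_{s,b}$ be the completion of $C_c^\infty(\mathbb R^2)$ in the norm $$\|f\|_{X_{s,b}}^2=\int_{\mathbb R^2}\langle\xi\rangle^{2s}\langle\tau-p(\xi)\rangle^{2b}\,|\widehat f(\xi,\tau)|^2\,d\xi\,d\tau ,$$ that is, the space of tempered distributions on $\mathbb R^2$ whose Fourier transform is a function with finite norm. Consider the initial-value problem $$u_t+uu_x+\alpha u_{xxx}+\beta u_{xxxxx}=0,\qquad u(x,0)=u_0(x). \tag{1}$$ A solution of (1) on $[0,T]$ in $C([0,T];H^s(\mathbb R))\cap X_{s,b}$ is a $u\in C([0,T];H^s(\mathbb R))$ with $u(0)=u_0$ which on $(0,T)$ is the restriction of some $U\in X_{s,b}$, such that the equation holds in the sense of distributions on $\mathbb R\times(0,T)$. Here $uu_x=\frac12(u^2)_x$ is the restriction of the tempered distribution whose Fourier transform is $\frac12 i\xi$ times the Fourier transform of $U^2$, the latter being given, up to the normalizing constant,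 by the almost everywhere absolutely convergent convolution $\widehat U*\widehat U$. **Theorem 1.1.** Let $s>-\frac74$. There is $b=b(s)\in(\frac12,1)$ such that for all real $\alpha$ and $\beta\neq0$ and every $R\ge0$ there are $T=T(R)>0$ and $L=L(R)$ (which may also depend on $s,b,\alpha,\beta$) with the following properties. 1. For every $u_0\in H^s(\mathbb R)$ with $\|u_0\|_{H^s}\le R$ there is exactly one solution $u$ of (1) on $[0,T]$ in $C([0,T];H^s(\mathbb R))\cap X_{s,b}$. In particular, for each datum $u_0$ the time $T$ can be chosen depending only on $\|u_0\|_{H^s}$. 2. The solution depends on the data in a Lipschitz way: if $u$ and $v$ are the solutions with data $u_0$ and $v_0$, where $\|u_0\|_{H^s},\|v_0\|_{H^s}\le R$, then $$\sup_{t\in[0,T]}\|u(t)-v(t)\|_{H^s}\le L\,\|u_0-v_0\|_{H^s},$$ and $u-v$ is on $(0,T)$ the restriction of some $W\in X_{s,b}$ with $\|W\|_{X_{s,b}}\le L\,\|u_0-v_0\|_{H^s}$. -/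

import Mathlib

open MeasureTheory Set Filter Topology
open scoped SchwartzMap FourierTransform LineDeriv ENNReal NNReal

noncomputable section

namespace Kawahara

/-- Space-time `ℝ × ℝ`: the coordinate `z 0` is the space variable `x` and `z 1` is the time `t`.
On the Fourier side, `ζ 0` and `ζ 1` are the dual variables. With Mathlib's normalization
`𝓕 f ζ = ∫ exp (-2πi ⟪z, ζ⟫) f z`, the frequencies `(ξ, τ)` of the convention
`∫ exp (-i (x ξ + t τ)) f` are `ξ = 2π ζ 0` and `τ = 2π ζ 1`. -/
abbrev Spacetime : Type := EuclideanSpace ℝ (Fin 2)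

/-- The unit vector in the direction of `x`. -/
def ex : Spacetime := EuclideanSpace.single 0 1

/-- The unit vector in the direction of `t`. -/
def et : Spacetime := EuclideanSpace.single 1 1

/-- The dispersion relation `p(ξ) = -β ξ⁵ + α ξ³`. -/
def symbol (α β ξ : ℝ) : ℝ := -β * ξ ^ 5 + α * ξ ^ 3

/-- The Fourier transform of the tempered distribution `f` is (represented by) the function `g`. -/
def HasFourier (f : 𝓢'(Spacetime, ℂ)) (g : Spacetime → ℂ) : Prop :=
  AEStronglyMeasurable g volume ∧
    ∀ φ : 𝓢(Spacetime, ℂ), Integrable (fun ζ => φ ζ * g ζ) volume ∧ 𝓕 f φ = ∫ ζ, φ ζ * g ζ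

/-- The `H^s(ℝ)` norm of a tempered distribution: the `L²` norm of its Bessel potential of
order `s`, and `∞` if that is not an `L²` function, that is, if `f` is not in `H^s`. -/
def hsNorm (s : ℝ) (f : 𝓢'(ℝ, ℂ)) : ℝ≥0∞ :=
  ⨅ (g : Lp ℂ 2 (volume : Measure ℝ))
    (_ : TemperedDistribution.besselPotential ℝ ℂ s f = (g : 𝓢'(ℝ, ℂ))), ‖g‖ₑ

/-- The weight `⟨ξ⟩^s ⟨τ - p(ξ)⟩^b`, where `⟨a⟩ = 1 + |a|`. -/
def xWeight (α β s b : ℝ) (ζ : Spacetime) : ℝ :=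
  (1 + |2 * Real.pi * ζ 0|) ^ s *
    (1 + |2 * Real.pi * ζ 1 - symbol α β (2 * Real.pi * ζ 0)|) ^ b

/-- The norm of the Bourgain space `X_{s,b}`: the `L²` norm of `⟨ξ⟩^s ⟨τ - p(ξ)⟩^b` times the
Fourier transform of `U`, and `∞` if the Fourier transform of `U` is not a function. The space
`X_{s,b}` consists of the tempered distributions for which it is finite; this is the completion
of `C_c^∞(ℝ²)` in this norm. -/
def xNorm (α β s b : ℝ) (U : 𝓢'(Spacetime, ℂ)) : ℝ≥0∞ :=
  ⨅ (g : Spacetime → ℂ) (_ : HasFourier U g),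
    eLpNorm (fun ζ => (xWeight α β s b ζ : ℂ) * g ζ) 2 volume

/-- `N = u u_x = ½ (u²)_x`, where the product is taken through the convolution theorem:
the convolution of the Fourier transform of `U` with itself converges absolutely almost
everywhere, and the Fourier transform of `N` is `½ · 2πi ζ₀` times this convolution. -/
def IsConvection (U N : 𝓢'(Spacetime, ℂ)) : Prop :=
  ∃ g : Spacetime → ℂ, HasFourier U g ∧
    (∀ᵐ ζ, Integrable (fun η => g η * g (ζ - η)) volume) ∧
    HasFourier N
      (fun ζ => (1 / 2 : ℂ) * (2 * Real.pi * Complex.I * (ζ 0 : ℂ)) * ∫ η, g η * g (ζ - η))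

/-- The point `(x, t)` of space-time. -/
def point (t x : ℝ) : Spacetime := x • ex + t • et

@[simp] theorem point_zero (t x : ℝ) : point t x 0 = x := by simp [point, ex, et]

@[simp] theorem point_one (t x : ℝ) : point t x 1 = t := by simp [point, ex, et]

theorem hasTemperateGrowth_point (t : ℝ) : (point t).HasTemperateGrowth := by
  unfold point
  fun_prop

theorem norm_le_point (t : ℝ) :
    ∃ (k : ℕ) (C : ℝ), ∀ x : ℝ, ‖x‖ ≤ C * (1 + ‖point t x‖) ^ k := by
  refine ⟨1, 1, fun x => ?_⟩
  have h := PiLp.norm_apply_le (point t x) 0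
  rw [point_zero] at h
  linarith

/-- The restriction `x ↦ φ(x, t)` of a test function to the time `t`. -/
def slice (t : ℝ) : 𝓢(Spacetime, ℂ) →L[ℂ] 𝓢(ℝ, ℂ) :=
  SchwartzMap.compCLM ℂ (hasTemperateGrowth_point t) (norm_le_point t)

/-- `φ` is a test function with compact support in the open strip `ℝ × (0, T)`. -/
def IsTest (T : ℝ) (φ : 𝓢(Spacetime, ℂ)) : Prop :=
  HasCompactSupport φ ∧ tsupport φ ⊆ {z : Spacetime | z 1 ∈ Ioo 0 T}

/-- On the strip `ℝ × (0, T)`, the space-time distribution `U` is the curve `t ↦ u t`. -/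
def Extends (T : ℝ) (U : 𝓢'(Spacetime, ℂ)) (u : ℝ → 𝓢'(ℝ, ℂ)) : Prop :=
  ∀ φ : 𝓢(Spacetime, ℂ), IsTest T φ → U φ = ∫ t in Ioo 0 T, u t (slice t φ)

/-- `u ∈ C([0, T]; H^s(ℝ))`. -/
def ContinuousInHs (s T : ℝ) (u : ℝ → 𝓢'(ℝ, ℂ)) : Prop :=
  (∀ t ∈ Icc 0 T, TemperedDistribution.MemSobolev s 2 (u t)) ∧
    ∀ t ∈ Icc 0 T, Tendsto (fun r => hsNorm s (u r - u t)) (𝓝[Icc 0 T] t) (𝓝 0)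

/-- `u` is a solution on `[0, T]` of `u_t + u u_x + α u_xxx + β u_xxxxx = 0`, `u(0) = u₀`, in the
class `C([0, T]; H^s) ∩ X_{s,b}`. Only the values of `u` on `[0, T]` matter: `u ∈ X_{s,b}` means
that `u` is the restriction to `[0, T]` of an element `U` of `X_{s,b}`, and the equation holds in
the sense of distributions on `ℝ × (0, T)`. -/
def IsSolution (α β s b T : ℝ) (u₀ : 𝓢'(ℝ, ℂ)) (u : ℝ → 𝓢'(ℝ, ℂ)) : Prop :=
  ContinuousInHs s T u ∧ u 0 = u₀ ∧
    ∃ U N : 𝓢'(Spacetime, ℂ), xNorm α β s b U < ∞ ∧ Extends T U u ∧ IsConvection U N ∧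
      ∀ φ : 𝓢(Spacetime, ℂ), IsTest T φ →
        (∂_{et} U + N + (α : ℂ) • ∂_{ex} (∂_{ex} (∂_{ex} U)) +
          (β : ℂ) • ∂_{ex} (∂_{ex} (∂_{ex} (∂_{ex} (∂_{ex} U))))) φ = 0

end Kawahara

end

/-! The equation is solved by contraction on the Fourier side. Let `z` be the space-time Fourier
transform of the unknown and `h` that of the datum. On a short time scale `δ` one looks for a fixed
point of `z = freeOp h - duhOp (bil z z)`, where `freeOp` and `duhOp` are the transforms of the free
evolution and of the Duhamel integral, each multiplied by a cut-off that equals one for `|t| ≤ δ`.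
For `b > 1/2` such a `z` has a trace `tr z t` at every time, continuous in `H^s`, and on `[0, δ]`
the traces form a solution.

The analytic core is `bilinear_estimate`: the derivative of a product is bounded from `X_{s,b} ×
X_{s,b}` to `X_{s,b'-1}` with some `b' > b`. If three frequencies interact, their modulations `τ -
p(ξ)` combine to the resonance function `p(x+y) - p(x) - p(y)`, of size `|(x+y)xy|((x+y)² + x² +
y²)` at high frequency (`resonance_ge`), so the largest modulation has at least this size
(`exists_modulation_bound`) and pays for the derivative and for the negative Sobolev weights. The
other two modulations keep the exponent `2b > 1`. The frequency of the function with the largest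
modulation is held fixed and the other two vary along a line; integrating in `τ` first and then
changing variables by the phase leaves a bounded integral, provided that the multiplier is dominated
by the speed of the phase (`rate`, `lintegral_rate_le`). The pointwise inequalities behind this are
`exists_rate_bound` and `exists_multSq_le`; `s > -7/4` is the range in which the powers match.
Duality and Cauchy-Schwarz turn the kernel bounds into the estimate.

The localized operators have norms with explicit powers of `δ`: squared, the free part costs
`δ^(1-2b)` and the Duhamel part gains `δ^(2(b'-b))`. Since `b` and `b'` are chosen with `2(b'-b) >
2b-1`, a small `δ` depending only on the size of the data makes the map a contraction of a ball
(`exists_isLocal`), and subtracting two fixed points gives Lipschitz dependence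
(`sub_le_of_isLocal`).

Uniqueness is claimed among all solutions having some extension in `X_{s,b}`, of any size, so the
ball does not suffice. A distributional solution satisfies Duhamel's formula from every starting
time (`duhamel`), which is obtained from test functions that are products of space and time factors.
The difference `v` of two solutions solves a linear equation whose coefficient is their sum `y`. The
Picard iterates of this equation, started from `v`, tend to zero in `X_{s,b}` on a time scale that
depends only on the norm of `y`; but all of them have the traces of `v` on the interval considered,
because the Duhamel integral of a product up to time `t` sees its factors only at times in `[0, t]`
(`integral_bil_mul_evoKer_eq_zero`). Hence the traces of `v` vanish, and finitely many translated
steps cover `[0, T]` (`tr_ae_eq`). No norm on a restriction space is needed.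

The remaining lemmas translate between tempered distributions and functions on the Fourier side.
Mathlib's frequencies differ from the classical ones by the factor `2π`, which is absorbed in the
coefficients `nα` and `nβ`. -/

noncomputable section

namespace Kawahara

/-! ### The Japanese bracket -/

/-- The bracket `⟨a⟩ = 1 + |a|`. -/
def br (a : ℝ) : ℝ := 1 + |a|

theorem one_le_br (a : ℝ) : 1 ≤ br a := by unfold br; linarith [abs_nonneg a]

theorem br_pos (a : ℝ) : 0 < br a := by linarith [one_le_br a]

theorem abs_le_br (a : ℝ) : |a| ≤ br a := by unfold br; linarith

@[simp] theorem br_neg (a : ℝ) : br (-a) = br a := by simp [br]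

theorem br_add_le_mul (x y : ℝ) : br (x + y) ≤ br x * br y := by
  unfold br
  nlinarith [abs_add_le x y, abs_nonneg x, abs_nonneg y, mul_nonneg (abs_nonneg x) (abs_nonneg y)]

theorem br_add_le (x y : ℝ) : br (x + y) ≤ br x + br y := by
  unfold br
  linarith [abs_add_le x y]

@[fun_prop]
theorem continuous_br : Continuous br := by unfold br; fun_prop

@[fun_prop]
theorem measurable_br : Measurable br := continuous_br.measurable

theorem continuous_br_rpow (r : ℝ) : Continuous fun a => br a ^ r :=
  continuous_br.rpow_const fun a => Or.inl (br_pos a).ne'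

/-- The integral of `⟨a⟩^{-r}`. -/
def jap (r : ℝ) : ℝ≥0∞ := ∫⁻ a : ℝ, ENNReal.ofReal (br a ^ (-r))

theorem integrable_br {r : ℝ} (hr : 1 < r) : Integrable fun a : ℝ => br a ^ (-r) := by
  have := integrable_one_add_norm (E := ℝ) (μ := volume) (r := r) (by simpa using hr)
  simpa [br] using this

theorem jap_lt_top {r : ℝ} (hr : 1 < r) : jap r < ∞ := by
  have h := (integrable_br hr).lintegral_lt_top
  exact h

/-- By the triangle inequality one of the two brackets is at least half of `⟨B - A⟩` at each `t`.
That factor leaves the integral, and the other one has a translation-invariant integral. -/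
theorem lintegral_br_mul_br {r : ℝ} (hr : 1 < r) (A B : ℝ) :
    ∫⁻ t : ℝ, ENNReal.ofReal (br (t - A) ^ (-r)) * ENNReal.ofReal (br (B - t) ^ (-r)) ≤
      ENNReal.ofReal (2 ^ r) * (2 * jap r) * ENNReal.ofReal (br (B - A) ^ (-r)) := by
  have key : ∀ t : ℝ, ENNReal.ofReal (br (t - A) ^ (-r)) * ENNReal.ofReal (br (B - t) ^ (-r)) ≤
      ENNReal.ofReal (2 ^ r * br (B - A) ^ (-r)) *
        (ENNReal.ofReal (br (t - A) ^ (-r)) + ENNReal.ofReal (br (B - t) ^ (-r))) := by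
    intro t
    have h0 : br (B - A) ≤ br (t - A) + br (B - t) := by
      have := br_add_le (t - A) (B - t)
      rwa [show t - A + (B - t) = B - A by ring] at this
    have aux : ∀ u : ℝ, br (B - A) / 2 ≤ br u → br u ^ (-r) ≤ 2 ^ r * br (B - A) ^ (-r) := by
      intro u hu
      have h1 : 0 < br (B - A) / 2 := by linarith [br_pos (B - A)]
      calc br u ^ (-r) ≤ (br (B - A) / 2) ^ (-r) :=
            Real.rpow_le_rpow_of_nonpos h1 hu (by linarith)
        _ = 2 ^ r * br (B - A) ^ (-r) := by
            rw [Real.div_rpow (br_pos _).le (by norm_num), Real.rpow_neg (by norm_num : (0:ℝ) ≤ 2)]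
            rw [div_inv_eq_mul, mul_comm]
    rcases le_total (br (B - A) / 2) (br (t - A)) with h | h
    · calc _ ≤ ENNReal.ofReal (2 ^ r * br (B - A) ^ (-r)) * ENNReal.ofReal (br (B - t) ^ (-r)) := by
            gcongr; exact aux _ h
        _ ≤ _ := by gcongr; exact le_add_self
    · have h' : br (B - A) / 2 ≤ br (B - t) := by linarith
      calc _ ≤ ENNReal.ofReal (br (t - A) ^ (-r)) * ENNReal.ofReal (2 ^ r * br (B - A) ^ (-r)) := by
            gcongr; exact aux _ h'
        _ ≤ _ := by rw [mul_comm]; gcongr; exact le_self_add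
  have e1 : ∫⁻ t : ℝ, ENNReal.ofReal (br (t - A) ^ (-r)) = jap r :=
    lintegral_sub_right_eq_self (fun t => ENNReal.ofReal (br t ^ (-r))) A
  have e2 : ∫⁻ t : ℝ, ENNReal.ofReal (br (B - t) ^ (-r)) = jap r :=
    lintegral_sub_left_eq_self (fun t => ENNReal.ofReal (br t ^ (-r))) B
  have m1 : Measurable fun t : ℝ => ENNReal.ofReal (br (t - A) ^ (-r)) := by fun_prop
  have m2 : Measurable fun t : ℝ => ENNReal.ofReal (br (B - t) ^ (-r)) := by fun_prop
  calc _ ≤ ∫⁻ t : ℝ, ENNReal.ofReal (2 ^ r * br (B - A) ^ (-r)) *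
        (ENNReal.ofReal (br (t - A) ^ (-r)) + ENNReal.ofReal (br (B - t) ^ (-r))) :=
        lintegral_mono key
    _ = ENNReal.ofReal (2 ^ r * br (B - A) ^ (-r)) * (2 * jap r) := by
        rw [lintegral_const_mul' _ _ ENNReal.ofReal_ne_top, lintegral_add_left m1, e1, e2, two_mul]
    _ = _ := by
        rw [ENNReal.ofReal_mul (by positivity)]; ring

/-! ### Quadratic estimates for integral operators -/

section Quadratic

variable {X : Type*} [MeasurableSpace X] {μ : Measure X}

theorem lintegral_mul_sq_le {f g : X → ℝ≥0∞} (hf : AEMeasurable f μ) (hg : AEMeasurable g μ) :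
    (∫⁻ x, f x * g x ∂μ) ^ 2 ≤ (∫⁻ x, f x ^ 2 ∂μ) * ∫⁻ x, g x ^ 2 ∂μ := by
  have h := ENNReal.lintegral_mul_le_Lp_mul_Lq μ Real.HolderConjugate.two_two hf hg
  have h2 := pow_le_pow_left₀ zero_le h 2
  simp only [Pi.mul_apply, mul_pow, ← ENNReal.rpow_natCast, ← ENNReal.rpow_mul] at h2 ⊢
  simpa using h2

/-- Duality: the `L²` norm of a function is controlled by its pairings. -/
theorem lintegral_sq_le_of_forall [SigmaFinite μ] {T : X → ℝ≥0∞} (hT : Measurable T) {A : ℝ≥0∞}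
    (h : ∀ E : X → ℝ≥0∞, Measurable E → (∫⁻ x, E x * T x ∂μ) ^ 2 ≤ A * ∫⁻ x, E x ^ 2 ∂μ) :
    ∫⁻ x, T x ^ 2 ∂μ ≤ A := by
  -- The truncations have finite `L²` norm, so that after pairing `T` with them the norm can be
  -- cancelled; monotone convergence then recovers `T`.
  set E : ℕ → X → ℝ≥0∞ := fun n => (spanningSets μ n).indicator fun x => min (T x) n with hE
  have hEm : ∀ n, Measurable (E n) := fun n =>
    (hT.min measurable_const).indicator (measurableSet_spanningSets μ n)
  have hET : ∀ n x, E n x ≤ T x := fun n x => by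
    by_cases hx : x ∈ spanningSets μ n <;> simp [hE, hx]
  have hbound : ∀ n, ∫⁻ x, E n x ^ 2 ∂μ ≤ A := by
    intro n
    have hfin : ∫⁻ x, E n x ^ 2 ∂μ ≠ ∞ := by
      have : ∀ x, E n x ^ 2 ≤ (spanningSets μ n).indicator (fun _ => (n : ℝ≥0∞) ^ 2) x := by
        intro x
        by_cases hx : x ∈ spanningSets μ n
        · simp only [hE, hx, indicator_of_mem]
          gcongr
          exact min_le_right _ _
        · simp [hE, hx]
      refine ((lintegral_mono this).trans_lt ?_).ne
      rw [lintegral_indicator (measurableSet_spanningSets μ n), setLIntegral_const]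
      exact ENNReal.mul_lt_top (by finiteness) (measure_spanningSets_lt_top μ n)
    have h1 : (∫⁻ x, E n x ^ 2 ∂μ) ^ 2 ≤ A * ∫⁻ x, E n x ^ 2 ∂μ := by
      refine le_trans ?_ (h (E n) (hEm n))
      gcongr with x
      rw [sq]
      gcongr
      exact hET n x
    rcases eq_or_ne (∫⁻ x, E n x ^ 2 ∂μ) 0 with h0 | h0
    · rw [h0]; exact zero_le
    · rw [sq] at h1
      exact (ENNReal.mul_le_mul_iff_left h0 hfin).1 h1
  have hmono : Monotone E := by
    intro m n hmn x
    by_cases hx : x ∈ spanningSets μ m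
    · have hx' : x ∈ spanningSets μ n := monotone_spanningSets μ hmn hx
      simp only [hE, hx, hx', indicator_of_mem]
      gcongr
    · simp [hE, hx]
  have hlim : ∀ x, Tendsto (fun n => E n x) atTop (𝓝 (T x)) := by
    intro x
    have h1 : Tendsto (fun n : ℕ => min (T x) (n : ℝ≥0∞)) atTop (𝓝 (min (T x) ∞)) :=
      tendsto_const_nhds.min ENNReal.tendsto_nat_nhds_top
    rw [min_eq_left le_top] at h1
    refine h1.congr' ?_
    filter_upwards [eventually_ge_atTop (spanningSetsIndex μ x)] with n hn
    have : x ∈ spanningSets μ n := monotone_spanningSets μ hn (mem_spanningSetsIndex μ x)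
    simp [hE, this]
  have hlim2 : Tendsto (fun n => ∫⁻ x, E n x ^ 2 ∂μ) atTop (𝓝 (∫⁻ x, T x ^ 2 ∂μ)) := by
    refine lintegral_tendsto_of_tendsto_of_monotone (fun n => ((hEm n).pow_const 2).aemeasurable)
      (ae_of_all _ fun x m n hmn => ?_) (ae_of_all _ fun x => ?_)
    · exact pow_le_pow_left₀ zero_le (hmono hmn x) 2
    · exact ENNReal.Tendsto.pow (hlim x)
  exact le_of_tendsto' hlim2 hbound

variable {Y : Type*} [MeasurableSpace Y] {ν : Measure Y}

/-- If the square of the kernel `k x ·` has integral at most `C` for every `x`, then the form with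
kernel `k` is bounded by the `L²` norms of the two functions it is applied to. -/
theorem sq_lintegral_kernel_le [SFinite ν] {k B : X → Y → ℝ≥0∞} {E : X → ℝ≥0∞}
    (hk : Measurable (Function.uncurry k)) (hB : Measurable (Function.uncurry B))
    (hE : Measurable E) {C : ℝ≥0∞} (hC : ∀ x, ∫⁻ y, k x y ^ 2 ∂ν ≤ C) :
    (∫⁻ x, E x * ∫⁻ y, k x y * B x y ∂ν ∂μ) ^ 2 ≤
      C * (∫⁻ x, E x ^ 2 ∂μ) * ∫⁻ x, ∫⁻ y, B x y ^ 2 ∂ν ∂μ := by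
  have hkx : ∀ x, Measurable (k x) := fun x => hk.comp measurable_prodMk_left
  have hBx : ∀ x, Measurable (B x) := fun x => hB.comp measurable_prodMk_left
  have hm : Measurable fun x => ∫⁻ y, k x y * B x y ∂ν := (hk.mul hB).lintegral_prod_right'
  calc _ ≤ (∫⁻ x, E x ^ 2 ∂μ) * ∫⁻ x, (∫⁻ y, k x y * B x y ∂ν) ^ 2 ∂μ :=
        lintegral_mul_sq_le hE.aemeasurable hm.aemeasurable
    _ ≤ (∫⁻ x, E x ^ 2 ∂μ) * ∫⁻ x, C * ∫⁻ y, B x y ^ 2 ∂ν ∂μ := by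
        gcongr with x
        exact (lintegral_mul_sq_le (hkx x).aemeasurable (hBx x).aemeasurable).trans
          (by gcongr; exact hC x)
    _ = _ := by
        have : Measurable fun x => ∫⁻ y, B x y ^ 2 ∂ν := (hB.pow_const 2).lintegral_prod_right'
        rw [lintegral_const_mul _ this]
        ring

end Quadratic

/-! ### The resonance function and its level sets -/

/-- The derivative of the dispersion relation. -/
def dsymbol (α β ξ : ℝ) : ℝ := -5 * β * ξ ^ 4 + 3 * α * ξ ^ 2

theorem hasDerivAt_symbol (α β ξ : ℝ) : HasDerivAt (symbol α β) (dsymbol α β ξ) ξ := by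
  have h1 := ((hasDerivAt_pow 5 ξ).const_mul (-β)).add ((hasDerivAt_pow 3 ξ).const_mul α)
  refine (h1.congr_deriv ?_).congr_of_eventuallyEq ?_
  · simp [dsymbol]; ring
  · exact Eventually.of_forall fun x => by simp [symbol]

@[simp] theorem symbol_neg (α β ξ : ℝ) : symbol α β (-ξ) = -symbol α β ξ := by
  simp only [symbol]; ring

@[simp] theorem dsymbol_neg (α β ξ : ℝ) : dsymbol α β (-ξ) = dsymbol α β ξ := by
  simp only [dsymbol]; ring

@[fun_prop]
theorem continuous_symbol (α β : ℝ) : Continuous (symbol α β) := by unfold symbol; fun_prop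

@[fun_prop]
theorem continuous_dsymbol (α β : ℝ) : Continuous (dsymbol α β) := by unfold dsymbol; fun_prop

/-- The difference factors through `(u - v)(u + v)`. In the remaining quadratic the quintic term
contributes `5|β|(u² + v²)`, of which the hypothesis lets the cubic term consume at most four
fifths. -/
theorem abs_dsymbol_sub_ge {α β u v : ℝ} (h : 3 * |α| ≤ 4 * |β| * (u ^ 2 + v ^ 2)) :
    |β| * (|u - v| * |u + v| * (u ^ 2 + v ^ 2)) ≤ |dsymbol α β u - dsymbol α β v| := by
  have e : dsymbol α β u - dsymbol α β v =
      (u - v) * (u + v) * (-(5 * β * (u ^ 2 + v ^ 2)) + 3 * α) := by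
    simp only [dsymbol]; ring
  have h1 : |β| * (u ^ 2 + v ^ 2) ≤ |-(5 * β * (u ^ 2 + v ^ 2)) + 3 * α| := by
    have h2 : |5 * β * (u ^ 2 + v ^ 2)| = 5 * |β| * (u ^ 2 + v ^ 2) := by
      rw [abs_mul, abs_mul, abs_of_nonneg (by positivity : (0:ℝ) ≤ u ^ 2 + v ^ 2)]; norm_num
    have h3 : |3 * α| = 3 * |α| := by rw [abs_mul]; norm_num
    have h4 := abs_sub_abs_le_abs_sub (5 * β * (u ^ 2 + v ^ 2)) (3 * α)
    rw [show -(5 * β * (u ^ 2 + v ^ 2)) + 3 * α = -(5 * β * (u ^ 2 + v ^ 2) - 3 * α) by ring,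
      abs_neg]
    linarith
  rw [e, abs_mul, abs_mul]
  calc _ = |u - v| * |u + v| * (|β| * (u ^ 2 + v ^ 2)) := by ring
    _ ≤ _ := by gcongr

/-- Both `(x+y)³ - x³ - y³` and `(x+y)⁵ - x⁵ - y⁵` are divisible by `(x+y)xy`. The quintic quotient
is `5/2` times the sum of the three squares and dominates at high frequency. -/
theorem resonance_ge {α β x y : ℝ} (h : 3 * |α| ≤ |β| * (x ^ 2 + y ^ 2)) :
    |β| * (|(x + y) * x * y| * ((x + y) ^ 2 + x ^ 2 + y ^ 2)) ≤
      |symbol α β (x + y) - symbol α β x - symbol α β y| := by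
  have e : symbol α β (x + y) - symbol α β x - symbol α β y =
      (x + y) * x * y * (-(5 / 2 * β * ((x + y) ^ 2 + x ^ 2 + y ^ 2)) + 3 * α) := by
    simp only [symbol]; ring
  have h1 : |β| * ((x + y) ^ 2 + x ^ 2 + y ^ 2) ≤
      |-(5 / 2 * β * ((x + y) ^ 2 + x ^ 2 + y ^ 2)) + 3 * α| := by
    have h2 : |5 / 2 * β * ((x + y) ^ 2 + x ^ 2 + y ^ 2)| =
        5 / 2 * |β| * ((x + y) ^ 2 + x ^ 2 + y ^ 2) := by
      rw [abs_mul, abs_mul, abs_of_nonneg (by positivity : (0:ℝ) ≤ (x + y) ^ 2 + x ^ 2 + y ^ 2)]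
      norm_num
    have h3 : |3 * α| = 3 * |α| := by rw [abs_mul]; norm_num
    have h4 := abs_sub_abs_le_abs_sub (5 / 2 * β * ((x + y) ^ 2 + x ^ 2 + y ^ 2)) (3 * α)
    rw [show -(5 / 2 * β * ((x + y) ^ 2 + x ^ 2 + y ^ 2)) + 3 * α =
      -(5 / 2 * β * ((x + y) ^ 2 + x ^ 2 + y ^ 2) - 3 * α) by ring, abs_neg]
    have h5 : 0 ≤ |β| * (x + y) ^ 2 := by positivity
    have h6 : 0 ≤ |β| * x ^ 2 := by positivity
    have h7 : 0 ≤ |β| * y ^ 2 := by positivity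
    linarith
  rw [e, abs_mul ((x + y) * x * y)]
  calc _ = |(x + y) * x * y| * (|β| * ((x + y) ^ 2 + x ^ 2 + y ^ 2)) := by ring
    _ ≤ _ := by gcongr

/-- A majorant for the multipliers on the line `u + v = const`: the speed at which the resonance
function varies along it, apart from a small neighbourhood of its critical point `u = v` and from
low frequencies. -/
def rate (α β M u v : ℝ) : ℝ :=
  {w : ℝ × ℝ | M ≤ w.1 ^ 2 + w.2 ^ 2}.indicator (fun w => |dsymbol α β w.1 - dsymbol α β w.2|) (u, v)
    + {w : ℝ × ℝ | |w.1 - w.2| * br (w.1 + w.2) ^ 2 ≤ 1}.indicator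
        (fun w => br (w.1 + w.2) ^ 2) (u, v)
    + {w : ℝ × ℝ | |w.1| ≤ M ∧ |w.2| ≤ M}.indicator (fun _ => 1) (u, v)

theorem rate_nonneg (α β M u v : ℝ) : 0 ≤ rate α β M u v := by
  unfold rate
  refine add_nonneg (add_nonneg ?_ ?_) ?_ <;> refine indicator_nonneg (fun _ _ => ?_) _
  · positivity
  · have := br_pos; positivity
  · norm_num

theorem one_le_rate {α β M u v : ℝ} (hu : |u| ≤ M) (hv : |v| ≤ M) : 1 ≤ rate α β M u v := by
  unfold rate
  rw [indicator_of_mem (s := {w : ℝ × ℝ | |w.1| ≤ M ∧ |w.2| ≤ M}) (by exact ⟨hu, hv⟩)]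
  refine le_add_of_nonneg_left (add_nonneg ?_ ?_) <;> refine indicator_nonneg (fun _ _ => ?_) _
  · positivity
  · positivity

theorem rate_ge_of_close {α β M u v : ℝ} (h : |u - v| * br (u + v) ^ 2 ≤ 1) :
    br (u + v) ^ 2 ≤ rate α β M u v := by
  unfold rate
  rw [indicator_of_mem (s := {w : ℝ × ℝ | |w.1 - w.2| * br (w.1 + w.2) ^ 2 ≤ 1}) (by exact h)]
  refine le_add_of_le_of_nonneg (le_add_of_nonneg_left ?_) ?_ <;>
    refine indicator_nonneg (fun _ _ => ?_) _
  · positivity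
  · norm_num

theorem rate_ge_of_large {α β M u v : ℝ} (hM : 3 * |α| ≤ 4 * |β| * M) (h : M ≤ u ^ 2 + v ^ 2) :
    |β| * (|u - v| * |u + v| * (u ^ 2 + v ^ 2)) ≤ rate α β M u v := by
  have h1 : |β| * (|u - v| * |u + v| * (u ^ 2 + v ^ 2)) ≤ |dsymbol α β u - dsymbol α β v| := by
    refine abs_dsymbol_sub_ge (hM.trans ?_)
    gcongr
  refine h1.trans ?_
  unfold rate
  rw [indicator_of_mem (s := {w : ℝ × ℝ | M ≤ w.1 ^ 2 + w.2 ^ 2}) (by exact h), add_assoc]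
  refine le_add_of_nonneg_right (add_nonneg ?_ ?_) <;> refine indicator_nonneg (fun _ _ => ?_) _
  · positivity
  · norm_num

theorem measurable_rate (α β M : ℝ) : Measurable fun w : ℝ × ℝ => rate α β M w.1 w.2 := by
  unfold rate
  refine ((Measurable.indicator ?_ ?_).add (Measurable.indicator ?_ ?_)).add
    (Measurable.indicator ?_ ?_)
  · fun_prop
  · exact measurableSet_le (by fun_prop) (by fun_prop)
  · fun_prop
  · exact measurableSet_le (by fun_prop) (by fun_prop)
  · fun_prop
  · exact MeasurableSet.inter (s₁ := {w : ℝ × ℝ | |w.1| ≤ M}) (s₂ := {w : ℝ × ℝ | |w.2| ≤ M})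
      (measurableSet_le (by fun_prop) (by fun_prop)) (measurableSet_le (by fun_prop) (by fun_prop))

theorem rate_comm (α β M u v : ℝ) : rate α β M u v = rate α β M v u := by
  simp only [rate, indicator, mem_ofPred_eq, abs_sub_comm v u, add_comm v u,
    add_comm (v ^ 2) (u ^ 2), abs_sub_comm (dsymbol α β v), and_comm]

/-- Change of variables on a set where the phase is injective. -/
theorem lintegral_abs_deriv_mul_br_le {μ μ' : ℝ → ℝ} {s : Set ℝ} (hs : MeasurableSet s)
    (hd : ∀ x, HasDerivAt μ (μ' x) x) (hinj : InjOn μ s) (r t : ℝ) :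
    ∫⁻ x in s, ENNReal.ofReal |μ' x| * ENNReal.ofReal (br (t - μ x) ^ (-r)) ≤ jap r := by
  rw [← lintegral_image_eq_lintegral_abs_deriv_mul hs (fun x _ => (hd x).hasDerivWithinAt) hinj
    (fun y => ENNReal.ofReal (br (t - y) ^ (-r)))]
  refine (setLIntegral_le_lintegral _ _).trans ?_
  exact (lintegral_sub_left_eq_self (fun t => ENNReal.ofReal (br t ^ (-r))) t).le

/-- The phase difference at `u` and `v` is `c (u - v)(u + v - c)` times a factor that cannot vanish
at high frequency. Equal values therefore occur only at points symmetric about `c / 2`, and `hs'`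
confines the set to one side of it. -/
theorem injOn_phase {α β M c : ℝ} (hβ : β ≠ 0) (hM0 : 0 < M) (hM : 3 * |α| ≤ 4 * |β| * M)
    (hc : c ≠ 0) {s : Set ℝ} (hs : ∀ u ∈ s, M ≤ u ^ 2 + (c - u) ^ 2)
    (hs' : ∀ u ∈ s, ∀ v ∈ s, 0 < (2 * u - c) * (2 * v - c) ∨ u = v) :
    InjOn (fun u => symbol α β u + symbol α β (c - u)) s := by
  intro u hu v hv huv
  rcases hs' u hu v hv with hpos | h
  swap
  · exact h
  have e : (symbol α β u + symbol α β (c - u)) - (symbol α β v + symbol α β (c - v)) =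
      c * ((u - v) * (u + v - c)) *
        (-(5 / 2 * β * ((u ^ 2 + (c - u) ^ 2) + (v ^ 2 + (c - v) ^ 2))) + 3 * α) := by
    simp only [symbol]; ring
  have h0 : c * ((u - v) * (u + v - c)) *
        (-(5 / 2 * β * ((u ^ 2 + (c - u) ^ 2) + (v ^ 2 + (c - v) ^ 2))) + 3 * α) = 0 := by
    rw [← e]; exact sub_eq_zero.2 huv
  have hβ' : 0 < |β| := abs_pos.2 hβ
  have hne : -(5 / 2 * β * ((u ^ 2 + (c - u) ^ 2) + (v ^ 2 + (c - v) ^ 2))) + 3 * α ≠ 0 := by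
    intro h
    have h1 : |5 / 2 * β * ((u ^ 2 + (c - u) ^ 2) + (v ^ 2 + (c - v) ^ 2))| = |3 * α| := by
      congr 1; linarith
    rw [abs_mul, abs_mul, abs_mul, abs_of_nonneg (by positivity :
      (0:ℝ) ≤ (u ^ 2 + (c - u) ^ 2) + (v ^ 2 + (c - v) ^ 2))] at h1
    norm_num at h1
    have h2 := mul_le_mul_of_nonneg_left (add_le_add (hs u hu) (hs v hv)) hβ'.le
    have h3 : 0 < |β| * M := by positivity
    nlinarith
  have hne2 : u + v - c ≠ 0 := by
    intro h
    have : 2 * v - c = -(2 * u - c) := by linarith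
    rw [this] at hpos
    nlinarith [sq_nonneg (2 * u - c)]
  rcases mul_eq_zero.1 h0 with h1 | h1
  · rcases mul_eq_zero.1 h1 with h2 | h2
    · exact absurd h2 hc
    · rcases mul_eq_zero.1 h2 with h3 | h3
      · linarith
      · exact absurd h3 hne2
  · exact absurd h1 hne

/-- Each part of `rate` is handled separately: the speed by change of variables on the two sides of
the critical point `c / 2`, the neighbourhood of that point because its length is at most the
inverse of the height `⟨c⟩²`, the low frequencies because they fill an interval of length at most
`2M`. -/
theorem lintegral_rate_le {α β M r : ℝ} (hβ : β ≠ 0) (hM0 : 0 < M)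
    (hM : 3 * |α| ≤ 4 * |β| * M) (hr : 0 ≤ r) (c t : ℝ) :
    ∫⁻ u : ℝ, ENNReal.ofReal (rate α β M u (c - u)) *
        ENNReal.ofReal (br (t - (symbol α β u + symbol α β (c - u))) ^ (-r)) ≤
      2 * jap r + 1 + ENNReal.ofReal (2 * M) := by
  set μ : ℝ → ℝ := fun u => symbol α β u + symbol α β (c - u) with hμ
  set μ' : ℝ → ℝ := fun u => dsymbol α β u - dsymbol α β (c - u) with hμ'
  have hd : ∀ x, HasDerivAt μ (μ' x) x := by
    intro x
    have h1 := (hasDerivAt_symbol α β (c - x)).comp x ((hasDerivAt_id x).const_sub c)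
    exact ((hasDerivAt_symbol α β x).add h1).congr_deriv (by simp [hμ']; ring)
  set S : Set ℝ := {u | M ≤ u ^ 2 + (c - u) ^ 2}
  set D : Set ℝ := {u | |u - (c - u)| * br (u + (c - u)) ^ 2 ≤ 1}
  set L : Set ℝ := {u | |u| ≤ M ∧ |c - u| ≤ M}
  set w : ℝ → ℝ≥0∞ := fun u => ENNReal.ofReal (br (t - μ u) ^ (-r)) with hw
  have hSm : MeasurableSet S := measurableSet_le (by fun_prop) (by fun_prop)
  have hDm : MeasurableSet D := measurableSet_le (by fun_prop) (by fun_prop)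
  have hLm : MeasurableSet L := MeasurableSet.inter (s₁ := {u : ℝ | |u| ≤ M})
    (s₂ := {u : ℝ | |c - u| ≤ M}) (measurableSet_le (by fun_prop) (by fun_prop))
    (measurableSet_le (by fun_prop) (by fun_prop))
  have hμc : Continuous μ := by fun_prop
  have hwm : Measurable w :=
    (((continuous_br_rpow (-r)).comp (continuous_const.sub hμc)).measurable).ennreal_ofReal
  have hw1 : ∀ u, w u ≤ 1 := fun u => by
    rw [hw]
    simp only [ENNReal.ofReal_le_one]
    exact Real.rpow_le_one_of_one_le_of_nonpos (one_le_br _) (by linarith)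
  have split : ∀ u, ENNReal.ofReal (rate α β M u (c - u)) * w u =
      S.indicator (fun u => ENNReal.ofReal |μ' u| * w u) u +
      D.indicator (fun _ => ENNReal.ofReal (br c ^ 2)) u * w u + L.indicator 1 u * w u := by
    intro u
    have hb := br_pos c
    have e1 : rate α β M u (c - u) = S.indicator (fun u => |μ' u|) u +
        D.indicator (fun _ => br c ^ 2) u + L.indicator 1 u := by
      simp only [rate, indicator, mem_ofPred_eq, S, D, L, hμ', add_sub_cancel, Pi.one_apply]
    rw [e1, ENNReal.ofReal_add, ENNReal.ofReal_add, add_mul, add_mul]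
    · congr 1
      · congr 1
        · by_cases h : u ∈ S <;> simp [h]
        · by_cases h : u ∈ D <;> simp [h]
      · by_cases h : u ∈ L <;> simp [h]
    all_goals first
      | exact add_nonneg (indicator_nonneg (fun _ _ => by positivity) _)
          (indicator_nonneg (fun _ _ => by positivity) _)
      | exact indicator_nonneg (fun _ _ => by positivity) _
      | exact indicator_nonneg (fun _ _ => by simp) _
  have hSint : ∫⁻ u, S.indicator (fun u => ENNReal.ofReal |μ' u| * w u) u ≤ 2 * jap r := by
    rw [lintegral_indicator hSm]
    rcases eq_or_ne c 0 with rfl | hc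
    -- On the line through the origin the odd symbol cancels, the phase is constant, and injectivity
    -- fails; but then the speed is zero.
    · have : ∀ u, μ' u = 0 := fun u => by simp [hμ']
      simp [this]
    · set A : Set ℝ := S ∩ {u | 0 < 2 * u - c}
      set B : Set ℝ := S ∩ {u | 2 * u - c < 0}
      have hAm : MeasurableSet A := hSm.inter (measurableSet_lt (by fun_prop) (by fun_prop))
      have hBm : MeasurableSet B := hSm.inter (measurableSet_lt (by fun_prop) (by fun_prop))
      have hsub : S ⊆ (A ∪ B) ∪ {c / 2} := by
        intro u hu
        rcases lt_trichotomy 0 (2 * u - c) with h | h | h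
        · exact Or.inl (Or.inl ⟨hu, h⟩)
        · right; simp only [mem_singleton_iff]; linarith
        · exact Or.inl (Or.inr ⟨hu, h⟩)
      have iA : InjOn μ A := injOn_phase hβ hM0 hM hc (fun u hu => hu.1)
        fun u hu v hv => Or.inl (mul_pos hu.2 hv.2)
      have iB : InjOn μ B := injOn_phase hβ hM0 hM hc (fun u hu => hu.1)
        fun u hu v hv => Or.inl (mul_pos_of_neg_of_neg hu.2 hv.2)
      calc _ ≤ ∫⁻ u in (A ∪ B) ∪ {c / 2}, ENNReal.ofReal |μ' u| * w u :=
            lintegral_mono_set hsub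
        _ ≤ (∫⁻ u in A, ENNReal.ofReal |μ' u| * w u) + (∫⁻ u in B, ENNReal.ofReal |μ' u| * w u)
            + ∫⁻ u in {c / 2}, ENNReal.ofReal |μ' u| * w u :=
            (lintegral_union_le _ _ _).trans (by gcongr; exact lintegral_union_le _ _ _)
        _ ≤ jap r + jap r + 0 := by
            gcongr
            · exact lintegral_abs_deriv_mul_br_le hAm hd iA r t
            · exact lintegral_abs_deriv_mul_br_le hBm hd iB r t
            · simp
        _ = 2 * jap r := by rw [add_zero, two_mul]
  have hDint : ∫⁻ u, D.indicator (fun _ => ENNReal.ofReal (br c ^ 2)) u * w u ≤ 1 := by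
    calc _ ≤ ∫⁻ u, D.indicator (fun _ => ENNReal.ofReal (br c ^ 2)) u :=
          lintegral_mono fun u => mul_le_of_le_one_right' (hw1 u)
      _ = ENNReal.ofReal (br c ^ 2) * volume D := by
          rw [lintegral_indicator hDm, setLIntegral_const]
      _ ≤ ENNReal.ofReal (br c ^ 2) * ENNReal.ofReal ((br c ^ 2)⁻¹) := by
          gcongr
          have hb : 0 < br c ^ 2 := by have := br_pos c; positivity
          have : D ⊆ Icc (c / 2 - (br c ^ 2)⁻¹ / 2) (c / 2 + (br c ^ 2)⁻¹ / 2) := by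
            intro u hu
            have h1 : |u - (c - u)| * br c ^ 2 ≤ 1 := by
              have := hu; simp only [D, mem_ofPred_eq, add_sub_cancel] at this; exact this
            have h2 : |u - (c - u)| ≤ (br c ^ 2)⁻¹ := by
              rw [← one_div, le_div_iff₀ hb]; exact h1
            have := abs_le.1 h2
            constructor <;> linarith [this.1, this.2]
          refine (measure_mono this).trans ?_
          rw [Real.volume_Icc]
          exact ENNReal.ofReal_le_ofReal (by linarith)
      _ = 1 := by
          have hb : 0 < br c ^ 2 := by have := br_pos c; positivity
          rw [← ENNReal.ofReal_mul hb.le, mul_inv_cancel₀ hb.ne', ENNReal.ofReal_one]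
  have hLint : ∫⁻ u, L.indicator 1 u * w u ≤ ENNReal.ofReal (2 * M) := by
    calc _ ≤ ∫⁻ u, L.indicator 1 u := lintegral_mono fun u => mul_le_of_le_one_right' (hw1 u)
      _ = volume L := by rw [lintegral_indicator_one hLm]
      _ ≤ volume (Icc (-M) M) := measure_mono fun u hu => abs_le.1 hu.1
      _ = _ := by rw [Real.volume_Icc]; congr 1; ring
  have hm1 : Measurable (S.indicator (fun u => ENNReal.ofReal |μ' u| * w u)) :=
    (Measurable.mul (by fun_prop) hwm).indicator hSm
  have hm2 : Measurable fun u => D.indicator (fun _ => ENNReal.ofReal (br c ^ 2)) u * w u :=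
    (measurable_const.indicator hDm).mul hwm
  calc _ = ∫⁻ u, (S.indicator (fun u => ENNReal.ofReal |μ' u| * w u) u +
      D.indicator (fun _ => ENNReal.ofReal (br c ^ 2)) u * w u + L.indicator 1 u * w u) :=
        lintegral_congr split
    _ ≤ _ := by
        have hm3 : Measurable fun u => S.indicator (fun u => ENNReal.ofReal |μ' u| * w u) u +
          D.indicator (fun _ => ENNReal.ofReal (br c ^ 2)) u * w u := hm1.add hm2
        rw [lintegral_add_left hm3, lintegral_add_left hm1]
        gcongr

/-! ### Pointwise bounds for the multiplier of the bilinear estimate -/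

/-- The size of the resonance function. -/
def reso (x y : ℝ) : ℝ := |(x + y) * x * y| * ((x + y) ^ 2 + x ^ 2 + y ^ 2)

theorem reso_nonneg (x y : ℝ) : 0 ≤ reso x y := by unfold reso; positivity

/-- A rational majorant of the frequency part of the multiplier. -/
def freqMajorant (x y : ℝ) : ℝ :=
  (x + y) ^ 2 / br (x + y) ^ 3 * (br x ^ 4 * br y ^ 3) / (1 + reso x y)

theorem sq_div_br_cube_le_one (a : ℝ) : a ^ 2 / br a ^ 3 ≤ 1 := by
  have hb := br_pos a
  rw [div_le_one (by positivity)]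
  calc a ^ 2 = |a| ^ 2 := (sq_abs a).symm
    _ ≤ br a ^ 2 := by gcongr; exact abs_le_br a
    _ ≤ br a ^ 3 := pow_le_pow_right₀ (one_le_br a) (by norm_num)

theorem freqMajorant_le_of_le {x y m : ℝ} (hx : |x| ≤ m) (hy : |y| ≤ m) :
    freqMajorant x y ≤ (1 + m) ^ 7 := by
  unfold freqMajorant
  have hm : 0 ≤ m := (abs_nonneg x).trans hx
  have h0 := reso_nonneg x y
  have hbx := br_pos x
  have hby := br_pos y
  refine (div_le_self ?_ (by linarith)).trans ?_
  · have := br_pos (x + y); positivity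
  calc _ ≤ 1 * ((1 + m) ^ 4 * (1 + m) ^ 3) := by
        gcongr
        · exact sq_div_br_cube_le_one _
        · unfold br; gcongr
        · unfold br; gcongr
    _ = _ := by ring

/-- The resonance is at least `|x+y||x|³|y|`. Dividing by it removes one power of the output, three
of the larger and one of the smaller input frequency; `128 = 2⁷` comes from replacing brackets by
absolute values. -/
theorem freqMajorant_le {x y : ℝ} (hy : 1 ≤ |y|) (hxy : |y| ≤ |x|) :
    freqMajorant x y ≤ 128 * (|x + y| / br (x + y) ^ 3) * (|x| * |y| ^ 2) := by
  unfold freqMajorant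
  have hb := br_pos (x + y)
  have hX : 0 < |x| := by linarith
  have h0 := reso_nonneg x y
  have hbx : br x ≤ 2 * |x| := by unfold br; linarith
  have hby : br y ≤ 2 * |y| := by unfold br; linarith
  have hbx0 := br_pos x
  have hby0 := br_pos y
  rw [div_le_iff₀ (by linarith)]
  have hr : |x + y| * |x| ^ 3 * |y| ≤ 1 + reso x y := by
    have : |x + y| * |x| ^ 3 * |y| ≤ reso x y := by
      unfold reso
      rw [abs_mul, abs_mul]
      have h1 : |x| ^ 2 ≤ (x + y) ^ 2 + x ^ 2 + y ^ 2 := by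
        rw [sq_abs]; nlinarith [sq_nonneg (x + y), sq_nonneg y]
      calc _ = |x + y| * |x| * |y| * |x| ^ 2 := by ring
        _ ≤ _ := by gcongr
    linarith
  calc (x + y) ^ 2 / br (x + y) ^ 3 * (br x ^ 4 * br y ^ 3)
      ≤ (x + y) ^ 2 / br (x + y) ^ 3 * ((2 * |x|) ^ 4 * (2 * |y|) ^ 3) := by gcongr
    _ = 128 * (|x + y| / br (x + y) ^ 3) * (|x| * |y| ^ 2) * (|x + y| * |x| ^ 3 * |y|) := by
        rw [← sq_abs (x + y)]; ring
    _ ≤ _ := by gcongr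

theorem abs_div_br_cube_le_one (a : ℝ) : |a| / br a ^ 3 ≤ 1 := by
  have hb := br_pos a
  rw [div_le_one (by positivity)]
  exact (abs_le_br a).trans (le_self_pow₀ (one_le_br a) (by norm_num))

/-- When the output is comparable to `x`, the factor `|x+y| / ⟨x+y⟩³` gains two powers of `|x|` over
the cubic bound of `freqMajorant_le`. -/
theorem freqMajorant_le_of_ge {x y k : ℝ} (hk : 0 < k) (hy : 1 ≤ |y|) (hxy : |y| ≤ |x|)
    (ha : k * |x| ≤ |x + y|) : freqMajorant x y ≤ 128 / k ^ 2 * |x| := by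
  have hX : 0 < |x| := by linarith
  have hA : 0 < |x + y| := lt_of_lt_of_le (by positivity) ha
  have hb := br_pos (x + y)
  have h1 : |x + y| / br (x + y) ^ 3 ≤ 1 / (k * |x|) ^ 2 := by
    calc |x + y| / br (x + y) ^ 3 ≤ |x + y| / |x + y| ^ 3 := by
          gcongr; exact abs_le_br _
      _ = 1 / |x + y| ^ 2 := by field_simp
      _ ≤ _ := by gcongr
  calc _ ≤ 128 * (|x + y| / br (x + y) ^ 3) * (|x| * |y| ^ 2) := freqMajorant_le hy hxy
    _ ≤ 128 * (1 / (k * |x|) ^ 2) * (|x| * |x| ^ 2) := by gcongr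
    _ = _ := by field_simp

/-- This covers pairs `(u, v)` that may approach the critical point `u = v`, where only the bound by
`|x|` is available. Where `|u - v| ⟨u + v⟩² ≤ 1` the second part of `rate` exceeds `|x|`; elsewhere
`|u - v| ≥ (3|x|)⁻²`, which leaves a speed of at least `|β||x| / 18`. -/
theorem freqMajorant_le_rate_of_ge {α β M x y u v k : ℝ} (hβ : β ≠ 0)
    (hM : 3 * |α| ≤ 4 * |β| * M) (hk : 0 < k) (hx : 1 ≤ |x|) (hy : 1 ≤ |y|)
    (hxy : |y| ≤ |x|)
    (ha : k * |x| ≤ |x + y|) (huv : M ≤ u ^ 2 + v ^ 2) (huv' : x ^ 2 / 2 ≤ u ^ 2 + v ^ 2)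
    (hs : |x| ≤ |u + v|) (hs' : |u + v| ≤ 2 * |x|) :
    freqMajorant x y ≤ 128 / k ^ 2 * (1 + 18 / |β|) * rate α β M u v := by
  have hβ' : 0 < |β| := abs_pos.2 hβ
  have hQ := freqMajorant_le_of_ge hk hy hxy ha
  have hb := br_pos (u + v)
  have key : |x| ≤ (1 + 18 / |β|) * rate α β M u v := by
    have hR := rate_nonneg α β M u v
    rcases le_total (|u - v| * br (u + v) ^ 2) 1 with h | h
    · have h1 := rate_ge_of_close (α := α) (β := β) (M := M) h
      have h2 : |x| ≤ br (u + v) ^ 2 := by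
        have : |x| ≤ br (u + v) := hs.trans (abs_le_br _)
        exact this.trans (le_self_pow₀ (one_le_br _) (by norm_num))
      have : 0 ≤ 18 / |β| * rate α β M u v := by positivity
      linarith
    · have h1 := rate_ge_of_large hM huv
      have h2 : br (u + v) ≤ 3 * |x| := by unfold br; linarith
      have h3 : 1 ≤ |u - v| * (3 * |x|) ^ 2 := h.trans (by gcongr)
      have h4 : |β| * |x| / 18 ≤ rate α β M u v := by
        refine le_trans ?_ h1
        calc |β| * |x| / 18 = |β| * (1 * |x| / 18) := by ring
          _ ≤ |β| * ((|u - v| * (3 * |x|) ^ 2) * |x| / 18) := by gcongr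
          _ = |β| * (|u - v| * |x| * (x ^ 2 / 2)) := by rw [← sq_abs x]; ring
          _ ≤ _ := by gcongr
      have h5 : |x| ≤ 18 / |β| * rate α β M u v := by
        rw [div_mul_eq_mul_div, le_div_iff₀ hβ']
        linarith
      linarith
  calc _ ≤ 128 / k ^ 2 * |x| := hQ
    _ ≤ 128 / k ^ 2 * ((1 + 18 / |β|) * rate α β M u v) := by gcongr
    _ = _ := by ring

set_option maxHeartbeats 1000000 in
/-- Outside of low frequencies, the frequency part of the multiplier is controlled by `rate` on
each of the three lines along which it will be integrated. -/
theorem exists_rate_bound {α β : ℝ} (hβ : β ≠ 0) :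
    ∃ m C : ℝ, 10 ≤ m ∧ 0 < C ∧ 3 * |α| ≤ |β| * m ^ 2 ∧ ∀ x y : ℝ, |y| ≤ |x| →
      (|y| ≤ 1 → (x + y) ^ 2 ≤ C * rate α β (m ^ 2 / 2) x y) ∧
      (1 ≤ |y| → freqMajorant x y ≤ C * rate α β (m ^ 2 / 2) x y ∧
        freqMajorant x y ≤ C * rate α β (m ^ 2 / 2) (x + y) (-y) ∧
        freqMajorant x y ≤ C * rate α β (m ^ 2 / 2) (x + y) (-x)) := by
  have hβ' : 0 < |β| := abs_pos.2 hβ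
  -- Above `m` the quintic part of the dispersion dominates the cubic part; the `10` only leaves
  -- room in the numerical inequalities.
  set m : ℝ := 10 + |α| / |β| with hm
  have hm10 : 10 ≤ m := by rw [hm]; have : 0 ≤ |α| / |β| := by positivity
                           linarith
  have hαβ : 3 * |α| ≤ |β| * m ^ 2 := by
    have h1 : |α| / |β| ≤ m := by rw [hm]; linarith
    have h2 : |α| ≤ m * |β| := (div_le_iff₀ hβ').1 h1
    have h3 : 0 ≤ m * |β| := by positivity
    nlinarith
  have hM : 3 * |α| ≤ 4 * |β| * (m ^ 2 / 2) := by
    have : 0 ≤ |β| * m ^ 2 := by positivity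
    linarith
  -- The first term serves the bounded frequencies. In the second, `2048` is `128 / k²` for `k =
  -- 1/4`, the worst comparability constant used below.
  set C : ℝ := (1 + m) ^ 7 + 2048 * (1 + 18 / |β|) with hC
  have hC1 : (1 + m) ^ 7 ≤ C := by rw [hC]; have : 0 ≤ 2048 * (1 + 18 / |β|) := by positivity
                                   linarith
  have hC2 : 2048 * (1 + 18 / |β|) ≤ C := by rw [hC]; have : 0 ≤ (1 + m) ^ 7 := by positivity
                                             linarith
  have hC0 : 0 < C := lt_of_lt_of_le (by positivity) hC1
  have hC3 : 256 / |β| ≤ C := by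
    refine le_trans ?_ hC2
    have : 256 / |β| = 256 * (1 / |β|) := by ring
    have h2 : 18 / |β| = 18 * (1 / |β|) := by ring
    have h3 : 0 < 1 / |β| := by positivity
    rw [this, h2]
    nlinarith
  refine ⟨m, C, hm10, hC0, hαβ, fun x y hxy => ?_⟩
  have hR := fun u v => rate_nonneg α β (m ^ 2 / 2) u v
  rcases lt_or_ge |x| m with hx | hx
  -- For bounded frequencies all three pairs lie in the box where the last part of `rate` is one.
  · have hm2 : 2 * m ≤ m ^ 2 / 2 := by nlinarith
    have ha : |x + y| ≤ 2 * m := (abs_add_le x y).trans (by linarith)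
    have b1 : ∀ {u v Q : ℝ}, |u| ≤ 2 * m → |v| ≤ 2 * m → Q ≤ (1 + m) ^ 7 →
        Q ≤ C * rate α β (m ^ 2 / 2) u v := by
      intro u v Q hu hv hQ
      have := one_le_rate (α := α) (β := β) (hu.trans hm2) (hv.trans hm2)
      calc Q ≤ C * 1 := by linarith
        _ ≤ _ := by gcongr
    have hx2 : |x| ≤ 2 * m := by linarith
    have hy2 : |y| ≤ 2 * m := by linarith
    have hQ := freqMajorant_le_of_le hx.le (hxy.trans hx.le)
    refine ⟨fun _ => b1 hx2 hy2 ?_, fun _ => ⟨b1 hx2 hy2 hQ, b1 ha (by simpa using hy2) hQ,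
      b1 ha (by simpa using hx2) hQ⟩⟩
    rw [← sq_abs]
    calc |x + y| ^ 2 ≤ (2 * m) ^ 2 := by gcongr
      _ ≤ (1 + m) ^ 3 := by nlinarith [sq_nonneg m]
      _ ≤ _ := pow_le_pow_right₀ (by linarith) (by norm_num)
  · have hX : 0 < |x| := by linarith
    have hx2 : m ^ 2 ≤ x ^ 2 := by rw [← sq_abs x]; gcongr
    have hL1 : m ^ 2 / 2 ≤ x ^ 2 + y ^ 2 := by nlinarith [sq_nonneg y, sq_nonneg x]
    have hL2 : x ^ 2 / 2 ≤ (x + y) ^ 2 + (-y) ^ 2 := by nlinarith [sq_nonneg (x + 2 * y)]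
    have hL3 : m ^ 2 / 2 ≤ (x + y) ^ 2 + (-x) ^ 2 := by nlinarith [sq_nonneg (x + y), sq_nonneg x]
    have conv : ∀ {Q q R k : ℝ}, 0 ≤ R → k / |β| ≤ C → 0 ≤ k → Q ≤ k * q → |β| * q ≤ R →
        Q ≤ C * R := by
      intro Q q R k hR0 hk hk0 hQ hq
      calc Q ≤ k * q := hQ
        _ = k / |β| * (|β| * q) := by field_simp
        _ ≤ k / |β| * R := by gcongr
        _ ≤ C * R := by gcongr
    refine ⟨fun hy1 => ?_, fun hy1 => ⟨?_, ?_, ?_⟩⟩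
    -- A low frequency meets a high one: `|x - y|` is comparable to `|x + y|`, so the speed alone
    -- beats the square of the derivative.
    · refine conv (k := 2) (hR x y) ?_ (by norm_num) ?_ (rate_ge_of_large hM hL1)
      · exact le_trans (by gcongr; norm_num) hC3
      · have h1 : |x| - 1 ≤ |x - y| := by linarith [abs_sub_abs_le_abs_sub x y]
        have h2 : |x| - 1 ≤ |x + y| := by
          have := abs_sub_abs_le_abs_sub x (-y)
          rw [abs_neg, sub_neg_eq_add] at this; linarith
        have h3 : |x + y| ≤ |x| + 1 := (abs_add_le x y).trans (by linarith)
        have h4 : (100:ℝ) ≤ x ^ 2 + y ^ 2 := by nlinarith [sq_nonneg y]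
        rw [← sq_abs (x + y)]
        calc |x + y| ^ 2 = |x + y| * |x + y| := sq _
          _ ≤ (2 * |x - y|) * |x + y| := by gcongr; linarith
          _ ≤ (2 * |x - y|) * |x + y| * (x ^ 2 + y ^ 2) :=
            le_mul_of_one_le_right (by positivity) (by linarith)
          _ = _ := by ring
    -- The output frequency is fixed. For opposite signs the pair is far from the critical point `x
    -- = y`; if moreover `x + y` is bounded, both sides have size `|x+y||x|³` and no power is to
    -- spare. For equal signs the critical point can be met, but then the output is large.
    · rcases le_total (x * y) 0 with hs | hs
      · have h1 : |x| ≤ |x - y| := by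
          apply sq_le_sq.1
          nlinarith [sq_nonneg y]
        refine conv (k := 128) (hR x y) ?_ (by norm_num) ?_ (rate_ge_of_large hM hL1)
        · exact le_trans (by gcongr; norm_num) hC3
        · have hb := br_pos (x + y)
          calc _ ≤ 128 * (|x + y| / br (x + y) ^ 3) * (|x| * |y| ^ 2) := freqMajorant_le hy1 hxy
            _ ≤ 128 * (|x + y| / 1) * (|x - y| * |y| ^ 2) := by
                gcongr; exact one_le_pow₀ (one_le_br _)
            _ = 128 * (|x - y| * |x + y| * y ^ 2) := by rw [sq_abs]; ring
            _ ≤ _ := by gcongr; nlinarith [sq_nonneg x]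
      · have h1 : |x| ≤ |x + y| := by
          apply sq_le_sq.1
          nlinarith [sq_nonneg y]
        have h2 : |x + y| ≤ 2 * |x| := (abs_add_le x y).trans (by linarith)
        refine (freqMajorant_le_rate_of_ge (k := 1) hβ hM one_pos (by linarith) hy1 hxy
          (by linarith) hL1 (by nlinarith [sq_nonneg x, sq_nonneg y]) h1 h2).trans ?_
        refine mul_le_mul_of_nonneg_right (le_trans ?_ hC2) (hR _ _)
        have : 0 ≤ 1 + 18 / |β| := by positivity
        linarith
    · have hS : x + y + -y = x := by ring
      have hL2' : m ^ 2 / 2 ≤ (x + y) ^ 2 + (-y) ^ 2 := by linarith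
      -- The frequency `x` is fixed, and the critical point is `x = -2y`. Within distance one of it
      -- the output is comparable to `x`, which is the situation of `freqMajorant_le_rate_of_ge`.
      rcases le_total 1 |x + y + y| with h1 | h1
      · refine conv (k := 256) (hR _ _) hC3 (by norm_num) ?_ (rate_ge_of_large hM hL2')
        rw [hS, sub_neg_eq_add]
        have h3 := abs_div_br_cube_le_one (x + y)
        calc _ ≤ 128 * (|x + y| / br (x + y) ^ 3) * (|x| * |y| ^ 2) := freqMajorant_le hy1 hxy
          _ ≤ 128 * 1 * (|x| * |x| ^ 2) := by gcongr
          _ = 256 * (1 * |x| * (x ^ 2 / 2)) := by rw [sq_abs]; ring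
          _ ≤ _ := by gcongr
      · have h2 : 1 / 4 * |x| ≤ |x + y| := by
          have h3 : |x| ≤ |2 * (x + y)| + |x + y + y| := by
            have := abs_sub (2 * (x + y)) (x + y + y)
            rwa [show 2 * (x + y) - (x + y + y) = x by ring] at this
          rw [abs_mul, abs_two] at h3
          linarith
        refine (freqMajorant_le_rate_of_ge (k := 1 / 4) hβ hM (by norm_num)
          (by linarith) hy1 hxy h2 hL2' hL2 (by rw [hS]) (by rw [hS]; linarith)).trans ?_
        refine mul_le_mul_of_nonneg_right (le_trans (le_of_eq ?_) hC2) (hR _ _)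
        norm_num
    · have hS : x + y + -x = y := by ring
      refine conv (k := 128) (hR _ _) ?_ (by norm_num) ?_ (rate_ge_of_large hM hL3)
      · exact le_trans (by gcongr; norm_num) hC3
      · rw [hS, sub_neg_eq_add]
        -- The smaller frequency `y` is fixed. The critical point would be `2x + y = 0`, which `|y|
        -- ≤ |x|` excludes.
        have h1 : |x| ≤ |x + y + x| := by
          have h3 := abs_sub_abs_le_abs_sub (2 * x) (-y)
          rw [abs_mul, abs_two, abs_neg, sub_neg_eq_add] at h3
          rw [show x + y + x = 2 * x + y by ring]
          linarith
        have h3 := abs_div_br_cube_le_one (x + y)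
        have h4 : 1 ≤ |x| := by linarith
        calc _ ≤ 128 * (|x + y| / br (x + y) ^ 3) * (|x| * |y| ^ 2) := freqMajorant_le hy1 hxy
          _ ≤ 128 * 1 * (|x| * (|y| * |x| ^ 2)) := by
              have h5 : |y| ^ 2 ≤ |y| * |x| ^ 2 := by
                rw [sq]
                refine mul_le_mul_of_nonneg_left ?_ (abs_nonneg y)
                exact hxy.trans (le_self_pow₀ h4 (by norm_num))
              gcongr
          _ = 128 * (|x| * |y| * x ^ 2) := by rw [sq_abs]; ring
          _ ≤ 128 * (|x + y + x| * |y| * ((x + y) ^ 2 + (-x) ^ 2)) := by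
              have h5 : x ^ 2 ≤ (x + y) ^ 2 + (-x) ^ 2 := by nlinarith [sq_nonneg (x + y)]
              gcongr

/-- This lets the weaker exponent `γ`, which belongs to the output, be carried by whichever
modulation is largest. -/
theorem rpow_swap {S T γ b : ℝ} (hS : 1 ≤ S) (hST : S ≤ T) (hγ : γ ≤ b) :
    S ^ (-γ) * T ^ (-b) ≤ S ^ (-b) * T ^ (-γ) := by
  have hT : 1 ≤ T := hS.trans hST
  have hS0 : 0 < S := by linarith
  have hT0 : 0 < T := by linarith
  have h1 : S ^ (b - γ) ≤ T ^ (b - γ) := Real.rpow_le_rpow hS0.le hST (by linarith)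
  have e1 : S ^ (-γ) = S ^ (-b) * S ^ (b - γ) := by
    rw [← Real.rpow_add hS0]; congr 1; ring
  have e2 : T ^ (-γ) = T ^ (-b) * T ^ (b - γ) := by
    rw [← Real.rpow_add hT0]; congr 1; ring
  rw [e1, e2]
  calc _ = S ^ (-b) * T ^ (-b) * S ^ (b - γ) := by ring
    _ ≤ S ^ (-b) * T ^ (-b) * T ^ (b - γ) := by gcongr
    _ = _ := by ring

/-- The largest modulation dominates the resonance. -/
theorem exists_modulation_bound {α β m : ℝ} (hβ : β ≠ 0) (hm : 10 ≤ m)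
    (hα : 3 * |α| ≤ |β| * m ^ 2) :
    ∃ c : ℝ, 0 < c ∧ c ≤ 1 ∧ ∀ x y A B D S : ℝ, |y| ≤ |x| →
      |symbol α β (x + y) - symbol α β x - symbol α β y| ≤ |A| + |B| + |D| →
      br A ≤ S → br B ≤ S → br D ≤ S → c * (1 + reso x y) ≤ S := by
  have hβ' : 0 < |β| := abs_pos.2 hβ
  -- One third because the resonance is shared among three modulations; the second entry handles
  -- bounded frequencies, where `reso` is at most `12 m⁵` and `S ≥ 1` is enough.
  refine ⟨min (min 1 |β| / 3) (1 / (1 + 12 * m ^ 5)), by positivity, ?_, ?_⟩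
  · refine (min_le_left _ _).trans ?_
    linarith [min_le_left 1 |β|]
  intro x y A B D S hxy hH hA hB hD
  have hr := reso_nonneg x y
  have hS1 : 1 ≤ S := (one_le_br A).trans hA
  rcases lt_or_ge |x| m with hx | hx
  · have hr2 : reso x y ≤ 12 * m ^ 5 := by
      unfold reso
      have hy : |y| ≤ m := hxy.trans hx.le
      have ha : |x + y| ≤ 2 * m := (abs_add_le x y).trans (by linarith)
      rw [abs_mul, abs_mul, ← sq_abs (x + y), ← sq_abs x, ← sq_abs y]
      calc |x + y| * |x| * |y| * (|x + y| ^ 2 + |x| ^ 2 + |y| ^ 2)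
          ≤ (2 * m) * m * m * ((2 * m) ^ 2 + m ^ 2 + m ^ 2) := by gcongr
        _ = _ := by ring
    calc _ ≤ 1 / (1 + 12 * m ^ 5) * (1 + reso x y) := by gcongr; exact min_le_right _ _
      _ ≤ 1 / (1 + 12 * m ^ 5) * (1 + 12 * m ^ 5) := by gcongr
      _ = 1 := by field_simp
      _ ≤ S := hS1
  · have h1 : 3 * |α| ≤ |β| * (x ^ 2 + y ^ 2) := by
      refine hα.trans ?_
      gcongr
      have : m ^ 2 ≤ x ^ 2 := by rw [← sq_abs x]; gcongr
      linarith [sq_nonneg y]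
    have h2 := (resonance_ge h1).trans hH
    change |β| * reso x y ≤ _ at h2
    unfold br at hA hB hD
    calc _ ≤ min 1 |β| / 3 * (1 + reso x y) := by gcongr; exact min_le_left _ _
      _ = (min 1 |β| * 1 + min 1 |β| * reso x y) / 3 := by ring
      _ ≤ (1 * 1 + |β| * reso x y) / 3 := by
          gcongr
          · exact min_le_left _ _
          · exact min_le_right _ _
      _ ≤ S := by linarith

/-- The part of the multiplier depending on frequencies is controlled by `freqMajorant`, when the
largest modulation is given the weight with exponent `-γ`. -/
theorem freq_weight_le {ρ κ c S x y : ℝ} (hρ : ρ = 7 / 4 - κ) (hκ0 : 0 < κ) (hκ : κ ≤ 1 / 4)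
    (hc0 : 0 < c) (hc1 : c ≤ 1) (hxy : |y| ≤ |x|) (hS : c * (1 + reso x y) ≤ S) :
    (x + y) ^ 2 * (br (x + y) / (br x * br y)) ^ (-(2 * ρ)) * S ^ (-(1 - 4 / 5 * κ)) ≤
      13 / c * freqMajorant x y := by
  have ha := br_pos (x + y)
  have hx := br_pos x
  have hy := br_pos y
  have hx1 := one_le_br x
  have hr := reso_nonneg x y
  have hbxy : br y ≤ br x := by unfold br; linarith
  have h1r : 0 < 1 + reso x y := by linarith
  -- Here `κ ≤ 1/4` enters: it gives `2ρ ≥ 3`.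
  have e1 : (br (x + y) / (br x * br y)) ^ (-(2 * ρ)) ≤
      (br (x + y) ^ 3)⁻¹ * (br x ^ (2 * ρ) * br y ^ (2 * ρ)) := by
    rw [Real.rpow_neg (by positivity), Real.div_rpow (by positivity) (by positivity),
      Real.mul_rpow hx.le hy.le, inv_div, div_eq_inv_mul]
    gcongr
    rw [← Real.rpow_natCast]
    exact Real.rpow_le_rpow_of_exponent_le (one_le_br _) (by push_cast; linarith)
  -- The resonance has degree five, so the power `4κ/5` missing from a full inverse costs
  -- `⟨x⟩^(4κ)`. This fixes the relation between `b'` and `κ`.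
  have e2 : S ^ (-(1 - 4 / 5 * κ)) ≤ 13 / c * (br x ^ (4 * κ) / (1 + reso x y)) := by
    have hreso : 1 + reso x y ≤ 13 * br x ^ 5 := by
      have hxb : |x| ≤ br x := abs_le_br x
      have hyb : |y| ≤ br x := hxy.trans hxb
      have hab : |x + y| ≤ 2 * br x := (abs_add_le x y).trans (by linarith)
      have : reso x y ≤ 12 * br x ^ 5 := by
        unfold reso
        rw [abs_mul, abs_mul, ← sq_abs (x + y), ← sq_abs x, ← sq_abs y]
        calc |x + y| * |x| * |y| * (|x + y| ^ 2 + |x| ^ 2 + |y| ^ 2)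
            ≤ (2 * br x) * br x * br x * ((2 * br x) ^ 2 + br x ^ 2 + br x ^ 2) := by gcongr
          _ = _ := by ring
      have h5 : 1 ≤ br x ^ 5 := one_le_pow₀ hx1
      linarith
    calc S ^ (-(1 - 4 / 5 * κ)) ≤ (c * (1 + reso x y)) ^ (-(1 - 4 / 5 * κ)) :=
          Real.rpow_le_rpow_of_nonpos (by positivity) hS (by linarith)
      _ = c ^ (-(1 - 4 / 5 * κ)) * ((1 + reso x y)⁻¹ * (1 + reso x y) ^ (4 / 5 * κ)) := by
          rw [Real.mul_rpow hc0.le h1r.le]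
          congr 1
          rw [← Real.rpow_neg_one, ← Real.rpow_add h1r]
          congr 1; ring
      _ ≤ c ^ (-1 : ℝ) * ((1 + reso x y)⁻¹ * (13 * br x ^ 5) ^ (4 / 5 * κ)) := by
          have : c ^ (-(1 - 4 / 5 * κ)) ≤ c ^ (-1 : ℝ) :=
            Real.rpow_le_rpow_of_exponent_ge hc0 hc1 (by linarith)
          gcongr
      _ ≤ c ^ (-1 : ℝ) * ((1 + reso x y)⁻¹ * (13 * br x ^ (4 * κ))) := by
          gcongr
          have e5 : ((5 : ℕ) : ℝ) * (4 / 5 * κ) = 4 * κ := by push_cast; ring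
          rw [Real.mul_rpow (by norm_num) (by positivity), ← Real.rpow_natCast,
            ← Real.rpow_mul hx.le, e5]
          refine mul_le_mul_of_nonneg_right ?_ (by positivity)
          calc (13:ℝ) ^ (4 / 5 * κ) ≤ 13 ^ (1:ℝ) :=
                Real.rpow_le_rpow_of_exponent_le (by norm_num) (by linarith)
            _ = 13 := Real.rpow_one _
      _ = _ := by rw [Real.rpow_neg_one]; field_simp
  -- The exponents of `⟨x⟩` and `⟨y⟩` are `4 - (1/2 - 2κ)` and `3 + (1/2 - 2κ)`; the excess is moved
  -- from `⟨y⟩` to the larger `⟨x⟩`.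
  have e3 : br x ^ (2 * ρ) * br y ^ (2 * ρ) * br x ^ (4 * κ) ≤ br x ^ 4 * br y ^ 3 := by
    have h1 : br x ^ (2 * ρ) * br x ^ (4 * κ) = br x ^ 4 * br x ^ (-(1 / 2 - 2 * κ)) := by
      rw [← Real.rpow_natCast (br x) 4, ← Real.rpow_add hx, ← Real.rpow_add hx]
      congr 1; rw [hρ]; push_cast; ring
    have h2 : br y ^ (2 * ρ) = br y ^ 3 * br y ^ (1 / 2 - 2 * κ) := by
      rw [← Real.rpow_natCast (br y) 3, ← Real.rpow_add hy]
      congr 1; rw [hρ]; push_cast; ring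
    have h3 : br x ^ (-(1 / 2 - 2 * κ)) * br y ^ (1 / 2 - 2 * κ) ≤ 1 := by
      rw [Real.rpow_neg hx.le, inv_mul_le_iff₀ (by positivity), mul_one]
      exact Real.rpow_le_rpow hy.le hbxy (by linarith)
    calc _ = (br x ^ (2 * ρ) * br x ^ (4 * κ)) * br y ^ (2 * ρ) := by ring
      _ = br x ^ 4 * br y ^ 3 * (br x ^ (-(1 / 2 - 2 * κ)) * br y ^ (1 / 2 - 2 * κ)) := by
          rw [h1, h2]; ring
      _ ≤ br x ^ 4 * br y ^ 3 * 1 := by gcongr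
      _ = _ := mul_one _
  have hS0 : 0 < S := lt_of_lt_of_le (by positivity) hS
  calc _ ≤ (x + y) ^ 2 * ((br (x + y) ^ 3)⁻¹ * (br x ^ (2 * ρ) * br y ^ (2 * ρ))) *
        (13 / c * (br x ^ (4 * κ) / (1 + reso x y))) := by gcongr
    _ = 13 / c * ((x + y) ^ 2 / br (x + y) ^ 3 *
        (br x ^ (2 * ρ) * br y ^ (2 * ρ) * br x ^ (4 * κ)) / (1 + reso x y)) := by
        field_simp
    _ ≤ _ := by
        unfold freqMajorant
        gcongr

/-- The square of the multiplier of the bilinear estimate. -/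
def multSq (s b b' x y A B D : ℝ) : ℝ :=
  (x + y) ^ 2 * (br (x + y) ^ s * br x ^ (-s) * br y ^ (-s)) ^ 2 *
    (br A ^ (-(2 * (1 - b'))) * (br B ^ (-(2 * b)) * br D ^ (-(2 * b))))

theorem multSq_swap (s b b' x y A B D : ℝ) :
    multSq s b b' x y A B D = multSq s b b' y x A D B := by
  unfold multSq
  rw [add_comm y x]
  ring

/-- The ratio `⟨x+y⟩ / (⟨x⟩⟨y⟩)` is at most one, so its powers decrease in `s` and only the lowest
regularity `-ρ` has to be treated. -/
theorem bracket_ratio_sq_le {s ρ x y : ℝ} (hs : -ρ ≤ s) :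
    (br (x + y) ^ s * br x ^ (-s) * br y ^ (-s)) ^ 2 ≤
      (br (x + y) / (br x * br y)) ^ (-(2 * ρ)) := by
  have ha := br_pos (x + y)
  have hx := br_pos x
  have hy := br_pos y
  have ht : 0 < br (x + y) / (br x * br y) := by positivity
  have ht1 : br (x + y) / (br x * br y) ≤ 1 := by
    rw [div_le_one (by positivity)]; exact br_add_le_mul x y
  have e : br (x + y) ^ s * br x ^ (-s) * br y ^ (-s) = (br (x + y) / (br x * br y)) ^ s := by
    rw [Real.div_rpow ha.le (by positivity), Real.mul_rpow hx.le hy.le, Real.rpow_neg hx.le,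
      Real.rpow_neg hy.le]
    field_simp
  rw [e, ← Real.rpow_natCast, ← Real.rpow_mul ht.le]
  exact Real.rpow_le_rpow_of_exponent_ge ht ht1 (by push_cast; linarith)

set_option maxHeartbeats 1000000 in
/-- The pointwise bound for the multiplier by kernels that can be integrated along one of three
families of lines. -/
theorem exists_multSq_le {α β s κ b b' : ℝ} (hβ : β ≠ 0) (hκ0 : 0 < κ) (hκ : κ ≤ 1 / 4)
    (hs : -(7 / 4) + κ ≤ s) (hb : 1 / 2 < b) (hb' : 2 * (1 - b') = 1 - 4 / 5 * κ) :
    ∃ M C : ℝ, 0 < M ∧ 3 * |α| ≤ 4 * |β| * M ∧ 0 < C ∧ ∀ x y A B D : ℝ,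
      |symbol α β (x + y) - symbol α β x - symbol α β y| ≤ |A| + |B| + |D| →
      multSq s b b' x y A B D ≤
        C * (rate α β M x y * (br B ^ (-(2 * b)) * br D ^ (-(2 * b))) +
          rate α β M (x + y) (-y) * (br A ^ (-(2 * b)) * br D ^ (-(2 * b))) +
          rate α β M (x + y) (-x) * (br A ^ (-(2 * b)) * br B ^ (-(2 * b)))) := by
  obtain ⟨m, C, hm, hC, hα, hrate⟩ := exists_rate_bound (α := α) hβ
  obtain ⟨c, hc0, hc1, hmod⟩ := exists_modulation_bound hβ hm hα
  have hM0 : 0 < m ^ 2 / 2 := by positivity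
  have hMα : 3 * |α| ≤ 4 * |β| * (m ^ 2 / 2) := by
    have : 0 ≤ |β| * m ^ 2 := by positivity
    linarith
  set ρ : ℝ := 7 / 4 - κ with hρ
  set C' : ℝ := 256 * C + 13 / c * C with hC'
  have hC'1 : 256 * C ≤ C' := by rw [hC']; have : 0 < 13 / c * C := by positivity
                                 linarith
  have hC'2 : 13 / c * C ≤ C' := by rw [hC']; linarith
  have hC'0 : 0 < C' := by positivity
  refine ⟨m ^ 2 / 2, C', hM0, hMα, hC'0, ?_⟩
  have main : ∀ x y A B D : ℝ, |y| ≤ |x| →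
      |symbol α β (x + y) - symbol α β x - symbol α β y| ≤ |A| + |B| + |D| →
      multSq s b b' x y A B D ≤
        C' * (rate α β (m ^ 2 / 2) x y * (br B ^ (-(2 * b)) * br D ^ (-(2 * b))) +
          rate α β (m ^ 2 / 2) (x + y) (-y) * (br A ^ (-(2 * b)) * br D ^ (-(2 * b))) +
          rate α β (m ^ 2 / 2) (x + y) (-x) * (br A ^ (-(2 * b)) * br B ^ (-(2 * b)))) := by
    intro x y A B D hxy hH
    have hA0 := br_pos A
    have hB0 := br_pos B
    have hD0 := br_pos D
    have hR0 := rate_nonneg α β (m ^ 2 / 2) x y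
    have hR1 := rate_nonneg α β (m ^ 2 / 2) (x + y) (-y)
    have hR2 := rate_nonneg α β (m ^ 2 / 2) (x + y) (-x)
    have hw := bracket_ratio_sq_le (s := s) (ρ := ρ) (x := x) (y := y) (by rw [hρ]; linarith)
    set t := br (x + y) / (br x * br y) with ht
    have ht0 : 0 < t := by
      have := br_pos (x + y); have := br_pos x; have := br_pos y; positivity
    obtain ⟨hlow, hhigh⟩ := hrate x y hxy
    set PA := br A ^ (-(2 * b))
    set PB := br B ^ (-(2 * b))
    set PD := br D ^ (-(2 * b))
    have hPA : 0 < PA := by positivity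
    have hPB : 0 < PB := by positivity
    have hPD : 0 < PD := by positivity
    have T0 : 0 ≤ rate α β (m ^ 2 / 2) x y * (PB * PD) := by positivity
    have T1 : 0 ≤ rate α β (m ^ 2 / 2) (x + y) (-y) * (PA * PD) := by positivity
    have T2 : 0 ≤ rate α β (m ^ 2 / 2) (x + y) (-x) * (PA * PB) := by positivity
    have step : multSq s b b' x y A B D ≤
        (x + y) ^ 2 * t ^ (-(2 * ρ)) * (br A ^ (-(1 - 4 / 5 * κ)) * (PB * PD)) := by
      unfold multSq
      rw [hb']
      gcongr
    refine step.trans ?_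
    -- If `|y| ≤ 1`, the Sobolev weights are bounded and the resonance is not used: the output
    -- modulation is simply discarded.
    rcases le_total |y| 1 with hy | hy
    · have h1 : t ^ (-(2 * ρ)) ≤ 256 := by
        have hbx := br_pos x
        have hby := br_pos y
        have h2 : (1 / 4 : ℝ) ≤ t := by
          rw [ht, le_div_iff₀ (by positivity)]
          have h3 : br x ≤ br (x + y) * br y := by
            have := br_add_le_mul (x + y) (-y)
            rwa [br_neg, add_neg_cancel_right] at this
          have h4 : br y ≤ 2 := by unfold br; linarith
          have h5 := br_pos (x + y)
          calc 1 / 4 * (br x * br y) ≤ 1 / 4 * ((br (x + y) * 2) * 2) := by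
                gcongr; exact h3.trans (by gcongr)
            _ = _ := by ring
        calc t ^ (-(2 * ρ)) ≤ (1 / 4 : ℝ) ^ (-(2 * ρ)) :=
              Real.rpow_le_rpow_of_nonpos (by norm_num) h2 (by rw [hρ]; linarith)
          _ ≤ (1 / 4 : ℝ) ^ (-4 : ℝ) :=
              Real.rpow_le_rpow_of_exponent_ge (by norm_num) (by norm_num) (by rw [hρ]; linarith)
          _ = 256 := by
              rw [Real.rpow_neg (by norm_num)]; norm_num
      have h2 : br A ^ (-(1 - 4 / 5 * κ)) ≤ 1 :=
        Real.rpow_le_one_of_one_le_of_nonpos (one_le_br A) (by linarith)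
      calc _ ≤ (C * rate α β (m ^ 2 / 2) x y) * 256 * (1 * (PB * PD)) := by
            gcongr; exact hlow hy
        _ = 256 * C * (rate α β (m ^ 2 / 2) x y * (PB * PD)) := by ring
        _ ≤ C' * (rate α β (m ^ 2 / 2) x y * (PB * PD)) := by gcongr
        _ ≤ _ := by gcongr; linarith
    · obtain ⟨q0, q1, q2⟩ := hhigh hy
      have fin : ∀ {S R P : ℝ}, c * (1 + reso x y) ≤ S → freqMajorant x y ≤ C * R → 0 ≤ P →
          0 ≤ R → (x + y) ^ 2 * t ^ (-(2 * ρ)) * (S ^ (-(1 - 4 / 5 * κ)) * P) ≤ C' * (R * P) := by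
        intro S R P hS hR hP hRn
        have h1 := freq_weight_le hρ hκ0 hκ hc0 hc1 hxy hS
        calc _ = (x + y) ^ 2 * t ^ (-(2 * ρ)) * S ^ (-(1 - 4 / 5 * κ)) * P := by ring
          _ ≤ 13 / c * freqMajorant x y * P := by gcongr
          _ ≤ 13 / c * (C * R) * P := by gcongr
          _ = 13 / c * C * (R * P) := by ring
          _ ≤ _ := by gcongr
      have hγ : 1 - 4 / 5 * κ ≤ 2 * b := by linarith
      -- The largest modulation selects the family of lines: it pays for the frequencies, and the
      -- other two are left with the integrable exponent `2b`.
      by_cases hAmax : br B ≤ br A ∧ br D ≤ br A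
      · have hS := hmod x y A B D (br A) hxy hH le_rfl hAmax.1 hAmax.2
        refine (fin hS q0 (mul_pos hPB hPD).le hR0).trans ?_
        gcongr; linarith
      · rcases le_total (br D) (br B) with hDB | hDB
        · have hAB : br A ≤ br B := by
            by_contra! h
            exact hAmax ⟨h.le, hDB.trans h.le⟩
          have hS := hmod x y A B D (br B) hxy hH hAB le_rfl hDB
          have h1 := rpow_swap (one_le_br A) hAB hγ
          calc _ = (x + y) ^ 2 * t ^ (-(2 * ρ)) * (br A ^ (-(1 - 4 / 5 * κ)) * PB * PD) := by ring
            _ ≤ (x + y) ^ 2 * t ^ (-(2 * ρ)) * (PA * br B ^ (-(1 - 4 / 5 * κ)) * PD) := by gcongr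
            _ = (x + y) ^ 2 * t ^ (-(2 * ρ)) * (br B ^ (-(1 - 4 / 5 * κ)) * (PA * PD)) := by ring
            _ ≤ _ := (fin hS q1 (mul_pos hPA hPD).le hR1)
            _ ≤ _ := by gcongr; linarith
        · have hAD : br A ≤ br D := by
            by_contra! h
            exact hAmax ⟨hDB.trans h.le, h.le⟩
          have hS := hmod x y A B D (br D) hxy hH hAD hDB le_rfl
          have h1 := rpow_swap (one_le_br A) hAD hγ
          calc _ = (x + y) ^ 2 * t ^ (-(2 * ρ)) * (br A ^ (-(1 - 4 / 5 * κ)) * PD * PB) := by ring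
            _ ≤ (x + y) ^ 2 * t ^ (-(2 * ρ)) * (PA * br D ^ (-(1 - 4 / 5 * κ)) * PB) := by gcongr
            _ = (x + y) ^ 2 * t ^ (-(2 * ρ)) * (br D ^ (-(1 - 4 / 5 * κ)) * (PA * PB)) := by ring
            _ ≤ _ := (fin hS q2 (mul_pos hPA hPB).le hR2)
            _ ≤ _ := by gcongr; linarith
  intro x y A B D hH
  rcases le_total |y| |x| with h | h
  · exact main x y A B D h hH
  · have h1 := main y x A D B h (by
      rw [add_comm y x, add_right_comm, show symbol α β (x + y) - symbol α β y - symbol α β x =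
        symbol α β (x + y) - symbol α β x - symbol α β y by ring]; exact hH)
    rw [multSq_swap]
    refine h1.trans (le_of_eq ?_)
    rw [add_comm y x, rate_comm α β _ y x]
    ring

/-! ### The bilinear estimate -/

theorem ENNReal_add_sq_le (a b : ℝ≥0∞) : (a + b) ^ 2 ≤ 2 * (a ^ 2 + b ^ 2) := by
  rcases eq_or_ne a ∞ with rfl | ha
  · simp
  rcases eq_or_ne b ∞ with rfl | hb
  · simp
  lift a to ℝ≥0 using ha
  lift b to ℝ≥0 using hb
  norm_cast
  exact add_sq_le

section Convolution

variable {G : Type*} [MeasurableSpace G] [AddCommGroup G] [MeasurableAdd₂ G] [MeasurableNeg G] [MeasurableSub₂ G]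
  {μ : Measure G} [SigmaFinite μ] [μ.IsAddLeftInvariant]

theorem lintegral_lintegral_mul_sub_sq {f g : G → ℝ≥0∞} (hf : Measurable f) (hg : Measurable g) :
    ∫⁻ x, ∫⁻ y, (f y * g (x - y)) ^ 2 ∂μ ∂μ = (∫⁻ x, f x ^ 2 ∂μ) * ∫⁻ x, g x ^ 2 ∂μ := by
  have hm : Measurable fun z : G × G => (f z.2 * g (z.1 - z.2)) ^ 2 := by fun_prop
  rw [lintegral_lintegral_swap hm.aemeasurable]
  have : ∀ y, ∫⁻ x, (f y * g (x - y)) ^ 2 ∂μ = f y ^ 2 * ∫⁻ x, g x ^ 2 ∂μ := by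
    intro y
    simp only [mul_pow]
    rw [lintegral_const_mul _ (by fun_prop)]
    congr 1
    exact lintegral_sub_right_eq_self (fun x => g x ^ 2) y
  simp only [this]
  rw [lintegral_mul_const _ (hf.pow_const 2)]

variable {h : G → G → ℝ≥0∞} {A : ℝ≥0∞} {f g : G → ℝ≥0∞}

/-- The output `p` is fixed and `q` runs along a line on which `h` is square integrable uniformly,
so Cauchy-Schwarz applies in `q`. -/
theorem lintegral_sq_kernel_output_le (hh : Measurable (Function.uncurry h))
    (hA : ∀ c, ∫⁻ u, h u (c - u) ^ 2 ∂μ ≤ A) (hf : Measurable f) (hg : Measurable g) :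
    ∫⁻ p, (∫⁻ q, h q (p - q) * (f q * g (p - q)) ∂μ) ^ 2 ∂μ ≤
      A * ((∫⁻ x, f x ^ 2 ∂μ) * ∫⁻ x, g x ^ 2 ∂μ) := by
  have m1 : Measurable fun z : G × G => h z.2 (z.1 - z.2) :=
    hh.comp (measurable_snd.prodMk (measurable_fst.sub measurable_snd))
  have m2 : Measurable fun z : G × G => f z.2 * g (z.1 - z.2) := by fun_prop
  refine lintegral_sq_le_of_forall (m1.mul m2).lintegral_prod_right' fun E hE => ?_
  have := sq_lintegral_kernel_le (μ := μ) (ν := μ) (k := fun p q => h q (p - q))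
    (B := fun p q => f q * g (p - q)) m1 m2 hE (C := A) hA
  refine this.trans (le_of_eq ?_)
  rw [lintegral_lintegral_mul_sub_sq hf hg]
  ring

/-- Pairing with `E` makes the three functions interchangeable: by Tonelli the input variable `q`
becomes the fixed one, and the kernel is square integrable in `p`. -/
theorem lintegral_sq_kernel_input_le [μ.IsNegInvariant] (hh : Measurable (Function.uncurry h))
    (hA : ∀ c, ∫⁻ u, h u (c - u) ^ 2 ∂μ ≤ A) (hf : Measurable f) (hg : Measurable g) :
    ∫⁻ p, (∫⁻ q, h p (q - p) * (f q * g (p - q)) ∂μ) ^ 2 ∂μ ≤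
      A * ((∫⁻ x, f x ^ 2 ∂μ) * ∫⁻ x, g x ^ 2 ∂μ) := by
  have m1 : Measurable fun z : G × G => h z.1 (z.2 - z.1) :=
    hh.comp (measurable_fst.prodMk (measurable_snd.sub measurable_fst))
  have m2 : Measurable fun z : G × G => f z.2 * g (z.1 - z.2) := by fun_prop
  refine lintegral_sq_le_of_forall (m1.mul m2).lintegral_prod_right' fun E hE => ?_
  have m3 : Measurable fun z : G × G => h z.2 (z.1 - z.2) :=
    hh.comp (measurable_snd.prodMk (measurable_fst.sub measurable_snd))
  have m4 : Measurable fun z : G × G => E z.2 * g (z.2 - z.1) := by fun_prop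
  have e1 : ∫⁻ p, E p * ∫⁻ q, h p (q - p) * (f q * g (p - q)) ∂μ ∂μ =
      ∫⁻ q, f q * ∫⁻ p, h p (q - p) * (E p * g (p - q)) ∂μ ∂μ := by
    have l1 : ∀ p, E p * ∫⁻ q, h p (q - p) * (f q * g (p - q)) ∂μ =
        ∫⁻ q, E p * (h p (q - p) * (f q * g (p - q))) ∂μ := fun p =>
      (lintegral_const_mul _ ((m1.mul m2).comp measurable_prodMk_left)).symm
    have l2 : ∀ q, f q * ∫⁻ p, h p (q - p) * (E p * g (p - q)) ∂μ =
        ∫⁻ p, f q * (h p (q - p) * (E p * g (p - q))) ∂μ := fun q =>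
      (lintegral_const_mul _ ((m3.mul m4).comp measurable_prodMk_left)).symm
    simp only [l1, l2]
    rw [lintegral_lintegral_swap]
    · refine lintegral_congr fun q => lintegral_congr fun p => ?_
      ring
    · exact ((hE.comp measurable_fst).mul (m1.mul m2)).aemeasurable
  refine (congrArg (· ^ 2) e1).trans_le ?_
  have := sq_lintegral_kernel_le (μ := μ) (ν := μ) (k := fun q p => h p (q - p))
    (B := fun q p => E p * g (p - q)) m3 m4 hf (C := A) hA
  refine this.trans (le_of_eq ?_)
  have e2 : ∫⁻ q, ∫⁻ p, (E p * g (p - q)) ^ 2 ∂μ ∂μ =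
      (∫⁻ x, E x ^ 2 ∂μ) * ∫⁻ x, g x ^ 2 ∂μ := by
    have := lintegral_lintegral_mul_sub_sq (μ := μ) hE (g := fun x => g (-x)) (by fun_prop)
    simp only [neg_sub] at this
    rw [this]
    congr 1
    exact lintegral_neg_eq_self (fun x => g x ^ 2)
  rw [e2]
  ring

/-- The reflection `q ↦ p - q` exchanges the two inputs and reduces this to the previous case. -/
theorem lintegral_sq_kernel_input_le' [μ.IsNegInvariant] (hh : Measurable (Function.uncurry h))
    (hA : ∀ c, ∫⁻ u, h u (c - u) ^ 2 ∂μ ≤ A) (hf : Measurable f) (hg : Measurable g) :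
    ∫⁻ p, (∫⁻ q, h p (-q) * (f q * g (p - q)) ∂μ) ^ 2 ∂μ ≤
      A * ((∫⁻ x, f x ^ 2 ∂μ) * ∫⁻ x, g x ^ 2 ∂μ) := by
  have e : ∀ p, ∫⁻ q, h p (-q) * (f q * g (p - q)) ∂μ =
      ∫⁻ q, h p (q - p) * (g q * f (p - q)) ∂μ := by
    intro p
    rw [← lintegral_sub_left_eq_self (fun q => h p (-q) * (f q * g (p - q))) p]
    refine lintegral_congr fun q => ?_
    rw [neg_sub, sub_sub_cancel, mul_comm (f _)]
  simp only [e]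
  rw [mul_comm (∫⁻ x, f x ^ 2 ∂μ)]
  exact lintegral_sq_kernel_input_le hh hA hg hf

end Convolution

theorem sqrt_add_le (a b : ℝ) : √(a + b) ≤ √a + √b := by
  refine Real.sqrt_le_iff.2 ⟨by positivity, ?_⟩
  have h1 : a ≤ √a ^ 2 := by
    rcases le_total 0 a with h | h
    · rw [Real.sq_sqrt h]
    · exact h.trans (sq_nonneg _)
  have h2 : b ≤ √b ^ 2 := by
    rcases le_total 0 b with h | h
    · rw [Real.sq_sqrt h]
    · exact h.trans (sq_nonneg _)
  nlinarith [Real.sqrt_nonneg a, Real.sqrt_nonneg b,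
    mul_nonneg (Real.sqrt_nonneg a) (Real.sqrt_nonneg b)]

/-- The weight `⟨ξ⟩^s ⟨τ - p(ξ)⟩^b`. -/
def wt (α β s b : ℝ) (p : ℝ × ℝ) : ℝ := br p.1 ^ s * br (p.2 - symbol α β p.1) ^ b

theorem wt_pos (α β s b : ℝ) (p : ℝ × ℝ) : 0 < wt α β s b p := by
  have h1 := br_pos p.1
  have h2 := br_pos (p.2 - symbol α β p.1)
  unfold wt; positivity

@[fun_prop]
theorem continuous_wt (α β s b : ℝ) : Continuous (wt α β s b) := by
  unfold wt
  exact ((continuous_br_rpow s).comp continuous_fst).mul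
    ((continuous_br_rpow b).comp (by fun_prop))

@[fun_prop]
theorem measurable_wt (α β s b : ℝ) : Measurable (wt α β s b) := (continuous_wt α β s b).measurable

/-- The kernels that majorize the multiplier of the bilinear estimate. -/
def rateKernel (α β M b : ℝ) (u v : ℝ × ℝ) : ℝ :=
  √(rate α β M u.1 v.1 *
    (br (u.2 - symbol α β u.1) ^ (-(2 * b)) * br (v.2 - symbol α β v.1) ^ (-(2 * b))))

theorem measurable_rateKernel (α β M b : ℝ) :
    Measurable (Function.uncurry fun u v => ENNReal.ofReal (rateKernel α β M b u v)) := by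
  have h1 : Measurable fun w : (ℝ × ℝ) × (ℝ × ℝ) => rate α β M w.1.1 w.2.1 :=
    (measurable_rate α β M).comp (by fun_prop : Measurable fun w : (ℝ × ℝ) × (ℝ × ℝ) =>
      (w.1.1, w.2.1))
  have h2 : Measurable fun w : ℝ × ℝ => br (w.2 - symbol α β w.1) ^ (-(2 * b)) :=
    ((continuous_br_rpow _).comp (by fun_prop)).measurable
  exact (h1.mul ((h2.comp measurable_fst).mul (h2.comp measurable_snd))).sqrt.ennreal_ofReal

/-- Integrating in the time frequency convolves the two modulation weights, by
`lintegral_br_mul_br`, into one weight of the phase along the line; then `lintegral_rate_le` bounds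
the rest uniformly in `c`. -/
theorem lintegral_rateKernel_le {α β M b : ℝ} (hβ : β ≠ 0) (hM0 : 0 < M)
    (hM : 3 * |α| ≤ 4 * |β| * M) (hb : 1 / 2 < b) (c : ℝ × ℝ) :
    ∫⁻ u : ℝ × ℝ, ENNReal.ofReal (rateKernel α β M b u (c - u)) ^ 2 ≤
      ENNReal.ofReal (2 ^ (2 * b)) * (2 * jap (2 * b)) *
        (2 * jap (2 * b) + 1 + ENNReal.ofReal (2 * M)) := by
  set r := 2 * b with hr
  have hr1 : 1 < r := by rw [hr]; linarith
  set A := ENNReal.ofReal (2 ^ r) * (2 * jap r)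
  have e : ∀ u : ℝ × ℝ, ENNReal.ofReal (rateKernel α β M b u (c - u)) ^ 2 =
      ENNReal.ofReal (rate α β M u.1 (c.1 - u.1)) *
        (ENNReal.ofReal (br (u.2 - symbol α β u.1) ^ (-r)) *
          ENNReal.ofReal (br ((c.2 - symbol α β (c.1 - u.1)) - u.2) ^ (-r))) := by
    intro u
    have h0 := rate_nonneg α β M u.1 (c.1 - u.1)
    have h1 := br_pos (u.2 - symbol α β u.1)
    have h2 := br_pos (c.2 - u.2 - symbol α β (c.1 - u.1))
    unfold rateKernel
    rw [← ENNReal.ofReal_pow (Real.sqrt_nonneg _), Real.sq_sqrt (by simp; positivity),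
      ENNReal.ofReal_mul (by simpa using h0), ENNReal.ofReal_mul (by positivity)]
    simp only [Prod.fst_sub, Prod.snd_sub]
    rw [sub_right_comm c.2 u.2]
  simp only [e]
  have hm2 : Measurable fun w : ℝ × ℝ => ENNReal.ofReal (br (w.2 - symbol α β w.1) ^ (-r)) *
      ENNReal.ofReal (br ((c.2 - symbol α β (c.1 - w.1)) - w.2) ^ (-r)) :=
    (((continuous_br_rpow _).comp (by fun_prop)).measurable.ennreal_ofReal).mul
      (((continuous_br_rpow _).comp (by fun_prop)).measurable.ennreal_ofReal)
  have hm1 : Measurable fun w : ℝ × ℝ => ENNReal.ofReal (rate α β M w.1 (c.1 - w.1)) :=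
    ((measurable_rate α β M).comp (by fun_prop : Measurable fun w : ℝ × ℝ =>
      (w.1, c.1 - w.1))).ennreal_ofReal
  have hm12 := (hm1.mul hm2).aemeasurable (μ := (volume : Measure ℝ).prod (volume : Measure ℝ))
  rw [Measure.volume_eq_prod]
  refine (lintegral_prod _ hm12).trans_le ?_
  simp only [Pi.mul_apply]
  calc _ ≤ ∫⁻ u : ℝ, A * (ENNReal.ofReal (rate α β M u (c.1 - u)) *
        ENNReal.ofReal (br (c.2 - (symbol α β u + symbol α β (c.1 - u))) ^ (-r))) := by
        refine lintegral_mono fun u => ?_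
        rw [lintegral_const_mul' _ _ ENNReal.ofReal_ne_top]
        have := lintegral_br_mul_br hr1 (symbol α β u) (c.2 - symbol α β (c.1 - u))
        calc _ ≤ ENNReal.ofReal (rate α β M u (c.1 - u)) * (A * ENNReal.ofReal
              (br (c.2 - symbol α β (c.1 - u) - symbol α β u) ^ (-r))) := by gcongr
          _ = _ := by
              rw [show c.2 - symbol α β (c.1 - u) - symbol α β u =
                c.2 - (symbol α β u + symbol α β (c.1 - u)) by ring]
              ring
    _ ≤ _ := by
        rw [lintegral_const_mul' _ _ (by
          have := (jap_lt_top hr1).ne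
          finiteness)]
        gcongr
        exact lintegral_rate_le hβ hM0 hM (by linarith) c.1 c.2

theorem multiplier_sq {α β s b b' : ℝ} (p q : ℝ × ℝ) :
    (wt α β s (b' - 1) p * |p.1| * ((wt α β s b q)⁻¹ * (wt α β s b (p - q))⁻¹)) ^ 2 =
      multSq s b b' q.1 (p.1 - q.1) (p.2 - symbol α β p.1) (q.2 - symbol α β q.1)
        (p.2 - q.2 - symbol α β (p.1 - q.1)) := by
  unfold multSq wt
  simp only [Prod.fst_sub, Prod.snd_sub, add_sub_cancel]
  have h1 := br_pos p.1
  have h2 := br_pos q.1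
  have h3 := br_pos (p.1 - q.1)
  have h4 := br_pos (p.2 - symbol α β p.1)
  have h5 := br_pos (q.2 - symbol α β q.1)
  have h6 := br_pos (p.2 - q.2 - symbol α β (p.1 - q.1))
  have e : ∀ {a r : ℝ}, 0 < a → a ^ (-(2 * r)) = ((a ^ r)⁻¹) ^ 2 := by
    intro a r ha
    rw [← Real.rpow_neg ha.le, ← Real.rpow_natCast, ← Real.rpow_mul ha.le]
    congr 1; push_cast; ring
  rw [e h4, e h5, e h6, Real.rpow_neg h2.le, Real.rpow_neg h3.le,
    show b' - 1 = -(1 - b') by ring, Real.rpow_neg h4.le, ← sq_abs p.1]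
  rw [mul_inv, mul_inv]
  ring

theorem exists_multiplier_le {α β s κ b b' : ℝ} (hβ : β ≠ 0) (hκ0 : 0 < κ) (hκ : κ ≤ 1 / 4)
    (hs : -(7 / 4) + κ ≤ s) (hb : 1 / 2 < b) (hb' : 2 * (1 - b') = 1 - 4 / 5 * κ) :
    ∃ M C : ℝ, 0 < M ∧ 3 * |α| ≤ 4 * |β| * M ∧ ∀ p q : ℝ × ℝ,
      wt α β s (b' - 1) p * |p.1| * ((wt α β s b q)⁻¹ * (wt α β s b (p - q))⁻¹) ≤
        √C * (rateKernel α β M b q (p - q) + rateKernel α β M b p (q - p) +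
          rateKernel α β M b p (-q)) := by
  obtain ⟨M, C, hM0, hM, hC, hmult⟩ := exists_multSq_le (α := α) hβ hκ0 hκ hs hb hb'
  refine ⟨M, C, hM0, hM, fun p q => ?_⟩
  refine le_trans (Real.le_sqrt_of_sq_le (multiplier_sq p q).le) ?_
  -- In this combination of the three modulations the time frequencies cancel, leaving the resonance
  -- function.
  have hres : |symbol α β (q.1 + (p.1 - q.1)) - symbol α β q.1 - symbol α β (p.1 - q.1)| ≤
      |p.2 - symbol α β p.1| + |q.2 - symbol α β q.1| +
        |p.2 - q.2 - symbol α β (p.1 - q.1)| := by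
    have e : symbol α β (q.1 + (p.1 - q.1)) - symbol α β q.1 - symbol α β (p.1 - q.1) =
      -(p.2 - symbol α β p.1) + (q.2 - symbol α β q.1) +
        (p.2 - q.2 - symbol α β (p.1 - q.1)) := by
      rw [add_sub_cancel]; ring
    rw [e]
    refine (abs_add_le _ _).trans ?_
    gcongr
    refine (abs_add_le _ _).trans ?_
    rw [abs_neg]
  refine (Real.sqrt_le_sqrt (hmult _ _ _ _ _ hres)).trans ?_
  rw [Real.sqrt_mul hC.le]
  gcongr
  -- Since the symbol is odd, reflecting a frequency only changes the sign of its modulation.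
  have b1 : br (q.2 - p.2 - symbol α β (q.1 - p.1)) =
      br (p.2 - q.2 - symbol α β (p.1 - q.1)) := by
    rw [← br_neg, ← neg_sub p.1 q.1, symbol_neg]
    congr 1; ring
  have b2 : br (-q.2 - symbol α β (-q.1)) = br (q.2 - symbol α β q.1) := by
    rw [← br_neg, symbol_neg]
    congr 1; ring
  unfold rateKernel
  simp only [Prod.fst_sub, Prod.snd_sub, Prod.fst_neg, Prod.snd_neg, b1, b2, add_sub_cancel,
    neg_sub]
  exact (sqrt_add_le _ _).trans (by gcongr; exact sqrt_add_le _ _)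

set_option maxHeartbeats 400000 in
/-- The bilinear estimate: the derivative of a product in `X_{s,b'-1}` is controlled by the factors
in `X_{s,b}`, in terms of the moduli of the Fourier transforms. -/
theorem bilinear_estimate {α β s κ b b' : ℝ} (hβ : β ≠ 0) (hκ0 : 0 < κ) (hκ : κ ≤ 1 / 4)
    (hs : -(7 / 4) + κ ≤ s) (hb : 1 / 2 < b) (hb' : 2 * (1 - b') = 1 - 4 / 5 * κ) :
    ∃ C : ℝ≥0, ∀ f g : ℝ × ℝ → ℝ≥0∞, Measurable f → Measurable g →
      ∫⁻ p, (ENNReal.ofReal (wt α β s (b' - 1) p * |p.1|) * ∫⁻ q, f q * g (p - q)) ^ 2 ≤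
        C * ((∫⁻ p, (ENNReal.ofReal (wt α β s b p) * f p) ^ 2) *
          ∫⁻ p, (ENNReal.ofReal (wt α β s b p) * g p) ^ 2) := by
  obtain ⟨M, C, hM0, hM, hmult⟩ := exists_multiplier_le (α := α) hβ hκ0 hκ hs hb hb'
  set A : ℝ≥0∞ := ENNReal.ofReal (2 ^ (2 * b)) * (2 * jap (2 * b)) *
        (2 * jap (2 * b) + 1 + ENNReal.ofReal (2 * M)) with hAdef
  have hAtop : A ≠ ∞ := by
    have := (jap_lt_top (r := 2 * b) (by linarith)).ne
    finiteness
  set D : ℝ≥0∞ := ENNReal.ofReal √C ^ 2 * (2 * (2 * (A + A) + A)) with hD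
  have hDtop : D ≠ ∞ := by finiteness
  refine ⟨D.toNNReal, fun f g hf hg => ?_⟩
  rw [ENNReal.coe_toNNReal hDtop]
  set F : ℝ × ℝ → ℝ≥0∞ := fun p => ENNReal.ofReal (wt α β s b p) * f p with hF
  set G : ℝ × ℝ → ℝ≥0∞ := fun p => ENNReal.ofReal (wt α β s b p) * g p with hG
  have hFm : Measurable F := by fun_prop
  have hGm : Measurable G := by fun_prop
  set h : ℝ × ℝ → ℝ × ℝ → ℝ≥0∞ := fun u v => ENNReal.ofReal (rateKernel α β M b u v)
  have hh : Measurable (Function.uncurry h) := measurable_rateKernel α β M b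
  have hA : ∀ c, ∫⁻ u, h u (c - u) ^ 2 ≤ A := lintegral_rateKernel_le hβ hM0 hM hb
  -- Dividing out the weights turns the claim into an unweighted `L²` bound for `F` and `G` with the
  -- full multiplier as kernel.
  have unw : ∀ (φ : ℝ × ℝ → ℝ≥0∞) q, φ q =
      ENNReal.ofReal ((wt α β s b q)⁻¹) * (ENNReal.ofReal (wt α β s b q) * φ q) := by
    intro φ q
    have hw := wt_pos α β s b q
    rw [← mul_assoc, ← ENNReal.ofReal_mul (by positivity), inv_mul_cancel₀ hw.ne']
    simp
  have key : ∀ p q, ENNReal.ofReal (wt α β s (b' - 1) p * |p.1|) * (f q * g (p - q)) ≤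
      ENNReal.ofReal √C * ((h q (p - q) * (F q * G (p - q)) + h p (q - p) * (F q * G (p - q))) +
        h p (-q) * (F q * G (p - q))) := by
    intro p q
    have hw1 := wt_pos α β s (b' - 1) p
    have hw2 := wt_pos α β s b q
    have hw3 := wt_pos α β s b (p - q)
    have e1 : ENNReal.ofReal (wt α β s (b' - 1) p * |p.1|) * (f q * g (p - q)) =
        ENNReal.ofReal (wt α β s (b' - 1) p * |p.1| *
          ((wt α β s b q)⁻¹ * (wt α β s b (p - q))⁻¹)) * (F q * G (p - q)) := by
      have n1 : 0 ≤ wt α β s (b' - 1) p * |p.1| := by positivity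
      have n2 : 0 ≤ (wt α β s b q)⁻¹ := by positivity
      rw [unw f q, unw g (p - q), ENNReal.ofReal_mul n1 (q := _ * _), ENNReal.ofReal_mul n2]
      ring
    have e2 := hmult p q
    rw [e1]
    calc _ ≤ ENNReal.ofReal (√C * (rateKernel α β M b q (p - q) + rateKernel α β M b p (q - p) +
          rateKernel α β M b p (-q))) * (F q * G (p - q)) := by gcongr
      _ = _ := by
          have k0 : ∀ u v, 0 ≤ rateKernel α β M b u v := fun u v => Real.sqrt_nonneg _
          rw [ENNReal.ofReal_mul (Real.sqrt_nonneg _),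
            ENNReal.ofReal_add (add_nonneg (k0 _ _) (k0 _ _)) (k0 _ _),
            ENNReal.ofReal_add (k0 _ _) (k0 _ _)]
          ring
  clear_value h F G A
  have hFG : Measurable fun z : (ℝ × ℝ) × (ℝ × ℝ) => F z.2 * G (z.1 - z.2) := by fun_prop
  have m0 : Measurable fun z : (ℝ × ℝ) × (ℝ × ℝ) => h z.2 (z.1 - z.2) * (F z.2 * G (z.1 - z.2)) :=
    (hh.comp (measurable_snd.prodMk (measurable_fst.sub measurable_snd))).mul hFG
  have m1 : Measurable fun z : (ℝ × ℝ) × (ℝ × ℝ) => h z.1 (z.2 - z.1) * (F z.2 * G (z.1 - z.2)) :=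
    (hh.comp (measurable_fst.prodMk (measurable_snd.sub measurable_fst))).mul hFG
  have m2 : Measurable fun z : (ℝ × ℝ) × (ℝ × ℝ) => h z.1 (-z.2) * (F z.2 * G (z.1 - z.2)) :=
    (hh.comp (measurable_fst.prodMk measurable_snd.neg)).mul hFG
  have hfg : Measurable fun z : (ℝ × ℝ) × (ℝ × ℝ) => f z.2 * g (z.1 - z.2) := by fun_prop
  set T0 : ℝ × ℝ → ℝ≥0∞ := fun p => ∫⁻ q, h q (p - q) * (F q * G (p - q))
  set T1 : ℝ × ℝ → ℝ≥0∞ := fun p => ∫⁻ q, h p (q - p) * (F q * G (p - q))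
  set T2 : ℝ × ℝ → ℝ≥0∞ := fun p => ∫⁻ q, h p (-q) * (F q * G (p - q))
  have t0 : Measurable T0 := m0.lintegral_prod_right'
  have t1 : Measurable T1 := m1.lintegral_prod_right'
  have t2 : Measurable T2 := m2.lintegral_prod_right'
  have m0p : ∀ p, Measurable fun q => h q (p - q) * (F q * G (p - q)) := fun p =>
    m0.comp (measurable_prodMk_left (x := p))
  have m1p : ∀ p, Measurable fun q => h p (q - p) * (F q * G (p - q)) := fun p =>
    m1.comp (measurable_prodMk_left (x := p))
  have keyT : ∀ p, ENNReal.ofReal (wt α β s (b' - 1) p * |p.1|) * ∫⁻ q, f q * g (p - q) ≤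
      ENNReal.ofReal √C * (T0 p + T1 p + T2 p) := by
    intro p
    rw [← lintegral_const_mul' _ _ ENNReal.ofReal_ne_top]
    refine (lintegral_mono (key p)).trans (le_of_eq ?_)
    rw [lintegral_const_mul' _ _ ENNReal.ofReal_ne_top]
    congr 1
    have m01 : Measurable fun q => h q (p - q) * (F q * G (p - q)) + h p (q - p) *
      (F q * G (p - q)) := (m0p p).add (m1p p)
    rw [lintegral_add_left m01, lintegral_add_left (m0p p)]
  calc _ ≤ ∫⁻ p, ENNReal.ofReal √C ^ 2 * (2 * (2 * (T0 p ^ 2 + T1 p ^ 2) + T2 p ^ 2)) := by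
        refine lintegral_mono fun p => ?_
        refine (pow_le_pow_left₀ zero_le (keyT p) 2).trans ?_
        rw [mul_pow]
        gcongr
        refine (ENNReal_add_sq_le _ _).trans ?_
        gcongr
        exact ENNReal_add_sq_le _ _
    _ = ENNReal.ofReal √C ^ 2 * (2 * (2 * ((∫⁻ p, T0 p ^ 2) + ∫⁻ p, T1 p ^ 2) +
          ∫⁻ p, T2 p ^ 2)) := by
        have n0 := t0.pow_const 2
        have n1 := t1.pow_const 2
        have n2 := t2.pow_const 2
        rw [lintegral_const_mul' _ _ (by finiteness), lintegral_const_mul' _ _ (by finiteness),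
          lintegral_add_right _ n2, lintegral_const_mul' _ _ (by finiteness),
          lintegral_add_right _ n1]
    _ ≤ ENNReal.ofReal √C ^ 2 * (2 * (2 * (A * ((∫⁻ p, F p ^ 2) * ∫⁻ p, G p ^ 2) +
          A * ((∫⁻ p, F p ^ 2) * ∫⁻ p, G p ^ 2)) + A * ((∫⁻ p, F p ^ 2) * ∫⁻ p, G p ^ 2))) := by
        gcongr
        · exact lintegral_sq_kernel_output_le hh hA hFm hGm
        · exact lintegral_sq_kernel_input_le hh hA hFm hGm
        · exact lintegral_sq_kernel_input_le' hh hA hFm hGm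
    _ = _ := by rw [hD, hF, hG]; ring

/-! ### Tempered distributions whose Fourier transform is a function -/

section Rep

variable {E : Type*} [NormedAddCommGroup E] [InnerProductSpace ℝ E] [FiniteDimensional ℝ E]
  [MeasurableSpace E] [BorelSpace E]

/-- The Fourier transform of the tempered distribution `f` is the function `g`. -/
def IsFourierRep (f : 𝓢'(E, ℂ)) (g : E → ℂ) : Prop :=
  AEStronglyMeasurable g volume ∧
    ∀ φ : 𝓢(E, ℂ), Integrable (fun x => φ x * g x) volume ∧ 𝓕 f φ = ∫ x, φ x * g x

/-- A function of at most polynomial growth in the mean. -/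
def IsModerate (g : E → ℂ) : Prop :=
  AEStronglyMeasurable g volume ∧
    ∃ k : ℕ, Integrable (fun x => (((1 + ‖x‖) ^ (-(k : ℝ)) : ℝ) : ℂ) * g x) volume

theorem IsModerate.integrable_mul {g : E → ℂ} (hg : IsModerate g) :
    ∃ (k : ℕ) (C : ℝ), 0 ≤ C ∧ ∀ φ : 𝓢(E, ℂ), Integrable (fun x => φ x * g x) volume ∧
      ‖∫ x, φ x * g x‖ ≤ C * (Finset.Iic ((k, 0) : ℕ × ℕ)).sup (schwartzSeminormFamily ℂ E ℂ) φ := by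
  obtain ⟨hm, k, hk⟩ := hg
  refine ⟨k, 2 ^ k * ∫ x, ‖(((1 + ‖x‖) ^ (-(k : ℝ)) : ℝ) : ℂ) * g x‖,
    mul_nonneg (by positivity) (integral_nonneg fun x => norm_nonneg _), fun φ => ?_⟩
  set S := (Finset.Iic ((k, 0) : ℕ × ℕ)).sup (schwartzSeminormFamily ℂ E ℂ) φ with hS
  have hb : ∀ x, ‖φ x * g x‖ ≤ (2 ^ k * S) * ‖(((1 + ‖x‖) ^ (-(k : ℝ)) : ℝ) : ℂ) * g x‖ := by
    intro x
    have hp : 0 < 1 + ‖x‖ := by positivity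
    have h1 : (1 + ‖x‖) ^ k * ‖φ x‖ ≤ 2 ^ k * S := by
      have := SchwartzMap.one_add_le_sup_seminorm_apply (𝕜 := ℂ) (m := (k, 0)) (k := k) (n := 0) le_rfl le_rfl φ x
      rwa [norm_iteratedFDeriv_zero] at this
    have h2 : ‖φ x‖ ≤ (2 ^ k * S) * (1 + ‖x‖) ^ (-(k : ℝ)) := by
      rw [Real.rpow_neg hp.le, Real.rpow_natCast, ← div_eq_mul_inv, le_div_iff₀ (by positivity)]
      linarith
    rw [norm_mul, norm_mul, Complex.norm_real, Real.norm_of_nonneg (by positivity), ← mul_assoc]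
    gcongr
  have hi : Integrable (fun x => φ x * g x) volume :=
    (hk.norm.const_mul (2 ^ k * S)).mono' (φ.continuous.aestronglyMeasurable.mul hm)
      (ae_of_all _ hb)
  refine ⟨hi, (norm_integral_le_integral_norm _).trans ?_⟩
  refine (integral_mono hi.norm (hk.norm.const_mul (2 ^ k * S)) hb).trans (le_of_eq ?_)
  rw [integral_const_mul]
  ring

theorem IsModerate.exists_rep {g : E → ℂ} (hg : IsModerate g) :
    ∃ f : 𝓢'(E, ℂ), IsFourierRep f g := by
  obtain ⟨k, C, hC, h⟩ := hg.integrable_mul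
  let A : 𝓢(E, ℂ) →L[ℂ] ℂ := SchwartzMap.mkCLMtoNormedSpace (fun φ => ∫ x, φ x * g x)
    (fun φ ψ => by
      rw [← integral_add (h φ).1 (h ψ).1]
      exact integral_congr_ae (ae_of_all _ fun x => by simp [add_mul]))
    (fun a φ => by
      simp only [smul_eq_mul, RingHom.id_apply]
      rw [← integral_const_mul]
      exact integral_congr_ae (ae_of_all _ fun x => by simp [mul_assoc]))
    ⟨_, C, hC, fun φ => (h φ).2⟩
  let F : 𝓢'(E, ℂ) := ContinuousLinearMap.toPointwiseConvergenceCLM _ _ _ _ A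
  refine ⟨𝓕⁻ F, hg.1, fun φ => ⟨(h φ).1, ?_⟩⟩
  rw [FourierTransform.fourier_fourierInv_eq]
  rfl

theorem IsFourierRep.congr {f : 𝓢'(E, ℂ)} {g g' : E → ℂ} (h : IsFourierRep f g) (e : g =ᵐ[volume] g') :
    IsFourierRep f g' := by
  refine ⟨h.1.congr e, fun φ => ?_⟩
  have e' : (fun x => φ x * g x) =ᵐ[volume] fun x => φ x * g' x := by
    filter_upwards [e] with x hx
    rw [hx]
  exact ⟨(h.2 φ).1.congr e', (h.2 φ).2.trans (integral_congr_ae e')⟩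

theorem IsFourierRep.add {f f' : 𝓢'(E, ℂ)} {g g' : E → ℂ} (h : IsFourierRep f g)
    (h' : IsFourierRep f' g') : IsFourierRep (f + f') (fun x => g x + g' x) := by
  refine ⟨h.1.add h'.1, fun φ => ?_⟩
  simp only [mul_add]
  refine ⟨(h.2 φ).1.add (h'.2 φ).1, ?_⟩
  rw [integral_add (h.2 φ).1 (h'.2 φ).1, ← (h.2 φ).2, ← (h'.2 φ).2, FourierTransform.fourier_add]
  rfl

theorem IsFourierRep.smul {f : 𝓢'(E, ℂ)} {g : E → ℂ} (c : ℂ) (h : IsFourierRep f g) :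
    IsFourierRep (c • f) (fun x => c * g x) := by
  refine ⟨h.1.const_mul c, fun φ => ?_⟩
  simp only [mul_left_comm _ c]
  refine ⟨(h.2 φ).1.const_mul c, ?_⟩
  rw [integral_const_mul, ← (h.2 φ).2, FourierTransform.fourier_smul]
  rfl

theorem IsFourierRep.sub {f f' : 𝓢'(E, ℂ)} {g g' : E → ℂ} (h : IsFourierRep f g)
    (h' : IsFourierRep f' g') : IsFourierRep (f - f') (fun x => g x - g' x) := by
  have := h.add (h'.smul (-1))
  convert this using 1
  · ext φ; simp [sub_eq_add_neg]
  · ext x; ring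

theorem IsFourierRep.apply {f : 𝓢'(E, ℂ)} {g : E → ℂ} (h : IsFourierRep f g) (φ : 𝓢(E, ℂ)) :
    f φ = ∫ x, (𝓕⁻ φ) x * g x := by
  rw [← (h.2 (𝓕⁻ φ)).2, TemperedDistribution.fourier_apply, FourierTransform.fourier_fourierInv_eq]

theorem IsFourierRep.eq {f f' : 𝓢'(E, ℂ)} {g : E → ℂ} (h : IsFourierRep f g)
    (h' : IsFourierRep f' g) : f = f' := by
  ext φ
  rw [h.apply, h'.apply]

/-- Testing with a smooth bump equal to one near `x` gives integrability there. -/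
theorem IsFourierRep.locallyIntegrable {f : 𝓢'(E, ℂ)} {g : E → ℂ} (h : IsFourierRep f g) :
    LocallyIntegrable g volume := by
  intro x
  let c : ContDiffBump x := ⟨1, 2, one_pos, one_lt_two⟩
  have hg₁ : HasCompactSupport (Complex.ofRealCLM ∘ c) := c.hasCompactSupport.comp_left rfl
  have hg₂ : ContDiff ℝ (⊤ : ℕ∞) (Complex.ofRealCLM ∘ c) := Complex.ofRealCLM.contDiff.comp c.contDiff
  have hi := (h.2 (hg₁.toSchwartzMap hg₂)).1
  refine ⟨Metric.closedBall x 1, Metric.closedBall_mem_nhds x one_pos, ?_⟩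
  refine (hi.integrableOn (s := Metric.closedBall x 1)).congr_fun (fun y hy => ?_)
    Metric.isClosed_closedBall.measurableSet
  have : c y = 1 := c.one_of_mem_closedBall hy
  simp [this]

theorem IsFourierRep.ae_eq {f : 𝓢'(E, ℂ)} {g g' : E → ℂ} (h : IsFourierRep f g)
    (h' : IsFourierRep f g') : g =ᵐ[volume] g' := by
  have h0 : IsFourierRep (f - f) (fun x => g x - g' x) := h.sub h'
  have : ∀ᵐ x, g x - g' x = 0 := by
    refine ae_eq_zero_of_integral_contDiff_smul_eq_zero h0.locallyIntegrable fun c c_smooth c_cpt => ?_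
    have hg₁ : HasCompactSupport (Complex.ofRealCLM ∘ c) := c_cpt.comp_left rfl
    have hg₂ : ContDiff ℝ (⊤ : ℕ∞) (Complex.ofRealCLM ∘ c) := Complex.ofRealCLM.contDiff.comp c_smooth
    have := (h0.2 (hg₁.toSchwartzMap hg₂)).2
    rw [sub_self, FourierTransform.fourier_zero] at this
    simpa [Complex.real_smul] using this.symm
  filter_upwards [this] with x hx
  exact sub_eq_zero.1 hx

theorem IsFourierRep.lineDeriv {f : 𝓢'(E, ℂ)} {g : E → ℂ} (h : IsFourierRep f g) (m : E) :
    IsFourierRep (∂_{m} f) (fun x => (2 * Real.pi * Complex.I * (inner ℝ x m : ℝ)) * g x) := by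
  refine ⟨(Continuous.aestronglyMeasurable (by fun_prop)).mul h.1, fun φ => ?_⟩
  have hm : (fun x : E => ((inner ℝ x m : ℝ) : ℂ)).HasTemperateGrowth := by fun_prop
  have key := h.2 ((2 * Real.pi * Complex.I) • SchwartzMap.smulLeftCLM ℂ (fun x : E => ((inner ℝ x m : ℝ) : ℂ)) φ)
  have e : ∀ x, ((2 * Real.pi * Complex.I) • SchwartzMap.smulLeftCLM ℂ (fun x : E => ((inner ℝ x m : ℝ) : ℂ)) φ) x * g x
      = φ x * ((2 * Real.pi * Complex.I * (inner ℝ x m : ℝ)) * g x) := by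
    intro x
    simp only [smul_apply, SchwartzMap.smulLeftCLM_apply_apply hm, smul_eq_mul]
    ring
  simp only [e] at key
  refine ⟨key.1, ?_⟩
  rw [← key.2, TemperedDistribution.fourier_lineDerivOp_eq]
  simp

/-- By Cauchy-Schwarz, since a sufficiently negative power of `1 + ‖x‖`, divided by the weight, is
square integrable. -/
theorem isModerate_of_sq {g : E → ℂ} (hg : AEStronglyMeasurable g volume) {w : E → ℝ} (hw : Measurable w)
    {m c : ℝ} (hc : 0 < c) (hwm : ∀ x, c * (1 + ‖x‖) ^ (-m) ≤ w x)
    (h : ∫⁻ x, (ENNReal.ofReal (w x) * ‖g x‖ₑ) ^ 2 < ∞) : IsModerate g := by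
  refine ⟨hg, ?_⟩
  obtain ⟨k, hk⟩ := exists_nat_gt (m + Module.finrank ℝ E + 1)
  refine ⟨k, ?_, ?_⟩
  · exact (Complex.continuous_ofReal.comp ((continuous_const.add continuous_norm).rpow_const
      fun x => Or.inl (ne_of_gt (by have := norm_nonneg x; show (0:ℝ) < 1 + ‖x‖; linarith)))).aestronglyMeasurable.mul hg
  have hb : ∀ x : E, ‖(((1 + ‖x‖) ^ (-(k : ℝ)) : ℝ) : ℂ) * g x‖ₑ ≤
      ENNReal.ofReal (c⁻¹ * (1 + ‖x‖) ^ (m - k)) * (ENNReal.ofReal (w x) * ‖g x‖ₑ) := by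
    intro x
    have hp : 0 < 1 + ‖x‖ := by positivity
    rw [enorm_mul, ← mul_assoc, ← ENNReal.ofReal_mul (by positivity)]
    gcongr
    rw [← ofReal_norm, Complex.norm_real, Real.norm_of_nonneg (by positivity)]
    refine ENNReal.ofReal_le_ofReal ?_
    calc (1 + ‖x‖) ^ (-(k : ℝ)) = c⁻¹ * (1 + ‖x‖) ^ (m - k) * (c * (1 + ‖x‖) ^ (-m)) := by
          rw [show (-(k : ℝ)) = (m - k) + (-m) by ring, Real.rpow_add hp]
          field_simp
      _ ≤ _ := by gcongr; exact hwm x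
  have hm1 : AEMeasurable (fun x : E => ENNReal.ofReal (c⁻¹ * (1 + ‖x‖) ^ (m - k))) volume := by
    fun_prop
  have hm2 : AEMeasurable (fun x => ENNReal.ofReal (w x) * ‖g x‖ₑ) volume :=
    (hw.ennreal_ofReal.aemeasurable).mul hg.enorm
  refine (lintegral_mono hb).trans_lt ?_
  have h3 := lintegral_mul_sq_le hm1 hm2
  have h4 : ∫⁻ x : E, ENNReal.ofReal (c⁻¹ * (1 + ‖x‖) ^ (m - k)) ^ 2 < ∞ := by
    have hi := (integrable_one_add_norm (E := E) (μ := volume) (r := 2 * (k - m))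
      (by nlinarith [(Nat.cast_nonneg (Module.finrank ℝ E) : (0:ℝ) ≤ _)])).const_mul (c⁻¹ ^ 2)
    refine lt_of_le_of_lt (lintegral_mono fun x => ?_) hi.lintegral_lt_top
    have hp : 0 < 1 + ‖x‖ := by positivity
    rw [← ENNReal.ofReal_pow (by positivity), mul_pow, ← Real.rpow_mul_natCast hp.le]
    exact ENNReal.ofReal_le_ofReal (le_of_eq (by congr 2; push_cast; ring))
  by_contra hcon
  rw [not_lt, top_le_iff] at hcon
  rw [hcon] at h3
  simp only [ne_eq, OfNat.ofNat_ne_zero, not_false_eq_true, ENNReal.top_pow, top_le_iff] at h3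
  exact (ENNReal.mul_lt_top h4 h).ne h3

end Rep

/-! ### Density of compactly supported test functions -/

/-- A smooth cut-off function on the line, equal to `1` on `[-1, 1]`. -/
def cutoff : ContDiffBump (0 : ℝ) := ⟨1, 2, one_pos, one_lt_two⟩

def cutoffC (y : ℝ) : ℂ := (cutoff y : ℝ)

theorem contDiff_cutoffC : ContDiff ℝ (⊤ : ℕ∞) cutoffC := Complex.ofRealCLM.contDiff.comp cutoff.contDiff

theorem hasCompactSupport_cutoffC : HasCompactSupport cutoffC :=
  cutoff.hasCompactSupport.comp_left (g := ((↑) : ℝ → ℂ)) Complex.ofReal_zero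

theorem cutoffC_eq_one {y : ℝ} (hy : |y| ≤ 1) : cutoffC y = 1 := by
  have : cutoff y = 1 := cutoff.one_of_mem_closedBall (by simpa [cutoff] using hy)
  simp [cutoffC, this]

theorem norm_cutoffC_le (y : ℝ) : ‖cutoffC y‖ ≤ 1 := by
  rw [cutoffC, Complex.norm_real, Real.norm_of_nonneg cutoff.nonneg]
  exact cutoff.le_one

/-- All derivatives are bounded and vanish for `|y| < 1`. The factor `|y|` is recorded because it
becomes small under dilation. -/
theorem exists_iteratedDeriv_cutoff_le (i : ℕ) :
    ∃ M : ℝ, 0 ≤ M ∧ ∀ y, ‖iteratedDeriv i (fun y => 1 - cutoffC y) y‖ ≤ M * |y| := by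
  have hsm : ContDiff ℝ (⊤ : ℕ∞) (fun y => 1 - cutoffC y) := contDiff_const.sub contDiff_cutoffC
  have hc : Continuous (iteratedDeriv i (fun y => 1 - cutoffC y)) :=
    hsm.continuous_iteratedDeriv i (by exact_mod_cast le_top)
  have hb : ∃ M : ℝ, 0 ≤ M ∧ ∀ y, ‖iteratedDeriv i (fun y => 1 - cutoffC y) y‖ ≤ M := by
    rcases Nat.eq_zero_or_pos i with rfl | hi
    · refine ⟨2, by norm_num, fun y => ?_⟩
      rw [iteratedDeriv_zero]
      refine (norm_sub_le _ _).trans ?_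
      have := norm_cutoffC_le y
      rw [norm_one]
      linarith
    · have e : iteratedDeriv i (fun y => 1 - cutoffC y) = fun y => - iteratedDeriv i cutoffC y := by
        ext y
        rw [iteratedDeriv_const_sub hi, iteratedDeriv_neg]
      rw [e]
      have hcs : HasCompactSupport (iteratedDeriv i cutoffC) := by
        clear hc e
        rw [iteratedDeriv_eq_iterate]
        clear hi
        induction i with
        | zero => exact hasCompactSupport_cutoffC
        | succ j ih =>
          rw [Function.iterate_succ_apply']
          exact HasCompactSupport.deriv ih
      obtain ⟨M, hM⟩ := (contDiff_cutoffC.continuous_iteratedDeriv i (by exact_mod_cast le_top)).bounded_above_of_compact_support hcs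
      exact ⟨M, (norm_nonneg _).trans (hM 0), fun y => by simpa using hM y⟩
  obtain ⟨M, hM0, hM⟩ := hb
  refine ⟨M, hM0, fun y => ?_⟩
  rcases lt_or_ge |y| 1 with hy | hy
  · have : iteratedDeriv i (fun y => 1 - cutoffC y) y = 0 := by
      have he : (fun y => 1 - cutoffC y) =ᶠ[𝓝 y] fun _ => 0 := by
        filter_upwards [(isOpen_lt continuous_abs continuous_const).mem_nhds hy] with x hx
        rw [cutoffC_eq_one (le_of_lt hx), sub_self]
      rw [(he.iteratedDeriv_eq i)]
      simp
    rw [this, norm_zero]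
    positivity
  · exact (hM y).trans (by nlinarith)

theorem hasTemperateGrowth_of_compactSupport {f : ℝ → ℂ} (h : ContDiff ℝ (⊤ : ℕ∞) f) (hf : HasCompactSupport f) :
    f.HasTemperateGrowth := (hf.toSchwartzMap h).hasTemperateGrowth

def dilatedCutoff (n : ℕ) (y : ℝ) : ℂ := cutoffC ((n + 1 : ℝ)⁻¹ * y)

theorem hasTemperateGrowth_dilatedCutoff (n : ℕ) : (dilatedCutoff n).HasTemperateGrowth := by
  refine hasTemperateGrowth_of_compactSupport (contDiff_cutoffC.comp (contDiff_const.mul contDiff_id)) ?_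
  exact hasCompactSupport_cutoffC.comp_homeomorph (Homeomorph.mulLeft₀ ((n + 1 : ℝ)⁻¹) (by positivity))

/-- Derivatives of one minus the dilated cut-off are at most a constant times `|x| / (n + 1)`; the
extra power of `|x|` is absorbed by a higher Schwartz seminorm. -/
theorem tendsto_smul_dilatedCutoff (φ : 𝓢(ℝ, ℂ)) :
    Tendsto (fun n => SchwartzMap.smulLeftCLM ℂ (dilatedCutoff n) φ) atTop (𝓝 φ) := by
  rw [(schwartz_withSeminorms ℂ ℝ ℂ).tendsto_nhds _ φ]
  rintro ⟨k, m⟩ ε hε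
  choose M hM0 hM using exists_iteratedDeriv_cutoff_le
  set C := ∑ i ∈ Finset.range (m + 1), (m.choose i : ℝ) * M i * SchwartzMap.seminorm ℂ (k + 1) (m - i) φ with hC
  have hC0 : 0 ≤ C := Finset.sum_nonneg fun i _ => by
    have := hM0 i
    positivity
  have key : ∀ n : ℕ, SchwartzMap.seminorm ℂ k m (SchwartzMap.smulLeftCLM ℂ (dilatedCutoff n) φ - φ) ≤ C * (n + 1 : ℝ)⁻¹ := by
    intro n
    set r := (n + 1 : ℝ)⁻¹ with hr
    have hr0 : 0 < r := by positivity
    have hr1 : r ≤ 1 := inv_le_one_of_one_le₀ (by linarith [(Nat.cast_nonneg n : (0:ℝ) ≤ n)])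
    have hcd : ContDiff ℝ (⊤ : ℕ∞) (fun y => 1 - cutoffC y) := contDiff_const.sub contDiff_cutoffC
    refine SchwartzMap.seminorm_le_bound' ℂ k m _ (by positivity) fun x => ?_
    have e : ((SchwartzMap.smulLeftCLM ℂ (dilatedCutoff n) φ - φ : 𝓢(ℝ, ℂ)) : ℝ → ℂ) =
        fun x => -((1 - cutoffC (r * x)) * φ x) := by
      ext x
      rw [sub_apply, SchwartzMap.smulLeftCLM_apply_apply (hasTemperateGrowth_dilatedCutoff n)]
      simp only [dilatedCutoff, smul_eq_mul, ← hr]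
      ring
    rw [e, iteratedDeriv_fun_neg, norm_neg, ← norm_iteratedFDeriv_eq_norm_iteratedDeriv]
    have h1 := norm_iteratedFDeriv_mul_le (N := (⊤ : ℕ∞)) (n := m)
      (hcd.comp (contDiff_const.mul contDiff_id : ContDiff ℝ (⊤ : ℕ∞) fun x : ℝ => r * x))
      (φ.smooth ⊤) x (by exact_mod_cast le_top)
    refine (mul_le_mul_of_nonneg_left h1 (by positivity)).trans ?_
    rw [Finset.mul_sum, hC, Finset.sum_mul]
    refine Finset.sum_le_sum fun i _ => ?_
    rw [norm_iteratedFDeriv_eq_norm_iteratedDeriv, norm_iteratedFDeriv_eq_norm_iteratedDeriv]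
    have h2 : ‖iteratedDeriv i ((fun y => 1 - cutoffC y) ∘ fun x => r * x) x‖ ≤ M i * (r * |x|) := by
      have e2 : iteratedDeriv i ((fun y => 1 - cutoffC y) ∘ fun x => r * x) x =
          r ^ i • iteratedDeriv i (fun y => 1 - cutoffC y) (r * x) :=
        congrFun (iteratedDeriv_comp_const_smul (n := i) (f := fun y => 1 - cutoffC y)
          (hcd.of_le (by exact_mod_cast le_top)) r) x
      rw [e2, norm_smul, Real.norm_of_nonneg (by positivity)]
      have := hM i (r * x)
      rw [abs_mul, abs_of_pos hr0] at this
      exact (mul_le_of_le_one_left (norm_nonneg _) (pow_le_one₀ hr0.le hr1)).trans this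
    have h3 := SchwartzMap.le_seminorm' ℂ (k + 1) (m - i) φ x
    have := hM0 i
    calc |x| ^ k * ((m.choose i : ℝ) * _ * ‖iteratedDeriv (m - i) φ x‖)
        ≤ |x| ^ k * ((m.choose i : ℝ) * (M i * (r * |x|)) * ‖iteratedDeriv (m - i) φ x‖) := by gcongr
      _ = (m.choose i : ℝ) * M i * (|x| ^ (k + 1) * ‖iteratedDeriv (m - i) φ x‖) * r := by ring
      _ ≤ _ := by gcongr
  have ht : Tendsto (fun n : ℕ => C * (n + 1 : ℝ)⁻¹) atTop (𝓝 0) := by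
    have := (tendsto_one_div_add_atTop_nhds_zero_nat (𝕜 := ℝ)).const_mul C
    simpa using this
  filter_upwards [(tendsto_order.1 ht).2 ε hε] with n hn
  exact (key n).trans_lt hn

theorem eq_zero_of_forall_compactSupport {f : 𝓢'(ℝ, ℂ)}
    (h : ∀ φ : 𝓢(ℝ, ℂ), HasCompactSupport φ → f φ = 0) : f = 0 := by
  ext φ
  have h1 : Tendsto (fun n => f (SchwartzMap.smulLeftCLM ℂ (dilatedCutoff n) φ)) atTop (𝓝 (f φ)) :=
    (f.continuous.tendsto φ).comp (tendsto_smul_dilatedCutoff φ)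
  have h2 : ∀ n, f (SchwartzMap.smulLeftCLM ℂ (dilatedCutoff n) φ) = 0 := fun n => by
    refine h _ ?_
    have e : ((SchwartzMap.smulLeftCLM ℂ (dilatedCutoff n) φ : 𝓢(ℝ, ℂ)) : ℝ → ℂ) = dilatedCutoff n * φ := by
      ext x
      simp [SchwartzMap.smulLeftCLM_apply_apply (hasTemperateGrowth_dilatedCutoff n)]
    rw [e]
    exact HasCompactSupport.mul_right
      (hasCompactSupport_cutoffC.comp_homeomorph (Homeomorph.mulLeft₀ ((n + 1 : ℝ)⁻¹) (by positivity)))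
  simp only [h2] at h1
  exact tendsto_nhds_unique h1 tendsto_const_nhds |>.symm ▸ rfl

theorem IsFourierRep.ae_eq_zero {f : 𝓢'(ℝ, ℂ)} {g : ℝ → ℂ} (hf : IsFourierRep f g)
    (h : ∀ φ : 𝓢(ℝ, ℂ), HasCompactSupport φ → ∫ x, (𝓕⁻ φ) x * g x = 0) : ∀ᵐ x, g x = 0 := by
  have h0 : f = 0 := eq_zero_of_forall_compactSupport fun φ hφ => (hf.apply φ).trans (h φ hφ)
  have := hf.ae_eq (show IsFourierRep f (fun _ => 0) from ?_)
  · exact this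
  · subst h0
    refine ⟨aestronglyMeasurable_const, fun φ => ?_⟩
    rw [FourierTransform.fourier_zero]
    simp

/-! ### The Sobolev norm on the Fourier side -/

/-- The square of the weighted `L²` norm with weight `⟨ξ⟩^s`. -/
def sobSq (s : ℝ) (h : ℝ → ℂ) : ℝ≥0∞ := ∫⁻ x, (ENNReal.ofReal (br x ^ s) * ‖h x‖ₑ) ^ 2

theorem rpow_le_rpow_of_comparable {K a b : ℝ} (hK : 1 ≤ K) (ha : 0 < a) (hab : a ≤ b) (hba : b ≤ K * a) (r : ℝ) :
    b ^ r ≤ K ^ |r| * a ^ r ∧ a ^ r ≤ K ^ |r| * b ^ r := by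
  have hb : 0 < b := ha.trans_le hab
  have hK0 : 0 < K := by linarith
  have h2 : (1 : ℝ) ≤ K ^ |r| := Real.one_le_rpow hK (abs_nonneg r)
  rcases le_total 0 r with hr | hr
  · constructor
    · rw [abs_of_nonneg hr, ← Real.mul_rpow hK0.le ha.le]
      exact Real.rpow_le_rpow hb.le hba hr
    · exact (Real.rpow_le_rpow ha.le hab hr).trans (le_mul_of_one_le_left (by positivity) h2)
  · constructor
    · exact (Real.rpow_le_rpow_of_nonpos ha hab hr).trans (le_mul_of_one_le_left (by positivity) h2)
    · have := Real.rpow_le_rpow_of_nonpos hb hba hr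
      rw [Real.mul_rpow hK0.le ha.le] at this
      rw [abs_of_nonpos hr, Real.rpow_neg hK0.le, inv_mul_eq_div, le_div_iff₀ (by positivity)]
      linarith

/-- The weight of the Bessel potential of order `s`. -/
def besselWeight (s x : ℝ) : ℝ := (1 + ‖x‖ ^ 2) ^ (s / 2)

theorem besselWeight_pos (s x : ℝ) : 0 < besselWeight s x := by unfold besselWeight; positivity

theorem continuous_besselWeight (s : ℝ) : Continuous (besselWeight s) := by
  unfold besselWeight
  exact (by fun_prop : Continuous fun x : ℝ => 1 + ‖x‖ ^ 2).rpow_const fun x => Or.inl (by positivity)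

theorem besselWeight_br (s x : ℝ) :
    br x ^ s ≤ 2 ^ |s / 2| * besselWeight s x ∧ besselWeight s x ≤ 2 ^ |s / 2| * br x ^ s := by
  have e : br x ^ s = (br x ^ 2) ^ (s / 2) := by
    rw [← Real.rpow_natCast_mul (br_pos x).le]; congr 1; push_cast; ring
  rw [e, besselWeight]
  refine rpow_le_rpow_of_comparable one_le_two (by positivity) ?_ ?_ _ <;> rw [br, Real.norm_eq_abs] <;>
    nlinarith [abs_nonneg x, sq_nonneg (1 - |x|)]

theorem lintegral_sq_mul_le {X : Type*} [MeasurableSpace X] {μ : Measure X} {u v : X → ℝ} {c : ℝ} (hc : 0 ≤ c)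
    (h : ∀ x, u x ≤ c * v x) (g : X → ℝ≥0∞) :
    ∫⁻ x, (ENNReal.ofReal (u x) * g x) ^ 2 ∂μ ≤
      ENNReal.ofReal (c ^ 2) * ∫⁻ x, (ENNReal.ofReal (v x) * g x) ^ 2 ∂μ := by
  rw [← lintegral_const_mul' _ _ ENNReal.ofReal_ne_top]
  refine lintegral_mono fun x => ?_
  rw [ENNReal.ofReal_pow hc, ← mul_pow, ← mul_assoc, ← ENNReal.ofReal_mul hc]
  gcongr
  exact h x

/-- The constant comparing the two versions of the Sobolev weight. -/
def sobConst (s : ℝ) : ℝ≥0∞ := ENNReal.ofReal ((2 ^ |s / 2|) ^ 2)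

theorem eLpNorm_two_sq {X : Type*} [MeasurableSpace X] {μ : Measure X} (f : X → ℂ) :
    eLpNorm f 2 μ ^ 2 = ∫⁻ x, ‖f x‖ₑ ^ 2 ∂μ := by
  have := eLpNorm_nnreal_pow_eq_lintegral (f := f) (μ := μ) (p := 2) (by norm_num)
  simpa using this

theorem enorm_besselWeight_mul (s x : ℝ) (c : ℂ) :
    ‖(besselWeight s x : ℂ) * c‖ₑ = ENNReal.ofReal (besselWeight s x) * ‖c‖ₑ := by
  rw [enorm_mul, ← ofReal_norm, Complex.norm_real, Real.norm_of_nonneg (besselWeight_pos s x).le]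

theorem eLpNorm_besselWeight_sq_le (s : ℝ) (h : ℝ → ℂ) :
    eLpNorm (fun x => (besselWeight s x : ℂ) * h x) 2 volume ^ 2 ≤ sobConst s * sobSq s h := by
  rw [eLpNorm_two_sq]
  simp only [enorm_besselWeight_mul]
  exact lintegral_sq_mul_le (by positivity) (fun x => (besselWeight_br s x).2) _

theorem sobSq_le_eLpNorm (s : ℝ) (h : ℝ → ℂ) :
    sobSq s h ≤ sobConst s * eLpNorm (fun x => (besselWeight s x : ℂ) * h x) 2 volume ^ 2 := by
  rw [eLpNorm_two_sq]
  simp only [enorm_besselWeight_mul]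
  exact lintegral_sq_mul_le (by positivity) (fun x => (besselWeight_br s x).1) _

theorem sobSq_congr {s : ℝ} {h h' : ℝ → ℂ} (e : h =ᵐ[volume] h') : sobSq s h = sobSq s h' := by
  refine lintegral_congr_ae ?_
  filter_upwards [e] with x hx
  rw [hx]

theorem hasTemperateGrowth_besselWeight (s : ℝ) :
    (fun x : ℝ => (besselWeight s x : ℂ)).HasTemperateGrowth := by
  unfold besselWeight
  fun_prop

theorem IsFourierRep.smulLeft {f : 𝓢'(ℝ, ℂ)} {h : ℝ → ℂ} (hf : IsFourierRep f h) {w : ℝ → ℂ}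
    (hw : w.HasTemperateGrowth) (φ : 𝓢(ℝ, ℂ)) :
    TemperedDistribution.smulLeftCLM ℂ w (𝓕 f) φ = ∫ x, φ x * (w x * h x) := by
  rw [TemperedDistribution.smulLeftCLM_apply_apply, (hf.2 _).2]
  refine integral_congr_ae (ae_of_all _ fun x => ?_)
  simp only [SchwartzMap.smulLeftCLM_apply_apply hw, smul_eq_mul]
  ring

/-- Membership supplies an `L²` function equal to the weight times the Fourier transform; dividing
by the weight gives the representative. -/
theorem exists_isFourierRep_of_memSobolev {s : ℝ} {f : 𝓢'(ℝ, ℂ)} (hf : TemperedDistribution.MemSobolev s 2 f) :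
    ∃ h : ℝ → ℂ, Measurable h ∧ IsFourierRep f h ∧ sobSq s h < ∞ := by
  obtain ⟨G, hG⟩ := TemperedDistribution.memSobolev_iff_exists_smulLeftCLM_fourier.1 hf
  have hGm := (Lp.stronglyMeasurable G).measurable
  set h : ℝ → ℂ := fun x => ((besselWeight s x : ℝ) : ℂ)⁻¹ * G x with hh
  have hw0 : ∀ x, ((besselWeight s x : ℝ) : ℂ) ≠ 0 := fun x => by
    exact_mod_cast (besselWeight_pos s x).ne'
  have hinv : ∀ x, besselWeight (-s) x = (besselWeight s x)⁻¹ := fun x => by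
    rw [besselWeight, besselWeight, neg_div, Real.rpow_neg (by positivity)]
  have hwg : ∀ x, (besselWeight s x : ℂ) * h x = G x := fun x => by
    rw [hh]; exact mul_inv_cancel_left₀ (hw0 x) _
  have hhm : Measurable h := by
    refine Measurable.mul ?_ hGm
    exact (Complex.measurable_ofReal.comp (continuous_besselWeight s).measurable).inv
  have hGl : MemLp G 2 volume := Lp.memLp G
  have hsob : sobSq s h < ∞ := by
    refine (sobSq_le_eLpNorm s h).trans_lt (ENNReal.mul_lt_top ENNReal.ofReal_lt_top ?_)
    simp only [hwg]
    exact ENNReal.pow_lt_top hGl.2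
  refine ⟨h, hhm, ⟨hhm.aestronglyMeasurable, fun φ => ?_⟩, hsob⟩
  set ψ := SchwartzMap.smulLeftCLM ℂ (fun x : ℝ => (besselWeight (-s) x : ℂ)) φ with hψ
  have hψx : ∀ x, ψ x * G x = φ x * h x := fun x => by
    rw [hψ, SchwartzMap.smulLeftCLM_apply_apply (hasTemperateGrowth_besselWeight (-s)), hinv, hh]
    push_cast
    simp only [smul_eq_mul]
    ring
  constructor
  · have := (MemLp.mul (p := 2) (q := 2) (r := 1) hGl (ψ.memLp 2 volume))
    rw [memLp_one_iff_integrable] at this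
    exact this.congr (ae_of_all _ hψx)
  · have e : SchwartzMap.smulLeftCLM ℂ (fun x : ℝ => (besselWeight s x : ℂ)) ψ = φ := by
      ext x
      rw [SchwartzMap.smulLeftCLM_apply_apply (hasTemperateGrowth_besselWeight s), hψ,
        SchwartzMap.smulLeftCLM_apply_apply (hasTemperateGrowth_besselWeight (-s)), hinv]
      push_cast
      simp only [smul_eq_mul]
      exact mul_inv_cancel_left₀ (hw0 x) _
    have h1 := congrArg (fun F : 𝓢'(ℝ, ℂ) => F ψ) hG
    simp only [TemperedDistribution.smulLeftCLM_apply_apply, Lp.toTemperedDistribution_apply] at h1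
    have e' : SchwartzMap.smulLeftCLM ℂ (fun x : ℝ => (((1 + ‖x‖ ^ 2) ^ (s / 2) : ℝ) : ℂ)) ψ = φ := e
    rw [e'] at h1
    rw [h1]
    exact integral_congr_ae (ae_of_all _ hψx)

/-- Plancherel gives a candidate for the infimum, and `L²` embeds injectively in the tempered
distributions, so there is no other. -/
theorem IsFourierRep.hsNorm_eq {s : ℝ} {f : 𝓢'(ℝ, ℂ)} {h : ℝ → ℂ} (hf : IsFourierRep f h)
    (hs : sobSq s h < ∞) :
    TemperedDistribution.MemSobolev s 2 f ∧
      hsNorm s f = eLpNorm (fun x => (besselWeight s x : ℂ) * h x) 2 volume := by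
  have hL : MemLp (fun x => (besselWeight s x : ℂ) * h x) 2 volume := by
    refine ⟨(Complex.continuous_ofReal.comp (continuous_besselWeight s)).aestronglyMeasurable.mul hf.1, ?_⟩
    have h1 := (eLpNorm_besselWeight_sq_le s h).trans_lt (ENNReal.mul_lt_top ENNReal.ofReal_lt_top hs)
    by_contra hcon
    rw [not_lt, top_le_iff] at hcon
    simp [hcon] at h1
  have key : TemperedDistribution.smulLeftCLM ℂ (fun x : ℝ => (((1 + ‖x‖ ^ 2) ^ (s / 2) : ℝ) : ℂ)) (𝓕 f) =
      ((hL.toLp _ : Lp ℂ 2 (volume : Measure ℝ)) : 𝓢'(ℝ, ℂ)) := by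
    ext φ
    rw [Lp.toTemperedDistribution_apply]
    refine (hf.smulLeft (hasTemperateGrowth_besselWeight s) φ).trans ?_
    refine integral_congr_ae ?_
    filter_upwards [hL.coeFn_toLp] with x hx
    rw [hx, smul_eq_mul]
  have key2 : TemperedDistribution.besselPotential ℝ ℂ s f =
      ((𝓕⁻ (hL.toLp _ : Lp ℂ 2 (volume : Measure ℝ)) : Lp ℂ 2 (volume : Measure ℝ)) : 𝓢'(ℝ, ℂ)) := by
    rw [← Lp.fourierInv_toTemperedDistribution_eq, ← key,
      ← TemperedDistribution.fourier_besselPotential_eq_smulLeftCLM_fourier_apply,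
      FourierTransform.fourierInv_fourier_eq]
  refine ⟨TemperedDistribution.memSobolev_iff_exists_smulLeftCLM_fourier.2 ⟨_, key⟩, ?_⟩
  have hn : ‖(𝓕⁻ (hL.toLp _ : Lp ℂ 2 (volume : Measure ℝ)) : Lp ℂ 2 (volume : Measure ℝ))‖ₑ =
      eLpNorm (fun x => (besselWeight s x : ℂ) * h x) 2 volume := by
    rw [← ofReal_norm, ← Lp.norm_fourier_eq, FourierTransform.fourier_fourierInv_eq, ofReal_norm, Lp.enorm_toLp]
  rw [hsNorm]
  refine le_antisymm ?_ ?_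
  · exact (iInf₂_le (f := fun (g : Lp ℂ 2 (volume : Measure ℝ))
      (_ : TemperedDistribution.besselPotential ℝ ℂ s f = (g : 𝓢'(ℝ, ℂ))) => ‖g‖ₑ) _ key2).trans hn.le
  · refine le_iInf₂ fun g hg => ?_
    rw [← hn]
    have : (𝓕⁻ (hL.toLp _ : Lp ℂ 2 (volume : Measure ℝ)) : Lp ℂ 2 (volume : Measure ℝ)) = g := by
      have h0 := Lp.ker_toTemperedDistributionCLM_eq_bot (F := ℂ) (μ := (volume : Measure ℝ)) (p := 2)
      have h1 := LinearMap.ker_eq_bot.1 h0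
      exact h1 (key2.symm.trans hg)
    rw [this]

theorem IsFourierRep.hsNorm_sq_le {s : ℝ} {f : 𝓢'(ℝ, ℂ)} {h : ℝ → ℂ} (hf : IsFourierRep f h)
    (hs : sobSq s h < ∞) : hsNorm s f ^ 2 ≤ sobConst s * sobSq s h := by
  rw [(hf.hsNorm_eq hs).2]
  exact eLpNorm_besselWeight_sq_le s h

theorem IsFourierRep.sobSq_le {s : ℝ} {f : 𝓢'(ℝ, ℂ)} {h : ℝ → ℂ} (hf : IsFourierRep f h)
    (hs : sobSq s h < ∞) : sobSq s h ≤ sobConst s * hsNorm s f ^ 2 := by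
  rw [(hf.hsNorm_eq hs).2]
  exact sobSq_le_eLpNorm s h

theorem isModerate_of_sobSq {s : ℝ} {h : ℝ → ℂ} (hm : AEStronglyMeasurable h volume) (hs : sobSq s h < ∞) :
    IsModerate h := by
  refine isModerate_of_sq (w := fun x => br x ^ s) hm (continuous_br_rpow s).measurable (m := -s) one_pos (fun x => ?_) hs
  rw [neg_neg, one_mul]
  rfl

/-! ### Space-time in coordinates -/

/-- The point of space-time with the given pair of coordinates. -/
def ofPair (p : ℝ × ℝ) : Spacetime := point p.2 p.1

/-- The pair of coordinates of a point of space-time. -/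
def toPair (ζ : Spacetime) : ℝ × ℝ := (ζ 0, ζ 1)

@[simp] theorem toPair_ofPair (p : ℝ × ℝ) : toPair (ofPair p) = p := by simp [toPair, ofPair]

@[simp] theorem ofPair_toPair (ζ : Spacetime) : ofPair (toPair ζ) = ζ := by
  ext i
  fin_cases i <;> simp [toPair, ofPair]

@[simp] theorem ofPair_zero (p : ℝ × ℝ) : ofPair p 0 = p.1 := by simp [ofPair]

@[simp] theorem ofPair_one (p : ℝ × ℝ) : ofPair p 1 = p.2 := by simp [ofPair]

theorem continuous_ofPair : Continuous ofPair := by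
  unfold ofPair point
  fun_prop

theorem continuous_toPair : Continuous toPair := by
  unfold toPair
  fun_prop

theorem measurePreserving_toPair : MeasurePreserving toPair volume volume := by
  have h1 := (EuclideanSpace.volume_preserving_symm_measurableEquiv_toLp (Fin 2))
  have h2 := volume_preserving_finTwoArrow ℝ
  exact h2.comp h1

theorem measurePreserving_ofPair : MeasurePreserving ofPair volume volume := by
  have h := measurePreserving_toPair
  refine ⟨continuous_ofPair.measurable, ?_⟩
  rw [← h.map_eq, Measure.map_map continuous_ofPair.measurable continuous_toPair.measurable]
  have : ofPair ∘ toPair = id := funext fun ζ => ofPair_toPair ζ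
  rw [this, Measure.map_id]

theorem measurableEmbedding_ofPair : MeasurableEmbedding ofPair :=
  MeasurableEmbedding.of_measurable_inverse continuous_ofPair.measurable
    (by
      rw [Set.range_eq_univ.2 fun ζ => ⟨toPair ζ, ofPair_toPair ζ⟩]
      exact MeasurableSet.univ) continuous_toPair.measurable toPair_ofPair

theorem measurableEmbedding_toPair : MeasurableEmbedding toPair :=
  MeasurableEmbedding.of_measurable_inverse continuous_toPair.measurable
    (by
      rw [Set.range_eq_univ.2 fun ζ => ⟨ofPair ζ, toPair_ofPair ζ⟩]
      exact MeasurableSet.univ) continuous_ofPair.measurable ofPair_toPair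

theorem inner_ofPair (p q : ℝ × ℝ) : inner ℝ (ofPair p) (ofPair q) = p.1 * q.1 + p.2 * q.2 := by
  rw [PiLp.inner_apply, Fin.sum_univ_two]
  simp [mul_comm]

theorem br_le_norm_ofPair (p : ℝ × ℝ) : br p.1 ≤ 1 + ‖ofPair p‖ ∧ br p.2 ≤ 1 + ‖ofPair p‖ := by
  have h0 := PiLp.norm_apply_le (ofPair p) 0
  have h1 := PiLp.norm_apply_le (ofPair p) 1
  rw [ofPair_zero] at h0
  rw [ofPair_one] at h1
  exact ⟨by rw [br, ← Real.norm_eq_abs]; linarith, by rw [br, ← Real.norm_eq_abs]; linarith⟩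

/-! ### The additive character -/

/-- The character `exp (2πi x)`. -/
def chi (x : ℝ) : ℂ := (Real.fourierChar x : Circle)

theorem chi_eq (x : ℝ) : chi x = Complex.exp (2 * Real.pi * x * Complex.I) := by
  rw [chi, Real.fourierChar_apply]
  push_cast
  ring_nf

@[simp] theorem norm_chi (x : ℝ) : ‖chi x‖ = 1 := Circle.norm_coe _

@[simp] theorem enorm_chi (x : ℝ) : ‖chi x‖ₑ = 1 := by rw [← ofReal_norm]; simp

@[simp] theorem chi_zero : chi 0 = 1 := by simp [chi_eq]

theorem chi_add (x y : ℝ) : chi (x + y) = chi x * chi y := by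
  rw [chi_eq, chi_eq, chi_eq, ← Complex.exp_add]
  congr 1
  push_cast
  ring

@[fun_prop]
theorem continuous_chi : Continuous chi := by
  simp only [funext chi_eq]
  fun_prop

@[fun_prop]
theorem measurable_chi : Measurable chi := continuous_chi.measurable

theorem fourier_eq_chi (f : ℝ → ℂ) (t : ℝ) : 𝓕 f t = ∫ x, chi (-(t * x)) * f x := by
  rw [Real.fourier_real_eq]
  refine integral_congr_ae (ae_of_all _ fun x => ?_)
  simp only [Circle.smul_def, smul_eq_mul, mul_comm t x]
  rfl

theorem fourierInv_eq_chi (f : ℝ → ℂ) (t : ℝ) : 𝓕⁻ f t = ∫ x, chi (t * x) * f x := by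
  rw [Real.fourierInv_eq']
  refine integral_congr_ae (ae_of_all _ fun x => ?_)
  simp only [smul_eq_mul, chi_eq]
  congr 2
  simp

/-! ### Partial Fourier transforms of test functions -/

/-- The inverse Fourier transform of `φ` in coordinates. -/
def invF (φ : 𝓢(Spacetime, ℂ)) (p : ℝ × ℝ) : ℂ := (𝓕⁻ φ) (ofPair p)

theorem continuous_invF (φ : 𝓢(Spacetime, ℂ)) : Continuous (invF φ) :=
  (𝓕⁻ φ).continuous.comp continuous_ofPair

theorem exists_invF_le (φ : 𝓢(Spacetime, ℂ)) (r : ℝ) :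
    ∃ C : ℝ, 0 ≤ C ∧ ∀ p : ℝ × ℝ, ‖invF φ p‖ ≤ C * (br p.1 ^ (-r) * br p.2 ^ (-2 : ℝ)) := by
  obtain ⟨n, hn⟩ := exists_nat_ge r
  set S := (Finset.Iic ((n + 2, 0) : ℕ × ℕ)).sup (fun m => SchwartzMap.seminorm ℂ m.1 m.2) (𝓕⁻ φ)
  refine ⟨2 ^ (n + 2) * S, mul_nonneg (by positivity) (apply_nonneg _ _), fun p => ?_⟩
  have h := SchwartzMap.one_add_le_sup_seminorm_apply (𝕜 := ℂ) (m := (n + 2, 0)) (k := n + 2) (n := 0)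
    le_rfl le_rfl (𝓕⁻ φ) (ofPair p)
  rw [norm_iteratedFDeriv_zero] at h
  obtain ⟨h1, h2⟩ := br_le_norm_ofPair p
  have b1 := br_pos p.1
  have b2 := br_pos p.2
  have h3 : br p.1 ^ r * br p.2 ^ (2 : ℝ) ≤ (1 + ‖ofPair p‖) ^ (n + 2) := by
    rw [pow_add]
    gcongr
    · calc br p.1 ^ r ≤ br p.1 ^ (n : ℝ) := Real.rpow_le_rpow_of_exponent_le (one_le_br _) hn
        _ = br p.1 ^ n := Real.rpow_natCast _ _
        _ ≤ _ := by gcongr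
    · rw [Real.rpow_two]
      gcongr
  rw [Real.rpow_neg b1.le, Real.rpow_neg b2.le, ← mul_inv, ← div_eq_mul_inv,
    le_div_iff₀ (by positivity), mul_comm]
  exact (mul_le_mul_of_nonneg_right h3 (norm_nonneg _)).trans h

theorem integrable_invF_fiber (φ : 𝓢(Spacetime, ℂ)) (ξ : ℝ) : Integrable fun τ => invF φ (ξ, τ) := by
  obtain ⟨C, hC, h⟩ := exists_invF_le φ 0
  refine ((integrable_br (r := 2) one_lt_two).const_mul C).mono'
    ((continuous_invF φ).comp (Continuous.prodMk_right ξ)).aestronglyMeasurable (ae_of_all _ fun τ => ?_)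
  simpa using h (ξ, τ)

theorem integrable_invF (φ : 𝓢(Spacetime, ℂ)) : Integrable (invF φ) := by
  have := (𝓕⁻ φ).integrable (μ := volume)
  exact (measurePreserving_ofPair.integrable_comp_emb measurableEmbedding_ofPair).2 this

/-- The inverse Fourier transform in space of the restriction of `φ` to the time `t`. -/
def sliceF (φ : 𝓢(Spacetime, ℂ)) (t ξ : ℝ) : ℂ := (𝓕⁻ (slice t φ)) ξ

theorem exists_fourier_fiber_le (φ : 𝓢(Spacetime, ℂ)) (r : ℝ) :
    ∃ C : ℝ, 0 ≤ C ∧ ∀ t ξ, ‖∫ τ, chi (-(t * τ)) * invF φ (ξ, τ)‖ ≤ C * br ξ ^ (-r) := by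
  obtain ⟨C, hC, h⟩ := exists_invF_le φ r
  refine ⟨C * ∫ τ, br τ ^ (-2 : ℝ), mul_nonneg hC (integral_nonneg fun τ => by have := br_pos τ; positivity),
    fun t ξ => ?_⟩
  have hi := (integrable_br (r := 2) one_lt_two).const_mul (C * br ξ ^ (-r))
  refine (norm_integral_le_of_norm_le hi (ae_of_all _ fun τ => ?_)).trans (le_of_eq ?_)
  · rw [norm_mul, norm_chi, one_mul, mul_assoc]
    exact h (ξ, τ)
  · rw [integral_const_mul]
    ring

/-- By Fubini the right-hand side has `slice t φ` as its Fourier transform in `ξ`. It is continuous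
and integrable, so Fourier inversion applies. -/
theorem sliceF_eq (φ : 𝓢(Spacetime, ℂ)) (t ξ : ℝ) :
    sliceF φ t ξ = ∫ τ, chi (-(t * τ)) * invF φ (ξ, τ) := by
  set m : ℝ → ℂ := fun ξ => ∫ τ, chi (-(t * τ)) * invF φ (ξ, τ) with hm
  have hcont : Continuous m := by
    obtain ⟨C, hC, h⟩ := exists_invF_le φ 0
    refine continuous_of_dominated (bound := fun τ => C * br τ ^ (-2 : ℝ)) (fun ξ => ?_) (fun ξ => ae_of_all _ fun τ => ?_)
      ((integrable_br (r := 2) one_lt_two).const_mul C) (ae_of_all _ fun τ => ?_)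
    · exact (Continuous.mul (by fun_prop) ((continuous_invF φ).comp (Continuous.prodMk_right ξ))).aestronglyMeasurable
    · rw [norm_mul, norm_chi, one_mul]
      simpa using h (ξ, τ)
    · exact continuous_const.mul ((continuous_invF φ).comp (Continuous.prodMk_left τ))
  have hint : Integrable m := by
    obtain ⟨C, hC, h⟩ := exists_fourier_fiber_le φ 2
    exact ((integrable_br (r := 2) one_lt_two).const_mul C).mono' hcont.aestronglyMeasurable
      (ae_of_all _ fun ξ => h t ξ)
  have hF : 𝓕 m = (slice t φ : ℝ → ℂ) := by
    ext x
    have h1 : slice t φ x = (𝓕 (𝓕⁻ φ)) (ofPair (x, t)) := by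
      rw [FourierTransform.fourier_fourierInv_eq]
      rfl
    rw [h1, SchwartzMap.fourier_coe, fourier_eq_chi, Real.fourier_eq]
    have h2 := measurePreserving_ofPair.integral_comp measurableEmbedding_ofPair
      (fun v => (Real.fourierChar (-(inner ℝ v (ofPair (x, t))))) • (𝓕⁻ φ) v)
    rw [← h2]
    have h3 : ∀ p : ℝ × ℝ, (Real.fourierChar (-(inner ℝ (ofPair p) (ofPair (x, t))))) • (𝓕⁻ φ) (ofPair p) =
        chi (-(x * p.1)) * (chi (-(t * p.2)) * invF φ p) := by
      intro p
      rw [inner_ofPair, Circle.smul_def, smul_eq_mul, ← mul_assoc, ← chi_add, invF]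
      rw [show -(x * p.1) + -(t * p.2) = -(p.1 * x + p.2 * t) by ring]
      rfl
    simp only [h3]
    have h4 : Integrable fun p : ℝ × ℝ => chi (-(x * p.1)) * (chi (-(t * p.2)) * invF φ p) := by
      refine (integrable_invF φ).norm.mono'
        (Continuous.mul (by fun_prop) (Continuous.mul (by fun_prop) (continuous_invF φ))).aestronglyMeasurable
        (ae_of_all _ fun p => ?_)
      simp
    rw [Measure.volume_eq_prod] at h4 ⊢
    rw [integral_prod _ h4]
    refine integral_congr_ae (ae_of_all _ fun ξ => ?_)
    simp only [hm]
    rw [integral_const_mul]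
  rw [sliceF, SchwartzMap.fourierInv_coe, ← hF, hcont.fourierInv_fourier_eq hint]
  rw [hF]
  exact (slice t φ).integrable

theorem IsTest.slice_eq_zero {T : ℝ} {φ : 𝓢(Spacetime, ℂ)} (hφ : IsTest T φ) {t : ℝ} (ht : t ∉ Ioo 0 T) :
    slice t φ = 0 := by
  ext x
  change φ (point t x) = 0
  by_contra h
  have := hφ.2 (subset_tsupport φ (show φ (point t x) ≠ 0 from h))
  rw [mem_ofPred_eq, point_one] at this
  exact ht this

theorem IsTest.sliceF_eq_zero {T : ℝ} {φ : 𝓢(Spacetime, ℂ)} (hφ : IsTest T φ) {t : ℝ} (ht : t ∉ Ioo 0 T)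
    (ξ : ℝ) : sliceF φ t ξ = 0 := by
  rw [sliceF, hφ.slice_eq_zero ht, FourierTransform.fourierInv_zero]
  rfl

theorem continuous_sliceF (φ : 𝓢(Spacetime, ℂ)) : Continuous fun p : ℝ × ℝ => sliceF φ p.1 p.2 := by
  simp only [sliceF_eq]
  obtain ⟨C, hC, h⟩ := exists_invF_le φ 0
  refine continuous_of_dominated (bound := fun τ => C * br τ ^ (-2 : ℝ)) (fun ξ => ?_) (fun ξ => ae_of_all _ fun τ => ?_)
    ((integrable_br (r := 2) one_lt_two).const_mul C) (ae_of_all _ fun τ => ?_)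
  · have h1 : Continuous fun τ => invF φ (ξ.2, τ) := (continuous_invF φ).comp (Continuous.prodMk_right ξ.2)
    exact (Continuous.mul (by fun_prop) h1).aestronglyMeasurable
  · rw [norm_mul, norm_chi, one_mul]
    simpa using h (ξ.2, τ)
  · have h1 : Continuous fun p : ℝ × ℝ => invF φ (p.2, τ) := (continuous_invF φ).comp (continuous_snd.prodMk continuous_const)
    exact Continuous.mul (by fun_prop) h1

theorem IsTest.integrable_sliceF {T : ℝ} {φ : 𝓢(Spacetime, ℂ)} (hφ : IsTest T φ) (ξ : ℝ) :
    Integrable fun t => sliceF φ t ξ := by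
  have hc : Continuous fun t => sliceF φ t ξ := by
    have h := (continuous_sliceF φ).comp (continuous_id.prodMk (continuous_const (y := ξ)))
    simpa only [Function.comp_def, id_eq] using h
  refine hc.integrable_of_hasCompactSupport ?_
  refine HasCompactSupport.intro (isCompact_Icc (a := 0) (b := T)) fun t ht => hφ.sliceF_eq_zero (fun h => ht ?_) ξ
  exact Ioo_subset_Icc_self h

/-- Fourier inversion in time; it is available because the slices vanish outside `(0, T)` and are
therefore integrable in `t`. -/
theorem IsTest.integral_sliceF {T : ℝ} {φ : 𝓢(Spacetime, ℂ)} (hφ : IsTest T φ) (ξ τ : ℝ) :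
    ∫ t, chi (t * τ) * sliceF φ t ξ = invF φ (ξ, τ) := by
  set G : ℝ → ℂ := fun τ => invF φ (ξ, τ) with hG
  have h1 : (fun t => sliceF φ t ξ) = 𝓕 G := by
    ext t
    rw [sliceF_eq, fourier_eq_chi]
  have hGc : Continuous G := (continuous_invF φ).comp (Continuous.prodMk_right ξ)
  have h2 := congrFun (hGc.fourierInv_fourier_eq (integrable_invF_fiber φ ξ)
    (h1 ▸ hφ.integrable_sliceF ξ)) τ
  rw [← h1, fourierInv_eq_chi] at h2
  simp only [mul_comm τ] at h2
  exact h2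

/-! ### Bourgain spaces in coordinates -/

/-- The square of the norm of `X_{s,b}` on the Fourier side, in coordinates. -/
def bourSq (α β s b : ℝ) (z : ℝ × ℝ → ℂ) : ℝ≥0∞ :=
  ∫⁻ p, (ENNReal.ofReal (wt α β s b p) * ‖z p‖ₑ) ^ 2

theorem bourSq_congr {α β s b : ℝ} {z z' : ℝ × ℝ → ℂ} (e : z =ᵐ[volume] z') :
    bourSq α β s b z = bourSq α β s b z' := by
  refine lintegral_congr_ae ?_
  filter_upwards [e] with p hp
  rw [hp]

/-- The Fourier transform of `U` is `z` in coordinates. -/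
def PairRep (U : 𝓢'(Spacetime, ℂ)) (z : ℝ × ℝ → ℂ) : Prop :=
  IsFourierRep U (fun ζ => z (toPair ζ))

theorem exists_pairRep {U : 𝓢'(Spacetime, ℂ)} {g : Spacetime → ℂ} (h : HasFourier U g) :
    ∃ z : ℝ × ℝ → ℂ, StronglyMeasurable z ∧ PairRep U z ∧ (fun ζ => z (toPair ζ)) =ᵐ[volume] g := by
  have h1 : AEStronglyMeasurable (fun p => g (ofPair p)) volume :=
    h.1.comp_measurePreserving measurePreserving_ofPair
  have h2 : (fun ζ => h1.mk _ (toPair ζ)) =ᵐ[volume] g := by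
    have := measurePreserving_toPair.quasiMeasurePreserving.ae_eq_comp h1.ae_eq_mk.symm
    filter_upwards [this] with ζ hζ
    simpa using hζ
  exact ⟨h1.mk _, h1.stronglyMeasurable_mk, IsFourierRep.congr h h2.symm, h2⟩

theorem PairRep.integrable {U : 𝓢'(Spacetime, ℂ)} {z : ℝ × ℝ → ℂ} (h : PairRep U z)
    (φ : 𝓢(Spacetime, ℂ)) : Integrable fun p => invF φ p * z p := by
  have h1 := (h.2 (𝓕⁻ φ)).1
  have := (measurePreserving_ofPair.integrable_comp_emb measurableEmbedding_ofPair).2 h1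
  simpa [Function.comp_def, invF] using this

theorem PairRep.apply {U : 𝓢'(Spacetime, ℂ)} {z : ℝ × ℝ → ℂ} (h : PairRep U z)
    (φ : 𝓢(Spacetime, ℂ)) : U φ = ∫ p, invF φ p * z p := by
  have h1 := IsFourierRep.apply h φ
  rw [h1]
  have h2 := measurePreserving_ofPair.integral_comp measurableEmbedding_ofPair
      (fun x => (𝓕⁻ φ) x * z (toPair x))
  simpa [invF] using h2.symm

theorem br_two_pi_mul (x : ℝ) : br x ≤ br (2 * Real.pi * x) ∧ br (2 * Real.pi * x) ≤ 8 * br x := by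
  have h1 := Real.pi_gt_three
  have h2 := Real.pi_lt_four
  unfold br
  rw [abs_mul, abs_of_pos (show 0 < 2 * Real.pi by positivity)]
  constructor <;> nlinarith [abs_nonneg x]

/-- The coefficients of the dispersion relation in normalized frequencies. -/
def nα (α : ℝ) : ℝ := 4 * Real.pi ^ 2 * α

def nβ (β : ℝ) : ℝ := 16 * Real.pi ^ 4 * β

theorem nβ_ne_zero {β : ℝ} (hβ : β ≠ 0) : nβ β ≠ 0 := by
  have := Real.pi_pos
  unfold nβ
  positivity

theorem symbol_two_pi (α β ξ : ℝ) :
    symbol α β (2 * Real.pi * ξ) = 2 * Real.pi * symbol (nα α) (nβ β) ξ := by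
  unfold symbol nα nβ
  ring

/-- After normalizing the coefficients, both brackets are evaluated at arguments that differ by the
factor `2π`, and `2π < 8`. -/
theorem xWeight_comparable (α β s b : ℝ) (p : ℝ × ℝ) :
    xWeight α β s b (ofPair p) ≤ (8 ^ |s| * 8 ^ |b|) * wt (nα α) (nβ β) s b p ∧
    wt (nα α) (nβ β) s b p ≤ (8 ^ |s| * 8 ^ |b|) * xWeight α β s b (ofPair p) := by
  have e : xWeight α β s b (ofPair p) =
      br (2 * Real.pi * p.1) ^ s * br (2 * Real.pi * (p.2 - symbol (nα α) (nβ β) p.1)) ^ b := by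
    rw [xWeight, ofPair_zero, ofPair_one, symbol_two_pi, mul_sub]
    rfl
  have c1 := rpow_le_rpow_of_comparable (K := 8) (by norm_num) (br_pos p.1) (br_two_pi_mul p.1).1 (br_two_pi_mul p.1).2 s
  set σ := p.2 - symbol (nα α) (nβ β) p.1 with hσ
  have c2 := rpow_le_rpow_of_comparable (K := 8) (by norm_num) (br_pos σ) (br_two_pi_mul σ).1 (br_two_pi_mul σ).2 b
  have q1 := br_pos p.1
  have q2 := br_pos σ
  have q3 := br_pos (2 * Real.pi * p.1)
  have q4 := br_pos (2 * Real.pi * σ)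
  rw [e, wt, mul_mul_mul_comm (8 ^ |s|) (8 ^ |b|), mul_mul_mul_comm (8 ^ |s|) (8 ^ |b|)]
  exact ⟨mul_le_mul c1.1 c2.1 (by positivity) (by positivity), mul_le_mul c1.2 c2.2 (by positivity) (by positivity)⟩

theorem xWeight_pos (α β s b : ℝ) (ζ : Spacetime) : 0 < xWeight α β s b ζ := by
  unfold xWeight; positivity

/-- The constant comparing the two versions of the norm of `X_{s,b}`. -/
def bourConst (s b : ℝ) : ℝ≥0∞ := ENNReal.ofReal ((8 ^ |s| * 8 ^ |b|) ^ 2)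

theorem PairRep.xNorm_sq {U : 𝓢'(Spacetime, ℂ)} {z : ℝ × ℝ → ℂ} (h : PairRep U z) (α β s b : ℝ) :
    xNorm α β s b U ^ 2 = ∫⁻ p, (ENNReal.ofReal (xWeight α β s b (ofPair p)) * ‖z p‖ₑ) ^ 2 := by
  have e1 : xNorm α β s b U =
      eLpNorm (fun ζ => (xWeight α β s b ζ : ℂ) * z (toPair ζ)) 2 volume := by
    rw [xNorm]
    refine le_antisymm ?_ (le_iInf₂ fun g hg => ?_)
    · exact iInf₂_le (f := fun (g : Spacetime → ℂ) (_ : HasFourier U g) =>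
        eLpNorm (fun ζ => (xWeight α β s b ζ : ℂ) * g ζ) 2 volume) (fun ζ => z (toPair ζ)) h
    · refine (eLpNorm_congr_ae ?_).le
      filter_upwards [IsFourierRep.ae_eq h hg] with ζ hζ
      rw [hζ]
  rw [e1, eLpNorm_two_sq]
  have := measurePreserving_ofPair.lintegral_comp_emb measurableEmbedding_ofPair
    (fun ζ => ‖(xWeight α β s b ζ : ℂ) * z (toPair ζ)‖ₑ ^ 2)
  rw [← this]
  refine lintegral_congr fun p => ?_
  rw [enorm_mul, ← ofReal_norm, Complex.norm_real, Real.norm_of_nonneg (xWeight_pos _ _ _ _ _).le,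
    toPair_ofPair]

theorem PairRep.xNorm_sq_le {U : 𝓢'(Spacetime, ℂ)} {z : ℝ × ℝ → ℂ} (h : PairRep U z) (α β s b : ℝ) :
    xNorm α β s b U ^ 2 ≤ bourConst s b * bourSq (nα α) (nβ β) s b z := by
  rw [h.xNorm_sq]
  exact lintegral_sq_mul_le (by positivity) (fun p => (xWeight_comparable α β s b p).1) _

theorem PairRep.bourSq_le {U : 𝓢'(Spacetime, ℂ)} {z : ℝ × ℝ → ℂ} (h : PairRep U z) (α β s b : ℝ) :
    bourSq (nα α) (nβ β) s b z ≤ bourConst s b * xNorm α β s b U ^ 2 := by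
  rw [h.xNorm_sq]
  exact lintegral_sq_mul_le (by positivity) (fun p => (xWeight_comparable α β s b p).2) _

theorem br_symbol_le (α β ξ : ℝ) : br (symbol α β ξ) ≤ (1 + |α| + |β|) * br ξ ^ 5 := by
  have h1 : 1 ≤ br ξ := one_le_br ξ
  have h2 : |ξ| ≤ br ξ := abs_le_br ξ
  have h3 : |ξ| ^ 3 ≤ br ξ ^ 5 := (pow_le_pow_left₀ (abs_nonneg _) h2 3).trans (pow_le_pow_right₀ h1 (by norm_num))
  have h4 : |ξ| ^ 5 ≤ br ξ ^ 5 := pow_le_pow_left₀ (abs_nonneg _) h2 5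
  have h5 : 1 ≤ br ξ ^ 5 := one_le_pow₀ h1
  have h6 : |symbol α β ξ| ≤ |β| * |ξ| ^ 5 + |α| * |ξ| ^ 3 := by
    unfold symbol
    refine (abs_add_le _ _).trans (le_of_eq ?_)
    rw [abs_mul, abs_mul, abs_neg, abs_pow, abs_pow]
  have : br (symbol α β ξ) = 1 + |symbol α β ξ| := rfl
  rw [this]
  nlinarith [abs_nonneg α, abs_nonneg β]

theorem rpow_neg_abs_le {x y : ℝ} (hx : 1 ≤ x) (hxy : x ≤ y) (r : ℝ) : y ^ (-|r|) ≤ x ^ r := by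
  refine (Real.rpow_le_rpow_of_nonpos (by linarith) hxy (by simp)).trans ?_
  exact Real.rpow_le_rpow_of_exponent_le hx (neg_abs_le r)

/-- The modulation grows at most like the sixth power of `1 + ‖ζ‖`, five from the symbol and one
from `τ`. Such a lower bound makes elements of finite norm tempered. -/
theorem le_wt (α β s b : ℝ) : ∃ c > 0, ∃ m : ℝ, ∀ p : ℝ × ℝ, c * (1 + ‖ofPair p‖) ^ (-m) ≤ wt α β s b p := by
  set K := 1 + |α| + |β| with hK
  have hK0 : 0 < K := by positivity
  refine ⟨K ^ (-|b|), by positivity, |s| + 6 * |b|, fun p => ?_⟩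
  obtain ⟨h1, h2⟩ := br_le_norm_ofPair p
  set N := 1 + ‖ofPair p‖ with hN
  have hN1 : 1 ≤ N := by rw [hN]; linarith [norm_nonneg (ofPair p)]
  have hN0 : 0 < N := by linarith
  have e1 : N ^ (-|s|) ≤ br p.1 ^ s := rpow_neg_abs_le (one_le_br _) h1 s
  have e2 : br (p.2 - symbol α β p.1) ≤ K * N ^ 6 := by
    have h3 := br_add_le_mul p.2 (-symbol α β p.1)
    rw [br_neg, ← sub_eq_add_neg] at h3
    have h4 := br_symbol_le α β p.1
    have h5 := br_pos p.2
    have h6 := br_pos p.1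
    calc br (p.2 - symbol α β p.1) ≤ br p.2 * br (symbol α β p.1) := h3
      _ ≤ N * (K * N ^ 5) := by
        refine mul_le_mul h2 (h4.trans ?_) (br_pos _).le hN0.le
        gcongr
      _ = _ := by ring
  have e3 := rpow_neg_abs_le (one_le_br _) e2 b
  rw [Real.mul_rpow hK0.le (by positivity), ← Real.rpow_natCast_mul hN0.le] at e3
  rw [wt]
  calc K ^ (-|b|) * N ^ (-(|s| + 6 * |b|)) = N ^ (-|s|) * (K ^ (-|b|) * N ^ (((6 : ℕ) : ℝ) * -|b|)) := by
        rw [show (-(|s| + 6 * |b|)) = -|s| + ((6 : ℕ) : ℝ) * -|b| by push_cast; ring, Real.rpow_add hN0]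
        ring
    _ ≤ _ := mul_le_mul e1 e3 (by positivity) (by have := br_pos p.1; positivity)

theorem exists_pairRep_of_bourSq {α β s b : ℝ} {z : ℝ × ℝ → ℂ} (hz : AEStronglyMeasurable z volume)
    (h : bourSq α β s b z < ∞) : ∃ U : 𝓢'(Spacetime, ℂ), PairRep U z := by
  obtain ⟨c, hc, m, hw⟩ := le_wt α β s b
  refine IsModerate.exists_rep (isModerate_of_sq (w := fun ζ => wt α β s b (toPair ζ))
    (hz.comp_measurePreserving measurePreserving_toPair) ((measurable_wt (α := α) (β := β) (s := s) (b := b)).comp continuous_toPair.measurable)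
    hc (m := m) (fun ζ => by simpa using hw (toPair ζ)) ?_)
  have := measurePreserving_toPair.lintegral_comp_emb measurableEmbedding_toPair
    (fun p => (ENNReal.ofReal (wt α β s b p) * ‖z p‖ₑ) ^ 2)
  exact this.trans_lt h

/-! ### The nonlinearity -/

/-- The convolution of two functions of a pair of frequencies. -/
def conv (z w : ℝ × ℝ → ℂ) (p : ℝ × ℝ) : ℂ := ∫ q, z q * w (p - q)

/-- The Fourier transform of `½ ∂ₓ (U V)` in terms of those of `U` and `V`. -/
def bil (z w : ℝ × ℝ → ℂ) (p : ℝ × ℝ) : ℂ := (Real.pi * Complex.I * (p.1 : ℂ)) * conv z w p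

theorem convolution_ofPair (z : ℝ × ℝ → ℂ) (ζ : Spacetime) :
    (Integrable (fun η => z (toPair η) * z (toPair (ζ - η))) volume ↔
      Integrable (fun q => z q * z (toPair ζ - q)) volume) ∧
    ∫ η, z (toPair η) * z (toPair (ζ - η)) = conv z z (toPair ζ) := by
  have e : ∀ η, z (toPair η) * z (toPair (ζ - η)) =
      (fun q => z q * z (toPair ζ - q)) (toPair η) := fun η => rfl
  simp only [e]
  exact ⟨measurePreserving_toPair.integrable_comp_emb (g := fun q => z q * z (toPair ζ - q)) measurableEmbedding_toPair,
    measurePreserving_toPair.integral_comp measurableEmbedding_toPair (fun q => z q * z (toPair ζ - q))⟩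

theorem isConvection_of_pairRep {U N : 𝓢'(Spacetime, ℂ)} {z : ℝ × ℝ → ℂ} (h : PairRep U z)
    (hc : ∀ᵐ p, Integrable fun q => z q * z (p - q)) (hN : PairRep N (bil z z)) : IsConvection U N := by
  refine ⟨fun ζ => z (toPair ζ), h, ?_, ?_⟩
  · have := measurePreserving_toPair.quasiMeasurePreserving.ae hc
    filter_upwards [this] with ζ hζ
    exact (convolution_ofPair z ζ).1.2 hζ
  · have : (fun ζ : Spacetime => (1 / 2 : ℂ) * (2 * Real.pi * Complex.I * (ζ 0 : ℂ)) *
        ∫ η, z (toPair η) * z (toPair (ζ - η))) = fun ζ => bil z z (toPair ζ) := by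
      ext ζ
      rw [(convolution_ofPair z ζ).2, bil]
      simp only [toPair]
      ring
    change IsFourierRep N _
    rw [this]
    exact hN

theorem IsConvection.exists_pairRep {U N : 𝓢'(Spacetime, ℂ)} (h : IsConvection U N) :
    ∃ z : ℝ × ℝ → ℂ, StronglyMeasurable z ∧ PairRep U z ∧ PairRep N (bil z z) := by
  obtain ⟨g, hg, hi, hN⟩ := h
  obtain ⟨z, hz, hU, e⟩ := Kawahara.exists_pairRep hg
  refine ⟨z, hz, hU, ?_⟩
  have : (fun ζ : Spacetime => (1 / 2 : ℂ) * (2 * Real.pi * Complex.I * (ζ 0 : ℂ)) *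
      ∫ η, g η * g (ζ - η)) = fun ζ => bil z z (toPair ζ) := by
    ext ζ
    rw [bil, ← (convolution_ofPair z ζ).2]
    have e2 : (fun η => z (toPair (ζ - η))) =ᵐ[volume] fun η => g (ζ - η) :=
      (Measure.measurePreserving_sub_left volume ζ).quasiMeasurePreserving.ae_eq_comp e
    have e3 : ∫ η, g η * g (ζ - η) = ∫ η, z (toPair η) * z (toPair (ζ - η)) := by
      refine integral_congr_ae ?_
      filter_upwards [e, e2] with η h1 h2
      rw [h1, h2]
    rw [e3]
    simp only [toPair]
    ring
  change IsFourierRep N _ at hN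
  rw [this] at hN
  exact hN

section

/-! ### The trace at a fixed time -/

/-- The spatial Fourier transform at time `t` of the function with Fourier transform `z`. -/
def tr (z : ℝ × ℝ → ℂ) (t ξ : ℝ) : ℂ := ∫ τ, chi (t * τ) * z (ξ, τ)

/-- The `L¹` norm in the time frequency. -/
def fibL1 (z : ℝ × ℝ → ℂ) (ξ : ℝ) : ℝ≥0∞ := ∫⁻ τ, ‖z (ξ, τ)‖ₑ

theorem enorm_tr_le (z : ℝ × ℝ → ℂ) (t ξ : ℝ) : ‖tr z t ξ‖ₑ ≤ fibL1 z ξ := by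
  refine (enorm_integral_le_lintegral_enorm _).trans (le_of_eq ?_)
  simp [fibL1, enorm_mul]

variable {α β s b : ℝ} {z w : ℝ × ℝ → ℂ}

theorem measurable_fibL1 (hz : Measurable z) : Measurable (fibL1 z) :=
  Measurable.lintegral_prod_right' (f := fun p => ‖z p‖ₑ) hz.enorm

theorem measurable_tr (hz : Measurable z) (t : ℝ) : Measurable (tr z t) := by
  have : Measurable fun p : ℝ × ℝ => chi (t * p.2) * z p := by fun_prop
  exact (this.stronglyMeasurable.integral_prod_right').measurable

/-- Cauchy-Schwarz in `τ` against `⟨τ - p(ξ)⟩^(-b)`, whose square has integral `jap (2 * b)`, finite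
for `b > 1/2`. This is the source of traces at fixed times. -/
theorem lintegral_fiber_sq_le {f : ℝ × ℝ → ℝ≥0∞} (hf : Measurable f) :
    ∫⁻ ξ, (ENNReal.ofReal (br ξ ^ s) * ∫⁻ τ, f (ξ, τ)) ^ 2 ≤
      jap (2 * b) * ∫⁻ p, (ENNReal.ofReal (wt α β s b p) * f p) ^ 2 := by
  have hm : Measurable fun p : ℝ × ℝ => (ENNReal.ofReal (wt α β s b p) * f p) ^ 2 :=
    ((measurable_wt (α := α) (β := β) (s := s) (b := b)).ennreal_ofReal.mul hf).pow_const 2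
  rw [Measure.volume_eq_prod, lintegral_prod _ hm.aemeasurable,
    ← lintegral_const_mul _ (Measurable.lintegral_prod_right' (f := fun p => (ENNReal.ofReal (wt α β s b p) * f p) ^ 2) hm)]
  refine lintegral_mono fun ξ => ?_
  set q := symbol α β ξ with hq
  have e : ∀ τ, ENNReal.ofReal (br ξ ^ s) * f (ξ, τ) =
      ENNReal.ofReal (br (τ - q) ^ (-b)) * (ENNReal.ofReal (wt α β s b (ξ, τ)) * f (ξ, τ)) := by
    intro τ
    have h1 := br_pos ξ
    have h2 := br_pos (τ - q)
    rw [← mul_assoc, ← ENNReal.ofReal_mul (by positivity), wt]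
    congr 2
    simp only [← hq]
    rw [Real.rpow_neg h2.le]
    field_simp
  have hfξ : Measurable fun τ => f (ξ, τ) := hf.comp measurable_prodMk_left
  have h1 : ENNReal.ofReal (br ξ ^ s) * ∫⁻ τ, f (ξ, τ) =
      ∫⁻ τ, ENNReal.ofReal (br (τ - q) ^ (-b)) * (ENNReal.ofReal (wt α β s b (ξ, τ)) * f (ξ, τ)) := by
    rw [← lintegral_const_mul _ hfξ]
    exact lintegral_congr e
  rw [h1]
  have m1 : Measurable fun τ => ENNReal.ofReal (br (τ - q) ^ (-b)) :=
    (((continuous_br_rpow (-b)).comp (continuous_id.sub continuous_const)).measurable).ennreal_ofReal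
  have m2 : Measurable fun τ => ENNReal.ofReal (wt α β s b (ξ, τ)) * f (ξ, τ) :=
    ((measurable_wt (α := α) (β := β) (s := s) (b := b)).comp measurable_prodMk_left).ennreal_ofReal.mul hfξ
  refine (lintegral_mul_sq_le m1.aemeasurable m2.aemeasurable).trans ?_
  gcongr
  refine le_of_eq ?_
  rw [jap, ← lintegral_sub_right_eq_self (fun τ => ENNReal.ofReal (br τ ^ (-(2 * b)))) q]
  refine lintegral_congr fun τ => ?_
  have h2 := br_pos (τ - q)
  rw [← ENNReal.ofReal_pow (by positivity), ← Real.rpow_mul_natCast h2.le]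
  congr 2
  push_cast
  ring

theorem ae_lt_top_of_sobolev {F : ℝ → ℝ≥0∞} (hF : Measurable F)
    (h : ∫⁻ ξ, (ENNReal.ofReal (br ξ ^ s) * F ξ) ^ 2 < ∞) : ∀ᵐ ξ, F ξ < ∞ := by
  have hm : Measurable fun ξ => (ENNReal.ofReal (br ξ ^ s) * F ξ) ^ 2 :=
    ((continuous_br_rpow s).measurable.ennreal_ofReal.mul hF).pow_const 2
  filter_upwards [ae_lt_top hm h.ne] with ξ hξ
  by_contra hcon
  rw [not_lt, top_le_iff] at hcon
  have h1 := br_pos ξ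
  rw [hcon, ENNReal.mul_top (by simp; positivity)] at hξ
  simp at hξ

theorem lintegral_fibL1_sq_le (hz : Measurable z) :
    ∫⁻ ξ, (ENNReal.ofReal (br ξ ^ s) * fibL1 z ξ) ^ 2 ≤ jap (2 * b) * bourSq α β s b z :=
  lintegral_fiber_sq_le hz.enorm

theorem sobSq_tr_le (hz : Measurable z) (t : ℝ) :
    sobSq s (tr z t) ≤ jap (2 * b) * bourSq α β s b z := by
  refine (lintegral_mono fun ξ => ?_).trans (lintegral_fibL1_sq_le hz)
  gcongr
  exact enorm_tr_le z t ξ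

theorem lintegral_fibL1_sq_lt_top (hb : 1 / 2 < b) (hz : Measurable z) (h : bourSq α β s b z < ∞) :
    ∫⁻ ξ, (ENNReal.ofReal (br ξ ^ s) * fibL1 z ξ) ^ 2 < ∞ :=
  (lintegral_fibL1_sq_le hz).trans_lt (ENNReal.mul_lt_top (jap_lt_top (by linarith)) h)

theorem ae_fibL1_lt_top (hb : 1 / 2 < b) (hz : Measurable z) (h : bourSq α β s b z < ∞) :
    ∀ᵐ ξ, fibL1 z ξ < ∞ :=
  ae_lt_top_of_sobolev (measurable_fibL1 hz) (lintegral_fibL1_sq_lt_top hb hz h)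

theorem integrable_fiber (hz : Measurable z) {ξ : ℝ} (h : fibL1 z ξ < ∞) :
    Integrable fun τ => z (ξ, τ) :=
  ⟨(hz.comp measurable_prodMk_left).aestronglyMeasurable, h⟩

theorem continuous_tr (hz : Measurable z) {ξ : ℝ} (h : fibL1 z ξ < ∞) :
    Continuous fun t => tr z t ξ := by
  have hi := integrable_fiber hz h
  refine continuous_of_dominated (bound := fun τ => ‖z (ξ, τ)‖) (fun t => ?_) (fun t => ae_of_all _ fun τ => ?_)
    hi.norm (ae_of_all _ fun τ => ?_)
  · exact (by fun_prop : Continuous fun τ => chi (t * τ)).aestronglyMeasurable.mul hi.1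
  · simp
  · fun_prop

/-- Dominated convergence in `ξ`: each trace is at most the fibre norm `fibL1`, and on almost every
fibre the trace is continuous in time. -/
theorem tendsto_sobSq_tr (hb : 1 / 2 < b) (hz : Measurable z) (h : bourSq α β s b z < ∞) (t : ℝ) :
    Tendsto (fun r => sobSq s (fun ξ => tr z r ξ - tr z t ξ)) (𝓝 t) (𝓝 0) := by
  have hfin := lintegral_fibL1_sq_lt_top hb hz h
  have hL : Tendsto (fun r => ∫⁻ ξ, (ENNReal.ofReal (br ξ ^ s) * ‖tr z r ξ - tr z t ξ‖ₑ) ^ 2) (𝓝 t)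
      (𝓝 (∫⁻ _ : ℝ, 0)) := by
    refine tendsto_lintegral_filter_of_dominated_convergence
      (fun ξ => 4 * (ENNReal.ofReal (br ξ ^ s) * fibL1 z ξ) ^ 2) ?_ ?_ ?_ ?_
    · exact Eventually.of_forall fun r => ((continuous_br_rpow s).measurable.ennreal_ofReal.mul
        ((measurable_tr hz r).sub (measurable_tr hz t)).enorm).pow_const 2
    · refine Eventually.of_forall fun r => ae_of_all _ fun ξ => ?_
      have h1 : ‖tr z r ξ - tr z t ξ‖ₑ ≤ 2 * fibL1 z ξ := by
        refine (enorm_sub_le).trans ?_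
        rw [two_mul]
        exact add_le_add (enorm_tr_le z r ξ) (enorm_tr_le z t ξ)
      calc (ENNReal.ofReal (br ξ ^ s) * ‖tr z r ξ - tr z t ξ‖ₑ) ^ 2
          ≤ (ENNReal.ofReal (br ξ ^ s) * (2 * fibL1 z ξ)) ^ 2 := by gcongr
        _ = _ := by ring
    · rw [lintegral_const_mul' _ _ (by norm_num)]
      exact (ENNReal.mul_lt_top (by norm_num) hfin).ne
    · filter_upwards [ae_fibL1_lt_top hb hz h] with ξ hξ
      have h1 : Tendsto (fun r => tr z r ξ - tr z t ξ) (𝓝 t) (𝓝 0) := by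
        have := ((continuous_tr hz hξ).tendsto t).sub_const (tr z t ξ)
        simpa using this
      have h2 : Tendsto (fun r => ‖tr z r ξ - tr z t ξ‖ₑ) (𝓝 t) (𝓝 0) := by
        have := (continuous_enorm.tendsto (0 : ℂ)).comp h1
        simpa [Function.comp_def] using this
      have h3 := ENNReal.Tendsto.pow (n := 2) (ENNReal.Tendsto.const_mul h2 (a := ENNReal.ofReal (br ξ ^ s)) (Or.inr ENNReal.ofReal_ne_top))
      simpa using h3
  simpa [sobSq] using hL

/-- Giving up one derivative supplies a square integrable factor `⟨ξ⟩⁻¹`, which turns `L²` in `ξ`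
into `L¹`. The applications of Fubini to test functions rest on this. -/
theorem lintegral_br_mul_enorm_lt_top (hb : 1 / 2 < b) (hz : Measurable z) (h : bourSq α β s b z < ∞) :
    ∫⁻ p, ENNReal.ofReal (br p.1 ^ (s - 1)) * ‖z p‖ₑ < ∞ := by
  have hm : Measurable fun p : ℝ × ℝ => ENNReal.ofReal (br p.1 ^ (s - 1)) * ‖z p‖ₑ :=
    (((continuous_br_rpow (s - 1)).measurable.comp measurable_fst).ennreal_ofReal).mul hz.enorm
  rw [Measure.volume_eq_prod, lintegral_prod _ hm.aemeasurable]
  have e : ∀ ξ, ∫⁻ τ, ENNReal.ofReal (br ξ ^ (s - 1)) * ‖z (ξ, τ)‖ₑ =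
      ENNReal.ofReal (br ξ ^ (-1 : ℝ)) * (ENNReal.ofReal (br ξ ^ s) * fibL1 z ξ) := fun ξ => by
    have h1 := br_pos ξ
    rw [lintegral_const_mul' _ _ ENNReal.ofReal_ne_top, ← mul_assoc, ← ENNReal.ofReal_mul (by positivity),
      ← Real.rpow_add h1, fibL1]
    ring_nf
  simp only [e]
  have m1 : Measurable fun ξ => ENNReal.ofReal (br ξ ^ (-1 : ℝ)) := (continuous_br_rpow (-1)).measurable.ennreal_ofReal
  have m2 : Measurable fun ξ => ENNReal.ofReal (br ξ ^ s) * fibL1 z ξ :=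
    (continuous_br_rpow s).measurable.ennreal_ofReal.mul (measurable_fibL1 hz)
  have h1 := lintegral_mul_sq_le (μ := volume) m1.aemeasurable m2.aemeasurable
  have h2 : ∫⁻ ξ, ENNReal.ofReal (br ξ ^ (-1 : ℝ)) ^ 2 < ∞ := by
    refine lt_of_le_of_lt (lintegral_mono fun ξ => ?_) (jap_lt_top one_lt_two)
    have h3 := br_pos ξ
    rw [← ENNReal.ofReal_pow (by positivity), ← Real.rpow_mul_natCast h3.le]
    norm_num
  have h3 := h1.trans_lt (ENNReal.mul_lt_top h2 (lintegral_fibL1_sq_lt_top hb hz h))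
  by_contra hcon
  rw [not_lt, top_le_iff] at hcon
  simp [hcon] at h3

theorem integrable_br_mul (hb : 1 / 2 < b) (hz : Measurable z) (h : bourSq α β s b z < ∞) :
    Integrable fun p : ℝ × ℝ => br p.1 ^ (s - 1) * ‖z p‖ := by
  have hm : Measurable fun p : ℝ × ℝ => br p.1 ^ (s - 1) * ‖z p‖ :=
    ((continuous_br_rpow (s - 1)).measurable.comp measurable_fst).mul hz.norm
  refine ⟨hm.aestronglyMeasurable, ?_⟩
  refine lt_of_le_of_lt (lintegral_mono fun p => ?_) (lintegral_br_mul_enorm_lt_top hb hz h)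
  have h1 := br_pos p.1
  rw [← ofReal_norm, ← ofReal_norm, ← ENNReal.ofReal_mul (by positivity)]
  refine ENNReal.ofReal_le_ofReal (le_of_eq ?_)
  rw [norm_mul, norm_norm, Real.norm_of_nonneg (by positivity)]

/-- Fubini, followed by inversion in time; the integral over `(0, T)` may be extended to all times
because `sliceF` vanishes outside. -/
theorem integral_invF_mul {T : ℝ} {φ : 𝓢(Spacetime, ℂ)} (hφ : IsTest T φ) (hb : 1 / 2 < b) (hz : Measurable z)
    (h : bourSq α β s b z < ∞) :
    ∫ t in Ioo 0 T, ∫ ξ, sliceF φ t ξ * tr z t ξ = ∫ p, invF φ p * z p := by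
  obtain ⟨C, hC, hφC⟩ := exists_fourier_fiber_le φ (1 - s)
  have hC' : ∀ t ξ, ‖sliceF φ t ξ‖ ≤ C * br ξ ^ (s - 1) := fun t ξ => by
    rw [sliceF_eq]
    simpa using hφC t ξ
  have hI := (integrable_br_mul hb hz h).const_mul C
  have hbd : ∀ t (p : ℝ × ℝ), ‖sliceF φ t p.1 * (chi (t * p.2) * z p)‖ ≤ C * (br p.1 ^ (s - 1) * ‖z p‖) := by
    intro t p
    rw [norm_mul, norm_mul, norm_chi, one_mul, ← mul_assoc]
    gcongr
    exact hC' t p.1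
  have hsl : Measurable fun y : ℝ × (ℝ × ℝ) => sliceF φ y.1 y.2.1 := by
    have h1 := (continuous_sliceF φ).comp (continuous_fst.prodMk (continuous_fst.comp continuous_snd) :
      Continuous fun y : ℝ × (ℝ × ℝ) => (y.1, y.2.1))
    have h2 := h1.measurable
    simpa only [Function.comp_def] using h2
  have hm : Measurable fun y : ℝ × (ℝ × ℝ) => sliceF φ y.1 y.2.1 * (chi (y.1 * y.2.2) * z y.2) := by
    refine hsl.mul (Measurable.mul (by fun_prop) (hz.comp measurable_snd))
  have hint : Integrable (fun y : ℝ × (ℝ × ℝ) => sliceF φ y.1 y.2.1 * (chi (y.1 * y.2.2) * z y.2))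
      ((volume.restrict (Ioo 0 T)).prod volume) := by
    refine Integrable.mono' (g := fun y : ℝ × (ℝ × ℝ) => C * (br y.2.1 ^ (s - 1) * ‖z y.2‖)) ?_
      hm.aestronglyMeasurable (ae_of_all _ fun y => hbd y.1 y.2)
    have := (integrable_const (1 : ℝ) (μ := volume.restrict (Ioo 0 T))).mul_prod hI
    simpa using this
  have h1 : ∀ t, ∫ ξ, sliceF φ t ξ * tr z t ξ = ∫ p : ℝ × ℝ, sliceF φ t p.1 * (chi (t * p.2) * z p) := by
    intro t
    have hi : Integrable fun p : ℝ × ℝ => sliceF φ t p.1 * (chi (t * p.2) * z p) :=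
      hI.mono' (hm.comp measurable_prodMk_left).aestronglyMeasurable (ae_of_all _ fun p => hbd t p)
    rw [Measure.volume_eq_prod] at hi ⊢
    rw [integral_prod _ hi]
    refine integral_congr_ae (ae_of_all _ fun ξ => ?_)
    simp only [tr]
    rw [integral_const_mul]
  simp only [h1]
  rw [integral_integral_swap (f := fun (t : ℝ) (p : ℝ × ℝ) => sliceF φ t p.1 * (chi (t * p.2) * z p)) hint]
  refine integral_congr_ae (ae_of_all _ fun p => ?_)
  simp only
  rw [setIntegral_eq_integral_of_forall_compl_eq_zero]
  · rw [← hφ.integral_sliceF p.1 p.2, ← integral_mul_const]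
    refine integral_congr_ae (ae_of_all _ fun t => ?_)
    simp only
    ring
  · intro t ht
    rw [hφ.sliceF_eq_zero ht, zero_mul]

theorem extends_of_tr {T : ℝ} {U : 𝓢'(Spacetime, ℂ)} {u : ℝ → 𝓢'(ℝ, ℂ)} (hU : PairRep U z) (hb : 1 / 2 < b)
    (hz : Measurable z) (h : bourSq α β s b z < ∞) (hu : ∀ t ∈ Ioo 0 T, IsFourierRep (u t) (tr z t)) :
    Extends T U u := by
  intro φ hφ
  rw [hU.apply, ← integral_invF_mul hφ hb hz h]
  refine setIntegral_congr_fun measurableSet_Ioo fun t ht => ?_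
  rw [(hu t ht).apply]
  rfl

theorem exists_isFourierRep_tr (hb : 1 / 2 < b) (hz : Measurable z) (h : bourSq α β s b z < ∞) :
    ∃ u : ℝ → 𝓢'(ℝ, ℂ), ∀ t, IsFourierRep (u t) (tr z t) := by
  have : ∀ t, ∃ f : 𝓢'(ℝ, ℂ), IsFourierRep f (tr z t) := fun t => by
    refine IsModerate.exists_rep (isModerate_of_sobSq (s := s) (measurable_tr hz t).aestronglyMeasurable ?_)
    exact (sobSq_tr_le hz t).trans_lt (ENNReal.mul_lt_top (jap_lt_top (by linarith)) h)
  choose u hu using this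
  exact ⟨u, hu⟩

theorem sobSq_tr_lt_top (hb : 1 / 2 < b) (hz : Measurable z) (h : bourSq α β s b z < ∞) (t : ℝ) :
    sobSq s (tr z t) < ∞ :=
  (sobSq_tr_le hz t).trans_lt (ENNReal.mul_lt_top (jap_lt_top (by linarith)) h)

theorem sobSq_sub_le (s : ℝ) {h h' : ℝ → ℂ} (hm : AEStronglyMeasurable h volume) :
    sobSq s (fun ξ => h ξ - h' ξ) ≤ 2 * (sobSq s h + sobSq s h') := by
  have hm' : AEMeasurable (fun ξ => (ENNReal.ofReal (br ξ ^ s) * ‖h ξ‖ₑ) ^ 2) volume :=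
    ((continuous_br_rpow s).measurable.ennreal_ofReal.aemeasurable.mul hm.enorm).pow_const 2
  rw [sobSq, sobSq, sobSq, ← lintegral_add_left' hm', ← lintegral_const_mul' _ _ (by norm_num)]
  refine lintegral_mono fun ξ => ?_
  refine le_trans ?_ (ENNReal_add_sq_le _ _)
  rw [← mul_add]
  gcongr
  exact enorm_sub_le

theorem continuousInHs_of_tr {T : ℝ} {u : ℝ → 𝓢'(ℝ, ℂ)} (hb : 1 / 2 < b)
    (hz : Measurable z) (h : bourSq α β s b z < ∞) (hu : ∀ t ∈ Icc 0 T, IsFourierRep (u t) (tr z t)) :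
    ContinuousInHs s T u := by
  refine ⟨fun t ht => ((hu t ht).hsNorm_eq (sobSq_tr_lt_top hb hz h t)).1, fun t ht => ?_⟩
  have h1 : Tendsto (fun r => sobConst s * sobSq s (fun ξ => tr z r ξ - tr z t ξ)) (𝓝[Icc 0 T] t) (𝓝 0) := by
    have := ENNReal.Tendsto.const_mul ((tendsto_sobSq_tr hb hz h t).mono_left (nhdsWithin_le_nhds (s := Icc 0 T))) (a := sobConst s)
      (Or.inr ENNReal.ofReal_ne_top)
    simpa using this
  have h2 : Tendsto (fun r => hsNorm s (u r - u t) ^ 2) (𝓝[Icc 0 T] t) (𝓝 0) := by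
    refine tendsto_of_tendsto_of_tendsto_of_le_of_le' tendsto_const_nhds h1 (Eventually.of_forall fun _ => zero_le) ?_
    filter_upwards [self_mem_nhdsWithin] with r hr
    refine ((hu r hr).sub (hu t ht)).hsNorm_sq_le ?_
    refine (sobSq_sub_le s (measurable_tr hz r).aestronglyMeasurable).trans_lt (ENNReal.mul_lt_top (by norm_num) ?_)
    exact ENNReal.add_lt_top.2 ⟨sobSq_tr_lt_top hb hz h r, sobSq_tr_lt_top hb hz h t⟩
  have h3 := (ENNReal.continuous_rpow_const (y := 2⁻¹)).tendsto 0 |>.comp h2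
  have h4 : ∀ x : ℝ≥0∞, (x ^ 2) ^ (2⁻¹ : ℝ) = x := fun x => by
    rw [← ENNReal.rpow_natCast, ← ENNReal.rpow_mul]
    norm_num
  simpa [Function.comp_def, h4] using h3

end

/-! ### Uniqueness of the trace -/

/-- Test functions that are products of a function of space and a function of time. -/
theorem exists_product_test {T : ℝ} (X : 𝓢(ℝ, ℂ)) (hX : HasCompactSupport X) {η : ℝ → ℂ}
    (hη : ContDiff ℝ (⊤ : ℕ∞) η) (hηc : HasCompactSupport η) (hηT : tsupport η ⊆ Ioo 0 T) :
    ∃ φ : 𝓢(Spacetime, ℂ), IsTest T φ ∧ ∀ t, slice t φ = η t • X := by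
  set F : Spacetime → ℂ := fun ζ => η (ζ 1) * X (ζ 0) with hF
  have hsm : ContDiff ℝ (⊤ : ℕ∞) F := by
    have h0 : ContDiff ℝ (⊤ : ℕ∞) fun ζ : Spacetime => ζ 0 := by fun_prop
    have h1 : ContDiff ℝ (⊤ : ℕ∞) fun ζ : Spacetime => ζ 1 := by fun_prop
    exact (hη.comp h1).mul ((X.smooth ⊤).comp h0)
  have hK : IsCompact (ofPair '' (tsupport X ×ˢ tsupport η)) :=
    (hX.isCompact.prod hηc.isCompact).image continuous_ofPair
  have hsub : tsupport F ⊆ ofPair '' (tsupport X ×ˢ tsupport η) := by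
    refine closure_minimal (fun ζ hζ => ?_) hK.isClosed
    refine ⟨toPair ζ, ⟨?_, ?_⟩, ofPair_toPair ζ⟩
    · exact subset_tsupport _ fun h0 => hζ (by simp [hF, toPair] at h0 ⊢; simp [h0])
    · exact subset_tsupport _ fun h0 => hζ (by simp [hF, toPair] at h0 ⊢; simp [h0])
  have hFc : HasCompactSupport F := hK.of_isClosed_subset (isClosed_tsupport F) hsub
  refine ⟨hFc.toSchwartzMap hsm, ⟨hFc, fun ζ hζ => ?_⟩, fun t => ?_⟩
  · obtain ⟨p, hp, rfl⟩ := hsub hζ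
    rw [mem_ofPred_eq, ofPair_one]
    exact hηT hp.2
  · ext x
    change F (point t x) = η t * X x
    simp [hF]

/-- Duality between `H^s` and `H^{-s}`, with the Schwartz decay of the transform of `X` making `K`
finite. -/
theorem enorm_apply_sq_le (s : ℝ) (X : 𝓢(ℝ, ℂ)) : ∃ K : ℝ≥0∞, K < ∞ ∧
    ∀ (f : 𝓢'(ℝ, ℂ)) (h : ℝ → ℂ), IsFourierRep f h → ‖f X‖ₑ ^ 2 ≤ K * sobSq s h := by
  refine ⟨sobSq (-s) (𝓕⁻ X : 𝓢(ℝ, ℂ)), ?_, fun f h hf => ?_⟩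
  · set Y : 𝓢(ℝ, ℂ) := 𝓕⁻ X
    obtain ⟨n, hn⟩ := exists_nat_ge (-s)
    set S := (Finset.Iic ((n + 1, 0) : ℕ × ℕ)).sup (fun m => SchwartzMap.seminorm ℂ m.1 m.2) Y
    have hb : ∀ x, (ENNReal.ofReal (br x ^ (-s)) * ‖Y x‖ₑ) ^ 2 ≤
        ENNReal.ofReal ((2 ^ (n + 1) * S) ^ 2) * ENNReal.ofReal (br x ^ (-2 : ℝ)) := by
      intro x
      have h2 := SchwartzMap.one_add_le_sup_seminorm_apply (𝕜 := ℂ) (m := (n + 1, 0)) (k := n + 1) (n := 0)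
        le_rfl le_rfl Y x
      rw [norm_iteratedFDeriv_zero] at h2
      change br x ^ (n + 1) * ‖Y x‖ ≤ 2 ^ (n + 1) * S at h2
      have h3 := br_pos x
      have h4 : br x ^ (-s) ≤ br x ^ n := by
        rw [← Real.rpow_natCast]
        exact Real.rpow_le_rpow_of_exponent_le (one_le_br _) hn
      have hS : 0 ≤ 2 ^ (n + 1) * S := le_trans (by positivity) h2
      rw [← ofReal_norm, ← ENNReal.ofReal_mul (by positivity), ← ENNReal.ofReal_pow (by positivity),
        ← ENNReal.ofReal_mul (by positivity)]
      refine ENNReal.ofReal_le_ofReal ?_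
      have h5 : br x ^ (-s) * ‖Y x‖ ≤ 2 ^ (n + 1) * S * (br x)⁻¹ := by
        rw [← div_eq_mul_inv, le_div_iff₀ h3]
        calc br x ^ (-s) * ‖Y x‖ * br x ≤ br x ^ n * ‖Y x‖ * br x := by gcongr
          _ = br x ^ (n + 1) * ‖Y x‖ := by ring
          _ ≤ _ := h2
      have h6 : br x ^ (-2 : ℝ) = ((br x)⁻¹) ^ 2 := by
        rw [Real.rpow_neg h3.le, Real.rpow_two, inv_pow]
      rw [h6, ← mul_pow]
      exact pow_le_pow_left₀ (by positivity) h5 2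
    refine (lintegral_mono hb).trans_lt ?_
    rw [lintegral_const_mul' _ _ ENNReal.ofReal_ne_top]
    exact ENNReal.mul_lt_top ENNReal.ofReal_lt_top (jap_lt_top one_lt_two)
  · rw [hf.apply]
    have h1 : ‖∫ x, (𝓕⁻ X) x * h x‖ₑ ≤
        ∫⁻ x, (ENNReal.ofReal (br x ^ (-s)) * ‖(𝓕⁻ X) x‖ₑ) * (ENNReal.ofReal (br x ^ s) * ‖h x‖ₑ) := by
      refine (enorm_integral_le_lintegral_enorm _).trans (le_of_eq (lintegral_congr fun x => ?_))
      have h3 := br_pos x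
      rw [mul_mul_mul_comm, ← ENNReal.ofReal_mul (by positivity), ← Real.rpow_add h3, enorm_mul]
      simp
    have m1 : AEMeasurable (fun x => ENNReal.ofReal (br x ^ (-s)) * ‖(𝓕⁻ X) x‖ₑ) volume :=
      ((continuous_br_rpow (-s)).measurable.ennreal_ofReal.mul (𝓕⁻ X).continuous.measurable.enorm).aemeasurable
    have m2 : AEMeasurable (fun x => ENNReal.ofReal (br x ^ s) * ‖h x‖ₑ) volume :=
      (continuous_br_rpow s).measurable.ennreal_ofReal.aemeasurable.mul hf.1.enorm
    exact (pow_le_pow_left₀ zero_le h1 2).trans (lintegral_mul_sq_le m1 m2)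

theorem ContinuousInHs.continuousOn_apply {s T : ℝ} {u : ℝ → 𝓢'(ℝ, ℂ)} (hu : ContinuousInHs s T u) (X : 𝓢(ℝ, ℂ)) :
    ContinuousOn (fun t => u t X) (Icc 0 T) := by
  intro t ht
  obtain ⟨K, hK, hKX⟩ := enorm_apply_sq_le s X
  have h1 : Tendsto (fun r => K * (sobConst s * hsNorm s (u r - u t) ^ 2)) (𝓝[Icc 0 T] t) (𝓝 0) := by
    have h2 := ENNReal.Tendsto.pow (n := 2) (hu.2 t ht)
    have h3 := ENNReal.Tendsto.const_mul h2 (a := sobConst s) (Or.inr ENNReal.ofReal_ne_top)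
    have h4 := ENNReal.Tendsto.const_mul h3 (a := K) (Or.inr hK.ne)
    simpa using h4
  have h2 : Tendsto (fun r => ‖u r X - u t X‖ₑ ^ 2) (𝓝[Icc 0 T] t) (𝓝 0) := by
    refine tendsto_of_tendsto_of_tendsto_of_le_of_le' tendsto_const_nhds h1 (Eventually.of_forall fun _ => zero_le) ?_
    filter_upwards [self_mem_nhdsWithin] with r hr
    obtain ⟨h, -, hrep, hfin⟩ := exists_isFourierRep_of_memSobolev ((hu.1 r hr).sub (hu.1 t ht))
    have := hKX _ _ hrep
    exact this.trans (mul_le_mul_right (hrep.sobSq_le hfin) _)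
  have h3 : Tendsto (fun r => ‖u r X - u t X‖ ^ 2) (𝓝[Icc 0 T] t) (𝓝 0) := by
    have := (ENNReal.tendsto_toReal ENNReal.zero_ne_top).comp h2
    simpa [Function.comp_def] using this
  have h4 : Tendsto (fun r => ‖u r X - u t X‖) (𝓝[Icc 0 T] t) (𝓝 0) := by
    have := (Real.continuous_sqrt.tendsto 0).comp h3
    simpa [Function.comp_def] using this
  exact tendsto_iff_norm_sub_tendsto_zero.2 h4

/-- With product test functions, `t ↦ u t X - v t X` integrates to zero against every smooth
function with compact support in `(0, T)`. Continuity then gives equality on the closed interval,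
endpoints included. -/
theorem Extends.eq {s T : ℝ} (hT : 0 < T) {U : 𝓢'(Spacetime, ℂ)} {u v : ℝ → 𝓢'(ℝ, ℂ)} (hu : Extends T U u)
    (hv : Extends T U v) (hcu : ContinuousInHs s T u) (hcv : ContinuousInHs s T v) :
    ∀ t ∈ Icc 0 T, u t = v t := by
  have key : ∀ X : 𝓢(ℝ, ℂ), HasCompactSupport X → ∀ t ∈ Icc 0 T, u t X - v t X = 0 := by
    intro X hX
    have c1 := hcu.continuousOn_apply X
    have c2 := hcv.continuousOn_apply X
    have hc := c1.sub c2
    have hae : ∀ᵐ t ∂volume, t ∈ Ioo 0 T → u t X - v t X = 0 := by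
      refine isOpen_Ioo.ae_eq_zero_of_integral_contDiff_smul_eq_zero
        (f := fun t => u t X - v t X) ?_ fun g g_smooth g_cpt g_supp => ?_
      · exact ((hc.mono Ioo_subset_Icc_self).locallyIntegrableOn measurableSet_Ioo)
      · have hg₁ : HasCompactSupport (Complex.ofRealCLM ∘ g) := g_cpt.comp_left rfl
        have hg₂ : ContDiff ℝ (⊤ : ℕ∞) (Complex.ofRealCLM ∘ g) := Complex.ofRealCLM.contDiff.comp g_smooth
        have hg₃ : tsupport (Complex.ofRealCLM ∘ g) ⊆ Ioo 0 T :=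
          (tsupport_comp_subset (g := Complex.ofRealCLM) rfl g).trans g_supp
        obtain ⟨φ, hφ, hsl⟩ := exists_product_test X hX hg₂ hg₁ hg₃
        have e := (hu φ hφ).symm.trans (hv φ hφ)
        simp only [hsl, map_smul] at e
        have hi : ∀ w : ℝ → 𝓢'(ℝ, ℂ), ContinuousOn (fun t => w t X) (Icc 0 T) →
            IntegrableOn (fun t => (Complex.ofRealCLM ∘ g) t • w t X) (Ioo 0 T) volume := by
          intro w hw
          refine IntegrableOn.mono_set ?_ Ioo_subset_Icc_self
          exact (hg₂.continuous.continuousOn.smul hw).integrableOn_Icc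
        have e2 := integral_sub (hi u c1) (hi v c2)
        rw [e, sub_self] at e2
        rw [← e2, ← setIntegral_eq_integral_of_forall_compl_eq_zero (s := Ioo 0 T)]
        · refine integral_congr_ae (ae_of_all _ fun t => ?_)
          simp [mul_sub]
        · intro t ht
          have : g t = 0 := image_eq_zero_of_notMem_tsupport fun h => ht (g_supp h)
          rw [this, zero_smul]
    have h0 : (fun t => u t X - v t X) =ᵐ[volume.restrict (Icc 0 T)] fun _ => 0 := by
      rw [← restrict_Ioo_eq_restrict_Icc]
      exact (ae_restrict_iff' measurableSet_Ioo).2 hae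
    exact Measure.eqOn_Icc_of_ae_eq volume hT.ne h0 hc continuousOn_const
  intro t ht
  rw [← sub_eq_zero]
  exact eq_zero_of_forall_compactSupport fun X hX => key X hX t ht

/-- The traces of `z` define another continuous curve extended by `U`, and `Extends.eq` leaves only
one. -/
theorem isFourierRep_tr_of_extends {α β s b T : ℝ} {z : ℝ × ℝ → ℂ} (hT : 0 < T) {U : 𝓢'(Spacetime, ℂ)}
    {u : ℝ → 𝓢'(ℝ, ℂ)} (hU : PairRep U z) (hb : 1 / 2 < b) (hz : Measurable z) (h : bourSq α β s b z < ∞)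
    (hu : Extends T U u) (hcu : ContinuousInHs s T u) : ∀ t ∈ Icc 0 T, IsFourierRep (u t) (tr z t) := by
  obtain ⟨v, hv⟩ := exists_isFourierRep_tr hb hz h
  intro t ht
  rw [hu.eq hT (extends_of_tr hU hb hz h fun t _ => hv t) hcu (continuousInHs_of_tr hb hz h fun t _ => hv t) t ht]
  exact hv t

/-! ### The localized Duhamel operators -/

/-- The cut-off function in time. -/
def bump : 𝓢(ℝ, ℂ) := hasCompactSupport_cutoffC.toSchwartzMap contDiff_cutoffC

/-- The Fourier transform of the cut-off function in time. -/
def bhat : 𝓢(ℝ, ℂ) := 𝓕 bump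

/-- Scaling and translating the transform of the cut-off corresponds to dilating it in time and
multiplying it by a character. -/
theorem integral_chi_bhat {δ : ℝ} (hδ : 0 < δ) (t a : ℝ) :
    ∫ τ, chi (t * τ) * (δ * bhat (δ * (τ - a))) = chi (t * a) * cutoffC (t / δ) := by
  have h1 : ∫ y, chi (t / δ * y) * bhat y = cutoffC (t / δ) := by
    rw [← fourierInv_eq_chi, ← SchwartzMap.fourierInv_coe, bhat, FourierTransform.fourierInv_fourier_eq]
    rfl
  have h2 := integral_sub_right_eq_self (μ := volume) (fun τ => chi (t * (τ + a)) * (δ * bhat (δ * τ))) a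
  simp only [sub_add_cancel] at h2
  rw [h2]
  have h3 := Measure.integral_comp_mul_left (fun y => chi (t / δ * y) * bhat y) δ
  rw [h1, abs_of_pos (by positivity)] at h3
  have e : ∀ τ, chi (t * (τ + a)) * (δ * bhat (δ * τ)) =
      (chi (t * a) * δ) * (chi (t / δ * (δ * τ)) * bhat (δ * τ)) := by
    intro τ
    rw [show t / δ * (δ * τ) = t * τ by field_simp, mul_add, chi_add]
    ring
  simp only [e]
  rw [integral_const_mul, h3, Complex.real_smul]
  push_cast
  have : (δ : ℂ) ≠ 0 := by exact_mod_cast hδ.ne'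
  field_simp

theorem lintegral_comp_mul_left {δ : ℝ} (hδ : 0 < δ) (f : ℝ → ℝ≥0∞) :
    ENNReal.ofReal δ * ∫⁻ x, f (δ * x) = ∫⁻ x, f x := by
  have h1 := Real.smul_map_volume_mul_left hδ.ne'
  have h2 : ∫⁻ x, f x ∂(ENNReal.ofReal |δ| • Measure.map (δ * ·) volume) = ∫⁻ x, f x := by rw [h1]
  have h3 : ∫⁻ x, f x ∂(Measure.map (δ * ·) volume) = ∫⁻ x, f (δ * x) :=
    (Homeomorph.mulLeft₀ δ hδ.ne').measurableEmbedding.lintegral_map f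
  rw [lintegral_smul_measure, abs_of_pos hδ, h3] at h2
  exact h2

theorem exists_schwartz_le (f : 𝓢(ℝ, ℂ)) : ∃ C : ℝ, 0 ≤ C ∧ ∀ x, ‖f x‖ ≤ C * br x ^ (-3 : ℝ) := by
  set S := (Finset.Iic ((3, 0) : ℕ × ℕ)).sup (fun m => SchwartzMap.seminorm ℂ m.1 m.2) f
  refine ⟨2 ^ 3 * S, mul_nonneg (by positivity) (apply_nonneg _ _), fun x => ?_⟩
  have h := SchwartzMap.one_add_le_sup_seminorm_apply (𝕜 := ℂ) (m := (3, 0)) (k := 3) (n := 0)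
    le_rfl le_rfl f x
  rw [norm_iteratedFDeriv_zero] at h
  change br x ^ 3 * ‖f x‖ ≤ 2 ^ 3 * S at h
  have h1 := br_pos x
  rw [Real.rpow_neg h1.le, ← div_eq_mul_inv, le_div_iff₀ (by positivity), show (3 : ℝ) = ((3 : ℕ) : ℝ) by norm_num,
    Real.rpow_natCast]
  linarith

/-- The kernel of the localized Duhamel operator. -/
def duhKer (σ σ' : ℝ) : ℂ := (bhat (σ - σ') - bhat σ) / (2 * Real.pi * Complex.I * σ')

theorem measurable_duhKer : Measurable (Function.uncurry duhKer) := by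
  unfold duhKer Function.uncurry
  have h := bhat.continuous.measurable
  have h1 : Measurable fun p : ℝ × ℝ => bhat (p.1 - p.2) := h.comp (measurable_fst.sub measurable_snd)
  have h2 : Measurable fun p : ℝ × ℝ => bhat p.1 := h.comp measurable_fst
  exact (h1.sub h2).div (by fun_prop)

theorem norm_two_pi_I_mul (x : ℝ) : ‖(2 * Real.pi * Complex.I * x : ℂ)‖ = 2 * Real.pi * |x| := by
  simp [abs_of_pos Real.pi_pos]

/-- For `|σ'| ≥ 1` the two terms of the numerator are bounded separately. For `|σ'| ≤ 1` the mean
value theorem supplies the factor `|σ'|` that cancels the denominator. -/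
theorem exists_duhKer_le : ∃ C : ℝ, 0 ≤ C ∧ ∀ σ σ' : ℝ,
    ‖duhKer σ σ'‖ ≤ C * ((br (σ - σ') ^ (-3 : ℝ) + br σ ^ (-3 : ℝ)) * (br σ')⁻¹) := by
  obtain ⟨C0, hC0, h0⟩ := exists_schwartz_le bhat
  obtain ⟨C1, hC1, h1⟩ := exists_schwartz_le (∂_{(1 : ℝ)} bhat)
  have hd : ∀ x, HasDerivAt bhat ((∂_{(1 : ℝ)} bhat) x) x := fun x => by
    have := (bhat.differentiableAt (x := x)).hasDerivAt
    have e : (∂_{(1 : ℝ)} bhat) x = deriv bhat x := by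
      rw [SchwartzMap.lineDerivOp_apply_eq_fderiv]
      simp
    rwa [e]
  have hpi := Real.pi_gt_three
  refine ⟨2 * C0 + 16 * C1, by positivity, fun σ σ' => ?_⟩
  have b1 := br_pos (σ - σ')
  have b2 := br_pos σ
  have b3 := br_pos σ'
  have p1 : 0 < br (σ - σ') ^ (-3 : ℝ) := by positivity
  have p2 : 0 < br σ ^ (-3 : ℝ) := by positivity
  rw [duhKer, norm_div, norm_two_pi_I_mul, ← mul_assoc]
  -- Division by zero makes the kernel zero here instead of its limit, which changes it only on a
  -- null set.
  rcases eq_or_ne σ' 0 with rfl | hne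
  · simp only [abs_zero, mul_zero, div_zero]
    positivity
  have ha : 0 < |σ'| := abs_pos.2 hne
  rw [div_le_iff₀ (by positivity)]
  rcases le_total 1 |σ'| with h | h
  · have e1 : ‖bhat (σ - σ') - bhat σ‖ ≤ C0 * (br (σ - σ') ^ (-3 : ℝ) + br σ ^ (-3 : ℝ)) := by
      refine (norm_sub_le _ _).trans ?_
      rw [mul_add]
      exact add_le_add (h0 _) (h0 _)
    have e2 : 1 ≤ 2 * ((br σ')⁻¹ * (2 * Real.pi * |σ'|)) := by
      have : br σ' ≤ 2 * (2 * Real.pi * |σ'|) := by unfold br; nlinarith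
      rw [← mul_assoc, mul_comm 2, mul_assoc, inv_mul_eq_div, le_div_iff₀ b3, one_mul]
      exact this
    set P := br (σ - σ') ^ (-3 : ℝ) + br σ ^ (-3 : ℝ) with hP
    set Q := (br σ')⁻¹ * (2 * Real.pi * |σ'|) with hQ
    have hP0 : 0 < P := by positivity
    have hQ0 : 0 ≤ Q := by positivity
    calc ‖bhat (σ - σ') - bhat σ‖ ≤ C0 * P := e1
      _ ≤ C0 * P * (2 * Q) := le_mul_of_one_le_right (by positivity) e2
      _ = 2 * C0 * P * Q := by ring
      _ ≤ (2 * C0 + 16 * C1) * P * Q := by gcongr; linarith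
      _ = _ := by rw [hQ]; ring
  · have e1 : ‖bhat (σ - σ') - bhat σ‖ ≤ C1 * (8 * br σ ^ (-3 : ℝ)) * |σ'| := by
      have hm := (convex_segment σ (σ - σ')).norm_image_sub_le_of_norm_hasDerivWithin_le (f := bhat)
        (f' := fun x => (∂_{(1 : ℝ)} bhat) x) (C := C1 * (8 * br σ ^ (-3 : ℝ)))
        (fun x _ => (hd x).hasDerivWithinAt) (fun x hx => ?_) (left_mem_segment ℝ _ _) (right_mem_segment ℝ _ _)
      · refine hm.trans (le_of_eq ?_)
        simp
      · refine (h1 x).trans ?_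
        have hxσ : |x - σ| ≤ 1 := by
          have h3 := (convex_closedBall σ 1).segment_subset (Metric.mem_closedBall_self zero_le_one)
            (show σ - σ' ∈ Metric.closedBall σ 1 by simpa [Real.dist_eq] using h) hx
          simpa [Real.dist_eq] using h3
        have h4 : br σ ≤ 2 * br x := by
          unfold br
          have := abs_sub_abs_le_abs_sub σ x
          rw [abs_sub_comm] at this
          linarith [abs_nonneg x]
        have b4 := br_pos x
        gcongr
        have h5 := Real.rpow_le_rpow_of_nonpos b2 h4 (show (-3 : ℝ) ≤ 0 by norm_num)
        rw [Real.mul_rpow zero_le_two b4.le, show (2 : ℝ) ^ (-3 : ℝ) = 1 / 8 by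
          rw [Real.rpow_neg zero_le_two, show (3 : ℝ) = ((3 : ℕ) : ℝ) by norm_num, Real.rpow_natCast]; norm_num] at h5
        linarith
    have e2 : |σ'| ≤ 2 * ((br σ')⁻¹ * (2 * Real.pi * |σ'|)) := by
      have : br σ' ≤ 2 * (2 * Real.pi) := by unfold br; nlinarith
      rw [← mul_assoc, mul_comm 2, mul_assoc, inv_mul_eq_div, le_div_iff₀ b3]
      nlinarith
    set P := br (σ - σ') ^ (-3 : ℝ) with hP
    set P' := br σ ^ (-3 : ℝ) with hP'
    set Q := (br σ')⁻¹ * (2 * Real.pi * |σ'|) with hQ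
    have hQ0 : 0 ≤ Q := by positivity
    calc ‖bhat (σ - σ') - bhat σ‖ ≤ C1 * (8 * P') * |σ'| := e1
      _ ≤ C1 * (8 * P') * (2 * Q) := by gcongr
      _ = 16 * C1 * P' * Q := by ring
      _ ≤ (2 * C0 + 16 * C1) * (P + P') * Q := by gcongr <;> linarith
      _ = _ := by rw [hQ]; ring

/-- Young's inequality for `L¹ * L²`: the kernel is split into two square roots before
Cauchy-Schwarz. -/
theorem lintegral_young_sq {g N : ℝ → ℝ≥0∞} (hg : Measurable g) (hN : Measurable N) :
    ∫⁻ σ, (∫⁻ σ', g (σ - σ') * N σ') ^ 2 ≤ (∫⁻ x, g x) ^ 2 * ∫⁻ x, N x ^ 2 := by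
  have h1 : ∀ σ, (∫⁻ σ', g (σ - σ') * N σ') ^ 2 ≤ (∫⁻ x, g x) * ∫⁻ σ', g (σ - σ') * N σ' ^ 2 := by
    intro σ
    have hgs : Measurable fun σ' => g (σ - σ') := hg.comp (measurable_const.sub measurable_id)
    have e : ∀ σ', g (σ - σ') * N σ' = (g (σ - σ') ^ (1 / 2 : ℝ)) * (g (σ - σ') ^ (1 / 2 : ℝ) * N σ') := by
      intro σ'
      rw [← mul_assoc, ← ENNReal.rpow_add_of_nonneg _ _ (by norm_num) (by norm_num)]
      norm_num
    have e2 : ∀ x : ℝ≥0∞, (x ^ (1 / 2 : ℝ)) ^ 2 = x := fun x => by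
      rw [← ENNReal.rpow_natCast, ← ENNReal.rpow_mul]
      norm_num
    simp only [e]
    have hm2 : Measurable fun σ' => g (σ - σ') ^ (1 / 2 : ℝ) * N σ' := (hgs.pow_const _).mul hN
    refine (lintegral_mul_sq_le (hgs.pow_const _).aemeasurable hm2.aemeasurable).trans ?_
    simp only [mul_pow, e2]
    rw [lintegral_sub_left_eq_self g σ]
  refine (lintegral_mono h1).trans ?_
  have hm : Measurable fun p : ℝ × ℝ => g (p.1 - p.2) * N p.2 ^ 2 :=
    (hg.comp (measurable_fst.sub measurable_snd)).mul ((hN.comp measurable_snd).pow_const 2)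
  rw [lintegral_const_mul _ hm.lintegral_prod_right', lintegral_lintegral_swap hm.aemeasurable]
  have h2 : ∀ σ', ∫⁻ σ, g (σ - σ') * N σ' ^ 2 = (∫⁻ x, g x) * N σ' ^ 2 := fun σ' => by
    have hgs : Measurable fun σ => g (σ - σ') := hg.comp (measurable_id.sub measurable_const)
    rw [lintegral_mul_const _ hgs]
    congr 1
    exact lintegral_sub_right_eq_self g σ'
  simp only [h2]
  rw [lintegral_const_mul _ (hN.pow_const 2), pow_two, mul_assoc]

/-! ### Bounds for the localized operators with explicit powers of the time scale. -/

section

theorem mul_br_le {δ : ℝ} (hδ : 0 < δ) (hδ1 : δ ≤ 1) (x : ℝ) : δ * br x ≤ br (δ * x) := by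
  unfold br
  rw [abs_mul, abs_of_pos hδ]
  linarith

theorem br_rpow_le_dilate {δ b : ℝ} (hδ : 0 < δ) (hδ1 : δ ≤ 1) (hb : 0 ≤ b) (x : ℝ) :
    br x ^ b ≤ δ ^ (-b) * br (δ * x) ^ b := by
  have h1 := Real.rpow_le_rpow (by have := br_pos x; positivity) (mul_br_le hδ hδ1 x) hb
  rw [Real.mul_rpow hδ.le (br_pos x).le] at h1
  rw [Real.rpow_neg hδ.le, inv_mul_eq_div, le_div_iff₀ (by positivity)]
  linarith

theorem br_dilate_rpow_le {δ r : ℝ} (hδ : 0 < δ) (hδ1 : δ ≤ 1) (hr : r ≤ 0) (x : ℝ) :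
    br (δ * x) ^ r ≤ δ ^ r * br x ^ r := by
  rw [← Real.mul_rpow hδ.le (br_pos x).le]
  exact Real.rpow_le_rpow_of_nonpos (by have := br_pos x; positivity) (mul_br_le hδ hδ1 x) hr

theorem lintegral_dilate_sq {δ r : ℝ} (hδ : 0 < δ) :
    ∫⁻ x, ENNReal.ofReal (δ ^ (1 / 2 : ℝ) * br (δ * x) ^ (-r)) ^ 2 = jap (2 * r) := by
  rw [jap, ← lintegral_comp_mul_left hδ (fun a => ENNReal.ofReal (br a ^ (-(2 * r)))),
    ← lintegral_const_mul' _ _ ENNReal.ofReal_ne_top]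
  refine lintegral_congr fun x => ?_
  have h := br_pos (δ * x)
  rw [← ENNReal.ofReal_pow (by positivity), ← ENNReal.ofReal_mul hδ.le, mul_pow, ← Real.rpow_mul_natCast hδ.le,
    ← Real.rpow_mul_natCast h.le]
  congr 2
  · norm_num
  · congr 1; push_cast; ring

theorem lintegral_dilate {δ r : ℝ} (hδ : 0 < δ) :
    ∫⁻ x, ENNReal.ofReal (δ * br (δ * x) ^ (-r)) = jap r := by
  rw [jap, ← lintegral_comp_mul_left hδ (fun a => ENNReal.ofReal (br a ^ (-r))),
    ← lintegral_const_mul' _ _ ENNReal.ofReal_ne_top]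
  refine lintegral_congr fun x => ?_
  rw [ENNReal.ofReal_mul hδ.le]

/-- Removing the dilation from `⟨σ⟩^b` costs `δ^(-b)`, and from `⟨σ'⟩^(b'-1)` it costs `δ^(b'-1)`.
Together with `δ²` this leaves `δ^(b'-b)` and one more `δ`, which normalizes the convolution kernel
in `L¹`, or is split into two halves that normalize the factors of the rank-one part in `L²`. -/
theorem exists_dilated_duhKer_le {b b' : ℝ} (hb : 0 ≤ b) (hbb : b ≤ b') (hb' : b' ≤ 1) :
    ∃ C : ℝ, 0 ≤ C ∧ ∀ δ : ℝ, 0 < δ → δ ≤ 1 → ∀ σ σ' : ℝ,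
      br σ ^ b * (δ ^ 2 * ‖duhKer (δ * σ) (δ * σ')‖) ≤
        (C * δ ^ (b' - b)) * ((δ * br (δ * (σ - σ')) ^ (-2 : ℝ) +
          (δ ^ (1 / 2 : ℝ) * br (δ * σ) ^ (-2 : ℝ)) * (δ ^ (1 / 2 : ℝ) * br (δ * σ') ^ (-b))) * br σ' ^ (b' - 1)) := by
  obtain ⟨C, hC, h⟩ := exists_duhKer_le
  refine ⟨C, hC, fun δ hδ hδ1 σ σ' => ?_⟩
  have hk := h (δ * σ) (δ * σ')
  rw [← mul_sub] at hk
  have c1 := br_rpow_le_dilate hδ hδ1 hb σ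
  set S := br (δ * σ) with hS
  set S' := br (δ * σ') with hS'
  set D := br (δ * (σ - σ')) with hD
  have s1 : 1 ≤ S := one_le_br _
  have s2 : 1 ≤ S' := one_le_br _
  have s3 : 1 ≤ D := one_le_br _
  have p1 : 0 < S := by linarith
  have p2 : 0 < S' := by linarith
  have p3 : 0 < D := by linarith
  have p4 := br_pos σ
  have p5 := br_pos σ'
  have hSD : S ≤ D * S' := by
    rw [hS, hD, hS']
    have := br_add_le_mul (δ * (σ - σ')) (δ * σ')
    rwa [show δ * (σ - σ') + δ * σ' = δ * σ by ring] at this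
  have e1 : S ^ b * D ^ (-3 : ℝ) * S'⁻¹ ≤ D ^ (-2 : ℝ) * S' ^ (b - 1) := by
    have h1 : S ^ b ≤ D ^ b * S' ^ b := by
      rw [← Real.mul_rpow p3.le p2.le]
      exact Real.rpow_le_rpow p1.le hSD hb
    calc S ^ b * D ^ (-3 : ℝ) * S'⁻¹ ≤ (D ^ b * S' ^ b) * D ^ (-3 : ℝ) * S'⁻¹ := by gcongr
      _ = D ^ (b + (-3)) * (S' ^ b * S'⁻¹) := by rw [Real.rpow_add p3]; ring
      _ = D ^ (b + (-3)) * S' ^ (b - 1) := by rw [Real.rpow_sub p2, Real.rpow_one, div_eq_mul_inv]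
      _ ≤ _ := by
        gcongr
        linarith
  have e2 : S ^ b * S ^ (-3 : ℝ) * S'⁻¹ ≤ S ^ (-2 : ℝ) * S' ^ (-b) * S' ^ (b - 1) := by
    rw [← Real.rpow_add p1, mul_assoc, ← Real.rpow_add p2, show -b + (b - 1) = -1 by ring, Real.rpow_neg_one]
    gcongr
    linarith
  have e3 : S' ^ (b - 1) ≤ δ ^ (b' - 1) * br σ' ^ (b' - 1) :=
    (Real.rpow_le_rpow_of_exponent_le s2 (by linarith)).trans (br_dilate_rpow_le hδ hδ1 (by linarith) σ')
  have e4 : δ ^ (-b) * δ ^ 2 * δ ^ (b' - 1) = δ ^ (b' - b) * δ := by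
    rw [← Real.rpow_natCast, ← Real.rpow_add hδ, ← Real.rpow_add hδ, ← Real.rpow_add_one hδ.ne']
    congr 1; push_cast; ring
  have e5 : δ ^ (1 / 2 : ℝ) * δ ^ (1 / 2 : ℝ) = δ := by
    rw [← Real.rpow_add hδ]; norm_num
  calc br σ ^ b * (δ ^ 2 * ‖duhKer (δ * σ) (δ * σ')‖)
      ≤ (δ ^ (-b) * S ^ b) * (δ ^ 2 * (C * ((D ^ (-3 : ℝ) + S ^ (-3 : ℝ)) * S'⁻¹))) := by gcongr
    _ = C * (δ ^ (-b) * δ ^ 2) * (S ^ b * D ^ (-3 : ℝ) * S'⁻¹ + S ^ b * S ^ (-3 : ℝ) * S'⁻¹) := by ring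
    _ ≤ C * (δ ^ (-b) * δ ^ 2) * (D ^ (-2 : ℝ) * S' ^ (b - 1) + S ^ (-2 : ℝ) * S' ^ (-b) * S' ^ (b - 1)) := by
        gcongr
    _ = C * (δ ^ (-b) * δ ^ 2) * (D ^ (-2 : ℝ) + S ^ (-2 : ℝ) * S' ^ (-b)) * S' ^ (b - 1) := by ring
    _ ≤ C * (δ ^ (-b) * δ ^ 2) * (D ^ (-2 : ℝ) + S ^ (-2 : ℝ) * S' ^ (-b)) * (δ ^ (b' - 1) * br σ' ^ (b' - 1)) := by
        gcongr
    _ = C * (δ ^ (-b) * δ ^ 2 * δ ^ (b' - 1)) * (D ^ (-2 : ℝ) + S ^ (-2 : ℝ) * S' ^ (-b)) * br σ' ^ (b' - 1) := by ring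
    _ = C * δ ^ (b' - b) * ((δ * D ^ (-2 : ℝ) + (δ ^ (1 / 2 : ℝ) * δ ^ (1 / 2 : ℝ)) * (S ^ (-2 : ℝ) * S' ^ (-b))) * br σ' ^ (b' - 1)) := by
        rw [e4, e5]; ring
    _ = _ := by ring

/-- The convolution part of the kernel is bounded by Young's inequality, the rank-one part by
Cauchy-Schwarz; the normalizations make both constants independent of `δ`. -/
theorem exists_lintegral_duhKer_le {b b' : ℝ} (hb : 1 / 2 < b) (hbb : b ≤ b') (hb' : b' ≤ 1) :
    ∃ C : ℝ≥0∞, C < ∞ ∧ ∀ δ : ℝ, 0 < δ → δ ≤ 1 → ∀ N : ℝ → ℝ≥0∞, Measurable N →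
      ∫⁻ σ, (∫⁻ σ', ENNReal.ofReal (br σ ^ b * (δ ^ 2 * ‖duhKer (δ * σ) (δ * σ')‖)) * N σ') ^ 2 ≤
        C * ENNReal.ofReal (δ ^ (2 * (b' - b))) * ∫⁻ σ, (ENNReal.ofReal (br σ ^ (b' - 1)) * N σ) ^ 2 := by
  obtain ⟨C, hC, h⟩ := exists_dilated_duhKer_le (by linarith) hbb hb'
  refine ⟨ENNReal.ofReal (C ^ 2) * (2 * (jap 2 ^ 2 + jap (2 * 2) * jap (2 * b))), ?_, fun δ hδ hδ1 N hN => ?_⟩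
  · refine ENNReal.mul_lt_top ENNReal.ofReal_lt_top (ENNReal.mul_lt_top (by norm_num) (ENNReal.add_lt_top.2 ⟨?_, ?_⟩))
    · exact ENNReal.pow_lt_top (jap_lt_top one_lt_two)
    · exact ENNReal.mul_lt_top (jap_lt_top (by norm_num)) (jap_lt_top (by linarith))
  set c := ENNReal.ofReal (C * δ ^ (b' - b)) with hc
  set M : ℝ → ℝ≥0∞ := fun σ => ENNReal.ofReal (br σ ^ (b' - 1)) * N σ with hM
  set g : ℝ → ℝ≥0∞ := fun x => ENNReal.ofReal (δ * br (δ * x) ^ (-2 : ℝ)) with hg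
  set a : ℝ → ℝ≥0∞ := fun x => ENNReal.ofReal (δ ^ (1 / 2 : ℝ) * br (δ * x) ^ (-2 : ℝ)) with ha
  set e : ℝ → ℝ≥0∞ := fun x => ENNReal.ofReal (δ ^ (1 / 2 : ℝ) * br (δ * x) ^ (-b)) with he
  have hMm : Measurable M := (continuous_br_rpow _).measurable.ennreal_ofReal.mul hN
  have hdil : ∀ r : ℝ, Measurable fun x => br (δ * x) ^ r := fun r =>
    ((continuous_br_rpow r).comp (continuous_const.mul continuous_id)).measurable
  have hgm : Measurable g := ((hdil _).const_mul _).ennreal_ofReal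
  have ham : Measurable a := ((hdil _).const_mul _).ennreal_ofReal
  have hem : Measurable e := ((hdil _).const_mul _).ennreal_ofReal
  have hg1 : ∫⁻ x, g x = jap 2 := lintegral_dilate hδ
  have ha1 : ∫⁻ x, a x ^ 2 = jap (2 * 2) := lintegral_dilate_sq hδ
  have he1 : ∫⁻ x, e x ^ 2 = jap (2 * b) := lintegral_dilate_sq hδ
  have key : ∀ σ σ', ENNReal.ofReal (br σ ^ b * (δ ^ 2 * ‖duhKer (δ * σ) (δ * σ')‖)) * N σ' ≤
      c * (g (σ - σ') * M σ' + a σ * (e σ' * M σ')) := by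
    intro σ σ'
    have q1 := br_pos (δ * (σ - σ'))
    have q2 := br_pos (δ * σ)
    have q3 := br_pos (δ * σ')
    have q4 := br_pos σ'
    have h1 := ENNReal.ofReal_le_ofReal (h δ hδ hδ1 σ σ')
    rw [ENNReal.ofReal_mul (p := C * δ ^ (b' - b)) (by positivity), ENNReal.ofReal_mul (p := _ + _) (by positivity),
      ENNReal.ofReal_add (by positivity) (by positivity),
      ENNReal.ofReal_mul (p := δ ^ (1 / 2 : ℝ) * br (δ * σ) ^ (-2 : ℝ)) (by positivity)] at h1
    refine (mul_le_mul_left h1 _).trans (le_of_eq ?_)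
    simp only [hM, hg, ha, he, hc]
    ring
  have key2 : ∀ σ, (∫⁻ σ', ENNReal.ofReal (br σ ^ b * (δ ^ 2 * ‖duhKer (δ * σ) (δ * σ')‖)) * N σ') ^ 2 ≤
      c ^ 2 * (2 * ((∫⁻ σ', g (σ - σ') * M σ') ^ 2 + (∫⁻ σ', e σ' * M σ') ^ 2 * a σ ^ 2)) := by
    intro σ
    have m1 : Measurable fun σ' => g (σ - σ') * M σ' := (hgm.comp (measurable_const.sub measurable_id)).mul hMm
    have m2 : Measurable fun σ' => e σ' * M σ' := hem.mul hMm
    have h1 : ∫⁻ σ', ENNReal.ofReal (br σ ^ b * (δ ^ 2 * ‖duhKer (δ * σ) (δ * σ')‖)) * N σ' ≤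
        c * ((∫⁻ σ', g (σ - σ') * M σ') + a σ * ∫⁻ σ', e σ' * M σ') := by
      refine (lintegral_mono (key σ)).trans (le_of_eq ?_)
      rw [lintegral_const_mul' _ _ ENNReal.ofReal_ne_top, lintegral_add_left m1,
        lintegral_const_mul _ m2]
    refine (pow_le_pow_left₀ zero_le h1 2).trans ?_
    rw [mul_pow]
    gcongr
    refine (ENNReal_add_sq_le _ _).trans (le_of_eq ?_)
    rw [mul_pow]
    ring
  refine (lintegral_mono key2).trans ?_
  have hc2 : c ^ 2 = ENNReal.ofReal (C ^ 2) * ENNReal.ofReal (δ ^ (2 * (b' - b))) := by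
    rw [hc, ← ENNReal.ofReal_pow (by positivity), mul_pow, ENNReal.ofReal_mul (by positivity), ← Real.rpow_mul_natCast hδ.le]
    congr 3
    push_cast
    ring
  have m3 : Measurable fun σ => (∫⁻ σ', g (σ - σ') * M σ') ^ 2 := by
    have : Measurable fun p : ℝ × ℝ => g (p.1 - p.2) * M p.2 :=
      (hgm.comp (measurable_fst.sub measurable_snd)).mul (hMm.comp measurable_snd)
    exact this.lintegral_prod_right'.pow_const 2
  rw [lintegral_const_mul' _ _ (by rw [hc2]; exact ENNReal.mul_ne_top ENNReal.ofReal_ne_top ENNReal.ofReal_ne_top),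
    lintegral_const_mul' _ _ (by norm_num), lintegral_add_left m3, lintegral_const_mul _ (ham.pow_const 2), ha1, hc2]
  have h2 := lintegral_young_sq hgm hMm
  have h3 := lintegral_mul_sq_le (μ := volume) hem.aemeasurable hMm.aemeasurable
  rw [hg1] at h2
  rw [he1] at h3
  set J := ∫⁻ σ, M σ ^ 2 with hJ
  calc _ ≤ ENNReal.ofReal (C ^ 2) * ENNReal.ofReal (δ ^ (2 * (b' - b))) * (2 * (jap 2 ^ 2 * J + (jap (2 * b) * J) * jap (2 * 2))) := by
        gcongr
    _ = _ := by ring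

/-- The localized free evolution of the datum with Fourier transform `h`. -/
def freeOp (α β δ : ℝ) (h : ℝ → ℂ) (p : ℝ × ℝ) : ℂ :=
  h p.1 * (δ * bhat (δ * (p.2 - symbol α β p.1)))

/-- The localized Duhamel term with forcing `n`. -/
def duhOp (α β δ : ℝ) (n : ℝ × ℝ → ℂ) (p : ℝ × ℝ) : ℂ :=
  ∫ τ, (δ ^ 2 : ℝ) * duhKer (δ * (p.2 - symbol α β p.1)) (δ * (τ - symbol α β p.1)) * n (p.1, τ)

variable {α β s b b' : ℝ}

theorem measurable_freeOp {δ : ℝ} {h : ℝ → ℂ} (hh : Measurable h) : Measurable (freeOp α β δ h) := by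
  unfold freeOp
  refine (hh.comp measurable_fst).mul (Measurable.const_mul ?_ _)
  exact (bhat.continuous.comp (by fun_prop : Continuous fun p : ℝ × ℝ => δ * (p.2 - symbol α β p.1))).measurable

theorem measurable_duhOp_kernel {δ : ℝ} {n : ℝ × ℝ → ℂ} (hn : Measurable n) :
    Measurable fun y : (ℝ × ℝ) × ℝ => (δ ^ 2 : ℝ) *
      duhKer (δ * (y.1.2 - symbol α β y.1.1)) (δ * (y.2 - symbol α β y.1.1)) * n (y.1.1, y.2) := by
  have h1 : Measurable fun y : (ℝ × ℝ) × ℝ => (δ * (y.1.2 - symbol α β y.1.1), δ * (y.2 - symbol α β y.1.1)) :=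
    Continuous.measurable (by fun_prop)
  have h2 := measurable_duhKer.comp h1
  have h3 : Measurable fun y : (ℝ × ℝ) × ℝ =>
      duhKer (δ * (y.1.2 - symbol α β y.1.1)) (δ * (y.2 - symbol α β y.1.1)) := by
    simpa only [Function.comp_def, Function.uncurry] using h2
  have h4 : Measurable fun y : (ℝ × ℝ) × ℝ => n (y.1.1, y.2) :=
    hn.comp ((measurable_fst.comp measurable_fst).prodMk measurable_snd)
  exact (h3.const_mul _).mul h4

theorem measurable_duhOp {δ : ℝ} {n : ℝ × ℝ → ℂ} (hn : Measurable n) : Measurable (duhOp α β δ n) :=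
  (measurable_duhOp_kernel hn).stronglyMeasurable.integral_prod_right'.measurable

/-- The substitution `τ = σ + p(ξ)` straightens the dispersion curve, so one-dimensional bounds in
`σ` can be used on each fibre. -/
theorem bourSq_eq_lintegral {z : ℝ × ℝ → ℂ} (hz : Measurable z) :
    bourSq α β s b z = ∫⁻ ξ, ENNReal.ofReal (br ξ ^ s) ^ 2 *
      ∫⁻ σ, (ENNReal.ofReal (br σ ^ b) * ‖z (ξ, σ + symbol α β ξ)‖ₑ) ^ 2 := by
  have hm : Measurable fun p : ℝ × ℝ => (ENNReal.ofReal (wt α β s b p) * ‖z p‖ₑ) ^ 2 :=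
    ((measurable_wt (α := α) (β := β) (s := s) (b := b)).ennreal_ofReal.mul hz.enorm).pow_const 2
  rw [bourSq, Measure.volume_eq_prod, lintegral_prod _ hm.aemeasurable]
  refine lintegral_congr fun ξ => ?_
  rw [← lintegral_const_mul' _ _ (ENNReal.pow_ne_top ENNReal.ofReal_ne_top),
    ← lintegral_add_right_eq_self _ (symbol α β ξ)]
  refine lintegral_congr fun σ => ?_
  have := br_pos ξ
  rw [← mul_pow, ← mul_assoc, ← ENNReal.ofReal_mul (by positivity), wt]
  simp

/-- On each fibre this is the `H^b` norm of a cut-off of width `δ`, which scales like `δ^(1/2 - b)`.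
-/
theorem exists_bourSq_freeOp_le (hb : 0 ≤ b) (hb1 : b ≤ 1) :
    ∃ C : ℝ≥0∞, C < ∞ ∧ ∀ (α β s δ : ℝ), 0 < δ → δ ≤ 1 → ∀ h : ℝ → ℂ, Measurable h →
      bourSq α β s b (freeOp α β δ h) ≤ C * ENNReal.ofReal (δ ^ (1 - 2 * b)) * sobSq s h := by
  obtain ⟨C, hC, hb3⟩ := exists_schwartz_le bhat
  refine ⟨ENNReal.ofReal (C ^ 2) * jap (2 * 2), ENNReal.mul_lt_top ENNReal.ofReal_lt_top (jap_lt_top (by norm_num)),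
    fun α β s δ hδ hδ1 h hh => ?_⟩
  rw [bourSq_eq_lintegral (measurable_freeOp hh), sobSq]
  have key : ∀ ξ σ, (ENNReal.ofReal (br σ ^ b) * ‖freeOp α β δ h (ξ, σ + symbol α β ξ)‖ₑ) ^ 2 ≤
      (ENNReal.ofReal (C ^ 2) * ENNReal.ofReal (δ ^ (1 - 2 * b)) * ‖h ξ‖ₑ ^ 2) *
        ENNReal.ofReal (δ ^ (1 / 2 : ℝ) * br (δ * σ) ^ (-2 : ℝ)) ^ 2 := by
    intro ξ σ
    have q1 := br_pos σ
    have q2 := br_pos (δ * σ)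
    have e1 : ‖freeOp α β δ h (ξ, σ + symbol α β ξ)‖ₑ = ENNReal.ofReal (δ * ‖bhat (δ * σ)‖) * ‖h ξ‖ₑ := by
      rw [freeOp]
      simp only [add_sub_cancel_right]
      rw [enorm_mul, mul_comm, ← ofReal_norm, norm_mul, Complex.norm_real, Real.norm_of_nonneg hδ.le]
    have e2 : br σ ^ b * (δ * ‖bhat (δ * σ)‖) ≤ C * δ ^ (1 / 2 - b) * (δ ^ (1 / 2 : ℝ) * br (δ * σ) ^ (-2 : ℝ)) := by
      calc br σ ^ b * (δ * ‖bhat (δ * σ)‖)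
          ≤ (δ ^ (-b) * br (δ * σ) ^ b) * (δ * (C * br (δ * σ) ^ (-3 : ℝ))) := by
            gcongr
            · exact br_rpow_le_dilate hδ hδ1 hb σ
            · exact hb3 _
        _ = C * (δ ^ (-b) * δ) * br (δ * σ) ^ (b + (-3)) := by rw [Real.rpow_add q2]; ring
        _ ≤ C * (δ ^ (-b) * δ) * br (δ * σ) ^ (-2 : ℝ) := by
            gcongr
            · exact one_le_br _
            · linarith
        _ = C * (δ ^ (1 / 2 - b) * δ ^ (1 / 2 : ℝ)) * br (δ * σ) ^ (-2 : ℝ) := by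
            rw [← Real.rpow_add hδ, ← Real.rpow_add_one hδ.ne']
            ring_nf
        _ = _ := by ring
    rw [e1, ← mul_assoc, ← ENNReal.ofReal_mul (by positivity), mul_pow]
    have e3 : ENNReal.ofReal (br σ ^ b * (δ * ‖bhat (δ * σ)‖)) ^ 2 ≤
        (ENNReal.ofReal (C ^ 2) * ENNReal.ofReal (δ ^ (1 - 2 * b))) * ENNReal.ofReal (δ ^ (1 / 2 : ℝ) * br (δ * σ) ^ (-2 : ℝ)) ^ 2 := by
      refine (pow_le_pow_left₀ zero_le (ENNReal.ofReal_le_ofReal e2) 2).trans (le_of_eq ?_)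
      rw [ENNReal.ofReal_mul (by positivity), mul_pow, ENNReal.ofReal_mul hC, mul_pow, ENNReal.ofReal_pow hC,
        ← ENNReal.ofReal_pow (by positivity : 0 ≤ δ ^ (1 / 2 - b)), ← Real.rpow_mul_natCast hδ.le]
      congr 4
      push_cast
      ring
    refine (mul_le_mul_left e3 _).trans (le_of_eq (by ring))
  have hne : ∀ ξ, ENNReal.ofReal (br ξ ^ s) ^ 2 ≠ ∞ := fun ξ => ENNReal.pow_ne_top ENNReal.ofReal_ne_top
  have hm : Measurable fun σ => ENNReal.ofReal (δ ^ (1 / 2 : ℝ) * br (δ * σ) ^ (-2 : ℝ)) ^ 2 :=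
    ((((continuous_br_rpow (-2)).comp (continuous_const.mul continuous_id)).measurable.const_mul _).ennreal_ofReal).pow_const 2
  calc _ ≤ ∫⁻ ξ, ENNReal.ofReal (br ξ ^ s) ^ 2 * ((ENNReal.ofReal (C ^ 2) * ENNReal.ofReal (δ ^ (1 - 2 * b)) * ‖h ξ‖ₑ ^ 2) * jap (2 * 2)) := by
        refine lintegral_mono fun ξ => ?_
        dsimp only
        gcongr
        refine (lintegral_mono (key ξ)).trans (le_of_eq ?_)
        rw [lintegral_const_mul _ hm, lintegral_dilate_sq hδ]
    _ = ∫⁻ ξ, (ENNReal.ofReal (C ^ 2) * jap (2 * 2) * ENNReal.ofReal (δ ^ (1 - 2 * b))) * (ENNReal.ofReal (br ξ ^ s) * ‖h ξ‖ₑ) ^ 2 := by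
        refine lintegral_congr fun ξ => ?_
        ring
    _ = _ := by
        rw [lintegral_const_mul' _ _ (ENNReal.mul_ne_top (ENNReal.mul_ne_top ENNReal.ofReal_ne_top (jap_lt_top (by norm_num)).ne) ENNReal.ofReal_ne_top)]

theorem exists_bourSq_duhOp_le (hb : 1 / 2 < b) (hbb : b ≤ b') (hb' : b' ≤ 1) :
    ∃ C : ℝ≥0∞, C < ∞ ∧ ∀ (α β s δ : ℝ), 0 < δ → δ ≤ 1 → ∀ n : ℝ × ℝ → ℂ, Measurable n →
      bourSq α β s b (duhOp α β δ n) ≤ C * ENNReal.ofReal (δ ^ (2 * (b' - b))) * bourSq α β s (b' - 1) n := by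
  obtain ⟨C, hC, h⟩ := exists_lintegral_duhKer_le hb hbb hb'
  refine ⟨C, hC, fun α β s δ hδ hδ1 n hn => ?_⟩
  rw [bourSq_eq_lintegral (measurable_duhOp hn), bourSq_eq_lintegral hn,
    ← lintegral_const_mul' _ _ (ENNReal.mul_ne_top hC.ne ENNReal.ofReal_ne_top)]
  refine lintegral_mono fun ξ => ?_
  dsimp only
  rw [mul_left_comm]
  gcongr
  set q := symbol α β ξ with hq
  have hN : Measurable fun σ' => ‖n (ξ, σ' + q)‖ₑ :=
    (hn.comp (measurable_const.prodMk (measurable_id.add measurable_const))).enorm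
  refine le_trans (lintegral_mono fun σ => ?_) (h δ hδ hδ1 _ hN)
  dsimp only
  have hbr := br_pos σ
  gcongr
  have e1 : duhOp α β δ n (ξ, σ + q) = ∫ σ', (δ ^ 2 : ℝ) * duhKer (δ * σ) (δ * σ') * n (ξ, σ' + q) := by
    rw [duhOp]
    simp only [← hq]
    rw [← integral_add_right_eq_self _ q]
    simp
  rw [e1]
  calc _ ≤ ENNReal.ofReal (br σ ^ b) * ∫⁻ σ', ‖((δ ^ 2 : ℝ) : ℂ) * duhKer (δ * σ) (δ * σ') * n (ξ, σ' + q)‖ₑ := by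
        gcongr
        exact enorm_integral_le_lintegral_enorm _
    _ = _ := by
        rw [← lintegral_const_mul' _ _ ENNReal.ofReal_ne_top]
        refine lintegral_congr fun σ' => ?_
        rw [enorm_mul, ← mul_assoc, ENNReal.ofReal_mul (by positivity)]
        congr 2
        rw [← ofReal_norm, norm_mul, Complex.norm_real, Real.norm_of_nonneg (by positivity)]

end

/-! ### Duhamel integrals on the fibres of fixed spatial frequency. -/

section

variable {α β s b b' : ℝ}

/-- The integral of `⟨τ - p(ξ)⟩⁻¹ f` in the time frequency. -/
def fibC (α β : ℝ) (f : ℝ × ℝ → ℝ≥0∞) (ξ : ℝ) : ℝ≥0∞ :=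
  ∫⁻ τ, ENNReal.ofReal ((br (τ - symbol α β ξ))⁻¹) * f (ξ, τ)

theorem measurable_inv_br_sub : Measurable fun p : ℝ × ℝ => ENNReal.ofReal ((br (p.2 - symbol α β p.1))⁻¹) := by
  have h : Continuous fun p : ℝ × ℝ => br (p.2 - symbol α β p.1) := by fun_prop
  exact h.measurable.inv.ennreal_ofReal

theorem measurable_fibC {f : ℝ × ℝ → ℝ≥0∞} (hf : Measurable f) : Measurable (fibC α β f) :=
  Measurable.lintegral_prod_right' (f := fun p : ℝ × ℝ => ENNReal.ofReal ((br (p.2 - symbol α β p.1))⁻¹) * f p)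
    (measurable_inv_br_sub.mul hf)

/-- The trace bound applied to `f / ⟨τ - p(ξ)⟩`: the division lowers the weight exponent from `b` to
`b - 1`, where the nonlinearity lives. -/
theorem lintegral_fibC_sq_le {f : ℝ × ℝ → ℝ≥0∞} (hf : Measurable f) :
    ∫⁻ ξ, (ENNReal.ofReal (br ξ ^ s) * fibC α β f ξ) ^ 2 ≤
      jap (2 * b) * ∫⁻ p, (ENNReal.ofReal (wt α β s (b - 1) p) * f p) ^ 2 := by
  have h := lintegral_fiber_sq_le (α := α) (β := β) (s := s) (b := b)
    (f := fun p : ℝ × ℝ => ENNReal.ofReal ((br (p.2 - symbol α β p.1))⁻¹) * f p) (measurable_inv_br_sub.mul hf)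
  refine h.trans (le_of_eq ?_)
  congr 1
  refine lintegral_congr fun p => ?_
  have h1 := br_pos p.1
  have h2 := br_pos (p.2 - symbol α β p.1)
  rw [← mul_assoc, ← ENNReal.ofReal_mul (wt_pos _ _ _ _ _).le]
  congr 3
  rw [wt, wt, Real.rpow_sub_one h2.ne']
  ring

theorem ae_fibC_lt_top (hb : 1 / 2 < b) {f : ℝ × ℝ → ℝ≥0∞} (hf : Measurable f)
    (h : ∫⁻ p, (ENNReal.ofReal (wt α β s (b - 1) p) * f p) ^ 2 < ∞) : ∀ᵐ ξ, fibC α β f ξ < ∞ :=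
  ae_lt_top_of_sobolev (measurable_fibC hf)
    ((lintegral_fibC_sq_le hf).trans_lt (ENNReal.mul_lt_top (jap_lt_top (by linarith)) h))

/-- The `fibC` of the absolute value of a complex function. -/
abbrev fibN (α β : ℝ) (n : ℝ × ℝ → ℂ) (ξ : ℝ) : ℝ≥0∞ := fibC α β (fun p => ‖n p‖ₑ) ξ

theorem ae_fibN_lt_top (hb : 1 / 2 < b) {n : ℝ × ℝ → ℂ} (hn : Measurable n) (h : bourSq α β s (b - 1) n < ∞) :
    ∀ᵐ ξ, fibN α β n ξ < ∞ := ae_fibC_lt_top hb hn.enorm h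

theorem integrable_inv_br_mul {n : ℝ × ℝ → ℂ} (hn : Measurable n) {ξ : ℝ} (h : fibN α β n ξ < ∞) :
    Integrable fun τ => (br (τ - symbol α β ξ))⁻¹ * ‖n (ξ, τ)‖ := by
  have hm : Measurable fun τ => (br (τ - symbol α β ξ))⁻¹ * ‖n (ξ, τ)‖ :=
    (by fun_prop : Continuous fun τ => br (τ - symbol α β ξ)).measurable.inv.mul (hn.comp measurable_prodMk_left).norm
  refine ⟨hm.aestronglyMeasurable, lt_of_le_of_lt (lintegral_mono fun τ => ?_) h⟩
  have h2 := br_pos (τ - symbol α β ξ)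
  dsimp only
  rw [← ofReal_norm, ← ofReal_norm, ← ENNReal.ofReal_mul (by positivity), norm_mul, norm_norm,
    Real.norm_of_nonneg (by positivity)]

theorem norm_chi_sub_one_le (x : ℝ) : ‖chi x - 1‖ ≤ 2 * Real.pi * |x| := by
  rw [chi_eq]
  have := Real.norm_exp_I_mul_ofReal_sub_one_le (x := 2 * Real.pi * x)
  rw [Real.norm_eq_abs, abs_mul, abs_of_pos (by positivity)] at this
  convert this using 3
  push_cast
  ring_nf

/-- The kernel of the Duhamel operator on the time frequency side. -/
def evoKer (α β t : ℝ) (p : ℝ × ℝ) : ℂ :=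
  (chi (t * p.2) - chi (t * symbol α β p.1)) / (2 * Real.pi * Complex.I * ((p.2 - symbol α β p.1 : ℝ) : ℂ))

/-- The trivial bound on the numerator suffices for `|x| ≥ 1`, the Lipschitz bound for `|x| ≤ 1`. -/
theorem norm_chi_sub_chi_div_le (t r x : ℝ) :
    ‖(chi (t * x) - chi (r * x)) / (2 * Real.pi * Complex.I * (x : ℂ))‖ ≤ 2 * (1 + |t - r|) * (br x)⁻¹ := by
  have hb := br_pos x
  rw [norm_div, norm_two_pi_I_mul]
  rcases eq_or_ne x 0 with rfl | hx
  · simp only [abs_zero, mul_zero, div_zero]; positivity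
  have hx0 := abs_pos.2 hx
  have hpi := Real.pi_gt_three
  rw [div_le_iff₀ (by positivity), mul_assoc, mul_assoc, inv_mul_eq_div]
  rcases le_total 1 |x| with h | h
  · have h1 : ‖chi (t * x) - chi (r * x)‖ ≤ 2 := (norm_sub_le _ _).trans (by simp; norm_num)
    have h2 : 1 ≤ 2 * Real.pi * |x| / br x := by
      rw [le_div_iff₀ hb]; unfold br; nlinarith
    nlinarith [abs_nonneg (t - r)]
  · have h1 : ‖chi (t * x) - chi (r * x)‖ ≤ 2 * Real.pi * |x| * |t - r| := by
      have e : chi (t * x) - chi (r * x) = chi (r * x) * (chi ((t - r) * x) - 1) := by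
        rw [mul_sub, ← chi_add]; ring_nf
      rw [e, norm_mul, norm_chi, one_mul]
      refine (norm_chi_sub_one_le _).trans (le_of_eq ?_)
      rw [abs_mul]; ring
    have h2 : 2 * Real.pi * |x| / 2 ≤ 2 * Real.pi * |x| / br x := by
      apply div_le_div_of_nonneg_left (by positivity) hb
      unfold br; linarith
    nlinarith [abs_nonneg (t - r)]

theorem evoKer_eq (α β t : ℝ) (p : ℝ × ℝ) : evoKer α β t p = chi (t * symbol α β p.1) *
    ((chi (t * (p.2 - symbol α β p.1)) - chi (0 * (p.2 - symbol α β p.1))) /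
      (2 * Real.pi * Complex.I * ((p.2 - symbol α β p.1 : ℝ) : ℂ))) := by
  rw [evoKer, mul_div_assoc', mul_sub, ← chi_add]
  congr 2
  · congr 1; ring
  · simp

theorem norm_evoKer_le (α β t : ℝ) (p : ℝ × ℝ) :
    ‖evoKer α β t p‖ ≤ 2 * (1 + |t|) * (br (p.2 - symbol α β p.1))⁻¹ := by
  rw [evoKer_eq, norm_mul, norm_chi, one_mul]
  simpa using norm_chi_sub_chi_div_le t 0 (p.2 - symbol α β p.1)

theorem measurable_evoKer (α β t : ℝ) : Measurable (evoKer α β t) := by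
  unfold evoKer
  have h : Continuous (symbol α β) := by fun_prop
  have h0 := h.measurable
  have h1 : Measurable fun p : ℝ × ℝ => chi (t * p.2) - chi (t * symbol α β p.1) := by fun_prop
  have h2 : Measurable fun p : ℝ × ℝ => (2 * Real.pi * Complex.I * ((p.2 - symbol α β p.1 : ℝ) : ℂ)) := by fun_prop
  exact h1.div h2

theorem integrable_mul_evoKer {n : ℝ × ℝ → ℂ} (hn : Measurable n) {ξ : ℝ} (h : fibN α β n ξ < ∞) (t : ℝ) :
    Integrable fun τ => n (ξ, τ) * evoKer α β t (ξ, τ) := by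
  refine ((integrable_inv_br_mul hn h).const_mul (2 * (1 + |t|))).mono'
    ((hn.comp measurable_prodMk_left).mul ((measurable_evoKer α β t).comp measurable_prodMk_left)).aestronglyMeasurable
    (ae_of_all _ fun τ => ?_)
  rw [norm_mul, mul_comm]
  refine (mul_le_mul_of_nonneg_right (norm_evoKer_le α β t (ξ, τ)) (norm_nonneg _)).trans (le_of_eq ?_)
  ring

/-! ### Traces of the localized operators -/

theorem tr_freeOp {δ : ℝ} (hδ : 0 < δ) (h : ℝ → ℂ) (t ξ : ℝ) :
    tr (freeOp α β δ h) t ξ = h ξ * (chi (t * symbol α β ξ) * cutoffC (t / δ)) := by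
  rw [tr, ← integral_chi_bhat hδ, ← integral_const_mul]
  refine integral_congr_ae (ae_of_all _ fun τ => ?_)
  simp only [freeOp]
  ring

theorem integrable_bhat_dilate {δ : ℝ} (hδ : 0 < δ) (a : ℝ) : Integrable fun τ => δ * bhat (δ * (τ - a)) := by
  have h1 := (bhat.integrable (μ := volume)).comp_mul_left' hδ.ne'
  exact (h1.comp_sub_right a).const_mul _

theorem integral_duhKer {δ : ℝ} (hδ : 0 < δ) {m : ℝ → ℂ} (hm : Measurable m) {K : ℝ} (hK : ∀ τ, ‖m τ‖ ≤ K)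
    (q τ' : ℝ) :
    ∫ τ, m τ * ((δ ^ 2 : ℝ) * duhKer (δ * (τ - q)) (δ * (τ' - q))) =
      ((∫ τ, m τ * (δ * bhat (δ * (τ - τ')))) - ∫ τ, m τ * (δ * bhat (δ * (τ - q)))) /
        (2 * Real.pi * Complex.I * ((τ' - q : ℝ) : ℂ)) := by
  have hi : ∀ a, Integrable fun τ => m τ * (δ * bhat (δ * (τ - a))) := fun a =>
    (integrable_bhat_dilate hδ a).bdd_mul hm.aestronglyMeasurable (ae_of_all _ hK)
  rw [← integral_sub (hi τ') (hi q), div_eq_mul_inv, ← integral_mul_const]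
  refine integral_congr_ae (ae_of_all _ fun τ => ?_)
  have hδ' : (δ : ℂ) ≠ 0 := by exact_mod_cast hδ.ne'
  simp only [duhKer]
  rw [show δ * (τ - q) - δ * (τ' - q) = δ * (τ - τ') by ring]
  push_cast
  rw [show (2 * Real.pi * Complex.I * (δ * ((τ' : ℂ) - q)) : ℂ) = δ * (2 * Real.pi * Complex.I * ((τ' : ℂ) - q)) by ring,
    div_eq_mul_inv, mul_inv]
  field_simp

/-- In the output variable the kernel integrates to at most a constant times `⟨τ' - p(ξ)⟩⁻¹`, so
`fibN` is precisely the quantity that has to be finite. -/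
theorem integrable_duhKer_mul {δ : ℝ} (hδ : 0 < δ) (hδ1 : δ ≤ 1) {n : ℝ × ℝ → ℂ} (hn : Measurable n) {ξ : ℝ}
    (h : fibN α β n ξ < ∞) :
    Integrable (fun y : ℝ × ℝ => (δ ^ 2 : ℝ) *
      duhKer (δ * (y.1 - symbol α β ξ)) (δ * (y.2 - symbol α β ξ)) * n (ξ, y.2)) (volume.prod volume) := by
  set q := symbol α β ξ with hq
  have hm0 := (measurable_duhOp_kernel (α := α) (β := β) (δ := δ) hn).comp
    ((measurable_const.prodMk measurable_fst).prodMk measurable_snd : Measurable fun y : ℝ × ℝ => ((ξ, y.1), y.2))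
  have hm : Measurable fun y : ℝ × ℝ => (δ ^ 2 : ℝ) * duhKer (δ * (y.1 - q)) (δ * (y.2 - q)) * n (ξ, y.2) := by
    simpa only [Function.comp_def] using hm0
  refine ⟨hm.aestronglyMeasurable, ?_⟩
  obtain ⟨C, hC, hk⟩ := exists_duhKer_le
  set g : ℝ → ℝ≥0∞ := fun x => ENNReal.ofReal (δ * br (δ * x) ^ (-3 : ℝ)) with hg
  have hgm : Measurable g :=
    ((((continuous_br_rpow (-3)).comp (continuous_const.mul continuous_id)).measurable).const_mul _).ennreal_ofReal
  have hbd : ∀ y : ℝ × ℝ, ‖(δ ^ 2 : ℝ) * duhKer (δ * (y.1 - q)) (δ * (y.2 - q)) * n (ξ, y.2)‖ₑ ≤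
      (g (y.1 - y.2) + g (y.1 - q)) * (ENNReal.ofReal C * (ENNReal.ofReal ((br (y.2 - q))⁻¹) * ‖n (ξ, y.2)‖ₑ)) := by
    intro y
    have h1 := hk (δ * (y.1 - q)) (δ * (y.2 - q))
    rw [show δ * (y.1 - q) - δ * (y.2 - q) = δ * (y.1 - y.2) by ring] at h1
    have p1 := br_pos (δ * (y.1 - y.2))
    have p2 := br_pos (δ * (y.1 - q))
    have p3 := br_pos (δ * (y.2 - q))
    have p4 := br_pos (y.2 - q)
    have h2 : (br (δ * (y.2 - q)))⁻¹ ≤ δ⁻¹ * (br (y.2 - q))⁻¹ := by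
      rw [← mul_inv]
      exact inv_anti₀ (by positivity) (mul_br_le hδ hδ1 _)
    rw [enorm_mul, ← mul_assoc, ← mul_assoc, hg]
    dsimp only
    rw [← ENNReal.ofReal_add (by positivity) (by positivity), ← ENNReal.ofReal_mul (by positivity),
      ← ENNReal.ofReal_mul (by positivity)]
    gcongr
    rw [← ofReal_norm, norm_mul, Complex.norm_real, Real.norm_of_nonneg (by positivity)]
    refine ENNReal.ofReal_le_ofReal ?_
    set P := br (δ * (y.1 - y.2)) ^ (-3 : ℝ)
    set P' := br (δ * (y.1 - q)) ^ (-3 : ℝ)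
    calc δ ^ 2 * ‖duhKer (δ * (y.1 - q)) (δ * (y.2 - q))‖
        ≤ δ ^ 2 * (C * ((P + P') * (δ⁻¹ * (br (y.2 - q))⁻¹))) := by
          gcongr
          exact h1.trans (by gcongr)
      _ = _ := by field_simp
  have hNm : Measurable fun τ => ENNReal.ofReal C * (ENNReal.ofReal ((br (τ - q))⁻¹) * ‖n (ξ, τ)‖ₑ) :=
    (((by fun_prop : Continuous fun τ => br (τ - q)).measurable.inv.ennreal_ofReal).mul
      (hn.comp measurable_prodMk_left).enorm).const_mul _
  refine (lintegral_mono hbd).trans_lt ?_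
  have hm2 : Measurable fun y : ℝ × ℝ => (g (y.1 - y.2) + g (y.1 - q)) *
      (ENNReal.ofReal C * (ENNReal.ofReal ((br (y.2 - q))⁻¹) * ‖n (ξ, y.2)‖ₑ)) :=
    ((hgm.comp (measurable_fst.sub measurable_snd)).add (hgm.comp (measurable_fst.sub measurable_const))).mul
      (hNm.comp measurable_snd)
  rw [lintegral_prod_symm' _ hm2]
  have e : ∀ τ', ∫⁻ τ, (g (τ - τ') + g (τ - q)) *
      (ENNReal.ofReal C * (ENNReal.ofReal ((br (τ' - q))⁻¹) * ‖n (ξ, τ')‖ₑ)) =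
      (jap 3 + jap 3) * (ENNReal.ofReal C * (ENNReal.ofReal ((br (τ' - q))⁻¹) * ‖n (ξ, τ')‖ₑ)) := by
    intro τ'
    have hg1 : ∀ a, Measurable fun τ => g (τ - a) := fun a => hgm.comp (measurable_id.sub measurable_const)
    have hg2 : ∀ a, ∫⁻ τ, g (τ - a) = jap 3 := fun a => by
      rw [lintegral_sub_right_eq_self g a]
      exact lintegral_dilate hδ
    have hg3 : Measurable fun τ => g (τ - τ') + g (τ - q) := (hg1 τ').add (hg1 q)
    rw [lintegral_mul_const _ hg3, lintegral_add_left (hg1 τ'), hg2, hg2]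
  simp only [e]
  rw [lintegral_const_mul _ hNm, lintegral_const_mul' _ _ ENNReal.ofReal_ne_top]
  have hj : jap 3 < ∞ := jap_lt_top (by norm_num)
  exact ENNReal.mul_lt_top (ENNReal.add_lt_top.2 ⟨hj, hj⟩) (ENNReal.mul_lt_top ENNReal.ofReal_lt_top h)

theorem integral_mul_duhOp {δ : ℝ} (hδ : 0 < δ) (hδ1 : δ ≤ 1) {n : ℝ × ℝ → ℂ} (hn : Measurable n) {ξ : ℝ}
    (h : fibN α β n ξ < ∞) {m : ℝ → ℂ} (hm : Measurable m) {K : ℝ} (hK : ∀ τ, ‖m τ‖ ≤ K) :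
    ∫ τ, m τ * duhOp α β δ n (ξ, τ) =
      ∫ τ', ((∫ τ, m τ * (δ * bhat (δ * (τ - τ')))) - ∫ τ, m τ * (δ * bhat (δ * (τ - symbol α β ξ)))) /
        (2 * Real.pi * Complex.I * ((τ' - symbol α β ξ : ℝ) : ℂ)) * n (ξ, τ') := by
  have hi := integrable_duhKer_mul hδ hδ1 hn h
  have hi2 : Integrable (fun y : ℝ × ℝ => m y.1 * ((δ ^ 2 : ℝ) *
      duhKer (δ * (y.1 - symbol α β ξ)) (δ * (y.2 - symbol α β ξ)) * n (ξ, y.2))) (volume.prod volume) :=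
    hi.bdd_mul (hm.comp measurable_fst).aestronglyMeasurable (ae_of_all _ fun y => hK y.1)
  simp only [duhOp]
  simp only [← integral_const_mul]
  rw [integral_integral_swap (f := fun τ τ' => m τ * ((δ ^ 2 : ℝ) *
      duhKer (δ * (τ - symbol α β ξ)) (δ * (τ' - symbol α β ξ)) * n (ξ, τ'))) hi2]
  refine integral_congr_ae (ae_of_all _ fun τ' => ?_)
  dsimp only
  rw [← integral_duhKer hδ hm hK, ← integral_mul_const]
  refine integral_congr_ae (ae_of_all _ fun τ => ?_)
  dsimp only
  ring

/-- The cut-off factors out of the trace. Hence for `|t| ≤ δ` the operator reproduces the Duhamel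
integral of `n` exactly. -/
theorem tr_duhOp {δ : ℝ} (hδ : 0 < δ) (hδ1 : δ ≤ 1) {n : ℝ × ℝ → ℂ} (hn : Measurable n) {ξ : ℝ}
    (h : fibN α β n ξ < ∞) (t : ℝ) :
    tr (duhOp α β δ n) t ξ = cutoffC (t / δ) * ∫ τ, n (ξ, τ) * evoKer α β t (ξ, τ) := by
  rw [tr, integral_mul_duhOp hδ hδ1 hn h (m := fun τ => chi (t * τ)) (by fun_prop) (K := 1) (fun τ => by simp),
    ← integral_const_mul]
  refine integral_congr_ae (ae_of_all _ fun τ => ?_)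
  dsimp only
  rw [integral_chi_bhat hδ, integral_chi_bhat hδ, evoKer]
  ring

theorem ae_integrable_duhOp_kernel {δ : ℝ} (hδ : 0 < δ) (hδ1 : δ ≤ 1) {n : ℝ × ℝ → ℂ} (hn : Measurable n) {ξ : ℝ}
    (h : fibN α β n ξ < ∞) : ∀ᵐ τ, Integrable fun τ' => (δ ^ 2 : ℝ) *
      duhKer (δ * (τ - symbol α β ξ)) (δ * (τ' - symbol α β ξ)) * n (ξ, τ') :=
  (integrable_duhKer_mul hδ hδ1 hn h).prod_right_ae

theorem duhOp_sub_ae {δ : ℝ} (hδ : 0 < δ) (hδ1 : δ ≤ 1) (hb : 1 / 2 < b) {n n' : ℝ × ℝ → ℂ} (hn : Measurable n)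
    (hn' : Measurable n') (h : bourSq α β s (b - 1) n < ∞) (h' : bourSq α β s (b - 1) n' < ∞) :
    (fun p => duhOp α β δ n p - duhOp α β δ n' p) =ᵐ[volume] duhOp α β δ (fun p => n p - n' p) := by
  have hm : MeasurableSet {p : ℝ × ℝ | duhOp α β δ n p - duhOp α β δ n' p = duhOp α β δ (fun p => n p - n' p) p} :=
    measurableSet_eq_fun ((measurable_duhOp hn).sub (measurable_duhOp hn')) (measurable_duhOp (hn.sub hn'))
  rw [Filter.EventuallyEq, Measure.volume_eq_prod, Measure.ae_prod_iff_ae_ae hm]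
  filter_upwards [ae_fibN_lt_top hb hn h, ae_fibN_lt_top hb hn' h'] with ξ h1 h2
  filter_upwards [ae_integrable_duhOp_kernel hδ hδ1 hn h1, ae_integrable_duhOp_kernel hδ hδ1 hn' h2] with τ i1 i2
  simp only [duhOp]
  rw [← integral_sub i1 i2]
  refine integral_congr_ae (ae_of_all _ fun τ' => ?_)
  dsimp only
  ring

end

section

/-! ### The nonlinearity in Bourgain spaces -/

/-- The bilinear estimate with constant `C`. -/
def BilinearBound (α β s b b' : ℝ) (C : ℝ≥0) : Prop :=
  ∀ f g : ℝ × ℝ → ℝ≥0∞, Measurable f → Measurable g →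
    ∫⁻ p, (ENNReal.ofReal (wt α β s (b' - 1) p * |p.1|) * ∫⁻ q, f q * g (p - q)) ^ 2 ≤
      C * ((∫⁻ p, (ENNReal.ofReal (wt α β s b p) * f p) ^ 2) *
        ∫⁻ p, (ENNReal.ofReal (wt α β s b p) * g p) ^ 2)

variable {α β s b b' : ℝ} {C : ℝ≥0} {z w v : ℝ × ℝ → ℂ}

theorem measurable_conv (hz : Measurable z) (hw : Measurable w) : Measurable (conv z w) := by
  have h : Measurable fun y : (ℝ × ℝ) × (ℝ × ℝ) => z y.2 * w (y.1 - y.2) :=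
    (hz.comp measurable_snd).mul (hw.comp (measurable_fst.sub measurable_snd))
  exact h.stronglyMeasurable.integral_prod_right'.measurable

theorem measurable_bil (hz : Measurable z) (hw : Measurable w) : Measurable (bil z w) := by
  unfold bil
  have h := measurable_conv hz hw
  fun_prop

/-- The convolution of the absolute values. -/
def absConv (z w : ℝ × ℝ → ℂ) (p : ℝ × ℝ) : ℝ≥0∞ := ∫⁻ q, ‖z q‖ₑ * ‖w (p - q)‖ₑ

theorem measurable_absConv (hz : Measurable z) (hw : Measurable w) : Measurable (absConv z w) := by
  have h : Measurable fun y : (ℝ × ℝ) × (ℝ × ℝ) => ‖z y.2‖ₑ * ‖w (y.1 - y.2)‖ₑ :=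
    (hz.comp measurable_snd).enorm.mul (hw.comp (measurable_fst.sub measurable_snd)).enorm
  exact h.lintegral_prod_right'

theorem enorm_conv_le (z w : ℝ × ℝ → ℂ) (p : ℝ × ℝ) : ‖conv z w p‖ₑ ≤ absConv z w p := by
  refine (enorm_integral_le_lintegral_enorm _).trans (le_of_eq ?_)
  simp only [enorm_mul, absConv]

theorem BilinearBound.lintegral_le (hB : BilinearBound α β s b b' C) (hz : Measurable z) (hw : Measurable w) :
    ∫⁻ p, (ENNReal.ofReal (wt α β s (b' - 1) p) * (ENNReal.ofReal |p.1| * absConv z w p)) ^ 2 ≤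
      C * (bourSq α β s b z * bourSq α β s b w) := by
  refine le_trans (le_of_eq (lintegral_congr fun p => ?_)) (hB _ _ hz.enorm hw.enorm)
  rw [ENNReal.ofReal_mul (wt_pos _ _ _ _ _).le, mul_assoc]
  rfl

theorem BilinearBound.bourSq_bil_le (hB : BilinearBound α β s b b' C) (hz : Measurable z) (hw : Measurable w) :
    bourSq α β s (b' - 1) (bil z w) ≤
      ENNReal.ofReal (Real.pi ^ 2) * C * (bourSq α β s b z * bourSq α β s b w) := by
  rw [mul_assoc]
  refine le_trans ?_ (mul_le_mul_right (hB.lintegral_le hz hw) _)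
  rw [← lintegral_const_mul' _ _ ENNReal.ofReal_ne_top]
  refine lintegral_mono fun p => ?_
  have hpi := Real.pi_pos
  rw [ENNReal.ofReal_pow hpi.le, ← mul_pow, mul_left_comm]
  gcongr
  rw [bil, enorm_mul, ← mul_assoc, ← ENNReal.ofReal_mul hpi.le]
  gcongr
  · rw [← ofReal_norm]
    refine ENNReal.ofReal_le_ofReal (le_of_eq ?_)
    simp [abs_of_pos hpi]
  · exact enorm_conv_le z w p

theorem ae_fst_ne_zero : ∀ᵐ p : ℝ × ℝ, p.1 ≠ 0 := by
  rw [Measure.volume_eq_prod]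
  have : ∀ᵐ ξ : ℝ, ξ ≠ 0 := by simp [ae_iff]
  exact Measure.quasiMeasurePreserving_fst.ae this

/-- The bilinear bound controls the convolution of the moduli times `|p.1|`, and this factor
vanishes only on a null set. -/
theorem BilinearBound.ae_absConv_lt_top (hB : BilinearBound α β s b b' C) (hz : Measurable z) (hw : Measurable w)
    (h1 : bourSq α β s b z < ∞) (h2 : bourSq α β s b w < ∞) : ∀ᵐ p, absConv z w p < ∞ := by
  have hfin := (hB.lintegral_le hz hw).trans_lt (ENNReal.mul_lt_top ENNReal.coe_lt_top (ENNReal.mul_lt_top h1 h2))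
  have hm0 : Measurable fun p : ℝ × ℝ => ENNReal.ofReal |p.1| * absConv z w p :=
    Measurable.mul (by fun_prop) (measurable_absConv hz hw)
  have hm : Measurable fun p : ℝ × ℝ => (ENNReal.ofReal (wt α β s (b' - 1) p) * (ENNReal.ofReal |p.1| * absConv z w p)) ^ 2 :=
    ((measurable_wt (α := α) (β := β) (s := s) (b := b' - 1)).ennreal_ofReal.mul hm0).pow_const 2
  filter_upwards [ae_lt_top hm hfin.ne, ae_fst_ne_zero] with p hp hp0
  by_contra hcon
  rw [not_lt, top_le_iff] at hcon
  have h3 := abs_pos.2 hp0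
  have h4 := wt_pos α β s (b' - 1) p
  rw [hcon, ENNReal.mul_top (by simp [hp0]), ENNReal.mul_top (by simp [h4])] at hp
  simp at hp

theorem integrable_conv (hz : Measurable z) (hw : Measurable w) {p : ℝ × ℝ} (h : absConv z w p < ∞) :
    Integrable fun q => z q * w (p - q) := by
  refine ⟨(hz.mul (hw.comp (measurable_const.sub measurable_id))).aestronglyMeasurable, ?_⟩
  refine lt_of_le_of_lt (le_of_eq (lintegral_congr fun q => ?_)) h
  rw [enorm_mul]

theorem BilinearBound.ae_fibC_absConv_lt_top (hB : BilinearBound α β s b b' C) (hb' : 1 / 2 < b') (hz : Measurable z)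
    (hw : Measurable w) (h1 : bourSq α β s b z < ∞) (h2 : bourSq α β s b w < ∞) :
    ∀ᵐ ξ, fibC α β (absConv z w) ξ < ∞ := by
  have hfin := (hB.lintegral_le hz hw).trans_lt (ENNReal.mul_lt_top ENNReal.coe_lt_top (ENNReal.mul_lt_top h1 h2))
  have hm0 : Measurable fun p : ℝ × ℝ => ENNReal.ofReal |p.1| * absConv z w p :=
    Measurable.mul (by fun_prop) (measurable_absConv hz hw)
  have hne : ∀ᵐ ξ : ℝ, ξ ≠ 0 := by simp [ae_iff]
  filter_upwards [ae_fibC_lt_top hb' hm0 hfin, hne] with ξ hξ h0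
  have e : fibC α β (fun p : ℝ × ℝ => ENNReal.ofReal |p.1| * absConv z w p) ξ =
      ENNReal.ofReal |ξ| * fibC α β (absConv z w) ξ := by
    rw [fibC, fibC, ← lintegral_const_mul' _ _ ENNReal.ofReal_ne_top]
    refine lintegral_congr fun τ => ?_
    ring
  rw [e] at hξ
  by_contra hcon
  rw [not_lt, top_le_iff] at hcon
  rw [hcon, ENNReal.mul_top (by simp [h0])] at hξ
  simp at hξ

/-- The identity `z² - w² = (z + w)(z - w)` for convolutions, at the points where all four converge
absolutely. -/
theorem bil_sub_add_ae (hB : BilinearBound α β s b b' C) (hz : Measurable z) (hw : Measurable w)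
    (h1 : bourSq α β s b z < ∞) (h2 : bourSq α β s b w < ∞) :
    (fun p => bil z z p - bil w w p) =ᵐ[volume] bil (fun p => z p + w p) (fun p => z p - w p) := by
  filter_upwards [hB.ae_absConv_lt_top hz hz h1 h1, hB.ae_absConv_lt_top hz hw h1 h2,
    hB.ae_absConv_lt_top hw hz h2 h1, hB.ae_absConv_lt_top hw hw h2 h2] with p a1 a2 a3 a4
  have i1 := integrable_conv hz hz a1
  have i2 := integrable_conv hz hw a2
  have i3 := integrable_conv hw hz a3
  have i4 := integrable_conv hw hw a4
  have hsymm : conv z w p = conv w z p := by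
    rw [conv, conv, ← integral_sub_left_eq_self _ _ p]
    refine integral_congr_ae (ae_of_all _ fun q => ?_)
    simp [mul_comm]
  have e : conv (fun p => z p + w p) (fun p => z p - w p) p = (conv z z p - conv z w p) + (conv w z p - conv w w p) := by
    simp only [conv]
    have j1 : Integrable fun q => z q * z (p - q) - z q * w (p - q) := i1.sub i2
    have j2 : Integrable fun q => w q * z (p - q) - w q * w (p - q) := i3.sub i4
    rw [← integral_sub i1 i2, ← integral_sub i3 i4, ← integral_add j1 j2]
    refine integral_congr_ae (ae_of_all _ fun q => ?_)
    ring
  simp only [bil]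
  rw [e, hsymm]
  ring

/-! ### Locality in time -/

theorem measurable_tr_uncurry (hz : Measurable z) : Measurable fun p : ℝ × ℝ => tr z p.1 p.2 := by
  have h1 : Measurable fun y : (ℝ × ℝ) × ℝ => chi (y.1.1 * y.2) := by fun_prop
  have h : Measurable fun y : (ℝ × ℝ) × ℝ => chi (y.1.1 * y.2) * z (y.1.2, y.2) :=
    h1.mul (hz.comp ((measurable_snd.comp measurable_fst).prodMk measurable_snd))
  exact h.stronglyMeasurable.integral_prod_right'.measurable

theorem intervalIntegral_chi {x : ℝ} (hx : x ≠ 0) (c d : ℝ) :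
    ∫ r in c..d, chi (r * x) = (chi (d * x) - chi (c * x)) / (2 * Real.pi * Complex.I * (x : ℂ)) := by
  have hc : (2 * Real.pi * Complex.I * (x : ℂ)) ≠ 0 := by
    have := Real.pi_ne_zero
    simp [hx, this]
  have h := integral_exp_mul_complex (a := c) (b := d) hc
  have e : ∀ r : ℝ, chi (r * x) = Complex.exp (2 * Real.pi * Complex.I * (x : ℂ) * r) := fun r => by
    rw [chi_eq]; congr 1; push_cast; ring
  simp only [e]
  exact h

theorem evoKer_eq_integral {p : ℝ × ℝ} (h : p.2 ≠ symbol α β p.1) (t : ℝ) :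
    evoKer α β t p = ∫ r in 0..t, chi ((t - r) * symbol α β p.1) * chi (r * p.2) := by
  have hx : p.2 - symbol α β p.1 ≠ 0 := sub_ne_zero.2 h
  rw [evoKer_eq, ← intervalIntegral_chi hx, ← intervalIntegral.integral_const_mul]
  refine intervalIntegral.integral_congr fun r _ => ?_
  rw [← chi_add, ← chi_add]
  congr 1
  ring

/-- The kernel is an integral over `r ∈ [0, t]`, so after Fubini only the traces of `v` at such
times occur. The shift by `τ₁` merely multiplies them by a character. -/
theorem integral_mul_evoKer_eq_zero {a : ℝ} (hv : Measurable v) {η : ℝ} (hL : fibL1 v η < ∞)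
    (h0 : ∀ᵐ r, r ∈ Icc 0 a → tr v r η = 0) (ξ τ₁ : ℝ) {t : ℝ} (ht : t ∈ Icc 0 a) :
    ∫ τ, v (η, τ - τ₁) * evoKer α β t (ξ, τ) = 0 := by
  have hi : Integrable fun τ => v (η, τ - τ₁) := (integrable_fiber hv hL).comp_sub_right τ₁
  set q := symbol α β ξ with hq
  have e1 : ∫ τ, v (η, τ - τ₁) * evoKer α β t (ξ, τ) =
      ∫ τ, ∫ r in Ioc 0 t, v (η, τ - τ₁) * (chi ((t - r) * q) * chi (r * τ)) := by
    refine integral_congr_ae ?_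
    have hne : ∀ᵐ τ : ℝ, τ ≠ q := by simp [ae_iff]
    filter_upwards [hne] with τ hτ
    rw [evoKer_eq_integral (p := (ξ, τ)) hτ, intervalIntegral.integral_of_le ht.1, integral_const_mul]
  have hm : Measurable fun y : ℝ × ℝ => chi ((t - y.2) * q) * chi (y.2 * y.1) := by fun_prop
  have hint : Integrable (fun y : ℝ × ℝ => v (η, y.1 - τ₁) * (chi ((t - y.2) * q) * chi (y.2 * y.1)))
      (volume.prod (volume.restrict (Ioc 0 t))) := by
    have h1 := hi.mul_prod (integrable_const (1 : ℂ) (μ := volume.restrict (Ioc 0 t)))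
    have h2 := h1.bdd_mul (c := 1) hm.aestronglyMeasurable (ae_of_all _ fun y => by simp)
    refine h2.congr (ae_of_all _ fun y => ?_)
    dsimp only
    ring
  rw [e1, integral_integral_swap (f := fun τ r => v (η, τ - τ₁) * (chi ((t - r) * q) * chi (r * τ))) hint]
  refine integral_eq_zero_of_ae ?_
  have h0' := ae_restrict_of_ae (s := Ioc 0 t) h0
  filter_upwards [h0', ae_restrict_mem measurableSet_Ioc] with r hr hrt
  have h3 : tr v r η = 0 := hr ⟨hrt.1.le, hrt.2.trans ht.2⟩
  have h4 : ∫ τ, v (η, τ - τ₁) * (chi ((t - r) * q) * chi (r * τ)) =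
      (chi ((t - r) * q) * chi (r * τ₁)) * tr v r η := by
    rw [tr, ← integral_const_mul,
      ← integral_sub_right_eq_self (fun τ => chi ((t - r) * q) * chi (r * τ₁) * (chi (r * τ) * v (η, τ))) τ₁]
    refine integral_congr_ae (ae_of_all _ fun τ => ?_)
    dsimp only
    rw [show r * τ = r * τ₁ + r * (τ - τ₁) by ring, chi_add]
    ring
  rw [h4, h3, mul_zero]
  rfl

/-- The Duhamel integral of a product sees `v` only at the times integrated over. On the Fourier
side the convolution is exchanged with the time integral, and for almost every frequency `q` of `w`
the inner integral is that of `integral_mul_evoKer_eq_zero`. -/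
theorem BilinearBound.integral_bil_mul_evoKer_eq_zero (hB : BilinearBound α β s b b' C) (hb : 1 / 2 < b)
    (hb' : 1 / 2 < b') (hw : Measurable w) (hv : Measurable v) (h1 : bourSq α β s b w < ∞)
    (h2 : bourSq α β s b v < ∞) {a : ℝ} (h0 : ∀ r ∈ Icc 0 a, ∀ᵐ ξ, tr v r ξ = 0) {t : ℝ} (ht : t ∈ Icc 0 a) :
    ∀ᵐ ξ, ∫ τ, bil w v (ξ, τ) * evoKer α β t (ξ, τ) = 0 := by
  have hms : MeasurableSet {p : ℝ × ℝ | p.1 ∈ Icc 0 a → tr v p.1 p.2 = 0} := by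
    have e : {p : ℝ × ℝ | p.1 ∈ Icc 0 a → tr v p.1 p.2 = 0} =
        {p : ℝ × ℝ | p.1 ∈ Icc 0 a}ᶜ ∪ {p : ℝ × ℝ | tr v p.1 p.2 = 0} := by
      ext p; simp [imp_iff_not_or]
    rw [e]
    exact (measurable_fst measurableSet_Icc).compl.union
      (measurableSet_eq_fun (measurable_tr_uncurry hv) measurable_const)
  have h3 : ∀ᵐ r : ℝ, ∀ᵐ ξ : ℝ, r ∈ Icc 0 a → tr v r ξ = 0 := by
    refine ae_of_all _ fun r => ?_
    by_cases hr : r ∈ Icc 0 a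
    · filter_upwards [h0 r hr] with ξ hξ _ using hξ
    · exact ae_of_all _ fun ξ h => absurd h hr
  have hE0 : ∀ᵐ ξ : ℝ, ∀ᵐ r : ℝ, r ∈ Icc 0 a → tr v r ξ = 0 :=
    (Measure.ae_ae_comm (p := fun r ξ => r ∈ Icc 0 a → tr v r ξ = 0) hms).1 h3
  have hE : ∀ᵐ η : ℝ, fibL1 v η < ∞ ∧ ∀ᵐ r, r ∈ Icc 0 a → tr v r η = 0 :=
    (ae_fibL1_lt_top hb hv h2).and hE0
  filter_upwards [hB.ae_fibC_absConv_lt_top hb' hw hv h1 h2] with ξ hξ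
  have hm3 : Measurable fun y : ℝ × (ℝ × ℝ) => w y.2 * v ((ξ, y.1) - y.2) :=
    (hw.comp measurable_snd).mul (hv.comp ((measurable_const.prodMk measurable_fst).sub measurable_snd))
  have hm4 : Measurable fun y : ℝ × (ℝ × ℝ) => w y.2 * v ((ξ, y.1) - y.2) * evoKer α β t (ξ, y.1) :=
    hm3.mul ((measurable_evoKer α β t).comp (measurable_const.prodMk measurable_fst))
  have hint : Integrable (fun y : ℝ × (ℝ × ℝ) => w y.2 * v ((ξ, y.1) - y.2) * evoKer α β t (ξ, y.1))
      (volume.prod volume) := by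
    refine ⟨hm4.aestronglyMeasurable, ?_⟩
    rw [HasFiniteIntegral, lintegral_prod _ hm4.enorm.aemeasurable]
    have hle : ∀ τ, ∫⁻ q, ‖w q * v ((ξ, τ) - q) * evoKer α β t (ξ, τ)‖ₑ ≤
        ENNReal.ofReal (2 * (1 + |t|)) * (ENNReal.ofReal ((br (τ - symbol α β ξ))⁻¹) * absConv w v (ξ, τ)) := by
      intro τ
      have hbr := br_pos (τ - symbol α β ξ)
      rw [← mul_assoc, ← ENNReal.ofReal_mul (by positivity), absConv,
        ← lintegral_const_mul' _ _ ENNReal.ofReal_ne_top]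
      refine lintegral_mono fun q => ?_
      rw [enorm_mul, enorm_mul, mul_comm]
      gcongr
      rw [← ofReal_norm]
      exact ENNReal.ofReal_le_ofReal (norm_evoKer_le α β t (ξ, τ))
    refine (lintegral_mono hle).trans_lt ?_
    rw [lintegral_const_mul' _ _ ENNReal.ofReal_ne_top]
    exact ENNReal.mul_lt_top ENNReal.ofReal_lt_top hξ
  have e1 : ∫ τ, bil w v (ξ, τ) * evoKer α β t (ξ, τ) =
      (Real.pi * Complex.I * (ξ : ℂ)) * ∫ τ, ∫ q, w q * v ((ξ, τ) - q) * evoKer α β t (ξ, τ) := by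
    rw [← integral_const_mul]
    refine integral_congr_ae (ae_of_all _ fun τ => ?_)
    simp only [bil, conv]
    rw [integral_mul_const]
    ring
  rw [e1, integral_integral_swap (f := fun τ q => w q * v ((ξ, τ) - q) * evoKer α β t (ξ, τ)) hint,
    integral_eq_zero_of_ae, mul_zero]
  have hE2 : ∀ᵐ q : ℝ × ℝ, fibL1 v (ξ - q.1) < ∞ ∧ ∀ᵐ r, r ∈ Icc 0 a → tr v r (ξ - q.1) = 0 := by
    have h5 := (Measure.measurePreserving_sub_left volume ξ).quasiMeasurePreserving.ae hE
    rw [Measure.volume_eq_prod]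
    exact Measure.quasiMeasurePreserving_fst.ae h5
  filter_upwards [hE2] with q hq
  have h6 := integral_mul_evoKer_eq_zero (α := α) (β := β) hv hq.1 hq.2 ξ q.2 ht
  have h7 : ∫ τ, w q * v ((ξ, τ) - q) * evoKer α β t (ξ, τ) =
      w q * ∫ τ, v (ξ - q.1, τ - q.2) * evoKer α β t (ξ, τ) := by
    rw [← integral_const_mul]
    refine integral_congr_ae (ae_of_all _ fun τ => ?_)
    simp only [mul_assoc]
    rfl
  rw [h7, h6, mul_zero]
  rfl

end

section

/-! ### The equation on the Fourier side -/

/-- The Fourier transform of `U_t + N + α U_xxx + β U_xxxxx` in normalized coordinates, in terms of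
those of `U` and `N`. -/
def eqF (α β : ℝ) (z n : ℝ × ℝ → ℂ) (p : ℝ × ℝ) : ℂ :=
  2 * Real.pi * Complex.I * ((p.2 - symbol α β p.1 : ℝ) : ℂ) * z p + n p

theorem inner_ex (ζ : Spacetime) : (inner ℝ ζ ex : ℝ) = ζ 0 := by
  simp [ex, EuclideanSpace.inner_single_right]

theorem inner_et (ζ : Spacetime) : (inner ℝ ζ et : ℝ) = ζ 1 := by
  simp [et, EuclideanSpace.inner_single_right]

/-- Each derivative is multiplication by `2πi` times a frequency. The even powers of `2π` left after
one factor `2πi` is taken out are the ones in `nα` and `nβ`, and the powers of `i` give the signs of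
the symbol. -/
theorem PairRep.equation {U N : 𝓢'(Spacetime, ℂ)} {z n : ℝ × ℝ → ℂ} (hU : PairRep U z) (hN : PairRep N n)
    (α β : ℝ) :
    PairRep (∂_{et} U + N + (α : ℂ) • ∂_{ex} (∂_{ex} (∂_{ex} U)) +
      (β : ℂ) • ∂_{ex} (∂_{ex} (∂_{ex} (∂_{ex} (∂_{ex} U))))) (eqF (nα α) (nβ β) z n) := by
  have h1 := IsFourierRep.lineDeriv hU et
  have h3 := IsFourierRep.lineDeriv (IsFourierRep.lineDeriv (IsFourierRep.lineDeriv hU ex) ex) ex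
  have h5 := IsFourierRep.lineDeriv (IsFourierRep.lineDeriv h3 ex) ex
  have h := ((h1.add hN).add (h3.smul (α : ℂ))).add (h5.smul (β : ℂ))
  unfold PairRep
  convert h using 2 with ζ
  have hI : Complex.I ^ 2 = -1 := Complex.I_sq
  have hI3 : Complex.I ^ 3 = -Complex.I := by rw [pow_succ, hI]; ring
  have hI5 : Complex.I ^ 5 = Complex.I := by rw [show 5 = 2 + 3 by norm_num, pow_add, hI, hI3]; ring
  simp only [eqF, inner_ex, inner_et, toPair, symbol, nα, nβ]
  push_cast
  ring_nf
  simp only [hI3, hI5]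
  ring

theorem IsTest.lineDeriv {T : ℝ} {φ : 𝓢(Spacetime, ℂ)} (hφ : IsTest T φ) (m : Spacetime) :
    IsTest T (∂_{m} φ) :=
  ⟨hφ.1.of_isClosed_subset (isClosed_tsupport _) (SchwartzMap.tsupport_lineDerivOp_subset m φ),
    (SchwartzMap.tsupport_lineDerivOp_subset m φ).trans hφ.2⟩

theorem invF_lineDeriv_et (φ : 𝓢(Spacetime, ℂ)) (p : ℝ × ℝ) :
    invF (∂_{et} φ) p = -(2 * Real.pi * Complex.I * (p.2 : ℂ)) * invF φ p := by
  have hm : (fun x : Spacetime => ((inner ℝ x et : ℝ))).HasTemperateGrowth := by fun_prop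
  rw [invF, SchwartzMap.fourierInv_lineDerivOp_eq, smul_apply, SchwartzMap.smulLeftCLM_apply_apply hm, inner_et,
    ofPair_one, Complex.real_smul, smul_eq_mul, invF]
  ring

/-- In time this is multiplication of the test function by a cut-off that equals one on `(0, T)`,
hence no change. -/
theorem IsTest.integral_invF_mul_bhat {T : ℝ} {φ : 𝓢(Spacetime, ℂ)} (hφ : IsTest T φ) (hT : 0 < T) (ξ τ' : ℝ) :
    ∫ τ, invF φ (ξ, τ) * (T * bhat (T * (τ - τ'))) = invF φ (ξ, τ') := by
  have hS := hφ.integrable_sliceF ξ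
  have hK := integrable_bhat_dilate hT τ'
  have hint : Integrable (fun y : ℝ × ℝ => chi (y.2 * y.1) * (T * bhat (T * (y.1 - τ')) * sliceF φ y.2 ξ))
      (volume.prod volume) := by
    have hm : Measurable fun y : ℝ × ℝ => chi (y.2 * y.1) := by fun_prop
    exact (hK.mul_prod hS).bdd_mul (c := 1) hm.aestronglyMeasurable (ae_of_all _ fun y => by simp)
  have e1 : ∫ τ, invF φ (ξ, τ) * (T * bhat (T * (τ - τ'))) =
      ∫ τ, ∫ t, chi (t * τ) * (T * bhat (T * (τ - τ')) * sliceF φ t ξ) := by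
    refine integral_congr_ae (ae_of_all _ fun τ => ?_)
    dsimp only
    rw [← hφ.integral_sliceF ξ τ, ← integral_mul_const]
    refine integral_congr_ae (ae_of_all _ fun t => ?_)
    dsimp only
    ring
  rw [e1, integral_integral_swap (f := fun τ t => chi (t * τ) * (T * bhat (T * (τ - τ')) * sliceF φ t ξ)) hint,
    ← hφ.integral_sliceF ξ τ']
  refine integral_congr_ae (ae_of_all _ fun t => ?_)
  dsimp only
  have e2 : ∫ τ, chi (t * τ) * (T * bhat (T * (τ - τ')) * sliceF φ t ξ) =
      (chi (t * τ') * cutoffC (t / T)) * sliceF φ t ξ := by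
    rw [← integral_chi_bhat hT, ← integral_mul_const]
    refine integral_congr_ae (ae_of_all _ fun τ => ?_)
    dsimp only
    ring
  rw [e2]
  by_cases ht : t ∈ Ioo 0 T
  · rw [cutoffC_eq_one, mul_one]
    rw [abs_of_pos (div_pos ht.1 hT), div_le_one hT]
    exact ht.2.le
  · rw [hφ.sliceF_eq_zero ht]
    simp

theorem integrable_invF_mul_bhat (φ : 𝓢(Spacetime, ℂ)) {T : ℝ} (hT : 0 < T) (ξ τ' : ℝ) :
    Integrable fun τ => invF φ (ξ, τ) * (T * bhat (T * (τ - τ'))) := by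
  obtain ⟨C, hC, h⟩ := exists_invF_le φ 0
  refine (integrable_bhat_dilate hT τ').bdd_mul (c := C)
    ((continuous_invF φ).comp (Continuous.prodMk_right ξ)).aestronglyMeasurable (ae_of_all _ fun τ => ?_)
  refine (h (ξ, τ)).trans ?_
  have h1 : br τ ^ (-2 : ℝ) ≤ 1 := Real.rpow_le_one_of_one_le_of_nonpos (one_le_br τ) (by norm_num)
  simp only [neg_zero, Real.rpow_zero, one_mul]
  nlinarith

variable {α β s b : ℝ}

/-- Multiplication by `2πi(τ - p(ξ))` turns the transform of `φ` into a combination of those of `φ`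
and `∂_t φ`, to which the reproducing formula applies. The result `m` vanishes at `τ = p(ξ)`, which
kills the free part; in the Duhamel part it cancels the denominator of the kernel. -/
theorem IsTest.integral_mul_free_sub_duh {T : ℝ} {φ : 𝓢(Spacetime, ℂ)} (hφ : IsTest T φ) (hT : 0 < T) (hT1 : T ≤ 1)
    {n : ℝ × ℝ → ℂ} (hn : Measurable n) (h : ℝ → ℂ) {ξ : ℝ} (hξ : fibN α β n ξ < ∞) :
    ∫ τ, invF φ (ξ, τ) * (2 * Real.pi * Complex.I * ((τ - symbol α β ξ : ℝ) : ℂ) *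
      (freeOp α β T h (ξ, τ) - duhOp α β T n (ξ, τ))) = -∫ τ, invF φ (ξ, τ) * n (ξ, τ) := by
  set q := symbol α β ξ with hq
  set m : ℝ → ℂ := fun τ => -invF (∂_{et} φ) (ξ, τ) - (2 * Real.pi * Complex.I * (q : ℂ)) * invF φ (ξ, τ) with hm
  have em : ∀ τ, m τ = 2 * Real.pi * Complex.I * ((τ - q : ℝ) : ℂ) * invF φ (ξ, τ) := fun τ => by
    simp only [hm, invF_lineDeriv_et]
    push_cast
    ring
  have hmc : Continuous m := by
    have h1 := (continuous_invF (∂_{et} φ)).comp (Continuous.prodMk_right ξ)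
    have h2 := (continuous_invF φ).comp (Continuous.prodMk_right ξ)
    exact h1.neg.sub (continuous_const.mul h2)
  obtain ⟨C1, hC1, hb1⟩ := exists_invF_le (∂_{et} φ) 0
  obtain ⟨C2, hC2, hb2⟩ := exists_invF_le φ 0
  have hK : ∀ τ, ‖m τ‖ ≤ C1 + 2 * Real.pi * |q| * C2 := fun τ => by
    have h1 : br τ ^ (-2 : ℝ) ≤ 1 := Real.rpow_le_one_of_one_le_of_nonpos (one_le_br τ) (by norm_num)
    have h3 := hb1 (ξ, τ)
    have h4 := hb2 (ξ, τ)
    simp only [neg_zero, Real.rpow_zero, one_mul] at h3 h4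
    refine (norm_sub_le _ _).trans ?_
    rw [norm_neg, norm_mul, norm_two_pi_I_mul]
    have hpi := Real.pi_pos
    gcongr
    · nlinarith
    · nlinarith
  have hrep : ∀ a, ∫ τ, m τ * (T * bhat (T * (τ - a))) = m a := fun a => by
    have i1 : Integrable fun τ => -(invF (∂_{et} φ) (ξ, τ) * (T * bhat (T * (τ - a)))) :=
      (integrable_invF_mul_bhat (∂_{et} φ) hT ξ a).neg
    have i2 := (integrable_invF_mul_bhat φ hT ξ a).const_mul (2 * Real.pi * Complex.I * (q : ℂ))
    have e : ∀ τ, m τ * (T * bhat (T * (τ - a))) = -(invF (∂_{et} φ) (ξ, τ) * (T * bhat (T * (τ - a)))) -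
        (2 * Real.pi * Complex.I * (q : ℂ)) * (invF φ (ξ, τ) * (T * bhat (T * (τ - a)))) := fun τ => by
      simp only [hm]
      ring
    simp only [e]
    rw [integral_sub i1 i2, integral_neg, integral_const_mul, hφ.integral_invF_mul_bhat hT,
      (hφ.lineDeriv et).integral_invF_mul_bhat hT]
  have hmq : m q = 0 := by rw [em]; simp
  have hf : ∫ τ, m τ * freeOp α β T h (ξ, τ) = 0 := by
    have e : ∀ τ, m τ * freeOp α β T h (ξ, τ) = h ξ * (m τ * (T * bhat (T * (τ - q)))) := fun τ => by
      simp only [freeOp]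
      ring
    simp only [e]
    rw [integral_const_mul, hrep, hmq, mul_zero]
  have hif : Integrable fun τ => m τ * freeOp α β T h (ξ, τ) := by
    refine Integrable.bdd_mul (c := C1 + 2 * Real.pi * |q| * C2) ?_ hmc.aestronglyMeasurable (ae_of_all _ hK)
    exact (integrable_bhat_dilate hT q).const_mul (h ξ)
  have hid : Integrable fun τ => m τ * duhOp α β T n (ξ, τ) := by
    refine Integrable.bdd_mul (c := C1 + 2 * Real.pi * |q| * C2) ?_ hmc.aestronglyMeasurable (ae_of_all _ hK)
    exact (integrable_duhKer_mul hT hT1 hn hξ).integral_prod_left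
  have hd : ∫ τ, m τ * duhOp α β T n (ξ, τ) = ∫ τ, invF φ (ξ, τ) * n (ξ, τ) := by
    rw [integral_mul_duhOp hT hT1 hn hξ hmc.measurable hK]
    have hne : ∀ᵐ τ : ℝ, τ ≠ q := by simp [ae_iff]
    refine integral_congr_ae ?_
    filter_upwards [hne] with τ hτ
    rw [← hq, hrep, hrep, hmq, em, sub_zero]
    have h1 : ((τ - q : ℝ) : ℂ) ≠ 0 := by exact_mod_cast sub_ne_zero.2 hτ
    have h2 := Real.pi_ne_zero
    have h3 : (Real.pi : ℂ) ≠ 0 := by exact_mod_cast h2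
    have h4 := Complex.I_ne_zero
    field_simp
  have e : ∀ τ, invF φ (ξ, τ) * (2 * Real.pi * Complex.I * ((τ - q : ℝ) : ℂ) *
      (freeOp α β T h (ξ, τ) - duhOp α β T n (ξ, τ))) = m τ * freeOp α β T h (ξ, τ) - m τ * duhOp α β T n (ξ, τ) := by
    intro τ
    rw [em]
    ring
  simp only [e]
  rw [integral_sub hif hid, hf, hd, zero_sub]

theorem IsTest.integral_invF_mul_eqF {T : ℝ} {φ : 𝓢(Spacetime, ℂ)} (hφ : IsTest T φ) (hT : 0 < T) (hT1 : T ≤ 1)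
    (hb : 1 / 2 < b) {z n : ℝ × ℝ → ℂ} {h : ℝ → ℂ} (hz : Measurable z) (hn : Measurable n) (hh : Measurable h)
    (hnb : bourSq α β s (b - 1) n < ∞)
    (e : z =ᵐ[volume] fun p => freeOp α β T h p - duhOp α β T n p)
    (hM : Integrable fun p => invF φ p * eqF α β z n p) (hN : Integrable fun p => invF φ p * n p) :
    ∫ p, invF φ p * eqF α β z n p = 0 := by
  have hms : MeasurableSet {p | z p = freeOp α β T h p - duhOp α β T n p} :=
    measurableSet_eq_fun hz ((measurable_freeOp hh).sub (measurable_duhOp hn))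
  rw [Filter.EventuallyEq, Measure.volume_eq_prod, Measure.ae_prod_iff_ae_ae hms] at e
  rw [Measure.volume_eq_prod] at hM hN ⊢
  rw [integral_prod _ hM]
  refine integral_eq_zero_of_ae ?_
  filter_upwards [e, hM.prod_right_ae, hN.prod_right_ae, ae_fibN_lt_top hb hn hnb] with ξ h1 h2 h3 h4
  have h5 := hφ.integral_mul_free_sub_duh hT hT1 hn h h4
  have h6 := integral_sub h2 h3
  have h7 : ∫ τ, invF φ (ξ, τ) * eqF α β z n (ξ, τ) - invF φ (ξ, τ) * n (ξ, τ) =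
      ∫ τ, invF φ (ξ, τ) * (2 * Real.pi * Complex.I * ((τ - symbol α β ξ : ℝ) : ℂ) *
      (freeOp α β T h (ξ, τ) - duhOp α β T n (ξ, τ))) := by
    refine integral_congr_ae ?_
    filter_upwards [h1] with τ hτ
    rw [eqF, hτ]
    ring
  rw [← h7, h6] at h5
  have h8 := sub_eq_iff_eq_add.1 h5
  rw [h8]
  simp

end

section

/-! ### Duhamel's formula for distributional solutions -/

/-- The inverse Fourier transform of the cut-off function in time. -/
def binv : 𝓢(ℝ, ℂ) := 𝓕⁻ bump

theorem integral_chi_cutoff {ε : ℝ} (hε : 0 < ε) (y τ : ℝ) :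
    ∫ t, chi (t * τ) * cutoffC ((t - y) / ε) = chi (y * τ) * (ε * binv (ε * τ)) := by
  have h1 : ∫ u, chi (ε * τ * u) * cutoffC u = binv (ε * τ) := by
    rw [← fourierInv_eq_chi, binv, SchwartzMap.fourierInv_coe]
    rfl
  have h2 := integral_sub_right_eq_self (μ := volume) (fun t => chi ((t + y) * τ) * cutoffC (t / ε)) y
  simp only [sub_add_cancel] at h2
  rw [h2]
  have h3 := Measure.integral_comp_mul_left (fun t => chi ((t + y) * τ) * cutoffC (t / ε)) ε
  have e : ∀ u : ℝ, chi ((ε * u + y) * τ) * cutoffC (ε * u / ε) = chi (y * τ) * (chi (ε * τ * u) * cutoffC u) := by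
    intro u
    rw [mul_div_cancel_left₀ _ hε.ne', show (ε * u + y) * τ = y * τ + ε * τ * u by ring, chi_add]
    ring
  simp only [e] at h3
  rw [integral_const_mul, h1, abs_of_pos (inv_pos.2 hε), Complex.real_smul] at h3
  have hε' : (ε : ℂ) ≠ 0 := by exact_mod_cast hε.ne'
  push_cast at h3
  rw [eq_inv_mul_iff_mul_eq₀ hε'] at h3
  rw [← h3]
  ring

/-- Product of `X` with a narrow bump in time around `y`. The bump lives in `[y - 2ε, y + 2ε]`
because the outer radius of `cutoff` is two. -/
theorem exists_test_invF {T ε y : ℝ} (hε : 0 < ε) (h0 : 2 * ε < y) (hT : y + 2 * ε < T) (X : 𝓢(ℝ, ℂ))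
    (hX : HasCompactSupport X) : ∃ φ : 𝓢(Spacetime, ℂ), IsTest T φ ∧
      ∀ ξ τ, invF φ (ξ, τ) = (𝓕⁻ X) ξ * (ε * (chi (y * τ) * binv (ε * τ))) := by
  have hη : ContDiff ℝ (⊤ : ℕ∞) fun t : ℝ => cutoffC ((t - y) / ε) :=
    contDiff_cutoffC.comp ((contDiff_id.sub contDiff_const).div_const _)
  have hsub : tsupport (fun t : ℝ => cutoffC ((t - y) / ε)) ⊆ Icc (y - 2 * ε) (y + 2 * ε) := by
    refine closure_minimal (fun t ht => ?_) isClosed_Icc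
    by_contra hcon
    refine ht ?_
    have h3 : cutoff ((t - y) / ε) = 0 := by
      refine cutoff.zero_of_le_dist ?_
      rw [Real.dist_eq, sub_zero, abs_div, abs_of_pos hε]
      change 2 ≤ _
      rw [le_div_iff₀ hε]
      rw [mem_Icc, not_and_or, not_le, not_le] at hcon
      rcases hcon with h | h
      · rw [abs_of_neg (by linarith)]; linarith
      · rw [abs_of_pos (by linarith)]; linarith
    simp [cutoffC, h3]
  have hc : HasCompactSupport fun t : ℝ => cutoffC ((t - y) / ε) :=
    isCompact_Icc.of_isClosed_subset (isClosed_tsupport _) hsub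
  obtain ⟨φ, hφ, hsl⟩ := exists_product_test (T := T) X hX hη hc
    (hsub.trans (Icc_subset_Ioo (by linarith) hT))
  refine ⟨φ, hφ, fun ξ τ => ?_⟩
  rw [← hφ.integral_sliceF]
  have e : ∀ t, chi (t * τ) * sliceF φ t ξ = (𝓕⁻ X) ξ * (chi (t * τ) * cutoffC ((t - y) / ε)) := by
    intro t
    rw [sliceF, hsl, FourierTransform.fourierInv_smul, smul_apply, smul_eq_mul]
    ring
  simp only [e]
  rw [integral_const_mul, integral_chi_cutoff hε]
  ring

variable {α β s b b' T : ℝ} {z n M : ℝ × ℝ → ℂ}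

theorem measurable_eqF (hz : Measurable z) (hn : Measurable n) : Measurable (eqF α β z n) := by
  have h : Continuous (symbol α β) := by fun_prop
  have h0 := h.measurable
  unfold eqF
  fun_prop

theorem fibN_eqF_le (hz : Measurable z) (ξ : ℝ) :
    fibN α β (eqF α β z n) ξ ≤ ENNReal.ofReal (2 * Real.pi) * fibL1 z ξ + fibN α β n ξ := by
  have hm : Measurable fun τ => ENNReal.ofReal (2 * Real.pi) * ‖z (ξ, τ)‖ₑ :=
    (hz.comp measurable_prodMk_left).enorm.const_mul _
  rw [fibL1, ← lintegral_const_mul' _ _ ENNReal.ofReal_ne_top, fibN, fibN, fibC, fibC, ← lintegral_add_left hm]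
  refine lintegral_mono fun τ => ?_
  dsimp only
  have hb := br_pos (τ - symbol α β ξ)
  have h1 : ‖eqF α β z n (ξ, τ)‖ₑ ≤ ENNReal.ofReal (2 * Real.pi * br (τ - symbol α β ξ)) * ‖z (ξ, τ)‖ₑ + ‖n (ξ, τ)‖ₑ := by
    refine (enorm_add_le _ _).trans ?_
    rw [enorm_mul]
    gcongr
    rw [← ofReal_norm, norm_two_pi_I_mul]
    refine ENNReal.ofReal_le_ofReal ?_
    have := abs_le_br (τ - symbol α β ξ)
    have := Real.pi_pos
    gcongr
  refine (mul_le_mul_right h1 _).trans (le_of_eq ?_)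
  rw [mul_add, ← mul_assoc, ← ENNReal.ofReal_mul (by positivity)]
  congr 3
  field_simp

theorem lintegral_fibN_eqF_lt_top (hb : 1 / 2 < b) (hb' : 1 / 2 < b') (hz : Measurable z) (hn : Measurable n)
    (h1 : bourSq α β s b z < ∞) (h2 : bourSq α β s (b' - 1) n < ∞) :
    ∫⁻ ξ, (ENNReal.ofReal (br ξ ^ s) * fibN α β (eqF α β z n) ξ) ^ 2 < ∞ := by
  have e1 := lintegral_fibL1_sq_lt_top hb hz h1
  have e2 := (lintegral_fibC_sq_le (α := α) (β := β) (s := s) (b := b') hn.enorm).trans_lt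
    (ENNReal.mul_lt_top (jap_lt_top (by linarith)) h2)
  have hm : Measurable fun ξ => (ENNReal.ofReal (br ξ ^ s) * fibL1 z ξ) ^ 2 :=
    ((continuous_br_rpow s).measurable.ennreal_ofReal.mul (measurable_fibL1 hz)).pow_const 2
  have hm' : Measurable fun ξ => ENNReal.ofReal (2 * Real.pi) ^ 2 * (ENNReal.ofReal (br ξ ^ s) * fibL1 z ξ) ^ 2 :=
    hm.const_mul _
  have hle : ∀ ξ, (ENNReal.ofReal (br ξ ^ s) * fibN α β (eqF α β z n) ξ) ^ 2 ≤
      2 * (ENNReal.ofReal (2 * Real.pi) ^ 2 * (ENNReal.ofReal (br ξ ^ s) * fibL1 z ξ) ^ 2 +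
        (ENNReal.ofReal (br ξ ^ s) * fibN α β n ξ) ^ 2) := by
    intro ξ
    refine le_trans ?_ ((ENNReal_add_sq_le (ENNReal.ofReal (2 * Real.pi) * (ENNReal.ofReal (br ξ ^ s) * fibL1 z ξ))
      (ENNReal.ofReal (br ξ ^ s) * fibN α β n ξ)).trans (le_of_eq (by rw [mul_pow])))
    refine pow_le_pow_left₀ zero_le ((mul_le_mul_right (fibN_eqF_le hz ξ) _).trans (le_of_eq ?_)) 2
    ring
  refine (lintegral_mono hle).trans_lt ?_
  rw [lintegral_const_mul' _ _ (by norm_num), lintegral_add_left hm', lintegral_const_mul _ hm]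
  exact ENNReal.mul_lt_top (by norm_num) (ENNReal.add_lt_top.2
    ⟨ENNReal.mul_lt_top (ENNReal.pow_lt_top ENNReal.ofReal_lt_top) e1, e2⟩)

/-- Decay in `τ` is exchanged for decay in the modulation at the price of `⟨p(ξ)⟩`, that is, of five
powers of `⟨ξ⟩`. -/
theorem exists_binv_le (α β : ℝ) {ε : ℝ} (hε : 0 < ε) (hε1 : ε ≤ 1) :
    ∃ C : ℝ, 0 ≤ C ∧ ∀ ξ τ, ‖binv (ε * τ)‖ ≤ C * br ξ ^ (5 : ℝ) * (br (τ - symbol α β ξ))⁻¹ := by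
  obtain ⟨C, hC, h⟩ := exists_schwartz_le binv
  refine ⟨C * ε⁻¹ * (1 + |α| + |β|), by positivity, fun ξ τ => ?_⟩
  have p1 := br_pos (ε * τ)
  have p2 := br_pos τ
  have p3 := br_pos (τ - symbol α β ξ)
  have p4 := br_pos ξ
  have h1 : br (ε * τ) ^ (-3 : ℝ) ≤ (br (ε * τ))⁻¹ := by
    rw [← Real.rpow_neg_one]
    exact Real.rpow_le_rpow_of_exponent_le (one_le_br _) (by norm_num)
  have h2 : (br (ε * τ))⁻¹ ≤ ε⁻¹ * (br τ)⁻¹ := by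
    rw [← mul_inv]
    exact inv_anti₀ (by positivity) (mul_br_le hε hε1 _)
  have h3 : (br τ)⁻¹ ≤ br (symbol α β ξ) * (br (τ - symbol α β ξ))⁻¹ := by
    rw [← div_eq_mul_inv, le_div_iff₀ p3, inv_mul_le_iff₀ p2]
    have := br_add_le_mul τ (-symbol α β ξ)
    rwa [br_neg, ← sub_eq_add_neg] at this
  have h4 := br_symbol_le α β ξ
  rw [show br ξ ^ (5 : ℝ) = br ξ ^ 5 by rw [← Real.rpow_natCast]; norm_num]
  calc ‖binv (ε * τ)‖ ≤ C * (ε⁻¹ * (((1 + |α| + |β|) * br ξ ^ 5) * (br (τ - symbol α β ξ))⁻¹)) := by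
        refine (h _).trans ?_
        gcongr
        refine (h1.trans h2).trans ?_
        gcongr
        exact h3.trans (by gcongr)
    _ = _ := by ring

theorem measurable_binv_mul (hM : Measurable M) (ε : ℝ) : Measurable fun p : ℝ × ℝ => binv (ε * p.2) * M p := by
  have h1 : Measurable fun p : ℝ × ℝ => binv (ε * p.2) :=
    binv.continuous.measurable.comp (measurable_snd.const_mul ε)
  exact h1.mul hM

theorem exists_fibL1_binv_le (α β : ℝ) {ε : ℝ} (hε : 0 < ε) (hε1 : ε ≤ 1) :
    ∃ C : ℝ≥0∞, C < ∞ ∧ ∀ (M : ℝ × ℝ → ℂ) ξ, fibL1 (fun p : ℝ × ℝ => binv (ε * p.2) * M p) ξ ≤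
      C * (ENNReal.ofReal (br ξ ^ (5 : ℝ)) * fibN α β M ξ) := by
  obtain ⟨C, hC, h⟩ := exists_binv_le α β hε hε1
  refine ⟨ENNReal.ofReal C, ENNReal.ofReal_lt_top, fun M ξ => ?_⟩
  have p4 := br_pos ξ
  rw [← mul_assoc, ← ENNReal.ofReal_mul hC, fibL1, fibN, fibC, ← lintegral_const_mul' _ _ ENNReal.ofReal_ne_top]
  refine lintegral_mono fun τ => ?_
  dsimp only
  have p3 := br_pos (τ - symbol α β ξ)
  rw [enorm_mul, ← mul_assoc, ← ENNReal.ofReal_mul (by positivity), ← ofReal_norm]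
  gcongr
  exact h ξ τ

/-- `M` is annihilated by the test functions of the strip `ℝ × (0, T)`. -/
def Annihilated (T : ℝ) (M : ℝ × ℝ → ℂ) : Prop :=
  ∀ φ : 𝓢(Spacetime, ℂ), IsTest T φ → Integrable (fun p => invF φ p * M p) ∧ ∫ p, invF φ p * M p = 0

/-- The left side of the equation is too rough in time to have traces, but after averaging at scale
`ε` it has them, with a loss of five derivatives. Product test functions show that they vanish. -/
theorem Annihilated.ae_tr_eq_zero (hA : Annihilated T M) (hM : Measurable M)
    (h : ∫⁻ ξ, (ENNReal.ofReal (br ξ ^ s) * fibN α β M ξ) ^ 2 < ∞) {ε y : ℝ} (hε : 0 < ε) (hε1 : ε ≤ 1)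
    (h0 : 2 * ε < y) (hT : y + 2 * ε < T) :
    ∀ᵐ ξ, tr (fun p : ℝ × ℝ => binv (ε * p.2) * M p) y ξ = 0 := by
  have hm := measurable_binv_mul hM ε
  obtain ⟨C, hC, hle⟩ := exists_fibL1_binv_le α β hε hε1
  have hfin : sobSq (s - 5) (tr (fun p : ℝ × ℝ => binv (ε * p.2) * M p) y) < ∞ := by
    have h1 : ∀ ξ, (ENNReal.ofReal (br ξ ^ (s - 5)) * ‖tr (fun p : ℝ × ℝ => binv (ε * p.2) * M p) y ξ‖ₑ) ^ 2 ≤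
        C ^ 2 * (ENNReal.ofReal (br ξ ^ s) * fibN α β M ξ) ^ 2 := by
      intro ξ
      have p := br_pos ξ
      rw [← mul_pow]
      refine pow_le_pow_left₀ zero_le ((mul_le_mul_right ((enorm_tr_le _ y ξ).trans (hle M ξ)) _).trans (le_of_eq ?_)) 2
      rw [mul_left_comm, ← mul_assoc (ENNReal.ofReal _), ← ENNReal.ofReal_mul (by positivity), ← Real.rpow_add p]
      ring_nf
    refine (lintegral_mono h1).trans_lt ?_
    rw [lintegral_const_mul' _ _ (ENNReal.pow_lt_top hC).ne]
    exact ENNReal.mul_lt_top (ENNReal.pow_lt_top hC) h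
  obtain ⟨f, hf⟩ := IsModerate.exists_rep (isModerate_of_sobSq (measurable_tr hm y).aestronglyMeasurable hfin)
  refine hf.ae_eq_zero fun X hX => ?_
  obtain ⟨φ, hφ, hinv⟩ := exists_test_invF hε h0 hT X hX
  obtain ⟨hi, hi0⟩ := hA φ hφ
  have e : ∀ p : ℝ × ℝ, invF φ p * M p = ε * ((𝓕⁻ X) p.1 * (chi (y * p.2) * (binv (ε * p.2) * M p))) := by
    intro p
    rw [show invF φ p = invF φ (p.1, p.2) from rfl, hinv]
    ring
  rw [Measure.volume_eq_prod] at hi hi0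
  rw [integral_prod _ hi] at hi0
  simp only [e, integral_const_mul] at hi0
  have hε' : (ε : ℂ) ≠ 0 := by exact_mod_cast hε.ne'
  exact (mul_eq_zero.1 hi0).resolve_left hε'

/-- The vanishing averaged traces are multiplied by the character of the inverse free evolution and
integrated over `y ∈ [c, d]`. -/
theorem Annihilated.ae_integral_binv_eq_zero (hA : Annihilated T M) (hM : Measurable M)
    (h : ∫⁻ ξ, (ENNReal.ofReal (br ξ ^ s) * fibN α β M ξ) ^ 2 < ∞) {ε c d : ℝ} (hε : 0 < ε) (hε1 : ε ≤ 1)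
    (hc : 2 * ε < c) (hcd : c ≤ d) (hd : d + 2 * ε < T) :
    ∀ᵐ ξ, ∫ τ, binv (ε * τ) * M (ξ, τ) * ((chi (d * (τ - symbol α β ξ)) - chi (c * (τ - symbol α β ξ))) /
      (2 * Real.pi * Complex.I * ((τ - symbol α β ξ : ℝ) : ℂ))) = 0 := by
  set N : ℝ × ℝ → ℂ := fun p => binv (ε * p.2) * M p with hN
  have hm : Measurable N := measurable_binv_mul hM ε
  obtain ⟨C, hC, hle⟩ := exists_fibL1_binv_le α β hε hε1
  have hfib := ae_lt_top_of_sobolev (measurable_fibC hM.enorm) h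
  have hms : MeasurableSet {p : ℝ × ℝ | p.1 ∈ Icc c d → tr N p.1 p.2 = 0} := by
    have e : {p : ℝ × ℝ | p.1 ∈ Icc c d → tr N p.1 p.2 = 0} =
        {p : ℝ × ℝ | p.1 ∈ Icc c d}ᶜ ∪ {p : ℝ × ℝ | tr N p.1 p.2 = 0} := by
      ext p; simp [imp_iff_not_or]
    rw [e]
    exact (measurable_fst measurableSet_Icc).compl.union
      (measurableSet_eq_fun (measurable_tr_uncurry hm) measurable_const)
  have h3 : ∀ᵐ r : ℝ, ∀ᵐ ξ : ℝ, r ∈ Icc c d → tr N r ξ = 0 := by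
    refine ae_of_all _ fun r => ?_
    by_cases hr : r ∈ Icc c d
    · filter_upwards [hA.ae_tr_eq_zero hM h hε hε1 (y := r) (by linarith [hr.1]) (by linarith [hr.2])] with ξ hξ _ using hξ
    · exact ae_of_all _ fun ξ h => absurd h hr
  have h4 : ∀ᵐ ξ : ℝ, ∀ᵐ r : ℝ, r ∈ Icc c d → tr N r ξ = 0 :=
    (Measure.ae_ae_comm (p := fun r ξ => r ∈ Icc c d → tr N r ξ = 0) hms).1 h3
  filter_upwards [h4, hfib] with ξ hξ hf
  have hL : fibL1 N ξ < ∞ := (hle M ξ).trans_lt (ENNReal.mul_lt_top hC (ENNReal.mul_lt_top ENNReal.ofReal_lt_top hf))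
  have hi := integrable_fiber hm hL
  set q := symbol α β ξ with hq
  have e1 : ∫ τ, binv (ε * τ) * M (ξ, τ) * ((chi (d * (τ - q)) - chi (c * (τ - q))) /
      (2 * Real.pi * Complex.I * ((τ - q : ℝ) : ℂ))) =
      ∫ τ, ∫ y in Ioc c d, N (ξ, τ) * chi (y * (τ - q)) := by
    refine integral_congr_ae ?_
    have hne : ∀ᵐ τ : ℝ, τ ≠ q := by simp [ae_iff]
    filter_upwards [hne] with τ hτ
    rw [integral_const_mul, ← intervalIntegral.integral_of_le hcd, intervalIntegral_chi (sub_ne_zero.2 hτ)]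
  have hmc : Measurable fun y : ℝ × ℝ => chi (y.2 * (y.1 - q)) := by fun_prop
  have hint : Integrable (fun y : ℝ × ℝ => N (ξ, y.1) * chi (y.2 * (y.1 - q)))
      (volume.prod (volume.restrict (Ioc c d))) := by
    have h1 := hi.mul_prod (integrable_const (1 : ℂ) (μ := volume.restrict (Ioc c d)))
    have h2 := h1.bdd_mul (c := 1) hmc.aestronglyMeasurable (ae_of_all _ fun y => by simp)
    refine h2.congr (ae_of_all _ fun y => ?_)
    dsimp only
    ring
  rw [e1, integral_integral_swap (f := fun τ y => N (ξ, τ) * chi (y * (τ - q))) hint]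
  refine integral_eq_zero_of_ae ?_
  filter_upwards [ae_restrict_of_ae (s := Ioc c d) hξ, ae_restrict_mem measurableSet_Ioc] with y hy hyc
  have h5 : tr N y ξ = 0 := hy ⟨hyc.1.le, hyc.2⟩
  have h6 : ∫ τ, N (ξ, τ) * chi (y * (τ - q)) = chi (-(y * q)) * tr N y ξ := by
    rw [tr, ← integral_const_mul]
    refine integral_congr_ae (ae_of_all _ fun τ => ?_)
    dsimp only
    rw [show y * (τ - q) = -(y * q) + y * τ by ring, chi_add]
    ring
  rw [h6, h5, mul_zero]
  rfl

theorem binv_zero_ne_zero : binv 0 ≠ 0 := by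
  have h1 : binv 0 = ∫ x, cutoffC x := by
    have := integral_chi_cutoff one_pos 0 0
    simpa using this.symm
  rw [h1]
  simp only [cutoffC]
  rw [integral_complex_ofReal]
  exact_mod_cast cutoff.integral_pos.ne'

/-- Removal of the average: as `ε → 0` the factor `binv (ε τ)` tends to the nonzero constant `binv
0`, and the division by the modulation provides the integrable majorant that was missing for traces.
-/
theorem Annihilated.ae_integral_eq_zero (hA : Annihilated T M) (hT : 0 < T) (hM : Measurable M)
    (h : ∫⁻ ξ, (ENNReal.ofReal (br ξ ^ s) * fibN α β M ξ) ^ 2 < ∞) {c d : ℝ} (hc : 0 ≤ c) (hcd : c ≤ d) (hd : d ≤ T) :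
    ∀ᵐ ξ, ∫ τ, M (ξ, τ) * ((chi (d * (τ - symbol α β ξ)) - chi (c * (τ - symbol α β ξ))) /
      (2 * Real.pi * Complex.I * ((τ - symbol α β ξ : ℝ) : ℂ))) = 0 := by
  set l : ℕ → ℝ := fun k => 1 / ((k : ℝ) + 1) with hl
  have hl0 : ∀ k, 0 < l k := fun k => Nat.one_div_pos_of_nat
  have hl1 : ∀ k, l k ≤ 1 := fun k => by
    rw [hl]; dsimp only
    rw [div_le_one (by positivity)]
    have : (0 : ℝ) ≤ k := Nat.cast_nonneg k
    linarith
  have hlim : Tendsto l atTop (𝓝 0) := tendsto_one_div_add_atTop_nhds_zero_nat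
  -- The endpoints are moved towards `T / 2` by the fraction `l k`, which leaves enough room for the
  -- width `2ε` even when `c = 0` or `d = T`.
  set ε : ℕ → ℝ := fun k => l k * (min T 1 / 8) with hεd
  set C : ℕ → ℝ := fun k => (1 - l k) * c + l k * (T / 2) with hCd
  set D : ℕ → ℝ := fun k => (1 - l k) * d + l k * (T / 2) with hDd
  have hmin : 0 < min T 1 := lt_min hT one_pos
  have hminT := min_le_left T 1
  have hmin1 := min_le_right T 1
  have hk : ∀ᵐ ξ, ∀ k, ∫ τ, binv (ε k * τ) * M (ξ, τ) *
      ((chi (D k * (τ - symbol α β ξ)) - chi (C k * (τ - symbol α β ξ))) /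
        (2 * Real.pi * Complex.I * ((τ - symbol α β ξ : ℝ) : ℂ))) = 0 := by
    refine ae_all_iff.2 fun k => hA.ae_integral_binv_eq_zero hM h ?_ ?_ ?_ ?_ ?_
    · have := hl0 k; simp only [hεd]; positivity
    · have := hl0 k; have := hl1 k; simp only [hεd]; nlinarith
    · have := hl0 k; have := hl1 k; simp only [hεd, hCd]; nlinarith
    · have := hl1 k; simp only [hCd, hDd]; nlinarith
    · have := hl0 k; have := hl1 k; simp only [hεd, hDd]; nlinarith
  have hfib := ae_lt_top_of_sobolev (measurable_fibC hM.enorm) h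
  obtain ⟨K, hK, hKb⟩ := exists_schwartz_le binv
  have hKb' : ∀ x, ‖binv x‖ ≤ K := fun x => (hKb x).trans (by
    have : br x ^ (-3 : ℝ) ≤ 1 := Real.rpow_le_one_of_one_le_of_nonpos (one_le_br x) (by norm_num)
    nlinarith)
  filter_upwards [hk, hfib] with ξ hξ hf
  set q := symbol α β ξ with hq
  have hlimε : Tendsto ε atTop (𝓝 0) := by simpa using hlim.mul_const (min T 1 / 8)
  have hlimC : ∀ a : ℝ, Tendsto (fun k => (1 - l k) * a + l k * (T / 2)) atTop (𝓝 a) := fun a => by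
    simpa using ((hlim.const_sub 1).mul_const a).add (hlim.mul_const (T / 2))
  have hMi := integrable_inv_br_mul hM hf
  have hmeas : Measurable fun τ => M (ξ, τ) := hM.comp measurable_prodMk_left
  have hCD : ∀ k, |D k - C k| ≤ T := fun k => by
    have h1 : D k - C k = (1 - l k) * (d - c) := by simp only [hCd, hDd]; ring
    have h2 := hl0 k
    have h3 := hl1 k
    rw [h1, abs_of_nonneg (by nlinarith)]
    nlinarith
  have hDCT : Tendsto (fun k => ∫ τ, binv (ε k * τ) * M (ξ, τ) *
      ((chi (D k * (τ - q)) - chi (C k * (τ - q))) / (2 * Real.pi * Complex.I * ((τ - q : ℝ) : ℂ)))) atTop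
      (𝓝 (∫ τ, binv (0 * τ) * M (ξ, τ) *
      ((chi (d * (τ - q)) - chi (c * (τ - q))) / (2 * Real.pi * Complex.I * ((τ - q : ℝ) : ℂ))))) := by
    refine tendsto_integral_of_dominated_convergence
      (fun τ => K * (2 * (1 + T)) * ((br (τ - q))⁻¹ * ‖M (ξ, τ)‖)) (fun k => ?_) (hMi.const_mul _)
      (fun k => ae_of_all _ fun τ => ?_) (ae_of_all _ fun τ => ?_)
    · have h1 : Measurable fun τ => binv (ε k * τ) := binv.continuous.measurable.comp (measurable_id.const_mul _)
      have h2 : Measurable fun τ : ℝ => chi (D k * (τ - q)) - chi (C k * (τ - q)) := by fun_prop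
      have h3 : Measurable fun τ : ℝ => (2 * Real.pi * Complex.I * ((τ - q : ℝ) : ℂ)) := by fun_prop
      exact ((h1.mul hmeas).mul (h2.div h3)).aestronglyMeasurable
    · rw [norm_mul, norm_mul]
      have h1 := norm_chi_sub_chi_div_le (D k) (C k) (τ - q)
      have h2 := br_pos (τ - q)
      calc ‖binv (ε k * τ)‖ * ‖M (ξ, τ)‖ * _ ≤ K * ‖M (ξ, τ)‖ * (2 * (1 + T) * (br (τ - q))⁻¹) := by
            gcongr
            · exact hKb' _
            · exact h1.trans (by gcongr; exact hCD k)
        _ = _ := by ring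
    · have t1 : Tendsto (fun k => binv (ε k * τ)) atTop (𝓝 (binv (0 * τ))) :=
        (binv.continuous.tendsto _).comp (hlimε.mul_const τ)
      have t2 : ∀ a : ℝ, Tendsto (fun k => chi (((1 - l k) * a + l k * (T / 2)) * (τ - q))) atTop (𝓝 (chi (a * (τ - q)))) :=
        fun a => (continuous_chi.tendsto _).comp ((hlimC a).mul_const (τ - q))
      exact (t1.mul_const _).mul (((t2 d).sub (t2 c)).div_const _)
  simp only [hξ] at hDCT
  have h7 := tendsto_nhds_unique hDCT tendsto_const_nhds
  have e : ∀ τ : ℝ, binv (0 * τ) * M (ξ, τ) *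
      ((chi (d * (τ - q)) - chi (c * (τ - q))) / (2 * Real.pi * Complex.I * ((τ - q : ℝ) : ℂ))) =
      binv 0 * (M (ξ, τ) * ((chi (d * (τ - q)) - chi (c * (τ - q))) / (2 * Real.pi * Complex.I * ((τ - q : ℝ) : ℂ)))) := by
    intro τ
    rw [zero_mul, mul_assoc]
  simp only [e] at h7
  rw [integral_const_mul] at h7
  exact (mul_eq_zero.1 h7).resolve_left binv_zero_ne_zero

/-- Translation in time by `t₀` on the Fourier side. -/
def shift (t₀ : ℝ) (z : ℝ × ℝ → ℂ) (p : ℝ × ℝ) : ℂ := chi (t₀ * p.2) * z p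

/-- The factor `τ - p(ξ)` in the equation cancels the denominator of the time-integrated character,
so the terms with `z` become traces at `t₀ + r` and `t₀`, while the forcing term keeps the kernel
`evoKer`. -/
theorem duhamel (hA : Annihilated T (eqF α β z n)) (hT : 0 < T) (hb : 1 / 2 < b) (hb' : 1 / 2 < b') (hz : Measurable z)
    (hn : Measurable n) (h1 : bourSq α β s b z < ∞) (h2 : bourSq α β s (b' - 1) n < ∞) {t₀ r : ℝ} (ht₀ : 0 ≤ t₀)
    (hr : 0 ≤ r) (hT' : t₀ + r ≤ T) :
    ∀ᵐ ξ, tr (shift t₀ z) r ξ = chi (r * symbol α β ξ) * tr (shift t₀ z) 0 ξ -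
      ∫ τ, shift t₀ n (ξ, τ) * evoKer α β r (ξ, τ) := by
  have h3 := lintegral_fibN_eqF_lt_top hb hb' hz hn h1 h2
  filter_upwards [hA.ae_integral_eq_zero hT (measurable_eqF hz hn) h3 ht₀ (by linarith : t₀ ≤ t₀ + r) hT',
    ae_fibL1_lt_top hb hz h1, ae_fibN_lt_top hb' hn h2] with ξ hξ hL hN
  set q := symbol α β ξ with hq
  have hzi := integrable_fiber hz hL
  have hs : Measurable (shift t₀ n) := by
    have h1 : Measurable fun p : ℝ × ℝ => chi (t₀ * p.2) := by fun_prop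
    exact h1.mul hn
  have hNs : fibN α β (shift t₀ n) ξ < ∞ := by
    refine lt_of_le_of_lt (le_of_eq (lintegral_congr fun τ => ?_)) hN
    simp [shift, enorm_mul]
  have i3 := integrable_mul_evoKer hs hNs r
  have i1 : ∀ a : ℝ, Integrable fun τ => chi (a * τ) * z (ξ, τ) := fun a =>
    hzi.bdd_mul (c := 1) (by fun_prop : Continuous fun τ => chi (a * τ)).aestronglyMeasurable (ae_of_all _ fun τ => by simp)
  have etr : ∀ r, tr (shift t₀ z) r ξ = ∫ τ, chi ((t₀ + r) * τ) * z (ξ, τ) := fun r => by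
    refine integral_congr_ae (ae_of_all _ fun τ => ?_)
    simp only [shift]
    rw [add_mul, chi_add]
    ring
  have key : chi ((t₀ + r) * q) * ∫ τ, eqF α β z n (ξ, τ) * ((chi ((t₀ + r) * (τ - q)) - chi (t₀ * (τ - q))) /
      (2 * Real.pi * Complex.I * ((τ - q : ℝ) : ℂ))) =
      (∫ τ, chi ((t₀ + r) * τ) * z (ξ, τ)) - chi (r * q) * (∫ τ, chi ((t₀ + 0) * τ) * z (ξ, τ)) +
        ∫ τ, shift t₀ n (ξ, τ) * evoKer α β r (ξ, τ) := by
    have i2 := (i1 (t₀ + 0)).const_mul (chi (r * q))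
    have i12 : Integrable fun τ => chi ((t₀ + r) * τ) * z (ξ, τ) - chi (r * q) * (chi ((t₀ + 0) * τ) * z (ξ, τ)) :=
      (i1 (t₀ + r)).sub i2
    rw [← integral_const_mul, ← integral_const_mul, ← integral_sub (i1 (t₀ + r)) i2, ← integral_add i12 i3]
    have hne : ∀ᵐ τ : ℝ, τ ≠ q := by simp [ae_iff]
    refine integral_congr_ae ?_
    filter_upwards [hne] with τ hτ
    have h1 : ((τ - q : ℝ) : ℂ) ≠ 0 := by exact_mod_cast sub_ne_zero.2 hτ
    have h2 : (2 * Real.pi * Complex.I * ((τ - q : ℝ) : ℂ)) ≠ 0 := by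
      have h3 : (Real.pi : ℂ) ≠ 0 := by exact_mod_cast Real.pi_ne_zero
      have h4 := Complex.I_ne_zero
      simp only [ne_eq, mul_eq_zero, not_or]
      exact ⟨⟨⟨two_ne_zero, h3⟩, h4⟩, h1⟩
    have c1 : chi ((t₀ + r) * q) * chi ((t₀ + r) * (τ - q)) = chi ((t₀ + r) * τ) := by
      rw [← chi_add]; ring_nf
    have c2 : chi ((t₀ + r) * q) * chi (t₀ * (τ - q)) = chi (r * q) * chi (t₀ * τ) := by
      rw [← chi_add, ← chi_add]; ring_nf
    have c3 : chi ((t₀ + r) * τ) = chi (t₀ * τ) * chi (r * τ) := by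
      rw [← chi_add]; ring_nf
    simp only [eqF, evoKer, shift, add_zero]
    rw [← hq]
    set A : ℂ := 2 * Real.pi * Complex.I * ((τ - q : ℝ) : ℂ)
    have e1 : chi ((t₀ + r) * q) * ((A * z (ξ, τ) + n (ξ, τ)) * ((chi ((t₀ + r) * (τ - q)) - chi (t₀ * (τ - q))) / A)) =
        (z (ξ, τ) + n (ξ, τ) / A) * (chi ((t₀ + r) * q) * chi ((t₀ + r) * (τ - q)) -
          chi ((t₀ + r) * q) * chi (t₀ * (τ - q))) := by
      field_simp
    rw [e1, c1, c2, c3]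
    ring
  rw [hξ, mul_zero] at key
  rw [etr, etr]
  linear_combination -key

end

section

/-! ### Contractions in Bourgain spaces -/

variable {α β s b b' : ℝ}

/-- The function with weighted version `G`. -/
def unweight (α β s b : ℝ) (G : Lp ℂ 2 (volume : Measure (ℝ × ℝ))) (p : ℝ × ℝ) : ℂ :=
  (((wt α β s b p)⁻¹ : ℝ) : ℂ) * G p

theorem measurable_unweight (G : Lp ℂ 2 (volume : Measure (ℝ × ℝ))) : Measurable (unweight α β s b G) :=
  (Complex.measurable_ofReal.comp (measurable_wt (α := α) (β := β) (s := s) (b := b)).inv).mul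
    (Lp.stronglyMeasurable G).measurable

theorem ofReal_wt_mul_unweight (G : Lp ℂ 2 (volume : Measure (ℝ × ℝ))) (p : ℝ × ℝ) :
    ((wt α β s b p : ℝ) : ℂ) * unweight α β s b G p = G p := by
  have h : ((wt α β s b p : ℝ) : ℂ) ≠ 0 := by exact_mod_cast (wt_pos α β s b p).ne'
  rw [unweight, Complex.ofReal_inv, mul_inv_cancel_left₀ h]

theorem enorm_wt_mul (z : ℝ × ℝ → ℂ) (p : ℝ × ℝ) :
    ‖((wt α β s b p : ℝ) : ℂ) * z p‖ₑ = ENNReal.ofReal (wt α β s b p) * ‖z p‖ₑ := by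
  rw [enorm_mul, ← ofReal_norm, Complex.norm_real, Real.norm_of_nonneg (wt_pos α β s b p).le]

theorem bourSq_eq_eLpNorm (z : ℝ × ℝ → ℂ) :
    bourSq α β s b z = eLpNorm (fun p => ((wt α β s b p : ℝ) : ℂ) * z p) 2 volume ^ 2 := by
  rw [eLpNorm_two_sq, bourSq]
  simp only [enorm_wt_mul]

/-- Multiplication by the weight identifies the space with `L²`, which is complete, and Banach's
theorem is applied on a closed ball there. The factor `1/4` on squares means contraction by `1/2`.
-/
theorem exists_fixedPoint {Φ : (ℝ × ℝ → ℂ) → ℝ × ℝ → ℂ} {r : ℝ} (hr : 0 ≤ r)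
    (hm : ∀ z, Measurable z → Measurable (Φ z))
    (h1 : ∀ z, Measurable z → bourSq α β s b z ≤ ENNReal.ofReal r ^ 2 → bourSq α β s b (Φ z) ≤ ENNReal.ofReal r ^ 2)
    (h2 : ∀ z w, Measurable z → Measurable w → bourSq α β s b z ≤ ENNReal.ofReal r ^ 2 →
      bourSq α β s b w ≤ ENNReal.ofReal r ^ 2 →
      bourSq α β s b (fun p => Φ z p - Φ w p) ≤ (1 / 4) * bourSq α β s b (fun p => z p - w p)) :
    ∃ z, Measurable z ∧ bourSq α β s b z ≤ ENNReal.ofReal r ^ 2 ∧ z =ᵐ[volume] Φ z := by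
  classical
  set W : (ℝ × ℝ → ℂ) → ℝ × ℝ → ℂ := fun z p => ((wt α β s b p : ℝ) : ℂ) * z p with hW
  set Z := unweight α β s b with hZ
  have hZm : ∀ G, Measurable (Z G) := measurable_unweight
  have hWZ : ∀ G, W (Z G) = G := fun G => funext (ofReal_wt_mul_unweight G)
  have hZn : ∀ G, bourSq α β s b (Z G) = ‖G‖ₑ ^ 2 := fun G => by
    rw [bourSq_eq_eLpNorm, Lp.enorm_def]
    exact congrArg (fun g => eLpNorm g 2 volume ^ 2) (hWZ G)
  have hball : ∀ G : Lp ℂ 2 (volume : Measure (ℝ × ℝ)), G ∈ Metric.closedBall 0 r ↔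
      bourSq α β s b (Z G) ≤ ENNReal.ofReal r ^ 2 := fun G => by
    rw [hZn, ENNReal.pow_le_pow_left_iff two_ne_zero, mem_closedBall_zero_iff, ← ofReal_norm,
      ENNReal.ofReal_le_ofReal_iff hr]
  have hWm : ∀ z, Measurable z → Measurable (W z) := fun z hz =>
    (Complex.measurable_ofReal.comp (measurable_wt (α := α) (β := β) (s := s) (b := b))).mul hz
  have hmem : ∀ G ∈ Metric.closedBall (0 : Lp ℂ 2 (volume : Measure (ℝ × ℝ))) r, MemLp (W (Φ (Z G))) 2 volume := by
    intro G hG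
    have h3 := h1 _ (hZm G) ((hball G).1 hG)
    refine ⟨(hWm _ (hm _ (hZm G))).aestronglyMeasurable, ?_⟩
    rw [bourSq_eq_eLpNorm, ENNReal.pow_le_pow_left_iff two_ne_zero] at h3
    exact h3.trans_lt ENNReal.ofReal_lt_top
  -- The default value zero is never used: on the ball the image is in `L²`.
  set f : Lp ℂ 2 (volume : Measure (ℝ × ℝ)) → Lp ℂ 2 (volume : Measure (ℝ × ℝ)) := fun G =>
    if h : MemLp (W (Φ (Z G))) 2 volume then h.toLp _ else 0 with hf
  have hfG : ∀ G ∈ Metric.closedBall (0 : Lp ℂ 2 (volume : Measure (ℝ × ℝ))) r, f G =ᵐ[volume] W (Φ (Z G)) := by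
    intro G hG
    simp only [hf, dif_pos (hmem G hG)]
    exact (hmem G hG).coeFn_toLp
  have hmaps : MapsTo f (Metric.closedBall 0 r) (Metric.closedBall 0 r) := by
    intro G hG
    rw [hball, hZn, Lp.enorm_def, eLpNorm_congr_ae (hfG G hG), ← bourSq_eq_eLpNorm]
    exact h1 _ (hZm G) ((hball G).1 hG)
  have hcontr : ContractingWith (1 / 2) (hmaps.restrict f _ _) := by
    refine ⟨by rw [div_lt_one two_pos]; exact one_lt_two, fun G G' => ?_⟩
    have e1 : edist (f G.1) (f G'.1) ^ 2 = bourSq α β s b (fun p => Φ (Z G.1) p - Φ (Z G'.1) p) := by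
      rw [Lp.edist_def, bourSq_eq_eLpNorm]
      congr 1
      refine eLpNorm_congr_ae ?_
      filter_upwards [hfG _ G.2, hfG _ G'.2] with p p1 p2
      rw [Pi.sub_apply, p1, p2, ← mul_sub]
    have e2 : edist G.1 G'.1 ^ 2 = bourSq α β s b (fun p => Z G.1 p - Z G'.1 p) := by
      rw [Lp.edist_def, bourSq_eq_eLpNorm]
      congr 1
      refine eLpNorm_congr_ae (ae_of_all _ fun p => ?_)
      rw [Pi.sub_apply, ← ofReal_wt_mul_unweight (α := α) (β := β) (s := s) (b := b) G.1,
        ← ofReal_wt_mul_unweight (α := α) (β := β) (s := s) (b := b) G'.1, ← mul_sub]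
    change edist (f G.1) (f G'.1) ≤ ((1 / 2 : ℝ≥0) : ℝ≥0∞) * edist G.1 G'.1
    rw [← ENNReal.pow_le_pow_left_iff two_ne_zero, mul_pow, e1, e2]
    refine (h2 _ _ (hZm _) (hZm _) ((hball _).1 G.2) ((hball _).1 G'.2)).trans (le_of_eq ?_)
    congr 1
    rw [← ENNReal.coe_pow, show ((1 / 2 : ℝ≥0)) ^ 2 = 1 / 4 by rw [div_pow]; norm_num]
    rw [ENNReal.coe_div (by norm_num)]
    norm_num
  obtain ⟨G, hG, hfix, -, -⟩ := hcontr.exists_fixedPoint' (Metric.isClosed_closedBall.isComplete) hmaps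
    (x := 0) (Metric.mem_closedBall_self hr) (edist_ne_top _ _)
  refine ⟨Z G, hZm G, (hball G).1 hG, ?_⟩
  have h3 := hfG G hG
  rw [hfix] at h3
  filter_upwards [h3] with p hp
  have hne : ((wt α β s b p : ℝ) : ℂ) ≠ 0 := by exact_mod_cast (wt_pos α β s b p).ne'
  have h4 := ofReal_wt_mul_unweight (α := α) (β := β) (s := s) (b := b) G p
  rw [hp] at h4
  exact mul_left_cancel₀ hne h4

/-! ### The localized integral equation -/

/-- The estimates for the localized free and Duhamel terms. -/
structure IterationBounds (α β s b b' : ℝ) (C K : ℝ≥0) : Prop where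
  lt : 1 / 2 < b
  lt' : b < b'
  bilinear : BilinearBound α β s b b' C
  free : ∀ δ : ℝ, 0 < δ → δ ≤ 1 → ∀ h : ℝ → ℂ, Measurable h →
    bourSq α β s b (freeOp α β δ h) ≤ K * ENNReal.ofReal (δ ^ (1 - 2 * b)) * sobSq s h
  duh : ∀ δ : ℝ, 0 < δ → δ ≤ 1 → ∀ z w : ℝ × ℝ → ℂ, Measurable z → Measurable w →
    bourSq α β s b (duhOp α β δ (bil z w)) ≤
      K * ENNReal.ofReal (δ ^ (2 * (b' - b))) * (bourSq α β s b z * bourSq α β s b w)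

theorem BilinearBound.exists_iterationBounds {C : ℝ≥0} (hB : BilinearBound α β s b b' C) (hb : 1 / 2 < b) (hbb : b < b')
    (hb' : b' ≤ 1) : ∃ K : ℝ≥0, IterationBounds α β s b b' C K := by
  obtain ⟨C1, hC1, h1⟩ := exists_bourSq_freeOp_le (b := b) (by linarith) (by linarith)
  obtain ⟨C2, hC2, h2⟩ := exists_bourSq_duhOp_le hb hbb.le hb'
  have hC3 : C2 * (ENNReal.ofReal (Real.pi ^ 2) * C) < ∞ :=
    ENNReal.mul_lt_top hC2 (ENNReal.mul_lt_top ENNReal.ofReal_lt_top ENNReal.coe_lt_top)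
  lift C1 to ℝ≥0 using hC1.ne
  lift C2 * (ENNReal.ofReal (Real.pi ^ 2) * C) to ℝ≥0 using hC3.ne with C3 hC3'
  refine ⟨max C1 C3, hb, hbb, hB, fun δ hδ hδ1 h hh => ?_, fun δ hδ hδ1 z w hz hw => ?_⟩
  · refine (h1 α β s δ hδ hδ1 h hh).trans ?_
    gcongr
    exact le_max_left _ _
  · refine (h2 α β s δ hδ hδ1 _ (measurable_bil hz hw)).trans ?_
    refine (mul_le_mul_right (hB.bourSq_bil_le hz hw) _).trans ?_
    calc _ = (C2 * (ENNReal.ofReal (Real.pi ^ 2) * C)) * ENNReal.ofReal (δ ^ (2 * (b' - b))) *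
          (bourSq α β s b z * bourSq α β s b w) := by ring
      _ ≤ _ := by
        rw [← hC3']
        gcongr
        exact le_max_right _ _

variable {C K : ℝ≥0}

theorem bourSq_sub_le {z w : ℝ × ℝ → ℂ} (hz : Measurable z) :
    bourSq α β s b (fun p => z p - w p) ≤ 2 * (bourSq α β s b z + bourSq α β s b w) := by
  have hm : Measurable fun p => (ENNReal.ofReal (wt α β s b p) * ‖z p‖ₑ) ^ 2 :=
    ((measurable_wt (α := α) (β := β) (s := s) (b := b)).ennreal_ofReal.mul hz.enorm).pow_const 2
  rw [bourSq, bourSq, bourSq, ← lintegral_add_left hm, ← lintegral_const_mul' _ _ (by norm_num)]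
  refine lintegral_mono fun p => ?_
  refine le_trans ?_ (ENNReal_add_sq_le _ _)
  rw [← mul_add]
  gcongr
  exact enorm_sub_le

theorem bourSq_neg (z : ℝ × ℝ → ℂ) : bourSq α β s b (fun p => -z p) = bourSq α β s b z := by
  simp only [bourSq, enorm_neg]

theorem bourSq_add_le {z w : ℝ × ℝ → ℂ} (hz : Measurable z) :
    bourSq α β s b (fun p => z p + w p) ≤ 2 * (bourSq α β s b z + bourSq α β s b w) := by
  have h := bourSq_sub_le (α := α) (β := β) (s := s) (b := b) (w := fun p => -w p) hz
  simpa only [sub_neg_eq_add, bourSq_neg] using h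

theorem BilinearBound.bourSq_bil_lt_top (hB : BilinearBound α β s b b' C) {z w : ℝ × ℝ → ℂ} (hz : Measurable z)
    (hw : Measurable w) (h1 : bourSq α β s b z < ∞) (h2 : bourSq α β s b w < ∞) :
    bourSq α β s (b' - 1) (bil z w) < ∞ :=
  (hB.bourSq_bil_le hz hw).trans_lt (ENNReal.mul_lt_top (ENNReal.mul_lt_top ENNReal.ofReal_lt_top ENNReal.coe_lt_top)
    (ENNReal.mul_lt_top h1 h2))

theorem IterationBounds.duh_sub_ae (hI : IterationBounds α β s b b' C K) {δ : ℝ} (hδ : 0 < δ) (hδ1 : δ ≤ 1)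
    {z w : ℝ × ℝ → ℂ} (hz : Measurable z) (hw : Measurable w) (h1 : bourSq α β s b z < ∞) (h2 : bourSq α β s b w < ∞) :
    (fun p => duhOp α β δ (bil z z) p - duhOp α β δ (bil w w) p) =ᵐ[volume]
      duhOp α β δ (bil (fun p => z p + w p) (fun p => z p - w p)) := by
  have hb' : 1 / 2 < b' := hI.lt.trans hI.lt'
  refine (duhOp_sub_ae hδ hδ1 hb' (measurable_bil hz hz) (measurable_bil hw hw)
    (hI.bilinear.bourSq_bil_lt_top hz hz h1 h1) (hI.bilinear.bourSq_bil_lt_top hw hw h2 h2)).trans ?_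
  have e := bil_sub_add_ae hI.bilinear hz hw h1 h2
  rw [Filter.EventuallyEq, Measure.volume_eq_prod] at e
  have e1 := Measure.ae_ae_of_ae_prod e
  have hm : MeasurableSet {p : ℝ × ℝ | duhOp α β δ (fun p => bil z z p - bil w w p) p =
      duhOp α β δ (bil (fun p => z p + w p) (fun p => z p - w p)) p} :=
    measurableSet_eq_fun (measurable_duhOp ((measurable_bil hz hz).sub (measurable_bil hw hw)))
      (measurable_duhOp (measurable_bil (hz.add hw) (hz.sub hw)))
  rw [Filter.EventuallyEq, Measure.volume_eq_prod, Measure.ae_prod_iff_ae_ae hm]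
  filter_upwards [e1] with ξ hξ
  refine ae_of_all _ fun τ => ?_
  refine integral_congr_ae ?_
  filter_upwards [hξ] with τ' hτ'
  rw [hτ']

/-- The fixed-point condition for the Fourier transform of a localized solution. -/
def IsLocal (α β δ : ℝ) (h : ℝ → ℂ) (z : ℝ × ℝ → ℂ) : Prop :=
  z =ᵐ[volume] fun p => freeOp α β δ h p - duhOp α β δ (bil z z) p

/-- The size of the time interval on which data with `sobSq s h ≤ H` are treated. -/
def IsShort (b b' : ℝ) (K : ℝ≥0) (H δ : ℝ) : Prop :=
  0 < δ ∧ δ ≤ 1 ∧ 64 * K ^ 2 * δ ^ (2 * (b' - b) + (1 - 2 * b)) * H ≤ 1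

/-- The gain `δ^(2(b'-b))` of the Duhamel term has to outweigh the growth `δ^(1-2b)` of the squared
radius, which is the positivity assumed. -/
theorem exists_isShort (hbb : 0 < 2 * (b' - b) + (1 - 2 * b)) (K : ℝ≥0) (H : ℝ) : ∃ δ, IsShort b b' K H δ := by
  set e := 2 * (b' - b) + (1 - 2 * b) with he
  have h : Tendsto (fun δ : ℝ => 64 * (K : ℝ) ^ 2 * δ ^ e * H) (𝓝 0) (𝓝 (64 * (K : ℝ) ^ 2 * (0 : ℝ) ^ e * H)) :=
    ((tendsto_id.rpow_const (Or.inr hbb.le)).const_mul _).mul_const _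
  rw [Real.zero_rpow hbb.ne', mul_zero, zero_mul] at h
  have h1 : ∀ᶠ δ in 𝓝[>] (0 : ℝ), 64 * (K : ℝ) ^ 2 * δ ^ e * H ≤ 1 :=
    (h.mono_left nhdsWithin_le_nhds).eventually (eventually_le_nhds one_pos)
  have h2 : ∀ᶠ δ in 𝓝[>] (0 : ℝ), δ ∈ Ioc (0 : ℝ) 1 := Ioc_mem_nhdsGT one_pos
  obtain ⟨δ, h3, h4⟩ := (h1.and h2).exists
  exact ⟨δ, h4.1, h4.2, h3⟩

/-- The square of the radius of the ball for the contraction. -/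
def radSq (b : ℝ) (K : ℝ≥0) (H δ : ℝ) : ℝ := 4 * K * δ ^ (1 - 2 * b) * H

/-- The constant `64` in `IsShort` is `4 · 16`, with `4` from the squared radius `radSq`. -/
theorem IsShort.mul_radSq_le {H δ : ℝ} (h : IsShort b b' K H δ) : K * δ ^ (2 * (b' - b)) * radSq b K H δ ≤ 1 / 16 := by
  have h1 := h.2.2
  rw [Real.rpow_add h.1] at h1
  unfold radSq
  linarith

theorem IterationBounds.duh_bil_le (hI : IterationBounds α β s b b' C K) {H δ : ℝ} (hS : IsShort b b' K H δ) {c : ℝ}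
    (hc : 0 ≤ c) {z w : ℝ × ℝ → ℂ} (hz : Measurable z) (hw : Measurable w)
    (h1 : bourSq α β s b z ≤ ENNReal.ofReal (c * radSq b K H δ)) :
    bourSq α β s b (duhOp α β δ (bil z w)) ≤ ENNReal.ofReal (c / 16) * bourSq α β s b w := by
  have hδ := hS.1
  refine (hI.duh δ hS.1 hS.2.1 z w hz hw).trans ?_
  rw [← mul_assoc]
  gcongr
  refine (mul_le_mul_right h1 _).trans ?_
  rw [← ENNReal.ofReal_coe_nnreal, ← ENNReal.ofReal_mul K.coe_nonneg, ← ENNReal.ofReal_mul (by positivity)]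
  refine ENNReal.ofReal_le_ofReal ?_
  have := mul_le_mul_of_nonneg_left hS.mul_radSq_le hc
  linarith

/-- By the factorization of the difference of squares, with `z + w` of squared norm at most four
times `radSq`; `4 / 16 = 1 / 4`. -/
theorem IterationBounds.sub_le (hI : IterationBounds α β s b b' C K) {H δ : ℝ} (hS : IsShort b b' K H δ)
    {z w : ℝ × ℝ → ℂ} (hz : Measurable z) (hw : Measurable w)
    (h1 : bourSq α β s b z ≤ ENNReal.ofReal (radSq b K H δ)) (h2 : bourSq α β s b w ≤ ENNReal.ofReal (radSq b K H δ)) :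
    bourSq α β s b (fun p => duhOp α β δ (bil z z) p - duhOp α β δ (bil w w) p) ≤
      1 / 4 * bourSq α β s b (fun p => z p - w p) := by
  rw [bourSq_congr (hI.duh_sub_ae hS.1 hS.2.1 hz hw (h1.trans_lt ENNReal.ofReal_lt_top) (h2.trans_lt ENNReal.ofReal_lt_top))]
  have h3 : bourSq α β s b (fun p => z p + w p) ≤ ENNReal.ofReal (4 * radSq b K H δ) := by
    refine (bourSq_add_le hz).trans ?_
    refine (mul_le_mul_right (add_le_add h1 h2) _).trans (le_of_eq ?_)
    rw [← two_mul, ← mul_assoc, ENNReal.ofReal_mul (by norm_num)]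
    norm_num
  refine (hI.duh_bil_le hS (by norm_num) (hz.add hw) (hz.sub hw) h3).trans (le_of_eq ?_)
  congr 1
  rw [show (4 / 16 : ℝ) = 1 / 4 by norm_num, ENNReal.ofReal_div_of_pos (by norm_num)]
  norm_num

/-- The free term takes a quarter of the squared radius and the Duhamel term a sixteenth; the
quadratic triangle inequality doubles their sum, which stays below one. -/
theorem IterationBounds.exists_isLocal (hI : IterationBounds α β s b b' C K) {H δ : ℝ} (hS : IsShort b b' K H δ)
    (hH : 0 ≤ H) {h : ℝ → ℂ} (hh : Measurable h) (hhH : sobSq s h ≤ ENNReal.ofReal H) :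
    ∃ z, Measurable z ∧ bourSq α β s b z ≤ ENNReal.ofReal (radSq b K H δ) ∧ IsLocal α β δ h z := by
  have hδ := hS.1
  have hρ : 0 ≤ radSq b K H δ := by unfold radSq; positivity
  have hsq : ENNReal.ofReal (Real.sqrt (radSq b K H δ)) ^ 2 = ENNReal.ofReal (radSq b K H δ) := by
    rw [← ENNReal.ofReal_pow (Real.sqrt_nonneg _), Real.sq_sqrt hρ]
  have hfree : bourSq α β s b (freeOp α β δ h) ≤ ENNReal.ofReal (radSq b K H δ / 4) := by
    refine (hI.free δ hS.1 hS.2.1 h hh).trans ((mul_le_mul_right hhH _).trans (le_of_eq ?_))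
    rw [← ENNReal.ofReal_coe_nnreal, ← ENNReal.ofReal_mul K.coe_nonneg, ← ENNReal.ofReal_mul (by positivity), radSq]
    congr 1
    ring
  obtain ⟨z, hz, hzr, hfix⟩ := exists_fixedPoint (α := α) (β := β) (s := s) (b := b)
    (Φ := fun z p => freeOp α β δ h p - duhOp α β δ (bil z z) p) (Real.sqrt_nonneg (radSq b K H δ))
    (fun z hz => (measurable_freeOp hh).sub (measurable_duhOp (measurable_bil hz hz)))
    (fun z hz hzr => by
      rw [hsq] at hzr ⊢
      refine (bourSq_sub_le (measurable_freeOp hh)).trans ?_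
      have h1 := hI.duh_bil_le hS zero_le_one hz hz (by rwa [one_mul])
      refine (mul_le_mul_right (add_le_add hfree (h1.trans (mul_le_mul_right hzr _))) _).trans ?_
      rw [← ENNReal.ofReal_mul (by norm_num), ← ENNReal.ofReal_add (by positivity) (by positivity),
        show (2 : ℝ≥0∞) = ENNReal.ofReal 2 by norm_num, ← ENNReal.ofReal_mul (by norm_num)]
      refine ENNReal.ofReal_le_ofReal ?_
      linarith)
    (fun z w hz hw hzr hwr => by
      rw [hsq] at hzr hwr
      refine le_trans (le_of_eq ?_) (hI.sub_le hS hz hw hzr hwr)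
      rw [← bourSq_neg]
      congr 1
      funext p
      ring)
  exact ⟨z, hz, hsq ▸ hzr, hfix⟩

/-- In the difference of the fixed-point equations the Duhamel part is at most half of the left-hand
side, which is finite, and is absorbed. -/
theorem IterationBounds.sub_le_of_isLocal (hI : IterationBounds α β s b b' C K) {H δ : ℝ} (hS : IsShort b b' K H δ)
    {h k : ℝ → ℂ} (hh : Measurable h) (hk : Measurable k)
    {z w : ℝ × ℝ → ℂ} (hz : Measurable z) (hw : Measurable w)
    (h1 : bourSq α β s b z ≤ ENNReal.ofReal (radSq b K H δ)) (h2 : bourSq α β s b w ≤ ENNReal.ofReal (radSq b K H δ))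
    (hzl : IsLocal α β δ h z) (hwl : IsLocal α β δ k w) :
    bourSq α β s b (fun p => z p - w p) ≤
      4 * (K * ENNReal.ofReal (δ ^ (1 - 2 * b))) * sobSq s (fun ξ => h ξ - k ξ) := by
  set D := bourSq α β s b (fun p => z p - w p) with hD
  have hDfin : D < ∞ := (bourSq_sub_le hz).trans_lt (ENNReal.mul_lt_top (by norm_num) (ENNReal.add_lt_top.2
    ⟨h1.trans_lt ENNReal.ofReal_lt_top, h2.trans_lt ENNReal.ofReal_lt_top⟩))
  have e : (fun p => z p - w p) =ᵐ[volume] fun p => freeOp α β δ (fun ξ => h ξ - k ξ) p -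
      (duhOp α β δ (bil z z) p - duhOp α β δ (bil w w) p) := by
    filter_upwards [hzl, hwl] with p p1 p2
    rw [p1, p2]
    simp only [freeOp]
    ring
  have h3 : D ≤ 2 * (K * ENNReal.ofReal (δ ^ (1 - 2 * b)) * sobSq s (fun ξ => h ξ - k ξ)) + D / 2 := by
    rw [hD, bourSq_congr e]
    refine (bourSq_sub_le (measurable_freeOp (hh.sub hk))).trans ?_
    rw [mul_add]
    refine add_le_add (mul_le_mul_right (hI.free δ hS.1 hS.2.1 _ (hh.sub hk)) _) ?_
    rw [← bourSq_congr e]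
    refine (mul_le_mul_right (hI.sub_le hS hz hw h1 h2) _).trans (le_of_eq ?_)
    have hhalf : (2 : ℝ≥0∞) * (1 / 4) = 2⁻¹ := by
      rw [← ENNReal.toReal_eq_toReal_iff' (by finiteness) (by finiteness)]
      norm_num
    rw [← mul_assoc, hhalf, ENNReal.div_eq_inv_mul]
  have h4 : D / 2 + D / 2 ≤ 2 * (K * ENNReal.ofReal (δ ^ (1 - 2 * b)) * sobSq s (fun ξ => h ξ - k ξ)) + D / 2 := by
    rwa [ENNReal.add_halves]
  have h5 := (ENNReal.add_le_add_iff_right (ENNReal.div_lt_top hDfin.ne two_ne_zero).ne).1 h4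
  rw [ENNReal.div_le_iff two_ne_zero (by norm_num)] at h5
  refine h5.trans (le_of_eq ?_)
  ring

end

section

/-! ### Uniqueness -/

variable {α β s b b' T : ℝ} {C K : ℝ≥0} {z w v : ℝ × ℝ → ℂ}

theorem measurable_shift (t₀ : ℝ) (hz : Measurable z) : Measurable (shift t₀ z) := by
  have h1 : Measurable fun p : ℝ × ℝ => chi (t₀ * p.2) := by fun_prop
  exact h1.mul hz

theorem bourSq_shift (t₀ : ℝ) (z : ℝ × ℝ → ℂ) : bourSq α β s b (shift t₀ z) = bourSq α β s b z := by
  simp [bourSq, shift, enorm_mul]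

theorem tr_shift (t₀ : ℝ) (z : ℝ × ℝ → ℂ) (r ξ : ℝ) : tr (shift t₀ z) r ξ = tr z (t₀ + r) ξ := by
  refine integral_congr_ae (ae_of_all _ fun τ => ?_)
  simp only [shift]
  rw [add_mul, chi_add]
  ring

/-- Translation in time commutes with products, because characters are multiplicative along the
convolution. -/
theorem bil_shift (t₀ : ℝ) (z w : ℝ × ℝ → ℂ) : bil (shift t₀ z) (shift t₀ w) = shift t₀ (bil z w) := by
  ext p
  simp only [bil, shift, conv]
  rw [mul_left_comm, ← integral_const_mul (chi (t₀ * p.2))]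
  congr 1
  refine integral_congr_ae (ae_of_all _ fun q => ?_)
  dsimp only
  rw [Prod.snd_sub, show t₀ * p.2 = t₀ * q.2 + t₀ * (p.2 - q.2) by ring, chi_add]
  ring

theorem tr_sub (hz : Measurable z) (hw : Measurable w) {ξ : ℝ} (h1 : fibL1 z ξ < ∞) (h2 : fibL1 w ξ < ∞) (t : ℝ) :
    tr (fun p => z p - w p) t ξ = tr z t ξ - tr w t ξ := by
  have hi : ∀ y : ℝ × ℝ → ℂ, Measurable y → fibL1 y ξ < ∞ → Integrable fun τ => chi (t * τ) * y (ξ, τ) :=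
    fun y hy h => (integrable_fiber hy h).bdd_mul (c := 1)
      (by fun_prop : Continuous fun τ => chi (t * τ)).aestronglyMeasurable (ae_of_all _ fun τ => by simp)
  rw [tr, tr, tr, ← integral_sub (hi z hz h1) (hi w hw h2)]
  refine integral_congr_ae (ae_of_all _ fun τ => ?_)
  dsimp only
  ring

theorem BilinearBound.bil_sub_right_ae (hB : BilinearBound α β s b b' C) (hw : Measurable w) (hz : Measurable z)
    (hv : Measurable v) (h1 : bourSq α β s b w < ∞) (h2 : bourSq α β s b z < ∞) (h3 : bourSq α β s b v < ∞) :
    (fun p => bil w z p - bil w v p) =ᵐ[volume] bil w (fun p => z p - v p) := by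
  filter_upwards [hB.ae_absConv_lt_top hw hz h1 h2, hB.ae_absConv_lt_top hw hv h1 h3] with p a1 a2
  simp only [bil, conv]
  rw [← mul_sub, ← integral_sub (integrable_conv hw hz a1) (integrable_conv hw hv a2)]
  congr 1
  refine integral_congr_ae (ae_of_all _ fun q => ?_)
  dsimp only
  ring

/-- The Picard iterates of the linear equation with coefficient `w`. -/
def picard (α β δ : ℝ) (w v : ℝ × ℝ → ℂ) : ℕ → ℝ × ℝ → ℂ
  | 0 => v
  | k + 1 => fun p => -duhOp α β δ (bil w (picard α β δ w v k)) p

theorem measurable_picard (δ : ℝ) (hw : Measurable w) (hv : Measurable v) (k : ℕ) :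
    Measurable (picard α β δ w v k) := by
  induction k with
  | zero => exact hv
  | succ k ih => exact (measurable_duhOp (measurable_bil hw ih)).neg

/-- `δ` is short for the linear equation with coefficient `w`. -/
def IsContractive (α β s b b' : ℝ) (K : ℝ≥0) (w : ℝ × ℝ → ℂ) (δ : ℝ) : Prop :=
  0 < δ ∧ δ ≤ 1 ∧ K * ENNReal.ofReal (δ ^ (2 * (b' - b))) * bourSq α β s b w ≤ 1 / 2

theorem exists_isContractive (hbb : b < b') (K : ℝ≥0) (h : bourSq α β s b w < ∞) :
    ∃ δ, IsContractive α β s b b' K w δ := by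
  set e := 2 * (b' - b) with he
  have he0 : 0 < e := by linarith
  have h0 : Tendsto (fun δ : ℝ => K * ENNReal.ofReal (δ ^ e) * bourSq α β s b w) (𝓝 0)
      (𝓝 (K * ENNReal.ofReal ((0 : ℝ) ^ e) * bourSq α β s b w)) := by
    refine ENNReal.Tendsto.mul_const (ENNReal.Tendsto.const_mul ?_ (Or.inr ENNReal.coe_ne_top)) (Or.inr h.ne)
    exact ENNReal.tendsto_ofReal (tendsto_id.rpow_const (Or.inr he0.le))
  rw [Real.zero_rpow he0.ne', ENNReal.ofReal_zero, mul_zero, zero_mul] at h0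
  have h1 : ∀ᶠ δ in 𝓝[>] (0 : ℝ), K * ENNReal.ofReal (δ ^ e) * bourSq α β s b w ≤ 1 / 2 :=
    (h0.mono_left nhdsWithin_le_nhds).eventually (eventually_le_nhds (by norm_num))
  have h2 : ∀ᶠ δ in 𝓝[>] (0 : ℝ), δ ∈ Ioc (0 : ℝ) 1 := Ioc_mem_nhdsGT one_pos
  obtain ⟨δ, h3, h4⟩ := (h1.and h2).exists
  exact ⟨δ, h4.1, h4.2, h3⟩

theorem IterationBounds.bourSq_picard_le (hI : IterationBounds α β s b b' C K) (hw : Measurable w) (hv : Measurable v)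
    {δ : ℝ} (hδ : IsContractive α β s b b' K w δ) (k : ℕ) :
    bourSq α β s b (picard α β δ w v k) ≤ (1 / 2) ^ k * bourSq α β s b v := by
  induction k with
  | zero => simp [picard]
  | succ k ih =>
    rw [picard, bourSq_neg]
    refine (hI.duh δ hδ.1 hδ.2.1 w _ hw (measurable_picard δ hw hv k)).trans ?_
    calc _ = (K * ENNReal.ofReal (δ ^ (2 * (b' - b))) * bourSq α β s b w) * bourSq α β s b (picard α β δ w v k) := by
          ring
      _ ≤ 1 / 2 * ((1 / 2) ^ k * bourSq α β s b v) := mul_le_mul' hδ.2.2 ih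
      _ = _ := by rw [pow_succ']; ring

/-- On `[0, a]` the cut-off is one and `v` solves the linear equation. If an iterate has the traces
of `v` there, then by locality the next one has the same Duhamel integral as `v`, hence again the
traces of `v`. -/
theorem IterationBounds.tr_picard_ae (hI : IterationBounds α β s b b' C K) (hw : Measurable w) (hv : Measurable v)
    (h1 : bourSq α β s b w < ∞) (h2 : bourSq α β s b v < ∞) {δ a : ℝ} (hδ : IsContractive α β s b b' K w δ)
    (ha : a ≤ δ)
    (heq : ∀ r ∈ Icc 0 a, ∀ᵐ ξ, tr v r ξ = -∫ τ, bil w v (ξ, τ) * evoKer α β r (ξ, τ)) (k : ℕ) :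
    ∀ r ∈ Icc 0 a, ∀ᵐ ξ, tr (picard α β δ w v k) r ξ = tr v r ξ := by
  have hb := hI.lt
  have hb' : 1 / 2 < b' := hI.lt.trans hI.lt'
  have hB := hI.bilinear
  induction k with
  | zero => exact fun r _ => ae_of_all _ fun ξ => rfl
  | succ k ih =>
    set Z := picard α β δ w v k with hZ
    have hZm : Measurable Z := measurable_picard δ hw hv k
    have hZf : bourSq α β s b Z < ∞ := (hI.bourSq_picard_le hw hv hδ k).trans_lt
      (ENNReal.mul_lt_top (ENNReal.pow_lt_top (by norm_num)) h2)
    set V : ℝ × ℝ → ℂ := fun p => Z p - v p with hV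
    have hVm : Measurable V := hZm.sub hv
    have hVf : bourSq α β s b V < ∞ := (bourSq_sub_le hZm).trans_lt
      (ENNReal.mul_lt_top (by norm_num) (ENNReal.add_lt_top.2 ⟨hZf, h2⟩))
    have hV0 : ∀ r ∈ Icc 0 a, ∀ᵐ ξ, tr V r ξ = 0 := by
      intro r hr
      filter_upwards [ih r hr, ae_fibL1_lt_top hb hZm hZf, ae_fibL1_lt_top hb hv h2] with ξ e l1 l2
      rw [hV, tr_sub hZm hv l1 l2, e, sub_self]
    have hae := hB.bil_sub_right_ae hw hZm hv h1 hZf h2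
    rw [Filter.EventuallyEq, Measure.volume_eq_prod] at hae
    intro r hr
    filter_upwards [hB.integral_bil_mul_evoKer_eq_zero hb hb' hw hVm h1 hVf hV0 hr, Measure.ae_ae_of_ae_prod hae,
      ae_fibN_lt_top hb' (measurable_bil hw hZm) (hB.bourSq_bil_lt_top hw hZm h1 hZf),
      ae_fibN_lt_top hb' (measurable_bil hw hv) (hB.bourSq_bil_lt_top hw hv h1 h2), heq r hr] with ξ c1 c2 c3 c4 c5
    have e1 : tr (picard α β δ w v (k + 1)) r ξ = -tr (duhOp α β δ (bil w Z)) r ξ := by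
      rw [tr, tr, ← integral_neg]
      refine integral_congr_ae (ae_of_all _ fun τ => ?_)
      simp only [picard]
      ring
    have hcut : cutoffC (r / δ) = 1 := cutoffC_eq_one (by
      rw [abs_of_nonneg (div_nonneg hr.1 hδ.1.le), div_le_one hδ.1]
      exact hr.2.trans ha)
    rw [e1, tr_duhOp hδ.1 hδ.2.1 (measurable_bil hw hZm) c3, hcut, one_mul, c5, neg_inj, ← sub_eq_zero,
      ← integral_sub (integrable_mul_evoKer (measurable_bil hw hZm) c3 r) (integrable_mul_evoKer (measurable_bil hw hv) c4 r),
      ← c1]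
    refine integral_congr_ae ?_
    filter_upwards [c2] with τ hτ
    rw [← sub_mul, hτ]

theorem sobSq_eq_zero {h : ℝ → ℂ} (hm : Measurable h) (h0 : sobSq s h = 0) : ∀ᵐ ξ, h ξ = 0 := by
  have hm' : Measurable fun ξ => (ENNReal.ofReal (br ξ ^ s) * ‖h ξ‖ₑ) ^ 2 :=
    ((continuous_br_rpow s).measurable.ennreal_ofReal.mul hm.enorm).pow_const 2
  rw [sobSq, lintegral_eq_zero_iff hm'] at h0
  filter_upwards [h0] with ξ hξ
  have h1 := br_pos ξ
  have h2 : ¬ ENNReal.ofReal (br ξ ^ s) = 0 := by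
    rw [ENNReal.ofReal_eq_zero, not_le]
    positivity
  simpa [h2] using hξ

/-- All iterates share the traces of `v` on `[0, a]`, while their norms, and with them their traces,
decay geometrically. -/
theorem IterationBounds.tr_ae_eq_zero (hI : IterationBounds α β s b b' C K) (hw : Measurable w) (hv : Measurable v)
    (h1 : bourSq α β s b w < ∞) (h2 : bourSq α β s b v < ∞) {δ a : ℝ} (hδ : IsContractive α β s b b' K w δ)
    (ha : a ≤ δ)
    (heq : ∀ r ∈ Icc 0 a, ∀ᵐ ξ, tr v r ξ = -∫ τ, bil w v (ξ, τ) * evoKer α β r (ξ, τ)) :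
    ∀ r ∈ Icc 0 a, ∀ᵐ ξ, tr v r ξ = 0 := by
  intro r hr
  refine sobSq_eq_zero (s := s) (measurable_tr hv r) ?_
  have hle : ∀ k : ℕ, sobSq s (tr v r) ≤ (1 / 2) ^ k * (jap (2 * b) * bourSq α β s b v) := by
    intro k
    rw [← sobSq_congr (hI.tr_picard_ae hw hv h1 h2 hδ ha heq k r hr)]
    refine (sobSq_tr_le (α := α) (β := β) (b := b) (measurable_picard δ hw hv k) r).trans ?_
    rw [mul_left_comm]
    exact mul_le_mul_right (hI.bourSq_picard_le hw hv hδ k) _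
  have hfin : jap (2 * b) * bourSq α β s b v < ∞ := ENNReal.mul_lt_top (jap_lt_top (by linarith [hI.lt])) h2
  have hlim : Tendsto (fun k : ℕ => (1 / 2 : ℝ≥0∞) ^ k * (jap (2 * b) * bourSq α β s b v)) atTop (𝓝 0) := by
    have h3 := ENNReal.tendsto_pow_atTop_nhds_zero_of_lt_one (r := 1 / 2) (by
      rw [ENNReal.div_lt_iff (by norm_num) (by norm_num)]; norm_num)
    simpa using ENNReal.Tendsto.mul_const h3 (Or.inr hfin.ne)
  exact le_antisymm (ge_of_tendsto' hlim hle) zero_le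

/-- The difference `z - w` solves the linear equation with coefficient `z + w`. The admissible step
depends only on the norm of this coefficient, which translation in time preserves, so induction over
steps of one fixed length reaches `T`. -/
theorem IterationBounds.tr_ae_eq (hI : IterationBounds α β s b b' C K) (hT : 0 < T) (hz : Measurable z) (hw : Measurable w)
    (h1 : bourSq α β s b z < ∞) (h2 : bourSq α β s b w < ∞) (hA1 : Annihilated T (eqF α β z (bil z z)))
    (hA2 : Annihilated T (eqF α β w (bil w w))) (h0 : ∀ᵐ ξ, tr z 0 ξ = tr w 0 ξ) :
    ∀ t ∈ Icc 0 T, ∀ᵐ ξ, tr z t ξ = tr w t ξ := by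
  have hb := hI.lt
  have hb' : 1 / 2 < b' := hI.lt.trans hI.lt'
  have hB := hI.bilinear
  set y : ℝ × ℝ → ℂ := fun p => z p + w p with hy
  set v : ℝ × ℝ → ℂ := fun p => z p - w p with hv
  have hym : Measurable y := hz.add hw
  have hvm : Measurable v := hz.sub hw
  have hsum : 2 * (bourSq α β s b z + bourSq α β s b w) < ∞ :=
    ENNReal.mul_lt_top (by norm_num) (ENNReal.add_lt_top.2 ⟨h1, h2⟩)
  have hyf : bourSq α β s b y < ∞ := (bourSq_add_le hz).trans_lt hsum
  have hvf : bourSq α β s b v < ∞ := (bourSq_sub_le hz).trans_lt hsum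
  have hA : Annihilated T (eqF α β v (bil y v)) := by
    intro φ hφ
    obtain ⟨i1, e1⟩ := hA1 φ hφ
    obtain ⟨i2, e2⟩ := hA2 φ hφ
    have e : (fun p => invF φ p * eqF α β z (bil z z) p - invF φ p * eqF α β w (bil w w) p) =ᵐ[volume]
        fun p => invF φ p * eqF α β v (bil y v) p := by
      filter_upwards [bil_sub_add_ae hB hz hw h1 h2] with p hp
      simp only [eqF]
      rw [← hp, hv]
      ring
    refine ⟨(i1.sub i2).congr e, ?_⟩
    rw [← integral_congr_ae e, integral_sub i1 i2, e1, e2, sub_zero]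
  obtain ⟨δ, hδ⟩ := exists_isContractive hI.lt' K hyf
  have key : ∀ k : ℕ, ∀ t ∈ Icc 0 T, t ≤ k * δ → ∀ᵐ ξ, tr v t ξ = 0 := by
    intro k
    induction k with
    | zero =>
      intro t ht hk
      have : t = 0 := le_antisymm (by simpa using hk) ht.1
      subst this
      filter_upwards [h0, ae_fibL1_lt_top hb hz h1, ae_fibL1_lt_top hb hw h2] with ξ e l1 l2
      rw [hv, tr_sub hz hw l1 l2, e, sub_self]
    | succ k ih =>
      intro t ht hk
      rcases le_total t (k * δ) with h | h
      · exact ih t ht h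
      have ht0 : (0 : ℝ) ≤ k * δ := mul_nonneg (Nat.cast_nonneg k) hδ.1.le
      have hstart := ih (k * δ) ⟨ht0, h.trans ht.2⟩ le_rfl
      push_cast at hk
      -- Duhamel's formula from the starting time `k * δ`, where the trace already vanishes, is the
      -- homogeneous equation for the translated functions.
      have hstep := hI.tr_ae_eq_zero (measurable_shift (k * δ) hym) (measurable_shift (k * δ) hvm)
        (by rwa [bourSq_shift]) (by rwa [bourSq_shift]) (δ := δ) (a := t - k * δ)
        (by unfold IsContractive; rwa [bourSq_shift]) (by linarith) (fun r hr => by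
          filter_upwards [duhamel hA hT hb hb' hvm (measurable_bil hym hvm) hvf (hB.bourSq_bil_lt_top hym hvm hyf hvf)
            ht0 hr.1 (by linarith [hr.2, ht.2] : k * δ + r ≤ T), hstart] with ξ e1 e2
          rw [e1, tr_shift (k * δ) v 0, add_zero, e2, mul_zero, zero_sub, bil_shift])
        (t - k * δ) ⟨by linarith, le_rfl⟩
      filter_upwards [hstep] with ξ hξ
      rwa [tr_shift, add_sub_cancel] at hξ
  intro t ht
  obtain ⟨k, hk⟩ := exists_nat_ge (t / δ)
  filter_upwards [key k t ht ((div_le_iff₀ hδ.1).1 hk), ae_fibL1_lt_top hb hz h1, ae_fibL1_lt_top hb hw h2] with ξ e l1 l2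
  rw [hv, tr_sub hz hw l1 l2] at e
  exact sub_eq_zero.1 e

end

section

/-! ### Solutions and their Fourier transforms -/

variable {α β s b b' T : ℝ} {C K : ℝ≥0}

/-- Every solution, in whatever way its extension was chosen, is turned into a function `z` whose
traces are the solution and whose equation holds against test functions of the strip. -/
theorem IsSolution.exists_rep (hT : 0 < T) (hb : 1 / 2 < b) {u₀ : 𝓢'(ℝ, ℂ)} {u : ℝ → 𝓢'(ℝ, ℂ)}
    (hu : IsSolution α β s b T u₀ u) : ∃ z, Measurable z ∧ bourSq (nα α) (nβ β) s b z < ∞ ∧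
      (∀ t ∈ Icc 0 T, IsFourierRep (u t) (tr z t)) ∧ Annihilated T (eqF (nα α) (nβ β) z (bil z z)) := by
  obtain ⟨hcu, -, U, N, hU, hE, hN, heq⟩ := hu
  obtain ⟨z, hz, hUz, hNz⟩ := hN.exists_pairRep
  have hfin : bourSq (nα α) (nβ β) s b z < ∞ := (hUz.bourSq_le α β s b).trans_lt
    (ENNReal.mul_lt_top ENNReal.ofReal_lt_top (ENNReal.pow_lt_top hU))
  refine ⟨z, hz.measurable, hfin, isFourierRep_tr_of_extends hT hUz hb hz.measurable hfin hE hcu, fun φ hφ => ?_⟩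
  have h := hUz.equation hNz α β
  exact ⟨h.integrable φ, (h.apply φ).symm.trans (heq φ hφ)⟩

theorem evoKer_zero (α β : ℝ) (p : ℝ × ℝ) : evoKer α β 0 p = 0 := by simp [evoKer]

theorem IterationBounds.bourSq_duh_lt_top (hI : IterationBounds α β s b b' C K) {δ : ℝ} (hδ : 0 < δ) (hδ1 : δ ≤ 1)
    {z w : ℝ × ℝ → ℂ} (hz : Measurable z) (hw : Measurable w) (h1 : bourSq α β s b z < ∞) (h2 : bourSq α β s b w < ∞) :
    bourSq α β s b (duhOp α β δ (bil z w)) < ∞ :=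
  (hI.duh δ hδ hδ1 z w hz hw).trans_lt (ENNReal.mul_lt_top (ENNReal.mul_lt_top ENNReal.coe_lt_top ENNReal.ofReal_lt_top)
    (ENNReal.mul_lt_top h1 h2))

theorem IterationBounds.tr_zero_ae (hI : IterationBounds α β s b b' C K) {δ : ℝ} (hδ : 0 < δ) (hδ1 : δ ≤ 1)
    {h : ℝ → ℂ} (hh : Measurable h) (hs : sobSq s h < ∞) {z : ℝ × ℝ → ℂ} (hz : Measurable z)
    (hzf : bourSq α β s b z < ∞) (hzl : IsLocal α β δ h z) : tr z 0 =ᵐ[volume] h := by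
  have hb := hI.lt
  have hb' : 1 / 2 < b' := hI.lt.trans hI.lt'
  have hn := measurable_bil hz hz
  have h1 : bourSq α β s b (freeOp α β δ h) < ∞ := (hI.free δ hδ hδ1 h hh).trans_lt
    (ENNReal.mul_lt_top (ENNReal.mul_lt_top ENNReal.coe_lt_top ENNReal.ofReal_lt_top) hs)
  have h2 := hI.bourSq_duh_lt_top hδ hδ1 hz hz hzf hzf
  rw [IsLocal, Filter.EventuallyEq, Measure.volume_eq_prod] at hzl
  filter_upwards [Measure.ae_ae_of_ae_prod hzl, ae_fibL1_lt_top hb (measurable_freeOp hh) h1,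
    ae_fibL1_lt_top hb (measurable_duhOp hn) h2,
    ae_fibN_lt_top hb' hn (hI.bilinear.bourSq_bil_lt_top hz hz hzf hzf)] with ξ e l1 l2 l3
  have e1 : tr z 0 ξ = tr (fun p => freeOp α β δ h p - duhOp α β δ (bil z z) p) 0 ξ := by
    refine integral_congr_ae ?_
    filter_upwards [e] with τ hτ
    rw [hτ]
  rw [e1, tr_sub (measurable_freeOp hh) (measurable_duhOp hn) l1 l2, tr_freeOp hδ, tr_duhOp hδ hδ1 hn l3]
  simp only [evoKer_zero, mul_zero, integral_zero, zero_mul, chi_zero, zero_div, sub_zero, one_mul]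
  rw [cutoffC_eq_one (by simp), mul_one]

theorem BilinearBound.exists_pairRep_bil {z : ℝ × ℝ → ℂ} (hB : BilinearBound α β s b b' C) (hz : Measurable z)
    (h : bourSq α β s b z < ∞) : ∃ N : 𝓢'(Spacetime, ℂ), PairRep N (bil z z) :=
  exists_pairRep_of_bourSq (measurable_bil hz hz).aestronglyMeasurable (hB.bourSq_bil_lt_top hz hz h h)

theorem IterationBounds.exists_isSolution (hI : IterationBounds (nα α) (nβ β) s b b' C K) {δ : ℝ} (hδ : 0 < δ)
    (hδ1 : δ ≤ 1) {u₀ : 𝓢'(ℝ, ℂ)} {h : ℝ → ℂ} (hh : Measurable h) (hs : sobSq s h < ∞) (hu₀ : IsFourierRep u₀ h)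
    {z : ℝ × ℝ → ℂ} (hz : Measurable z) (hzf : bourSq (nα α) (nβ β) s b z < ∞) (hzl : IsLocal (nα α) (nβ β) δ h z) :
    ∃ u : ℝ → 𝓢'(ℝ, ℂ), IsSolution α β s b δ u₀ u ∧ ∀ t, IsFourierRep (u t) (tr z t) := by
  have hb := hI.lt
  have hb' : 1 / 2 < b' := hI.lt.trans hI.lt'
  have hB := hI.bilinear
  obtain ⟨u, hu⟩ := exists_isFourierRep_tr hb hz hzf
  obtain ⟨U, hU⟩ := exists_pairRep_of_bourSq hz.aestronglyMeasurable hzf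
  obtain ⟨N, hN⟩ := hB.exists_pairRep_bil hz hzf
  refine ⟨u, ⟨continuousInHs_of_tr hb hz hzf fun t _ => hu t,
    ((hu 0).congr (hI.tr_zero_ae hδ hδ1 hh hs hz hzf hzl)).eq hu₀, U, N, ?_,
    extends_of_tr hU hb hz hzf fun t _ => hu t, isConvection_of_pairRep hU ?_ hN, fun φ hφ => ?_⟩, hu⟩
  · have h1 := (hU.xNorm_sq_le α β s b).trans_lt (ENNReal.mul_lt_top ENNReal.ofReal_lt_top hzf)
    by_contra hcon
    rw [not_lt, top_le_iff] at hcon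
    simp [hcon] at h1
  · filter_upwards [hB.ae_absConv_lt_top hz hz hzf hzf] with p hp
    exact integrable_conv hz hz hp
  · have h1 := hU.equation hN α β
    rw [h1.apply]
    exact hφ.integral_invF_mul_eqF hδ hδ1 hb' hz (measurable_bil hz hz) hh (hB.bourSq_bil_lt_top hz hz hzf hzf) hzl
      (h1.integrable φ) (hN.integrable φ)

theorem IterationBounds.isSolution_unique (hI : IterationBounds (nα α) (nβ β) s b b' C K) (hT : 0 < T)
    {u₀ : 𝓢'(ℝ, ℂ)} {u v : ℝ → 𝓢'(ℝ, ℂ)} (hu : IsSolution α β s b T u₀ u) (hv : IsSolution α β s b T u₀ v) :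
    ∀ t ∈ Icc 0 T, v t = u t := by
  obtain ⟨z, hz, hzf, hzr, hzA⟩ := hu.exists_rep hT hI.lt
  obtain ⟨w, hw, hwf, hwr, hwA⟩ := hv.exists_rep hT hI.lt
  have h0 : (0 : ℝ) ∈ Icc 0 T := ⟨le_rfl, hT.le⟩
  have e0 : tr w 0 =ᵐ[volume] tr z 0 := by
    have h1 := hwr 0 h0
    have h2 := hzr 0 h0
    rw [hv.2.1] at h1
    rw [hu.2.1] at h2
    exact h1.ae_eq h2
  intro t ht
  exact ((hwr t ht).congr (hI.tr_ae_eq hT hw hz hwf hzf hwA hzA e0 t ht)).eq (hzr t ht)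

theorem exists_coe_mul_of_sq_le {M : ℝ≥0∞} (hM : M < ∞) : ∃ L : ℝ≥0, ∀ x y : ℝ≥0∞, x ^ 2 ≤ M * y ^ 2 → x ≤ L * y := by
  lift M to ℝ≥0 using hM.ne
  refine ⟨M + 1, fun x y h => ?_⟩
  rw [← ENNReal.pow_le_pow_left_iff two_ne_zero, mul_pow]
  refine h.trans (mul_le_mul_left ?_ _)
  exact_mod_cast (by nlinarith [M.coe_nonneg] : (M : ℝ) ≤ (M + 1) ^ 2)

/-- Local well-posedness for data of norm at most `R`. -/
theorem IterationBounds.wellPosed (hI : IterationBounds (nα α) (nβ β) s b b' C K)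
    (hbb : 0 < 2 * (b' - b) + (1 - 2 * b)) (R : ℝ≥0) : ∃ T : ℝ, 0 < T ∧
      (∀ u₀ : 𝓢'(ℝ, ℂ), TemperedDistribution.MemSobolev s 2 u₀ → hsNorm s u₀ ≤ R →
        ∃ u : ℝ → 𝓢'(ℝ, ℂ), IsSolution α β s b T u₀ u ∧
          ∀ v : ℝ → 𝓢'(ℝ, ℂ), IsSolution α β s b T u₀ v → ∀ t ∈ Icc 0 T, v t = u t) ∧
      ∃ L : ℝ≥0, ∀ u₀ v₀ : 𝓢'(ℝ, ℂ),
        TemperedDistribution.MemSobolev s 2 u₀ → hsNorm s u₀ ≤ R →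
        TemperedDistribution.MemSobolev s 2 v₀ → hsNorm s v₀ ≤ R →
        ∀ u v : ℝ → 𝓢'(ℝ, ℂ), IsSolution α β s b T u₀ u → IsSolution α β s b T v₀ v →
          (∀ t ∈ Icc 0 T, hsNorm s (u t - v t) ≤ L * hsNorm s (u₀ - v₀)) ∧
          ∃ W : 𝓢'(Spacetime, ℂ), Extends T W (fun t => u t - v t) ∧
            xNorm α β s b W ≤ L * hsNorm s (u₀ - v₀) := by
  have hb := hI.lt
  have hH : sobConst s * (R : ℝ≥0∞) ^ 2 < ∞ :=
    ENNReal.mul_lt_top ENNReal.ofReal_lt_top (ENNReal.pow_lt_top ENNReal.coe_lt_top)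
  set H : ℝ := (sobConst s * (R : ℝ≥0∞) ^ 2).toReal with hHd
  obtain ⟨T, hT⟩ := exists_isShort hbb K H
  have key : ∀ u₀ : 𝓢'(ℝ, ℂ), TemperedDistribution.MemSobolev s 2 u₀ → hsNorm s u₀ ≤ R →
      ∃ (h : ℝ → ℂ) (z : ℝ × ℝ → ℂ) (u : ℝ → 𝓢'(ℝ, ℂ)), Measurable h ∧ sobSq s h < ∞ ∧ IsFourierRep u₀ h ∧
        Measurable z ∧ bourSq (nα α) (nβ β) s b z ≤ ENNReal.ofReal (radSq b K H T) ∧ IsLocal (nα α) (nβ β) T h z ∧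
        IsSolution α β s b T u₀ u ∧ ∀ t, IsFourierRep (u t) (tr z t) := by
    intro u₀ hu₀ hR
    obtain ⟨h, hh, hrep, hs⟩ := exists_isFourierRep_of_memSobolev hu₀
    have hhH : sobSq s h ≤ ENNReal.ofReal H := by
      rw [hHd, ENNReal.ofReal_toReal hH.ne]
      refine (hrep.sobSq_le hs).trans ?_
      gcongr
    obtain ⟨z, hz, hzr, hzl⟩ := hI.exists_isLocal hT ENNReal.toReal_nonneg hh hhH
    obtain ⟨u, hu, hur⟩ := hI.exists_isSolution hT.1 hT.2.1 hh hs hrep hz (hzr.trans_lt ENNReal.ofReal_lt_top) hzl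
    exact ⟨h, z, u, hh, hs, hrep, hz, hzr, hzl, hu, hur⟩
  refine ⟨T, hT.1, fun u₀ hu₀ hR => ?_, ?_⟩
  · obtain ⟨h, z, u, -, -, -, -, -, -, hu, -⟩ := key u₀ hu₀ hR
    exact ⟨u, hu, fun v hv => hI.isSolution_unique hT.1 hu hv⟩
  -- The sum in the first factor serves both conclusions: trace bound for the `H^s` norm, comparison
  -- of weights for the `X_{s,b}` norm.
  have hM : (sobConst s * jap (2 * b) + bourConst s b) *
      (4 * (K * ENNReal.ofReal (T ^ (1 - 2 * b))) * sobConst s) < ∞ := by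
    have := jap_lt_top (r := 2 * b) (by linarith)
    refine ENNReal.mul_lt_top (ENNReal.add_lt_top.2 ⟨ENNReal.mul_lt_top ENNReal.ofReal_lt_top this, ENNReal.ofReal_lt_top⟩)
      (ENNReal.mul_lt_top (ENNReal.mul_lt_top (by norm_num) (ENNReal.mul_lt_top ENNReal.coe_lt_top ENNReal.ofReal_lt_top))
        ENNReal.ofReal_lt_top)
  obtain ⟨L, hL⟩ := exists_coe_mul_of_sq_le hM
  refine ⟨L, fun u₀ v₀ hu₀ hRu hv₀ hRv u v hu hv => ?_⟩
  obtain ⟨h, z, u', hh, hs, hrep, hz, hzr, hzl, hu', hur⟩ := key u₀ hu₀ hRu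
  obtain ⟨k, w, v', hk, ks, krep, hw, hwr, hwl, hv', hvr⟩ := key v₀ hv₀ hRv
  have hzf := hzr.trans_lt ENNReal.ofReal_lt_top
  have hwf := hwr.trans_lt ENNReal.ofReal_lt_top
  set y : ℝ × ℝ → ℂ := fun p => z p - w p with hy
  have hym : Measurable y := hz.sub hw
  have hyf : bourSq (nα α) (nβ β) s b y < ∞ := (bourSq_sub_le hz).trans_lt
    (ENNReal.mul_lt_top (by norm_num) (ENNReal.add_lt_top.2 ⟨hzf, hwf⟩))
  have hdiff : sobSq s (fun ξ => h ξ - k ξ) ≤ sobConst s * hsNorm s (u₀ - v₀) ^ 2 :=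
    (hrep.sub krep).sobSq_le ((sobSq_sub_le s hh.aestronglyMeasurable).trans_lt
      (ENNReal.mul_lt_top (by norm_num) (ENNReal.add_lt_top.2 ⟨hs, ks⟩)))
  have hyle : bourSq (nα α) (nβ β) s b y ≤
      (4 * (K * ENNReal.ofReal (T ^ (1 - 2 * b))) * sobConst s) * hsNorm s (u₀ - v₀) ^ 2 := by
    refine (hI.sub_le_of_isLocal hT hh hk hz hw hzr hwr hzl hwl).trans ?_
    rw [mul_assoc _ (sobConst s)]
    gcongr
  have hrepy : ∀ t ∈ Icc 0 T, IsFourierRep (u t - v t) (tr y t) := by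
    intro t ht
    -- The given solutions may have extensions of any size; uniqueness replaces them by the
    -- constructed ones, which lie in the ball.
    rw [hI.isSolution_unique hT.1 hu' hu t ht, hI.isSolution_unique hT.1 hv' hv t ht]
    refine ((hur t).sub (hvr t)).congr ?_
    filter_upwards [ae_fibL1_lt_top hb hz hzf, ae_fibL1_lt_top hb hw hwf] with ξ l1 l2
    rw [hy, tr_sub hz hw l1 l2]
  obtain ⟨W, hW⟩ := exists_pairRep_of_bourSq hym.aestronglyMeasurable hyf
  refine ⟨fun t ht => hL _ _ ?_, W,
    extends_of_tr hW hb hym hyf fun t ht => hrepy t (Ioo_subset_Icc_self ht), hL _ _ ?_⟩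
  · refine ((hrepy t ht).hsNorm_sq_le (sobSq_tr_lt_top hb hym hyf t)).trans ?_
    refine (mul_le_mul_right ((sobSq_tr_le hym t).trans (mul_le_mul_right hyle _)) _).trans ?_
    rw [← mul_assoc, ← mul_assoc]
    gcongr
    exact le_self_add
  · refine (hW.xNorm_sq_le α β s b).trans ((mul_le_mul_right hyle _).trans ?_)
    rw [← mul_assoc]
    gcongr
    exact le_add_self

end

end Kawahara

end

theorem theorem1p1 (s : ℝ) (hs : -7 / 4 < s) :
    ∃ b ∈ Ioo (1 / 2 : ℝ) 1, ∀ α β : ℝ, β ≠ 0 → ∀ R : ℝ≥0, ∃ T : ℝ, 0 < T ∧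
      -- existence and uniqueness on `[0, T]` for all data of norm at most `R`
      (∀ u₀ : 𝓢'(ℝ, ℂ), TemperedDistribution.MemSobolev s 2 u₀ → Kawahara.hsNorm s u₀ ≤ R →
        ∃ u : ℝ → 𝓢'(ℝ, ℂ), Kawahara.IsSolution α β s b T u₀ u ∧
          ∀ v : ℝ → 𝓢'(ℝ, ℂ), Kawahara.IsSolution α β s b T u₀ v → ∀ t ∈ Icc 0 T, v t = u t) ∧
      -- Lipschitz dependence on the data, in `C([0, T]; H^s)` and in `X_{s,b}`
      ∃ L : ℝ≥0, ∀ u₀ v₀ : 𝓢'(ℝ, ℂ),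
        TemperedDistribution.MemSobolev s 2 u₀ → Kawahara.hsNorm s u₀ ≤ R →
        TemperedDistribution.MemSobolev s 2 v₀ → Kawahara.hsNorm s v₀ ≤ R →
        ∀ u v : ℝ → 𝓢'(ℝ, ℂ),
          Kawahara.IsSolution α β s b T u₀ u → Kawahara.IsSolution α β s b T v₀ v →
          (∀ t ∈ Icc 0 T, Kawahara.hsNorm s (u t - v t) ≤ L * Kawahara.hsNorm s (u₀ - v₀)) ∧
          ∃ W : 𝓢'(Kawahara.Spacetime, ℂ), Kawahara.Extends T W (fun t => u t - v t) ∧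
            Kawahara.xNorm α β s b W ≤ L * Kawahara.hsNorm s (u₀ - v₀) := by
  -- The distance of `s` to the endpoint, capped at `1/4` as the weight estimates require.
  set κ : ℝ := min (1 / 4) (s + 7 / 4) with hκ
  have hκ0 : 0 < κ := lt_min (by norm_num) (by linarith)
  have hκ1 : κ ≤ 1 / 4 := min_le_left _ _
  have hκ2 : κ ≤ s + 7 / 4 := min_le_right _ _
  -- The bilinear estimate takes `b' - 1/2 = 2κ/5`. A third of this for `b - 1/2` makes the gain
  -- `2(b' - b)` twice the loss `2b - 1`.
  refine ⟨1 / 2 + 2 * κ / 15, ⟨by linarith, by linarith⟩, fun α β hβ R => ?_⟩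
  obtain ⟨C, hC⟩ := Kawahara.bilinear_estimate (α := Kawahara.nα α) (Kawahara.nβ_ne_zero hβ) hκ0 hκ1
    (s := s) (by linarith) (b := 1 / 2 + 2 * κ / 15) (by linarith) (b' := 1 / 2 + 3 * (2 * κ / 15)) (by ring)
  obtain ⟨K, hI⟩ := Kawahara.BilinearBound.exists_iterationBounds hC (by linarith) (by linarith) (by linarith)
  exact hI.wellPosed (by linarith) R
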